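/- **Setting.** Let $G_0$ be a real semi-simple Lie group with Lie algebra $\mathfrak g_0$, $\mathfrak g=\mathfrak g_0\otimes\mathbb C$, $\kappa$ the opposite of the Killing form, $C_{12}$ the split Casimir of $\kappa$, and write $\delta_{xy}=\delta(x-y)$, $\delta'_{xy}=\partial_x\delta(x-y)$. Algebras of observables are understood as local Poisson algebras of fields: a commutative complex algebra of local densities, with a spatial derivative $\partial_x$, a complex conjugation, and a local Poisson bracket of densities $\{f(x),g(y)\}=\sum_n c_n(y)\,\partial_y^n\delta_{xy}$ (equivalently a Poisson vertex algebra); $\int\mathrm dx\,f$ is the class of $f$ modulo total derivatives. *Non-constrained model.* Let $\mathcal A$ be such an algebra. Let $\Sigma$ be a finite set of sites with pairwise distinct positions $z_\alpha\in\mathbb C$, multiplicities $m_\alpha\ge 1$, levels $\ell^\alpha_p$ ($0\le p<m_\alpha$, $\ell^\alpha_{m_\alpha-1}\neq0$), and $\mathfrak g$-valued Takiff currents $J^\alpha_p$ in $\mathcal A$ with $$\{J^\alpha_{p\,1}(x),J^\beta_{q\,2}(y)\}=\delta_{\alpha\beta}\bigl([C_{12},J^\alpha_{p+q\,1}(x)]\,\delta_{xy}-\ell^\alpha_{p+q}\,C_{12}\,\delta'_{xy}\bigr)$$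 (zero if $p+q\ge m_\alpha$), all compatible with an involution $\alpha\mapsto\bar\alpha$ of $\Sigma$ and complex conjugation. Let $\ell^\infty\in\mathbb R\setminus\{0\}$ and $$\varphi(z)=\sum_{\alpha,p}\frac{\ell^\alpha_p}{(z-z_\alpha)^{p+1}}-\ell^\infty=-\ell^\infty\frac{\prod_{i=1}^M(z-\zeta_i)}{\prod_\alpha(z-z_\alpha)^{m_\alpha}},\qquad M=\sum_\alpha m_\alpha,$$ with pairwise distinct zeros $\zeta_i$. Put $$\Gamma(z)=\sum_{\alpha,p}\frac{J^\alpha_p}{(z-z_\alpha)^{p+1}},\qquad \mathcal L(z)=\frac{\Gamma(z)}{\varphi(z)},\qquad \mathcal Q(z)=-\frac1{2\varphi(z)}\int\mathrm dx\,\kappa(\Gamma(z),\Gamma(z)),$$ $$\mathcal Q_i=\operatorname{res}_{z=\zeta_i}\mathcal Q(z)\,\mathrm dz,\qquad \mathcal H=\sum_i\epsilon_i\mathcal Q_i,\qquad \mathcal M(z)=\sum_i\frac{\epsilon_i}{\varphi'(\zeta_i)}\frac{\Gamma(\zeta_i)}{z-\zeta_i},$$ with given parameters $\epsilon_1,\dots,\epsilon_M$.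 *The algebra $\mathcal A_{G_0}$.* It is the algebra of canonical fields on $T^*G_0$: polynomials in the derivatives of $j=g^{-1}\partial_xg$ and of a $\mathfrak g_0$-valued field $X$, with coefficients the smooth functions of a field $g$ valued in an open neighbourhood $U$ of $\mathrm{Id}$ in $G_0$, with $$\{g_1,g_2\}=0,\qquad \{X_1(x),g_2(y)\}=g_2(y)\,C_{12}\,\delta_{xy},\qquad \{X_1(x),X_2(y)\}=[C_{12},X_1(x)]\,\delta_{xy}.$$ Let $B$ be a two-form on $U$ whose differential is the left-invariant three-form equal to $-\kappa([\cdot,\cdot],\cdot)$ on $\mathfrak g_0$ ($B$ is not needed if $\sum_\alpha\ell^\alpha_0=0$), and define the $\mathfrak g_0$-valued field $W$ by $\kappa(\xi,W)=B(\xi,j)$ for $\xi\in\mathfrak g_0$ (left-invariant vector fields being identified with elements of $\mathfrak g_0$). *Gauged model.* Let $a,b,c,d\in\mathbb R$ with $\Delta=ad-bc\neq0$, $c\neq0$ and $cz_\alpha+d\neq0$ for all $\alpha$; let $f(z)=\frac{az+b}{cz+d}$ on $\mathbb P^1$. The gauged model has observables $\widetilde{\mathcal A}=\mathcal A\otimes\mathcal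 A_{G_0}$, twist function $\widetilde\varphi(w)=\frac{\Delta}{(cw-a)^2}\,\varphi\bigl(-\frac{dw-b}{cw-a}\bigr)$, sites $\widetilde\Sigma=\Sigma\sqcup\{(\infty)\}$ at $\widetilde z_\alpha=f(z_\alpha)$ and $\widetilde z_{(\infty)}=a/c$, $m_{(\infty)}=2$, levels and currents $$\widetilde\ell^\alpha_0=\ell^\alpha_0,\quad \widetilde\ell^\alpha_p=\sum_{k=p}^{m_\alpha-1}\binom{k-1}{p-1}\frac{(-c)^{k-p}\Delta^p}{(cz_\alpha+d)^{p+k}}\,\ell^\alpha_k\ (p>0),\quad \widetilde\ell^{(\infty)}_0=-\sum_{\alpha\in\Sigma}\ell^\alpha_0,\quad \widetilde\ell^{(\infty)}_1=-\frac{\ell^\infty\Delta}{c^2},$$ $\widetilde J^\alpha_p$ ($\alpha\in\Sigma$) given by the same formulas in terms of the $J^\alpha_k$, and $\widetilde J^{(\infty)}_0=X+\frac12\widetilde\ell^{(\infty)}_0(W+j)$, $\widetilde J^{(\infty)}_1=\widetilde\ell^{(\infty)}_1\,j$. Define $\widetilde\Gamma,\widetilde{\mathcal L}=\widetilde\Gamma/\widetilde\varphi,\widetilde{\mathcal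 Q}(w)$ as above from these data and $\widetilde\varphi$, and let $\widetilde\zeta_i=f(\zeta_i)\in\mathbb P^1$, $\widetilde{\mathcal Q}_i=\operatorname{res}_{w=\widetilde\zeta_i}\widetilde{\mathcal Q}(w)\,\mathrm dw$, $\widetilde{\mathcal H}_0=\sum_i\epsilon_i\widetilde{\mathcal Q}_i$, and $\widetilde{\mathcal C}=\sum_{\alpha\in\widetilde\Sigma}\widetilde J^\alpha_0$. For a $\mathfrak g$-valued Lagrange multiplier $\mu$ in $\widetilde{\mathcal A}$, let $\widetilde{\mathcal H}=\widetilde{\mathcal H}_0+\int\kappa(\mu,\widetilde{\mathcal C})$ and $$\widetilde{\mathcal M}(w)=\sum_{i:\,\widetilde\zeta_i\neq\infty}\frac{\epsilon_i}{\widetilde\varphi'(\widetilde\zeta_i)}\frac{\widetilde\Gamma(\widetilde\zeta_i)}{w-\widetilde\zeta_i}+\mu,$$ to which one adds $\epsilon_k\bigl(\widetilde{\mathcal L}(w)-\sum_{i\ne k}\frac{1}{\widetilde\varphi'(\widetilde\zeta_i)}\frac{\widetilde\Gamma(\widetilde\zeta_i)}{w-\widetilde\zeta_i}\bigr)$ if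 $\widetilde\zeta_k=\infty$ for some $k$. Let $\mathcal I$ be the ideal of $\widetilde{\mathcal A}$ generated by the constraint $\widetilde{\mathcal C}$, the functions $h(g)-h(\mathrm{Id})$ ($h\in C^\infty(U)$), and all their spatial derivatives, and write $\equiv$ for equality modulo $\mathcal I$ (modulo $\mathcal I$ and total derivatives for functionals). The Dirac bracket is $$\{F,F'\}^*=\{F,F'\}-\int\mathrm dx\,\kappa\bigl(\{\widetilde{\mathcal C}(x),F\},g^{-1}\{g(x),F'\}\bigr)+\int\mathrm dx\,\kappa\bigl(\{\widetilde{\mathcal C}(x),F'\},g^{-1}\{g(x),F\}\bigr).$$ **Theorem.** 0. The stated relations determine a unique local Poisson algebra structure on $\widetilde{\mathcal A}$. 1. The $\widetilde J^\alpha_p$ are Takiff currents with levels $\widetilde\ell^\alpha_p$ satisfying the reality conditions; $\widetilde\varphi(w)=\sum_{\alpha\in\widetilde\Sigma,p}\widetilde\ell^\alpha_p(w-\widetilde z_\alpha)^{-p-1}$ and $\sum_{\alpha\in\widetilde\Sigma}\widetilde\ell^\alpha_0=0$. The constraint is first-class, $\{\widetilde{\mathcal C}_1(x),\widetilde{\mathcal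 C}_2(y)\}=[C_{12},\widetilde{\mathcal C}_1(x)]\delta_{xy}$, and generates right multiplications of $g$, $\{\widetilde{\mathcal C}_1(x),g_2(y)\}=g_2(y)\,C_{12}\,\delta_{xy}$. The zeros in $\mathbb P^1$ of $\widetilde\varphi(w)\,\mathrm dw$ are exactly the $\widetilde\zeta_i$, and they are simple. 2. The Dirac bracket descends to a local Poisson structure on the algebra of physical observables $\widetilde{\mathcal A}/\mathcal I$ (the quotient by $\widetilde{\mathcal C}\equiv0$, $g\equiv\mathrm{Id}$), and $F\mapsto F\otimes1$ induces an isomorphism of local Poisson algebras $\mathcal A\cong\widetilde{\mathcal A}/\mathcal I$, compatible with complex conjugation. 3. Under this identification, $\Gamma(z)\equiv\frac{\Delta}{(cz+d)^2}\widetilde\Gamma(f(z))$ (that is, $\Gamma(z)\,\mathrm dz\equiv\widetilde\Gamma(\widetilde z)\,\mathrm d\widetilde z$ with $\widetilde z=f(z)$), $\widetilde{\mathcal L}(f(z))\equiv\mathcal L(z)$, $\widetilde{\mathcal Q}_i\equiv\mathcal Q_i$ for all $i$, and $\widetilde{\mathcal H}_0\equiv\mathcal H$. 4. There is a Lagrange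 multiplier $\mu$, unique modulo $\mathcal I$, for which the total Hamiltonian $\widetilde{\mathcal H}$ preserves $g\equiv\mathrm{Id}$. For such $\mu$ the time evolution generated by $\widetilde{\mathcal H}$ (on the surface $\widetilde{\mathcal C}=0$) induces on $\widetilde{\mathcal A}/\mathcal I\cong\mathcal A$ the time evolution $\{\mathcal H,\cdot\}$, and $\widetilde{\mathcal M}(f(z))\equiv\mathcal M(z)$. 5. The diagonal symmetry of the original model, with moment map $K=\int\mathrm dx\sum_{\alpha\in\Sigma}J^\alpha_0$, conserves $\mathcal H$ and acts by $\delta_\xi J^\alpha_p=[J^\alpha_p,\xi]$. The moment map $\widetilde K=-\int\mathrm dx\,g\bigl(X+\frac12\widetilde\ell^{(\infty)}_0W-\frac12\widetilde\ell^{(\infty)}_0j\bigr)g^{-1}$ of the site $(\infty)$ generates left multiplications $\delta_\xi g=-\xi g$, leaves all the currents $\widetilde J^\alpha_p$, $\alpha\in\widetilde\Sigma$, invariant and conserves $\widetilde{\mathcal H}_0$. One has $\widetilde K\equiv K$ (already for the densities), and under the isomorphism of 2. the two moment maps generate the same symmetry of the physical observables. -/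

import Mathlib

open scoped Manifold ContDiff TensorProduct Polynomial Topology

noncomputable section

namespace AGM

universe u v w

/-! ## Local Poisson algebras of fields

The Poisson algebra of local observables of a one-dimensional field theory is described by its
local densities: a differential algebra `(V, ∂ₓ)` with a `λ`-bracket
`{f_λ g}(y) = ∫ dx e^{λ (x - y)} {f(x), g(y)}`, that is,
`{f(x), g(y)} = ∑ₙ cₙ(y) ∂_yⁿ δ(x - y)` is encoded by the polynomial `∑ₙ cₙ λⁿ`. -/

section LambdaBracket

variable {V : Type u} [CommRing V]

/-- The operator `λ + ∂` on `V[λ]`. -/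
def shift [Algebra ℂ V] (D : Derivation ℂ V V) (p : V[X]) : V[X] :=
  Polynomial.X * p + p.sum fun n v => Polynomial.monomial n (D v)

/-- `p(λ) ↦ p(-λ-∂)`, with the derivative `∂` acting on the coefficients of `p`. -/
def adj [Algebra ℂ V] (D : Derivation ℂ V V) (p : V[X]) : V[X] :=
  p.sum fun n v => (-1) ^ n * (shift D)^[n] (Polynomial.C v)

/-- `p(λ+∂) q(λ)`: the coefficients of `p` stay on the left and `∂` acts on the coefficients
of `q`. -/
def act [Algebra ℂ V] (D : Derivation ℂ V V) (p q : V[X]) : V[X] :=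
  p.sum fun n v => Polynomial.C v * (shift D)^[n] q

end LambdaBracket

/-- A local Poisson algebra of fields (Poisson vertex algebra): a commutative complex algebra of
local densities, its spatial derivative, and the Poisson bracket of densities. In the Jacobi
identity the outer variable of `V[λ][μ]` is `μ` and the inner one is `λ`:
`{f_λ {g_μ h}} - {g_μ {f_λ h}} = {{f_λ g}_{λ+μ} h}`. -/
structure PVA (V : Type u) [CommRing V] [Algebra ℂ V] where
  D : Derivation ℂ V V
  br : V →ₗ[ℂ] V →ₗ[ℂ] V[X]
  br_D_left : ∀ f g, br (D f) g = -(Polynomial.X * br f g)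
  br_D_right : ∀ f g, br f (D g) = shift D (br f g)
  br_mul : ∀ f g h, br f (g * h) = Polynomial.C g * br f h + Polynomial.C h * br f g
  br_skew : ∀ f g, br g f = -adj D (br f g)
  br_jacobi : ∀ f g h,
    ((br g h).sum fun n v => Polynomial.C (br f v) * Polynomial.X ^ n)
      - ((br f h).sum fun n v =>
          (br g v).map (Polynomial.C : V →+* V[X]) * Polynomial.C (Polynomial.X ^ n))
    = (br f g).sum fun n v =>
        Polynomial.C (Polynomial.X ^ n) *
          (br v h).eval₂ ((Polynomial.C : V[X] →+* V[X][X]).comp Polynomial.C)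
            (Polynomial.C Polynomial.X + Polynomial.X)

namespace PVA

variable {V : Type u} [CommRing V] [Algebra ℂ V] (P : PVA V)

/-- Local functionals `∫ dx f(x)`: densities modulo total derivatives. -/
abbrev Fun : Type u := V ⧸ LinearMap.range (P.D : V →ₗ[ℂ] V)

/-- `f ↦ ∫ dx f(x)`. -/
def int : V →ₗ[ℂ] P.Fun := (LinearMap.range (P.D : V →ₗ[ℂ] V)).mkQ

/-- `{∫ dx f(x), g(y)} = {f_λ g}|_{λ=0}` at the level of densities. -/
def flowDensity : V →ₗ[ℂ] V →ₗ[ℂ] V :=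
  P.br.compr₂ ((Polynomial.lcoeff V 0).restrictScalars ℂ)

theorem flowDensity_apply (f g : V) : P.flowDensity f g = (P.br f g).coeff 0 := rfl

/-- The Hamiltonian flow `{F, ·}` of a local functional `F` on the densities. -/
def flow : P.Fun →ₗ[ℂ] V →ₗ[ℂ] V :=
  (LinearMap.range (P.D : V →ₗ[ℂ] V)).liftQ P.flowDensity (by
    rintro _ ⟨f, rfl⟩
    rw [LinearMap.mem_ker]
    ext g
    have h := P.br_D_left f g
    simp [flowDensity_apply, h])

/-- A reality structure: an antilinear involution (complex conjugation of observables)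
compatible with the product, the spatial derivative and the Poisson bracket. -/
structure IsConjugation (cj : V →+* V) : Prop where
  smul : ∀ (r : ℂ) (f : V), cj (r • f) = starRingEnd ℂ r • cj f
  invol : ∀ f, cj (cj f) = f
  D : ∀ f, cj (P.D f) = P.D (cj f)
  br : ∀ f g, P.br (cj f) (cj g) = (P.br f g).map cj

end PVA

/-! ## Lie algebra conventions

A `𝔤`-valued field `F` is described by its components `F a = κ(I_a, F)` along a basis `I` of the
real form `𝔤₀`. -/

section Lie

variable {𝔤 : Type v} [LieRing 𝔤] [LieAlgebra ℝ 𝔤] {ι : Type w} [Fintype ι]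
  (I : Module.Basis ι ℝ 𝔤)

/-- `κ(I_a, I_b)`, with `κ` the opposite of the Killing form. -/
def kap (a b : ι) : ℝ := -killingForm ℝ 𝔤 (I a) (I b)

/-- The inverse matrix of `κ(I_a, I_b)`. -/
def kinv [DecidableEq ι] (a b : ι) : ℝ := (Matrix.of (kap I))⁻¹ a b

variable {V : Type u} [CommRing V] [Algebra ℂ V]

/-- The component `κ(ξ, F)` of a `𝔤`-valued field `F` along `ξ ∈ 𝔤₀`. -/
def comp (F : ι → V) (ξ : 𝔤) : V := ∑ a, ((I.repr ξ a : ℝ) : ℂ) • F a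

/-- The density `κ(F, F₂)`. -/
def pairing [DecidableEq ι] (F F₂ : ι → V) : V :=
  ∑ a, ∑ b, ((kinv I a b : ℝ) : ℂ) • (F a * F₂ b)

end Lie

/-! ## Affine Gaudin models -/

/-- Sites with their conjugation, multiplicities, positions and levels, and the Takiff currents
`J α p` (given by their components `κ(I_a, J^α_[p])`). Only the modes `p < m α` are relevant. -/
structure GaudinData (S : Type*) (ι : Type w) (V : Type u) where
  bar : S → S
  m : S → ℕ
  z : S → ℂ
  lev : S → ℕ → ℂ
  J : S → ℕ → ι → V

section Gaudin

variable {S : Type*} [Fintype S] [DecidableEq S] {ι : Type w} [Fintype ι]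
  {V : Type u} [CommRing V] [Algebra ℂ V]

/-- The data define a (real) realisation, in the local Poisson algebra `P` with conjugation `cj`,
of the Takiff algebra of their levels, with pairwise distinct positions and non-zero highest
levels:
`{J^α_p(x)₁, J^β_q(y)₂} = δ_{αβ} ([C₁₂, J^α_{p+q}(x)₁] δ(x-y) - ℓ^α_{p+q} C₁₂ ∂ₓδ(x-y))`,
the right-hand side being zero if `p + q ≥ m α`. -/
structure IsRealisation {𝔤 : Type v} [LieRing 𝔤] [LieAlgebra ℝ 𝔤] (I : Module.Basis ι ℝ 𝔤)
    (P : PVA V) (cj : V →+* V) (𝒢 : GaudinData S ι V) : Prop where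
  bar_bar : ∀ α, 𝒢.bar (𝒢.bar α) = α
  m_pos : ∀ α, 0 < 𝒢.m α
  m_bar : ∀ α, 𝒢.m (𝒢.bar α) = 𝒢.m α
  z_inj : Function.Injective 𝒢.z
  z_bar : ∀ α, 𝒢.z (𝒢.bar α) = starRingEnd ℂ (𝒢.z α)
  lev_top : ∀ α, 𝒢.lev α (𝒢.m α - 1) ≠ 0
  lev_bar : ∀ α, ∀ p < 𝒢.m α, 𝒢.lev (𝒢.bar α) p = starRingEnd ℂ (𝒢.lev α p)
  J_bar : ∀ α, ∀ p < 𝒢.m α, ∀ a, 𝒢.J (𝒢.bar α) p a = cj (𝒢.J α p a)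
  takiff : ∀ α β, ∀ p < 𝒢.m α, ∀ q < 𝒢.m β, ∀ a b,
    P.br (𝒢.J α p a) (𝒢.J β q b) =
      if α = β ∧ p + q < 𝒢.m α then
        Polynomial.C (comp I (𝒢.J α (p + q)) ⁅I a, I b⁆)
          + Polynomial.C (algebraMap ℂ V (𝒢.lev α (p + q) * (kap I a b : ℝ))) * Polynomial.X
      else 0

/-- `∑_α ∑_p ℓ^α_p / (z - z_α)^{p+1}`. -/
def twist₀ (𝒢 : GaudinData S ι V) (z : ℂ) : ℂ :=
  ∑ α, ∑ p ∈ Finset.range (𝒢.m α), 𝒢.lev α p / (z - 𝒢.z α) ^ (p + 1)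

/-- The twist function `φ(z) = ∑_α ∑_p ℓ^α_p / (z - z_α)^{p+1} - ℓ^∞` of a non-constrained
model. -/
def twist (linf : ℝ) (𝒢 : GaudinData S ι V) (z : ℂ) : ℂ := twist₀ 𝒢 z - linf

/-- The Gaudin Lax matrix `Γ(z) = ∑_α ∑_p J^α_p / (z - z_α)^{p+1}`. -/
def gaudinLax (𝒢 : GaudinData S ι V) (z : ℂ) : ι → V := fun a =>
  ∑ α, ∑ p ∈ Finset.range (𝒢.m α), ((z - 𝒢.z α) ^ (p + 1))⁻¹ • 𝒢.J α p a

/-- The Lax matrix `L(z) = Γ(z) / φ(z)`. -/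
def laxL (φ : ℂ → ℂ) (𝒢 : GaudinData S ι V) (z : ℂ) : ι → V := (φ z)⁻¹ • gaudinLax 𝒢 z

/-- The term attached to a finite zero `ζ` of `φ` in the temporal component of the Lax pair:
`Γ(ζ) / (φ'(ζ) (z - ζ))`. -/
def laxTerm (φ : ℂ → ℂ) (𝒢 : GaudinData S ι V) (ζ z : ℂ) : ι → V :=
  (deriv φ ζ * (z - ζ))⁻¹ • gaudinLax 𝒢 ζ

/-- The temporal component of the Lax pair of the model with twist function `φ`, whose zeroes in
the Riemann sphere are the `ζ i`, with Hamiltonian `∑ εᵢ Qᵢ + ∫ κ(μ, C)`: a finite zero `ζ i`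
contributes `εᵢ Γ(ζᵢ) / (φ'(ζᵢ) (z - ζᵢ))`, and a zero at infinity contributes
`εᵢ (L(z) - ∑_{k, ζₖ ≠ ∞} Γ(ζₖ) / (φ'(ζₖ) (z - ζₖ)))`. -/
def laxM (φ : ℂ → ℂ) (𝒢 : GaudinData S ι V) {M : ℕ} (ζ : Fin M → OnePoint ℂ) (eps : Fin M → ℂ)
    (μ : ι → V) (z : ℂ) : ι → V :=
  (∑ i, eps i • (ζ i).elim
      (laxL φ 𝒢 z - ∑ k, (ζ k).elim 0 fun x => laxTerm φ 𝒢 x z)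
      fun x => laxTerm φ 𝒢 x z) + μ

/-- `Q(z) = - 1/(2 φ(z)) ∫ dx κ(Γ(z,x), Γ(z,x))`. -/
def quadQ [DecidableEq ι] {𝔤 : Type v} [LieRing 𝔤] [LieAlgebra ℝ 𝔤] (I : Module.Basis ι ℝ 𝔤)
    (P : PVA V) (φ : ℂ → ℂ) (𝒢 : GaudinData S ι V) (z : ℂ) : P.Fun :=
  (-(2 * φ z)⁻¹) • P.int (pairing I (gaudinLax 𝒢 z) (gaudinLax 𝒢 z))

end Gaudin

/-! ## Residues of vector-valued one-forms on the Riemann sphere -/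

section Residue

variable {W : Type*} [AddCommGroup W] [Module ℂ W]

/-- `r` is the residue of `F(z) dz` at the finite point `ζ`: for every linear form `ℓ` on `W`,
`1/(2πi) ∮ ℓ(F(z)) dz = ℓ(r)` on all small circles around `ζ`. -/
def HasResidue (F : ℂ → W) (ζ : ℂ) (r : W) : Prop :=
  ∀ ℓ : Module.Dual ℂ W, ∀ᶠ ρ in 𝓝[>] (0 : ℝ),
    (∮ z in C(ζ, ρ), ℓ (F z)) = 2 * Real.pi * Complex.I * ℓ r

/-- The residue of `F(z) dz` at a point of the Riemann sphere, with the coordinate `u = 1/z` at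
infinity, in which `F(z) dz = - u⁻² F(1/u) du`. -/
def HasSphereResidue (F : ℂ → W) (ζ : OnePoint ℂ) (r : W) : Prop :=
  ζ.elim (HasResidue (fun u => (-(u ^ 2)⁻¹) • F u⁻¹) 0 r) fun x => HasResidue F x r

end Residue

/-! ## Lie groups -/

section Group

variable {E : Type u} [NormedAddCommGroup E] [NormedSpace ℝ E]
  {G : Type v} [TopologicalSpace G] [ChartedSpace E G] [Group G]

instance leInfty_minSmoothness : ENat.LEInfty (minSmoothness ℝ 3) := by
  rw [minSmoothness_of_isRCLikeNormedField]
  infer_instance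

/-- The algebra of smooth real functions on an open subset `U` of the group. -/
abbrev SmoothFun (E : Type u) [NormedAddCommGroup E] [NormedSpace ℝ E]
    {G : Type v} [TopologicalSpace G] [ChartedSpace E G]
    (U : TopologicalSpace.Opens G) : Type v := C^∞⟮𝓘(ℝ, E), U; ℝ⟯

theorem contMDiff_leftDeriv [LieGroup 𝓘(ℝ, E) ∞ G] {U : TopologicalSpace.Opens G}
    (ξ : GroupLieAlgebra 𝓘(ℝ, E) G) (f : SmoothFun E U) :
    ContMDiff 𝓘(ℝ, E) 𝓘(ℝ, ℝ) ∞ (fun x : U =>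
      (mfderiv 𝓘(ℝ, E) 𝓘(ℝ, ℝ)
        (fun h : G => Function.extend Subtype.val f 0 (x.1 * h)) 1 ξ : ℝ)) := by
  intro x
  have : IsManifold 𝓘(ℝ, E) 1 G := .of_le (n := ∞) (by simp)
  set F : G → ℝ := Function.extend Subtype.val f 0 with hF
  have hFs : ContMDiffAt 𝓘(ℝ, E) 𝓘(ℝ, ℝ) ∞ F x.1 := by
    rw [← contMDiffAt_subtype_iff]
    have : (fun y : U => F y) = f := by
      funext y; exact Subtype.val_injective.extend_apply f 0 y
    rw [this]; exact f.contMDiff x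
  have h1 : ContMDiffAt (𝓘(ℝ, E).prod 𝓘(ℝ, E)) 𝓘(ℝ, ℝ) ∞
      (Function.uncurry (fun (y : U) (h : G) => F (y.1 * h))) (x, (1 : G)) := by
    have h2 : ContMDiffAt (𝓘(ℝ, E).prod 𝓘(ℝ, E)) 𝓘(ℝ, E) ∞
      (fun p : U × G => p.1.1 * p.2) (x, (1 : G)) :=
      ((contMDiff_subtype_val.comp contMDiff_fst).mul contMDiff_snd).contMDiffAt
    have hFs' : ContMDiffAt 𝓘(ℝ, E) 𝓘(ℝ, ℝ) ∞ F (x.1 * 1) := by rwa [mul_one]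
    exact ContMDiffAt.comp (x, (1 : G)) hFs' h2
  have h3 := ContMDiffAt.mfderiv_apply (I := 𝓘(ℝ, E)) (I' := 𝓘(ℝ, ℝ)) (J := 𝓘(ℝ, E)) (x₀ := x)
    (m := ∞) (n := ∞)
    (fun (y : U) (h : G) => F (y.1 * h)) (fun _ => (1 : G)) (fun y : U => y) (fun _ => (ξ : E))
    h1 contMDiffAt_const contMDiffAt_id contMDiffAt_const (by simp)
  refine h3.congr_of_eventuallyEq (Filter.Eventually.of_forall fun y => ?_)
  let ϕ : U → E →L[ℝ] ℝ := fun y => mfderiv 𝓘(ℝ, E) 𝓘(ℝ, ℝ) (fun h : G => F (y.1 * h)) 1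
  have key : inTangentCoordinates 𝓘(ℝ, E) 𝓘(ℝ, ℝ) (fun _ : U => (1 : G))
      (fun y : U => F (y.1 * 1)) ϕ x y = ϕ y := by
    refine (inTangentCoordinates_eq (I := 𝓘(ℝ, E)) (I' := 𝓘(ℝ, ℝ)) (fun _ : U => (1 : G))
      (fun y : U => F (y.1 * 1)) ϕ (mem_chart_source _ _)
      (by rw [chartAt_self_eq]; trivial)).trans ?_
    ext w
    rw [ContinuousLinearMap.comp_apply, ContinuousLinearMap.comp_apply,
      (tangentBundleCore 𝓘(ℝ, E) G).coordChange_self _ _ (mem_achart_source E (1 : G)),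
      tangentBundleCore_coordChange_model_space]
    rfl
  exact congrArg (fun L : E →L[ℝ] ℝ => L ξ) key.symm

theorem contMDiff_conjDeriv [FiniteDimensional ℝ E] [LieGroup 𝓘(ℝ, E) ∞ G]
    {U : TopologicalSpace.Opens G} (c : GroupLieAlgebra 𝓘(ℝ, E) G →ₗ[ℝ] ℝ)
    (ξ : GroupLieAlgebra 𝓘(ℝ, E) G) :
    ContMDiff 𝓘(ℝ, E) 𝓘(ℝ, ℝ) ∞ (fun x : U =>
      c (mfderiv 𝓘(ℝ, E) 𝓘(ℝ, E) (fun h : G => x.1⁻¹ * h * x.1) 1 ξ : E)) := by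
  intro x
  have : IsManifold 𝓘(ℝ, E) 1 G := .of_le (n := ∞) (by simp)
  have h1 : ContMDiffAt (𝓘(ℝ, E).prod 𝓘(ℝ, E)) 𝓘(ℝ, E) ∞
      (Function.uncurry (fun (y : U) (h : G) => y.1⁻¹ * h * y.1)) (x, (1 : G)) := by
    have h2 : ContMDiff (𝓘(ℝ, E).prod 𝓘(ℝ, E)) 𝓘(ℝ, E) ∞ (fun p : U × G => p.1.1) :=
      contMDiff_subtype_val.comp contMDiff_fst
    exact ((h2.inv.mul contMDiff_snd).mul h2).contMDiffAt
  have h3 := ContMDiffAt.mfderiv_apply (I := 𝓘(ℝ, E)) (I' := 𝓘(ℝ, E)) (J := 𝓘(ℝ, E)) (x₀ := x)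
    (m := ∞) (n := ∞)
    (fun (y : U) (h : G) => y.1⁻¹ * h * y.1) (fun _ => (1 : G)) (fun y : U => y)
    (fun _ => (ξ : E))
    h1 contMDiffAt_const contMDiffAt_id contMDiffAt_const (by simp)
  have hc : ContMDiff 𝓘(ℝ, E) 𝓘(ℝ, ℝ) ∞ (fun e : E => c e) := by
    let c' : E →ₗ[ℝ] ℝ := c
    exact (LinearMap.toContinuousLinearMap c').contMDiff
  refine ((hc.contMDiffAt).comp x h3).congr_of_eventuallyEq
    (Filter.Eventually.of_forall fun y => ?_)
  let ϕ : U → E →L[ℝ] E := fun y =>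
    mfderiv 𝓘(ℝ, E) 𝓘(ℝ, E) (fun h : G => y.1⁻¹ * h * y.1) 1
  have hy : ∀ y : U, y.1⁻¹ * 1 * y.1 = (1 : G) := fun y => by simp
  have key : inTangentCoordinates 𝓘(ℝ, E) 𝓘(ℝ, E) (fun _ : U => (1 : G))
      (fun y : U => y.1⁻¹ * 1 * y.1) ϕ x y = ϕ y := by
    have h5 : (fun y : U => y.1⁻¹ * 1 * y.1) = fun _ => (1 : G) := funext hy
    rw [h5]
    refine (inTangentCoordinates_eq (I := 𝓘(ℝ, E)) (I' := 𝓘(ℝ, E)) (fun _ : U => (1 : G))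
      (fun _ : U => (1 : G)) ϕ (mem_chart_source _ _) (mem_chart_source _ _)).trans ?_
    ext w
    rw [ContinuousLinearMap.comp_apply, ContinuousLinearMap.comp_apply,
      (tangentBundleCore 𝓘(ℝ, E) G).coordChange_self _ _ (mem_achart_source E (1 : G)),
      (tangentBundleCore 𝓘(ℝ, E) G).coordChange_self _ _ (mem_achart_source E (1 : G))]
  exact congrArg (fun L : E →L[ℝ] E => c (L ξ)) key.symm

variable [FiniteDimensional ℝ E] [LieGroup 𝓘(ℝ, E) ∞ G] {U : TopologicalSpace.Opens G}

/-- The left-invariant derivative: `(L_ξ f)(x) = d/dt f(x exp(t ξ))` at `t = 0`. -/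
def leftDeriv (ξ : GroupLieAlgebra 𝓘(ℝ, E) G) (f : SmoothFun E U) : SmoothFun E U :=
  ⟨_, contMDiff_leftDeriv ξ f⟩

/-- The component along `I_b` of `x ↦ x⁻¹ ξ x`. -/
def adInv {ι : Type w} (I : Module.Basis ι ℝ (GroupLieAlgebra 𝓘(ℝ, E) G)) (b : ι)
    (ξ : GroupLieAlgebra 𝓘(ℝ, E) G) : SmoothFun E U :=
  ⟨_, contMDiff_conjDeriv (I.coord b) ξ⟩

/-- `B` (given by its components `B(I_a, I_b)` along the left-invariant vector fields) is a
two-form on `U` whose exterior derivative is the three-form `-κ([·,·],·)` of the Wess-Zumino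
term. -/
structure IsWZPotential {ι : Type w} [Fintype ι]
    (I : Module.Basis ι ℝ (GroupLieAlgebra 𝓘(ℝ, E) G)) (B : ι → ι → SmoothFun E U) : Prop where
  antisymm : ∀ a b, B a b = -B b a
  d_eq : ∀ a b c,
    leftDeriv (I a) (B b c) + leftDeriv (I b) (B c a) + leftDeriv (I c) (B a b)
      - ∑ e, (I.repr ⁅I a, I b⁆ e • B e c + I.repr ⁅I b, I c⁆ e • B e a
          + I.repr ⁅I c, I a⁆ e • B e b)
    = algebraMap ℝ (SmoothFun E U) (killingForm ℝ _ ⁅I a, I b⁆ (I c))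

end Group

/-! ## The algebra `𝒜 ⊗ 𝒜_{G₀}` -/

/-- Jet coordinates: `inl (a, n)` is `∂ⁿ j^a`, where `j = g⁻¹ ∂ₓ g = ∑_a j^a I_a`, and
`inr (a, n)` is `∂ⁿ X_a`, where `X_a = κ(I_a, X)`. -/
abbrev Jet (ι : Type w) : Type w := (ι × ℕ) ⊕ (ι × ℕ)

/-- Densities of the canonical fields on `T^*G₀`: differential polynomials in `j = g⁻¹ ∂ₓ g` and
`X`, with coefficients the smooth functions of the field `g` (with values in `U`). -/
abbrev CotAlg (E : Type u) [NormedAddCommGroup E] [NormedSpace ℝ E] {G : Type v}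
    [TopologicalSpace G] [ChartedSpace E G] (U : TopologicalSpace.Opens G) (ι : Type w) :
    Type (max v w) :=
  MvPolynomial (Jet ι) (SmoothFun E U)

/-- The algebra `𝒜 ⊗ 𝒜_{G₀}`. -/
abbrev GaugedAlg (A : Type*) [CommRing A] [Algebra ℂ A] (E : Type u) [NormedAddCommGroup E]
    [NormedSpace ℝ E] {G : Type v} [TopologicalSpace G] [ChartedSpace E G]
    (U : TopologicalSpace.Opens G) (ι : Type w) :=
  A ⊗[ℝ] CotAlg E U ι

section Gauged

variable {A : Type*} [CommRing A] [Algebra ℂ A]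
  {E : Type u} [NormedAddCommGroup E] [NormedSpace ℝ E] [FiniteDimensional ℝ E]
  {G : Type v} [TopologicalSpace G] [ChartedSpace E G] [Group G] [LieGroup 𝓘(ℝ, E) ∞ G]
  {U : TopologicalSpace.Opens G} {ι : Type w} [Fintype ι] [DecidableEq ι]

/-- `𝒜 → 𝒜 ⊗ 𝒜_{G₀}`, `F ↦ F ⊗ 1`. -/
def inA : A →ₐ[ℂ] GaugedAlg A E U ι := Algebra.TensorProduct.includeLeft

/-- The observable `h(g)`. -/
def fn (h : SmoothFun E U) : GaugedAlg A E U ι := 1 ⊗ₜ MvPolynomial.C h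

/-- The observable `∂ⁿ j^a`. -/
def jv (a : ι) (n : ℕ) : GaugedAlg A E U ι := 1 ⊗ₜ MvPolynomial.X (Sum.inl (a, n))

/-- The observable `∂ⁿ X_a`. -/
def Xv (a : ι) (n : ℕ) : GaugedAlg A E U ι := 1 ⊗ₜ MvPolynomial.X (Sum.inr (a, n))

/-- The field `X`. -/
def fieldX : ι → GaugedAlg A E U ι := fun a => Xv a 0

/-- The field `j = g⁻¹ ∂ₓ g`. -/
def fieldj (I : Module.Basis ι ℝ (GroupLieAlgebra 𝓘(ℝ, E) G)) : ι → GaugedAlg A E U ι :=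
  fun a => ∑ b, ((kap I a b : ℝ) : ℂ) • jv b 0

/-- The field `W`: `κ(I_a, W) = ∑_b B(I_a, I_b) j^b`. -/
def fieldW (B : ι → ι → SmoothFun E U) : ι → GaugedAlg A E U ι :=
  fun a => ∑ b, fn (B a b) * jv b 0

/-- Complex conjugation on `𝒜 ⊗ 𝒜_{G₀}`, the fields `g` and `X` being real. -/
def gaugedConj (cj : A →+* A) (hcj : ∀ (r : ℂ) (f : A), cj (r • f) = starRingEnd ℂ r • cj f) :
    GaugedAlg A E U ι →+* GaugedAlg A E U ι :=
  (Algebra.TensorProduct.map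
    ({ cj with
        commutes' := fun r => by
          have h := hcj (r : ℂ) 1
          simpa [Algebra.algebraMap_eq_smul_one] using h } : A →ₐ[ℝ] A)
    (AlgHom.id ℝ (CotAlg E U ι))).toRingHom

/-- The local Poisson algebra `Pt` on `𝒜 ⊗ 𝒜_{G₀}` is the tensor product of `P` and of the
canonical Poisson algebra of `T^*G₀`:
`{g₁, g₂} = 0`, `{X₁(x), g₂(y)} = g₂ C₁₂ δ(x-y)`, `{X₁(x), X₂(y)} = [C₁₂, X₁] δ(x-y)`, with
`∂ₓ g = g j`. -/
structure IsTensorBracket (I : Module.Basis ι ℝ (GroupLieAlgebra 𝓘(ℝ, E) G)) (P : PVA A)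
    (Pt : PVA (GaugedAlg A E U ι)) : Prop where
  D_inA : ∀ f, Pt.D (inA f) = inA (P.D f)
  D_fn : ∀ h, Pt.D (fn h) = ∑ a, fn (leftDeriv (I a) h) * jv a 0
  D_j : ∀ a n, Pt.D (jv a n) = jv a (n + 1)
  D_X : ∀ a n, Pt.D (Xv a n) = Xv a (n + 1)
  br_inA : ∀ f k, Pt.br (inA f) (inA k) =
    (P.br f k).map (inA : A →ₐ[ℂ] GaugedAlg A E U ι).toRingHom
  br_inA_fn : ∀ f h, Pt.br (inA f) (fn h) = 0
  br_inA_j : ∀ f a, Pt.br (inA f) (jv a 0) = 0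
  br_inA_X : ∀ f a, Pt.br (inA f) (Xv a 0) = 0
  br_fn_fn : ∀ h k, Pt.br (fn h) (fn k) = 0
  br_fn_j : ∀ h a, Pt.br (fn h) (jv a 0) = 0
  br_j_j : ∀ a b, Pt.br (jv a 0) (jv b 0) = 0
  br_X_fn : ∀ a h, Pt.br (Xv a 0) (fn h) = Polynomial.C (fn (leftDeriv (I a) h))
  br_X_X : ∀ a b, Pt.br (Xv a 0) (Xv b 0) = Polynomial.C (comp I fieldX ⁅I a, I b⁆)
  br_X_j : ∀ a b, Pt.br (Xv a 0) (fieldj I b) =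
    Polynomial.C (comp I (fieldj I) ⁅I a, I b⁆)
      + Polynomial.C (algebraMap ℂ _ ((kap I a b : ℝ) : ℂ)) * Polynomial.X

/-! ## The Möbius transformation and the gauged model -/

/-- `∑_{k ≥ p} binom(k-1,p-1) (-c)^{k-p} (ad-bc)^p / (c z + d)^{p+k} x_k` for `p > 0`, and `x₀`
for `p = 0`. -/
def mobMode {W : Type*} [AddCommGroup W] [Module ℂ W] (a b c d : ℝ) (z : ℂ) (m : ℕ) (x : ℕ → W)
    (p : ℕ) : W :=
  if p = 0 then x 0 else
    ∑ k ∈ Finset.Ico p m,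
      (((k - 1).choose (p - 1) : ℂ) * (-(c : ℂ)) ^ (k - p) * ((a : ℂ) * d - b * c) ^ p
        / ((c : ℂ) * z + d) ^ (p + k)) • x k

/-- `f(z) = (a z + b) / (c z + d)`. -/
def mobius (a b c d : ℝ) (z : ℂ) : ℂ := ((a : ℂ) * z + b) / ((c : ℂ) * z + d)

/-- The image in the Riemann sphere of a finite point under the Möbius transformation. -/
def mobiusSphere (a b c d : ℝ) (z : ℂ) : OnePoint ℂ :=
  open Classical in if (c : ℂ) * z + d = 0 then OnePoint.infty else (mobius a b c d z : OnePoint ℂ)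

/-- The transformed twist function
`φ̃(w) = (ad-bc)/(c w - a)² φ(-(d w - b)/(c w - a))`. -/
def mobTwist (a b c d : ℝ) (φ : ℂ → ℂ) (w : ℂ) : ℂ :=
  ((a : ℂ) * d - b * c) / ((c : ℂ) * w - a) ^ 2 * φ (-((d : ℂ) * w - b) / ((c : ℂ) * w - a))

variable {S : Type*} [Fintype S]

/-- The levels of the gauged model; the site `none` is the new site `(∞)`. -/
def newLev (a b c d linf : ℝ) (𝒢 : GaudinData S ι A) : Option S → ℕ → ℂ
  | some α, p => mobMode a b c d (𝒢.z α) (𝒢.m α) (𝒢.lev α) p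
  | none, p => if p = 0 then -∑ α, 𝒢.lev α 0 else -(linf * ((a : ℂ) * d - b * c)) / (c : ℂ) ^ 2

/-- The Takiff currents of the gauged model, with the PCM+WZ realisation at the site `(∞)`:
`J_[0] = X + ½ ℓ₀ W + ½ ℓ₀ j` and `J_[1] = ℓ₁ j`. -/
def newJ (I : Module.Basis ι ℝ (GroupLieAlgebra 𝓘(ℝ, E) G)) (B : ι → ι → SmoothFun E U)
    (a b c d linf : ℝ) (𝒢 : GaudinData S ι A) : Option S → ℕ → ι → GaugedAlg A E U ι
  | some α, p => fun e => inA (mobMode a b c d (𝒢.z α) (𝒢.m α) (fun k => 𝒢.J α k e) p)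
  | none, p => if p = 0 then
      fieldX + (newLev a b c d linf 𝒢 none 0 / 2) • fieldW B
        + (newLev a b c d linf 𝒢 none 0 / 2) • fieldj I
    else newLev a b c d linf 𝒢 none 1 • fieldj I

/-- The sites, levels and Takiff currents of the gauged model. -/
def gaugedData (I : Module.Basis ι ℝ (GroupLieAlgebra 𝓘(ℝ, E) G)) (B : ι → ι → SmoothFun E U)
    (a b c d linf : ℝ) (𝒢 : GaudinData S ι A) :
    GaudinData (Option S) ι (GaugedAlg A E U ι) where
  bar := Option.map 𝒢.bar
  m := fun α => α.elim 2 𝒢.m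
  z := fun α => α.elim ((a : ℂ) / c) fun β => mobius a b c d (𝒢.z β)
  lev := newLev a b c d linf 𝒢
  J := newJ I B a b c d linf 𝒢

/-- `∑_α J^α_[0]`, the sum running over all the sites: the density of the moment map of the
diagonal symmetry in a non-constrained model, and the constraint in a constrained one. -/
def sumZeroModes {S₁ V : Type*} [Fintype S₁] [CommRing V] [Algebra ℂ V] (𝒢 : GaudinData S₁ ι V) :
    ι → V := fun a => ∑ α, 𝒢.J α 0 a

/-- The ideal of the observables vanishing weakly (`≡ 0`): it is generated by the constraints
`C̃ ≡ 0` and `g ≡ Id` and all their spatial derivatives. -/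
def weakIdeal (hU : (1 : G) ∈ U) (Pt : PVA (GaugedAlg A E U ι)) (C : ι → GaugedAlg A E U ι) :
    Ideal (GaugedAlg A E U ι) :=
  Ideal.span ({x | ∃ (n : ℕ) (a : ι), x = (Pt.D)^[n] (C a)} ∪
    {x | ∃ (n : ℕ) (h : SmoothFun E U),
      x = (Pt.D)^[n] (fn h - algebraMap ℂ _ ((h ⟨1, hU⟩ : ℝ) : ℂ))})

/-- `∂/∂(∂ⁿ X_a)` on `𝒜 ⊗ 𝒜_{G₀}`. -/
def momDeriv (a : ι) (n : ℕ) : GaugedAlg A E U ι →ₗ[ℝ] GaugedAlg A E U ι :=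
  LinearMap.lTensor A
    (((MvPolynomial.pderiv (R := SmoothFun E U) (Sum.inr (a, n) : Jet ι)) :
      CotAlg E U ι →ₗ[SmoothFun E U] CotAlg E U ι).restrictScalars ℝ)

/-- The component along `I_a` of the Lie algebra valued bracket `g⁻¹ {g_λ F}`
(a finite sum). -/
def gBracket (a : ι) (F : GaugedAlg A E U ι) : (GaugedAlg A E U ι)[X] :=
  -∑ᶠ n : ℕ, Polynomial.monomial n (momDeriv a n F)

/-- The Dirac bracket, which in terms of Poisson brackets reads
`{F, G}^* = {F, G} - ∫ κ({C(x), F}, g⁻¹{g(x), G}) + ∫ κ({C(x), G}, g⁻¹{g(x), F})`. -/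
def dirac (Pt : PVA (GaugedAlg A E U ι)) (C : ι → GaugedAlg A E U ι)
    (F F₂ : GaugedAlg A E U ι) : (GaugedAlg A E U ι)[X] :=
  Pt.br F F₂ + ∑ a, act Pt.D (gBracket a F₂) (Pt.br F (C a))
    + ∑ a, act Pt.D (Pt.br (C a) F₂) (adj Pt.D (gBracket a F))

/-- The time derivative of an observable `O` under the total Hamiltonian
`H + ∫ dx κ(μ(x), C(x))`, on the surface `C = 0`:
`{H, O} + ∫ dx κ(μ(x), {C(x), O})`. -/
def totalFlow {V : Type*} [CommRing V] [Algebra ℂ V] {𝔤 : Type*} [LieRing 𝔤] [LieAlgebra ℝ 𝔤]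
    (I : Module.Basis ι ℝ 𝔤) (P : PVA V) (C : ι → V) (H : P.Fun) (μ : ι → V) (O : V) : V :=
  P.flow H O + ∑ a, ∑ b, ((kinv I a b : ℝ) : ℂ) •
    (act P.D (P.br (C a) O) (Polynomial.C (μ b))).coeff 0

/-- The density of the moment map of the left symmetry `g ↦ h⁻¹ g` of the PCM+WZ realisation:
`- g (X + ½ ℓ₀ W - ½ ℓ₀ j) g⁻¹`. -/
def leftMoment (I : Module.Basis ι ℝ (GroupLieAlgebra 𝓘(ℝ, E) G)) (B : ι → ι → SmoothFun E U)
    (ℓ : ℂ) : ι → GaugedAlg A E U ι := fun a =>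
  -∑ b, fn (adInv I b (I a)) *
    (fieldX b + (ℓ / 2) • fieldW B b - (ℓ / 2) • fieldj I b)

end Gauged

/-- A simple zero, in the Riemann sphere, of the one-form `φ(z) dz` (with the coordinate
`u = 1/z` at infinity, in which the form is `- u⁻² φ(1/u) du`). -/
def IsSimpleFormZero (φ : ℂ → ℂ) (ζ : OnePoint ℂ) : Prop :=
  ζ.elim
    (∃ r : ℂ, r ≠ 0 ∧ Filter.Tendsto (fun u : ℂ => -(u ^ 3)⁻¹ * φ u⁻¹) (𝓝[≠] 0) (𝓝 r))
    fun x => φ x = 0 ∧ deriv φ x ≠ 0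

end AGM

end

open AGM

noncomputable section

namespace AGM

universe u v w

set_option linter.unusedSectionVars false

section GroupCalculus

variable {E : Type u} [NormedAddCommGroup E] [NormedSpace ℝ E]
  {G : Type v} [TopologicalSpace G] [ChartedSpace E G] [Group G]
  {U : TopologicalSpace.Opens G}

/-- Extension by zero of a function on an open subset. -/
def extZero (f : SmoothFun E U) : G → ℝ := Function.extend Subtype.val f 0

theorem extZero_coe (f : SmoothFun E U) (x : U) : extZero f x.1 = f x :=
  Subtype.val_injective.extend_apply f 0 x

theorem contMDiffAt_extZero (f : SmoothFun E U) (x : U) :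
    ContMDiffAt 𝓘(ℝ, E) 𝓘(ℝ, ℝ) ∞ (extZero f) x.1 := by
  rw [← contMDiffAt_subtype_iff]
  have : (fun y : U => extZero f y) = f := funext fun y => extZero_coe f y
  rw [this]; exact f.contMDiff x

variable [FiniteDimensional ℝ E] [LieGroup 𝓘(ℝ, E) ∞ G]

theorem leftDeriv_apply (ξ : GroupLieAlgebra 𝓘(ℝ, E) G) (f : SmoothFun E U) (x : U) :
    leftDeriv ξ f x = (mfderiv 𝓘(ℝ, E) 𝓘(ℝ, ℝ)
        (fun h : G => extZero f (x.1 * h)) 1 ξ : ℝ) := rfl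

theorem leftDeriv_eq (ξ : GroupLieAlgebra 𝓘(ℝ, E) G) (f : SmoothFun E U) (x : U) :
    leftDeriv ξ f x =
      (mfderiv 𝓘(ℝ, E) 𝓘(ℝ, ℝ) (extZero f) x.1 (mulInvariantVectorField ξ x.1) : ℝ) := by
  rw [leftDeriv_apply]
  have h1 : MDifferentiableAt 𝓘(ℝ, E) 𝓘(ℝ, E) (fun h : G => x.1 * h) 1 :=
    (contMDiff_mul_left (I := 𝓘(ℝ, E)) (n := ∞)).contMDiffAt.mdifferentiableAt (by simp)
  have h2 : MDifferentiableAt 𝓘(ℝ, E) 𝓘(ℝ, ℝ) (extZero f) (x.1 * 1) := by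
    rw [mul_one]; exact (contMDiffAt_extZero f x).mdifferentiableAt (by simp)
  have h3 := mfderiv_comp (1 : G) h2 h1
  have h4 : (mfderiv 𝓘(ℝ, E) 𝓘(ℝ, ℝ) (fun h : G => extZero f (x.1 * h)) 1) = _ := h3
  rw [h4]
  have h5 : ∀ y : G, y = x.1 → ∀ v : E, (mfderiv 𝓘(ℝ, E) 𝓘(ℝ, ℝ) (extZero f) y v : ℝ) =
     (mfderiv 𝓘(ℝ, E) 𝓘(ℝ, ℝ) (extZero f) x.1 v : ℝ) := by
    rintro y rfl v; rfl
  exact h5 (x.1 * 1) (mul_one _) _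

theorem leftDeriv_add_left (ξ η : GroupLieAlgebra 𝓘(ℝ, E) G) (f : SmoothFun E U) :
    leftDeriv (ξ + η) f = leftDeriv ξ f + leftDeriv η f := by
  ext x
  exact map_add (mfderiv 𝓘(ℝ, E) 𝓘(ℝ, ℝ) (fun h : G => extZero f (x.1 * h)) 1) ξ η

theorem leftDeriv_smul_left (r : ℝ) (ξ : GroupLieAlgebra 𝓘(ℝ, E) G) (f : SmoothFun E U) :
    leftDeriv (r • ξ) f = r • leftDeriv ξ f := by
  ext x
  exact map_smul (mfderiv 𝓘(ℝ, E) 𝓘(ℝ, ℝ) (fun h : G => extZero f (x.1 * h)) 1) r ξ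

theorem mdiff_extZero (f : SmoothFun E U) (x : U) :
    MDifferentiableAt 𝓘(ℝ, E) 𝓘(ℝ, ℝ) (extZero f) x.1 :=
  (contMDiffAt_extZero f x).mdifferentiableAt (by simp)

theorem eventually_mem (x : U) : ∀ᶠ y in 𝓝 x.1, y ∈ U := U.isOpen.mem_nhds x.2

theorem leftDeriv_add (ξ : GroupLieAlgebra 𝓘(ℝ, E) G) (f g : SmoothFun E U) :
    leftDeriv ξ (f + g) = leftDeriv ξ f + leftDeriv ξ g := by
  ext x
  change leftDeriv ξ (f + g) x = leftDeriv ξ f x + leftDeriv ξ g x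
  simp only [leftDeriv_eq]
  have h : extZero (f + g) =ᶠ[𝓝 x.1] extZero f + extZero g := by
    filter_upwards [eventually_mem x] with y hy
    have := fun k : SmoothFun E U => extZero_coe k ⟨y, hy⟩
    simp only at this
    simp [this]
  rw [h.mfderiv_eq]
  have := mfderiv_add (mdiff_extZero f x) (mdiff_extZero g x)
  erw [this]
  rfl

theorem leftDeriv_mul (ξ : GroupLieAlgebra 𝓘(ℝ, E) G) (f g : SmoothFun E U) :
    leftDeriv ξ (f * g) = f * leftDeriv ξ g + g * leftDeriv ξ f := by
  ext x
  change leftDeriv ξ (f * g) x = f x * leftDeriv ξ g x + g x * leftDeriv ξ f x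
  simp only [leftDeriv_eq]
  have h : extZero (f * g) =ᶠ[𝓝 x.1] extZero f * extZero g := by
    filter_upwards [eventually_mem x] with y hy
    have := fun k : SmoothFun E U => extZero_coe k ⟨y, hy⟩
    simp only at this
    simp [this]
  rw [h.mfderiv_eq]
  have h2 := mvfderiv_mul (mdiff_extZero f x) (mdiff_extZero g x)
  have h3 := congrArg (fun L => L (mulInvariantVectorField ξ x.1)) h2
  rw [← extZero_coe f, ← extZero_coe g]
  exact h3

theorem leftDeriv_const (ξ : GroupLieAlgebra 𝓘(ℝ, E) G) (r : ℝ) :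
    leftDeriv ξ (algebraMap ℝ (SmoothFun E U) r) = 0 := by
  ext x
  change leftDeriv ξ (algebraMap ℝ (SmoothFun E U) r) x = 0
  rw [leftDeriv_eq]
  have h : extZero (algebraMap ℝ (SmoothFun E U) r) =ᶠ[𝓝 x.1] fun _ => r := by
    filter_upwards [eventually_mem x] with y hy
    have := fun k : SmoothFun E U => extZero_coe k ⟨y, hy⟩
    simp only at this
    simp [this]; rfl
  rw [h.mfderiv_eq]
  erw [mfderiv_const]
  rfl

/-- The left-invariant derivative as a derivation. -/
def leftDer (ξ : GroupLieAlgebra 𝓘(ℝ, E) G) : Derivation ℝ (SmoothFun E U) (SmoothFun E U) :=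
  Derivation.mk'
    { toFun := leftDeriv ξ
      map_add' := leftDeriv_add ξ
      map_smul' := fun r f => by
        rw [Algebra.smul_def, leftDeriv_mul, leftDeriv_const, Algebra.smul_def]; simp }
    (fun f g => by simp [leftDeriv_mul])

open VectorField

theorem mlieBracket_smul_invariant (ξ χ : GroupLieAlgebra 𝓘(ℝ, E) G) (k : SmoothFun E U) (x : U) :
    mlieBracket 𝓘(ℝ, E) (mulInvariantVectorField ξ) (extZero k • mulInvariantVectorField χ) x.1 =
      (leftDeriv ξ k x) • (mulInvariantVectorField χ : (g : G) → TangentSpace 𝓘(ℝ, E) g) x.1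
        + extZero k x.1 • mulInvariantVectorField ⁅ξ, χ⁆ x.1 := by
  have : IsManifold 𝓘(ℝ, E) 1 G := .of_le (n := ∞) (by simp)
  rw [mlieBracket_smul_right (mdiff_extZero k x) (mdifferentiableAt_mulInvariantVectorField _),
    GroupLieAlgebra.bracket_def, mulInvariantVector_mlieBracket, leftDeriv_eq]
  rfl

theorem mlieBracket_smul_invariant_eventually (ξ χ : GroupLieAlgebra 𝓘(ℝ, E) G)
    (k : SmoothFun E U) (x : U) :
    mlieBracket 𝓘(ℝ, E) (mulInvariantVectorField ξ) (extZero k • mulInvariantVectorField χ)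
      =ᶠ[𝓝 x.1] (extZero (leftDeriv ξ k) • mulInvariantVectorField χ
        + extZero k • mulInvariantVectorField ⁅ξ, χ⁆ : (g : G) → TangentSpace 𝓘(ℝ, E) g) := by
  filter_upwards [eventually_mem x] with y hy
  have h := mlieBracket_smul_invariant ξ χ k ⟨y, hy⟩
  rw [← extZero_coe] at h
  exact h

theorem contMDiffAt_smul_invariant (χ : GroupLieAlgebra 𝓘(ℝ, E) G) (k : SmoothFun E U) (x : U) :
    ContMDiffAt 𝓘(ℝ, E) (𝓘(ℝ, E).prod 𝓘(ℝ, E)) (minSmoothness ℝ 2)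
      (fun g => (⟨g, (extZero k • mulInvariantVectorField χ) g⟩ : TangentBundle 𝓘(ℝ, E) G)) x.1 := by
  refine ContMDiffAt.smul_section ?_ (contMDiffAt_mulInvariantVectorField χ)
  refine (contMDiffAt_extZero k x).of_le ?_
  rw [minSmoothness_of_isRCLikeNormedField]; exact ENat.LEInfty.out

theorem mulInvariantVectorField_ne_zero {χ : GroupLieAlgebra 𝓘(ℝ, E) G} (hχ : χ ≠ 0) (x : G) :
    mulInvariantVectorField χ x ≠ 0 := by
  intro h
  apply hχ
  have h1 : mulInvariantVectorField (I := 𝓘(ℝ, E)) χ 1 = χ := by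
    have h2 : ∀ F : G → G, F = id → (mfderiv 𝓘(ℝ, E) 𝓘(ℝ, E) F 1 χ : E) = χ := by
      rintro _ rfl; rw [mfderiv_id]; rfl
    exact h2 (fun x : G => 1 * x) (by ext; simp)
  rw [← h1, ← mpullback_mulInvariantVectorField x χ, mpullback_apply]
  have h2 : ∀ y : G, y = x → (mulInvariantVectorField χ y : TangentSpace 𝓘(ℝ, E) y) = 0 := by
    rintro y rfl; exact h
  rw [h2 (x * 1) (mul_one x)]
  exact map_zero _

theorem leftDeriv_lie (ξ η : GroupLieAlgebra 𝓘(ℝ, E) G) (f : SmoothFun E U) :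
    leftDeriv ⁅ξ, η⁆ f = leftDeriv ξ (leftDeriv η f) - leftDeriv η (leftDeriv ξ f) := by
  have : IsManifold 𝓘(ℝ, E) 1 G := .of_le (n := ∞) (by simp)
  have : IsManifold 𝓘(ℝ, E) (minSmoothness ℝ 3) G := .of_le (n := ∞) ENat.LEInfty.out
  rcases subsingleton_or_nontrivial (GroupLieAlgebra 𝓘(ℝ, E) G) with hE | hE
  · have h0 : ∀ (ζ : GroupLieAlgebra 𝓘(ℝ, E) G) (k : SmoothFun E U), leftDeriv ζ k = 0 := by
      intro ζ k
      have h := leftDeriv_smul_left 0 ζ k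
      rw [zero_smul, zero_smul] at h
      rw [Subsingleton.elim ζ 0]; exact h
    rw [h0, h0, h0, sub_zero]
  obtain ⟨χ, hχ⟩ := exists_ne (0 : GroupLieAlgebra 𝓘(ℝ, E) G)
  ext x
  change leftDeriv ⁅ξ, η⁆ f x = leftDeriv ξ (leftDeriv η f) x - leftDeriv η (leftDeriv ξ f) x
  have hJ := leibniz_identity_mlieBracket_apply
    (contMDiffAt_mulInvariantVectorField ξ (g := x.1))
    (contMDiffAt_mulInvariantVectorField η (g := x.1)) (contMDiffAt_smul_invariant χ f x)
  have key : ∀ α β : GroupLieAlgebra 𝓘(ℝ, E) G,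
      mlieBracket 𝓘(ℝ, E) (mulInvariantVectorField α) (mlieBracket 𝓘(ℝ, E)
        (mulInvariantVectorField β) (extZero f • mulInvariantVectorField χ)) x.1 =
      ((leftDeriv α (leftDeriv β f) x) • (mulInvariantVectorField χ : (g : G) → TangentSpace 𝓘(ℝ, E) g) x.1
        + extZero (leftDeriv β f) x.1 • mulInvariantVectorField ⁅α, χ⁆ x.1)
      + ((leftDeriv α f x) • (mulInvariantVectorField ⁅β, χ⁆ : (g : G) → TangentSpace 𝓘(ℝ, E) g) x.1
        + extZero f x.1 • mulInvariantVectorField ⁅α, ⁅β, χ⁆⁆ x.1) := by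
    intro α β
    rw [(Filter.EventuallyEq.refl _ _).mlieBracket_vectorField_eq
      (mlieBracket_smul_invariant_eventually β χ f x),
      mlieBracket_add_right, mlieBracket_smul_invariant, mlieBracket_smul_invariant]
    · exact (contMDiffAt_smul_invariant χ _ x).mdifferentiableAt (by simp)
    · exact (contMDiffAt_smul_invariant _ _ x).mdifferentiableAt (by simp)
  rw [key, key, ← mulInvariantVector_mlieBracket, ← GroupLieAlgebra.bracket_def,
    mlieBracket_smul_invariant] at hJ
  simp only [extZero_coe] at hJ
  have hl : mulInvariantVectorField ⁅ξ, ⁅η, χ⁆⁆ x.1 =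
      mulInvariantVectorField ⁅⁅ξ, η⁆, χ⁆ x.1 + mulInvariantVectorField ⁅η, ⁅ξ, χ⁆⁆ x.1 := by
    rw [leibniz_lie, mulInvariantVectorField_add]; rfl
  rw [hl] at hJ
  have hz := mulInvariantVectorField_ne_zero hχ x.1
  have : (leftDeriv ⁅ξ, η⁆ f x - (leftDeriv ξ (leftDeriv η f) x - leftDeriv η (leftDeriv ξ f) x)) •
      (mulInvariantVectorField χ : (g : G) → TangentSpace 𝓘(ℝ, E) g) x.1 = 0 := by
    generalize (mulInvariantVectorField χ : (g : G) → TangentSpace 𝓘(ℝ, E) g) x.1 = z0 at *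
    generalize (mulInvariantVectorField ⁅ξ, χ⁆ : (g : G) → TangentSpace 𝓘(ℝ, E) g) x.1 = z1 at *
    generalize (mulInvariantVectorField ⁅η, χ⁆ : (g : G) → TangentSpace 𝓘(ℝ, E) g) x.1 = z2 at *
    generalize (mulInvariantVectorField ⁅⁅ξ, η⁆, χ⁆ : (g : G) → TangentSpace 𝓘(ℝ, E) g) x.1 = z3 at *
    generalize (mulInvariantVectorField ⁅η, ⁅ξ, χ⁆⁆ : (g : G) → TangentSpace 𝓘(ℝ, E) g) x.1 = z4 at *
    rw [← sub_eq_zero] at hJ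
    rw [← neg_eq_zero, ← hJ]
    module
  rcases smul_eq_zero.1 this with h | h
  · linarith
  · exact absurd h hz

end GroupCalculus

section MixedPartials

variable {E : Type u} [NormedAddCommGroup E] [NormedSpace ℝ E]
  {G : Type v} [TopologicalSpace G] [ChartedSpace E G]

theorem mfderiv_eq_fderiv_chart {H : G → ℝ} {p : G}
    (hH : MDifferentiableAt 𝓘(ℝ, E) 𝓘(ℝ, ℝ) H p) (w : E) :
    (mfderiv 𝓘(ℝ, E) 𝓘(ℝ, ℝ) H p w : ℝ) =
      fderiv ℝ (fun y => H ((extChartAt 𝓘(ℝ, E) p).symm y)) (extChartAt 𝓘(ℝ, E) p p) w := by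
  rw [hH.mfderiv, ModelWithCorners.range_eq_univ, fderivWithin_univ]
  rfl

variable [IsManifold 𝓘(ℝ, E) ∞ G]

theorem mfderiv_comp_chart {g : E → ℝ} {p : G}
    (hg : DifferentiableAt ℝ g (extChartAt 𝓘(ℝ, E) p p)) (w : E) :
    (mfderiv 𝓘(ℝ, E) 𝓘(ℝ, ℝ) (fun k => g (extChartAt 𝓘(ℝ, E) p k)) p w : ℝ) =
      fderiv ℝ g (extChartAt 𝓘(ℝ, E) p p) w := by
  have : IsManifold 𝓘(ℝ, E) 1 G := .of_le (n := ∞) (by simp)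
  have h1 : MDifferentiableAt 𝓘(ℝ, E) 𝓘(ℝ, E) (extChartAt 𝓘(ℝ, E) p) p :=
    mdifferentiableAt_extChartAt (mem_chart_source E p)
  refine (mfderiv_eq_fderiv_chart (H := fun k => g (extChartAt 𝓘(ℝ, E) p k))
    (hg.mdifferentiableAt.comp p h1) w).trans ?_
  have h2 : (fun y => g (extChartAt 𝓘(ℝ, E) p ((extChartAt 𝓘(ℝ, E) p).symm y)))
      =ᶠ[𝓝 (extChartAt 𝓘(ℝ, E) p p)] g := by
    filter_upwards [extChartAt_target_mem_nhds (I := 𝓘(ℝ, E)) p] with y hy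
    exact congrArg g (PartialEquiv.right_inv _ hy)
  rw [h2.fderiv_eq]

theorem mfderiv_mixed {F : G → G → ℝ} {p q : G}
    (hF : ContMDiffAt (𝓘(ℝ, E).prod 𝓘(ℝ, E)) 𝓘(ℝ, ℝ) ∞ (Function.uncurry F) (p, q)) (a b : E) :
    (mfderiv 𝓘(ℝ, E) 𝓘(ℝ, ℝ)
        (fun k => (mfderiv 𝓘(ℝ, E) 𝓘(ℝ, ℝ) (fun h => F k h) q b : ℝ)) p a : ℝ) =
      mfderiv 𝓘(ℝ, E) 𝓘(ℝ, ℝ)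
        (fun h => (mfderiv 𝓘(ℝ, E) 𝓘(ℝ, ℝ) (fun k => F k h) p a : ℝ)) q b := by
  have : IsManifold 𝓘(ℝ, E) 1 G := .of_le (n := ∞) (by simp)
  set e₁ := extChartAt 𝓘(ℝ, E) p
  set e₂ := extChartAt 𝓘(ℝ, E) q
  set Φ : E × E → ℝ := fun z => F (e₁.symm z.1) (e₂.symm z.2) with hΦ
  have hΦs : ContDiffAt ℝ ∞ Φ (e₁ p, e₂ q) := by
    rw [← contMDiffAt_iff_contDiffAt]
    have h1 : ContMDiffAt (𝓘(ℝ, E).prod 𝓘(ℝ, E)) (𝓘(ℝ, E).prod 𝓘(ℝ, E)) ∞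
        (fun z : E × E => (e₁.symm z.1, e₂.symm z.2)) (e₁ p, e₂ q) := by
      refine ContMDiffAt.prodMk ?_ ?_
      · exact ContMDiffAt.comp (e₁ p, e₂ q) (g := e₁.symm) (f := Prod.fst)
          ((contMDiffOn_extChartAt_symm (I := 𝓘(ℝ, E)) (n := ∞) p).contMDiffAt
            (extChartAt_target_mem_nhds (I := 𝓘(ℝ, E)) p)) contMDiffAt_fst
      · exact ContMDiffAt.comp (e₁ p, e₂ q) (g := e₂.symm) (f := Prod.snd)
          ((contMDiffOn_extChartAt_symm (I := 𝓘(ℝ, E)) (n := ∞) q).contMDiffAt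
            (extChartAt_target_mem_nhds (I := 𝓘(ℝ, E)) q)) contMDiffAt_snd
    have h2 : ContMDiffAt (𝓘(ℝ, E).prod 𝓘(ℝ, E)) 𝓘(ℝ, ℝ) ∞ (Function.uncurry F)
        (e₁.symm (e₁ p), e₂.symm (e₂ q)) := by
      rw [extChartAt_to_inv, extChartAt_to_inv]; exact hF
    have h3 := ContMDiffAt.comp (e₁ p, e₂ q) h2 h1
    rw [← modelWithCornersSelf_prod, chartedSpaceSelf_prod] at h3
    exact h3
  have hdiff : ∀ᶠ z in 𝓝 (e₁ p, e₂ q), DifferentiableAt ℝ Φ z := by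
    have := hΦs.of_le (m := 1) (by simp)
    exact (this.eventually (by simp)).mono fun z hz => hz.differentiableAt (by simp)
  have hFev : ∀ᶠ z in 𝓝 (p, q), ContMDiffAt (𝓘(ℝ, E).prod 𝓘(ℝ, E)) 𝓘(ℝ, ℝ) 1
      (Function.uncurry F) z :=
    (contMDiffAt_iff_contMDiffAt_nhds (by simp)).1 (hF.of_le (by simp))
  have hsnd : ∀ᶠ k in 𝓝 p, (mfderiv 𝓘(ℝ, E) 𝓘(ℝ, ℝ) (fun h => F k h) q b : ℝ) =
      fderiv ℝ Φ (e₁ k, e₂ q) (0, b) := by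
    have c1 : Filter.Tendsto (fun k => (e₁ k, e₂ q)) (𝓝 p) (𝓝 (e₁ p, e₂ q)) :=
      ((continuousAt_extChartAt p).prodMk continuousAt_const)
    have c2 : Filter.Tendsto (fun k => (k, q)) (𝓝 p) (𝓝 (p, q)) :=
      continuousAt_id.prodMk continuousAt_const
    filter_upwards [c1.eventually hdiff, c2.eventually hFev,
      extChartAt_source_mem_nhds (I := 𝓘(ℝ, E)) p] with k hk hk2 hk3
    have hd : MDifferentiableAt 𝓘(ℝ, E) 𝓘(ℝ, ℝ) (fun h => F k h) q :=
      (hk2.mdifferentiableAt (by simp)).comp q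
        (mdifferentiableAt_const.prodMk mdifferentiableAt_id)
    rw [mfderiv_eq_fderiv_chart hd]
    have h4 : (fun y => F k (e₂.symm y)) = fun y => Φ (e₁ k, y) := by
      funext y; simp only [hΦ, e₁, PartialEquiv.left_inv _ hk3]
    rw [h4]
    have h5 := hk.hasFDerivAt.comp (e₂ q) (hasFDerivAt_prodMk_right (𝕜 := ℝ) (e₁ k) (e₂ q))
    rw [show (fun y => Φ (e₁ k, y)) = Φ ∘ fun y => (e₁ k, y) from rfl, h5.fderiv]
    simp
    rfl
  have hfst : ∀ᶠ k in 𝓝 q, (mfderiv 𝓘(ℝ, E) 𝓘(ℝ, ℝ) (fun h => F h k) p a : ℝ) =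
      fderiv ℝ Φ (e₁ p, e₂ k) (a, 0) := by
    have c1 : Filter.Tendsto (fun k => (e₁ p, e₂ k)) (𝓝 q) (𝓝 (e₁ p, e₂ q)) :=
      (continuousAt_const.prodMk (continuousAt_extChartAt q))
    have c2 : Filter.Tendsto (fun k => (p, k)) (𝓝 q) (𝓝 (p, q)) :=
      continuousAt_const.prodMk continuousAt_id
    filter_upwards [c1.eventually hdiff, c2.eventually hFev,
      extChartAt_source_mem_nhds (I := 𝓘(ℝ, E)) q] with k hk hk2 hk3
    have hd : MDifferentiableAt 𝓘(ℝ, E) 𝓘(ℝ, ℝ) (fun h => F h k) p :=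
      (hk2.mdifferentiableAt (by simp)).comp p
        (mdifferentiableAt_id.prodMk mdifferentiableAt_const)
    rw [mfderiv_eq_fderiv_chart hd]
    have h4 : (fun y => F (e₁.symm y) k) = fun y => Φ (y, e₂ k) := by
      funext y; simp only [hΦ, e₂, PartialEquiv.left_inv _ hk3]
    rw [h4]
    have h5 := hk.hasFDerivAt.comp (e₁ p) (hasFDerivAt_prodMk_left (𝕜 := ℝ) (e₁ p) (e₂ k))
    rw [show (fun y => Φ (y, e₂ k)) = Φ ∘ fun y => (y, e₂ k) from rfl, h5.fderiv]
    simp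
    rfl
  have hd2 : DifferentiableAt ℝ (fderiv ℝ Φ) (e₁ p, e₂ q) :=
    (hΦs.fderiv_right (m := 1) (by rw [one_add_one_eq_two]; exact ENat.LEInfty.out)).differentiableAt (by simp)
  have g1 : HasFDerivAt (fun x => fderiv ℝ Φ (x, e₂ q) (0, b))
      (((ContinuousLinearMap.apply ℝ ℝ ((0 : E), b)).comp
        (fderiv ℝ (fderiv ℝ Φ) (e₁ p, e₂ q))).comp (ContinuousLinearMap.inl ℝ E E)) (e₁ p) :=
    HasFDerivAt.comp (f := fun e => (e, e₂ q)) (g := fun z => fderiv ℝ Φ z (0, b)) (e₁ p)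
      ((ContinuousLinearMap.apply ℝ ℝ ((0 : E), b)).hasFDerivAt.comp _ hd2.hasFDerivAt)
      (hasFDerivAt_prodMk_left (𝕜 := ℝ) (e₁ p) (e₂ q))
  have g2 : HasFDerivAt (fun x => fderiv ℝ Φ (e₁ p, x) (a, 0))
      (((ContinuousLinearMap.apply ℝ ℝ (a, (0 : E))).comp
        (fderiv ℝ (fderiv ℝ Φ) (e₁ p, e₂ q))).comp (ContinuousLinearMap.inr ℝ E E)) (e₂ q) :=
    HasFDerivAt.comp (f := fun e => (e₁ p, e)) (g := fun z => fderiv ℝ Φ z (a, 0)) (e₂ q)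
      ((ContinuousLinearMap.apply ℝ ℝ (a, (0 : E))).hasFDerivAt.comp _ hd2.hasFDerivAt)
      (hasFDerivAt_prodMk_right (𝕜 := ℝ) (e₁ p) (e₂ q))
  have hsym : IsSymmSndFDerivAt ℝ Φ (e₁ p, e₂ q) :=
    hΦs.isSymmSndFDerivAt (by rw [minSmoothness_of_isRCLikeNormedField]; exact ENat.LEInfty.out)
  have s1 := Filter.EventuallyEq.mfderiv_eq (I := 𝓘(ℝ, E)) (I' := 𝓘(ℝ, ℝ)) hsnd
  have s2 := Filter.EventuallyEq.mfderiv_eq (I := 𝓘(ℝ, E)) (I' := 𝓘(ℝ, ℝ)) hfst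
  have r1 := mfderiv_comp_chart (p := p) g1.differentiableAt a
  have r2 := mfderiv_comp_chart (p := q) g2.differentiableAt b
  rw [g1.fderiv] at r1
  rw [g2.fderiv] at r2
  have t1 := congrArg (fun L : E →L[ℝ] ℝ => L a) s1
  have t2 := congrArg (fun L : E →L[ℝ] ℝ => L b) s2
  refine t1.trans (r1.trans (Eq.trans ?_ (t2.trans r2).symm))
  exact hsym (a, 0) (0, b)

end MixedPartials

section GroupCalculus

variable {E : Type u} [NormedAddCommGroup E] [NormedSpace ℝ E] [FiniteDimensional ℝ E]
  {G : Type v} [TopologicalSpace G] [ChartedSpace E G] [Group G] [LieGroup 𝓘(ℝ, E) ∞ G]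
  {U : TopologicalSpace.Opens G}

/-- Smooth functions on `U` have arbitrary differentials at any given point. -/
theorem exists_leftDeriv_eq [T2Space G] (p : U) (c : GroupLieAlgebra 𝓘(ℝ, E) G →ₗ[ℝ] ℝ) :
    ∃ f : SmoothFun E U, ∀ ξ, leftDeriv ξ f p = c ξ := by
  have : IsManifold 𝓘(ℝ, E) 1 G := .of_le (n := ∞) (by simp)
  let c' : E →ₗ[ℝ] ℝ := c
  let cc : E →L[ℝ] ℝ := LinearMap.toContinuousLinearMap c'
  obtain ⟨φ⟩ : Nonempty (SmoothBumpFunction 𝓘(ℝ, E) (1 : G)) := inferInstance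
  let h : G → ℝ := fun x => φ x • cc (extChartAt 𝓘(ℝ, E) (1 : G) x)
  have hs : ContMDiff 𝓘(ℝ, E) 𝓘(ℝ, ℝ) ∞ h := by
    refine φ.contMDiff_smul ?_
    exact cc.contMDiff.comp_contMDiffOn contMDiffOn_extChartAt
  have hf : ContMDiff 𝓘(ℝ, E) 𝓘(ℝ, ℝ) ∞ (fun x : U => h (p.1⁻¹ * x.1)) :=
    hs.comp ((contMDiff_mul_left (I := 𝓘(ℝ, E)) (a := p.1⁻¹)).comp contMDiff_subtype_val)
  let f : SmoothFun E U := ⟨_, hf⟩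
  refine ⟨f, fun ξ => ?_⟩
  rw [leftDeriv_apply]
  have e1 : (fun k : G => extZero f (p.1 * k))
      =ᶠ[𝓝 1] fun k => cc (extChartAt 𝓘(ℝ, E) (1 : G) k) := by
    have c1 : Filter.Tendsto (fun k : G => p.1 * k) (𝓝 1) (𝓝 p.1) := by
      have := (contMDiff_mul_left (I := 𝓘(ℝ, E)) (n := ∞) (a := p.1)).continuous.tendsto (1 : G)
      simpa using this
    filter_upwards [c1.eventually (eventually_mem p), φ.eventuallyEq_one] with k hk hk2
    rw [extZero_coe f ⟨_, hk⟩]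
    change h (p.1⁻¹ * (p.1 * k)) = _
    rw [inv_mul_cancel_left]
    simp [h, hk2]
  rw [e1.mfderiv_eq]
  have := mfderiv_comp_chart (p := (1 : G)) (g := cc) cc.differentiableAt ξ
  rw [cc.fderiv] at this
  exact this


variable {ι : Type w} [Fintype ι] (I : Module.Basis ι ℝ (GroupLieAlgebra 𝓘(ℝ, E) G))

/-- Evaluation of smooth functions at a point. -/
def evalAt (x : U) : SmoothFun E U →ₐ[ℝ] ℝ :=
  { ContMDiffMap.evalRingHom (I := 𝓘(ℝ, E)) (I' := 𝓘(ℝ, ℝ)) (n := ∞) x with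
    commutes' := fun _ => rfl }

theorem evalAt_apply (x : U) (f : SmoothFun E U) : evalAt x f = f x := rfl

theorem exists_dual_functions [T2Space G] (p : U) [DecidableEq ι] :
    ∃ f : ι → SmoothFun E U, ∀ a b, evalAt p (leftDeriv (I a) (f b)) = if a = b then 1 else 0 := by
  choose f hf using fun b => exists_leftDeriv_eq p (I.coord b)
  refine ⟨f, fun a b => ?_⟩
  rw [evalAt_apply, hf, Module.Basis.coord_apply, Module.Basis.repr_self, Finsupp.single_apply]

theorem leftDeriv_sum (f : SmoothFun E U) (c : ι → ℝ) :
    leftDeriv (∑ a, c a • I a) f = ∑ a, c a • leftDeriv (I a) f := by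
  classical
  induction (Finset.univ : Finset ι) using Finset.induction_on with
  | empty =>
    have h := leftDeriv_smul_left 0 (0 : GroupLieAlgebra 𝓘(ℝ, E) G) f
    rw [zero_smul, zero_smul] at h
    simpa using h
  | insert a s ha ih =>
    rw [Finset.sum_insert ha, Finset.sum_insert ha, leftDeriv_add_left, leftDeriv_smul_left, ih]

theorem leftDeriv_eq_sum (ξ : GroupLieAlgebra 𝓘(ℝ, E) G) (f : SmoothFun E U) :
    leftDeriv ξ f = ∑ a, I.repr ξ a • leftDeriv (I a) f := by
  rw [← leftDeriv_sum, I.sum_repr]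

/-- `x⁻¹ ξ x`. -/
def adInvVec (x : G) (ξ : GroupLieAlgebra 𝓘(ℝ, E) G) : GroupLieAlgebra 𝓘(ℝ, E) G :=
  (mfderiv 𝓘(ℝ, E) 𝓘(ℝ, E) (fun h : G => x⁻¹ * h * x) 1 ξ : E)

theorem adInv_apply (b : ι) (ξ : GroupLieAlgebra 𝓘(ℝ, E) G) (x : U) :
    adInv I b ξ x = I.repr (adInvVec x.1 ξ) b := rfl

theorem adInv_one (hU : (1 : G) ∈ U) (b : ι) (ξ : GroupLieAlgebra 𝓘(ℝ, E) G) :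
    adInv I b ξ ⟨1, hU⟩ = I.repr ξ b := by
  rw [adInv_apply]
  have h2 : ∀ F : G → G, F = id → (mfderiv 𝓘(ℝ, E) 𝓘(ℝ, E) F 1 ξ : E) = ξ := by
    rintro _ rfl; rw [mfderiv_id]; rfl
  have h3 : adInvVec (1 : G) ξ = ξ := h2 (fun h : G => 1⁻¹ * h * 1) (by ext; simp)
  rw [h3]

theorem rightDeriv_eq (ξ : GroupLieAlgebra 𝓘(ℝ, E) G) (f : SmoothFun E U) (x : U) :
    (mfderiv 𝓘(ℝ, E) 𝓘(ℝ, ℝ) (fun k : G => extZero f (k * x.1)) 1 ξ : ℝ) =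
      leftDeriv (adInvVec x.1 ξ) f x := by
  rw [leftDeriv_apply]
  have h1 : MDifferentiableAt 𝓘(ℝ, E) 𝓘(ℝ, E) (fun h : G => x.1⁻¹ * h * x.1) 1 :=
    ((contMDiff_mul_left (I := 𝓘(ℝ, E)) (n := ∞)).mul contMDiff_const).contMDiffAt.mdifferentiableAt
      (by simp)
  have hx : x.1 * (x.1⁻¹ * 1 * x.1) = x.1 := by group
  have h2 : MDifferentiableAt 𝓘(ℝ, E) 𝓘(ℝ, ℝ) (fun h => extZero f (x.1 * h))
      (x.1⁻¹ * 1 * x.1) := by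
    have h3 : MDifferentiableAt 𝓘(ℝ, E) 𝓘(ℝ, ℝ) (extZero f) (x.1 * (x.1⁻¹ * 1 * x.1)) := by
      rw [hx]; exact mdiff_extZero f x
    exact h3.comp (x.1⁻¹ * 1 * x.1)
      ((contMDiff_mul_left (I := 𝓘(ℝ, E)) (n := ∞)).contMDiffAt.mdifferentiableAt (by simp))
  have h3 := mfderiv_comp (1 : G) h2 h1
  have h4 : (fun h => extZero f (x.1 * h)) ∘ (fun h : G => x.1⁻¹ * h * x.1) =
      fun k => extZero f (k * x.1) := by
    funext k; simp [mul_assoc]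
  rw [h4] at h3
  have h5 : ∀ y : G, y = 1 → ∀ v : E,
      (mfderiv 𝓘(ℝ, E) 𝓘(ℝ, ℝ) (fun h => extZero f (x.1 * h)) y v : ℝ) =
      (mfderiv 𝓘(ℝ, E) 𝓘(ℝ, ℝ) (fun h => extZero f (x.1 * h)) 1 v : ℝ) := by
    rintro y rfl v; rfl
  have h6 := congrArg (fun L : E →L[ℝ] ℝ => L ξ) h3
  exact h6.trans (h5 (x.1⁻¹ * 1 * x.1) (by group) _)

/-- The derivative of a smooth function along a right-invariant vector field. -/
theorem sum_adInv_leftDeriv_apply (ξ : GroupLieAlgebra 𝓘(ℝ, E) G) (f : SmoothFun E U) (x : U) :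
    (∑ b, adInv I b ξ * leftDeriv (I b) f : SmoothFun E U) x =
      mfderiv 𝓘(ℝ, E) 𝓘(ℝ, ℝ) (fun k : G => extZero f (k * x.1)) 1 ξ := by
  rw [rightDeriv_eq, leftDeriv_eq_sum I, ← evalAt_apply, ← evalAt_apply, map_sum, map_sum]
  rfl

/-- Left- and right-invariant vector fields commute. -/
theorem leftDeriv_rightDeriv_comm (ξ η : GroupLieAlgebra 𝓘(ℝ, E) G) (f : SmoothFun E U) :
    leftDeriv η (∑ b, adInv I b ξ * leftDeriv (I b) f) =
      ∑ b, adInv I b ξ * leftDeriv (I b) (leftDeriv η f) := by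
  ext x
  rw [sum_adInv_leftDeriv_apply, leftDeriv_apply]
  have hF : ContMDiffAt (𝓘(ℝ, E).prod 𝓘(ℝ, E)) 𝓘(ℝ, ℝ) ∞
      (Function.uncurry fun h k : G => extZero f (k * x.1 * h)) (1, 1) := by
    have h1 : ContMDiff (𝓘(ℝ, E).prod 𝓘(ℝ, E)) 𝓘(ℝ, E) ∞ (fun p : G × G => p.2 * x.1 * p.1) :=
      (contMDiff_snd.mul contMDiff_const).mul contMDiff_fst
    have h2 : ContMDiffAt 𝓘(ℝ, E) 𝓘(ℝ, ℝ) ∞ (extZero f) (1 * x.1 * 1) := by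
      rw [one_mul, mul_one]; exact contMDiffAt_extZero f x
    exact ContMDiffAt.comp ((1 : G), (1 : G)) h2 h1.contMDiffAt
  have hm := mfderiv_mixed hF η ξ
  have e1 : (fun h : G => extZero (∑ b, adInv I b ξ * leftDeriv (I b) f : SmoothFun E U) (x.1 * h))
      =ᶠ[𝓝 1] fun h => mfderiv 𝓘(ℝ, E) 𝓘(ℝ, ℝ) (fun k : G => extZero f (k * x.1 * h)) 1 ξ := by
    have c1 : Filter.Tendsto (fun k : G => x.1 * k) (𝓝 1) (𝓝 x.1) := by
      have := (contMDiff_mul_left (I := 𝓘(ℝ, E)) (n := ∞) (a := x.1)).continuous.tendsto (1 : G)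
      simpa using this
    filter_upwards [c1.eventually (eventually_mem x)] with h hh
    refine (extZero_coe _ ⟨_, hh⟩).trans ?_
    rw [sum_adInv_leftDeriv_apply]
    have : (fun k => extZero f (k * (x.1 * h))) = fun k => extZero f (k * x.1 * h) := by
      funext k; rw [mul_assoc]
    rw [this]
    rfl
  have e2 : (fun k : G => extZero (leftDeriv η f) (k * x.1))
      =ᶠ[𝓝 1] fun k => mfderiv 𝓘(ℝ, E) 𝓘(ℝ, ℝ) (fun h : G => extZero f (k * x.1 * h)) 1 η := by
    have c1 : Filter.Tendsto (fun k : G => k * x.1) (𝓝 1) (𝓝 x.1) := by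
      have := (contMDiff_mul_right (I := 𝓘(ℝ, E)) (n := ∞) (a := x.1)).continuous.tendsto (1 : G)
      simpa using this
    filter_upwards [c1.eventually (eventually_mem x)] with h hh
    exact (extZero_coe _ ⟨_, hh⟩).trans (leftDeriv_apply η f ⟨_, hh⟩)
  have r1 := congrArg (fun L : E →L[ℝ] ℝ => L η) (e1.mfderiv_eq (I := 𝓘(ℝ, E)) (I' := 𝓘(ℝ, ℝ)))
  have r2 := congrArg (fun L : E →L[ℝ] ℝ => L ξ) (e2.mfderiv_eq (I := 𝓘(ℝ, E)) (I' := 𝓘(ℝ, ℝ)))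
  exact r1.trans (hm.trans r2.symm)

/-- `d(x⁻¹ ξ x) = [x⁻¹ ξ x, x⁻¹ dx]`. -/
theorem leftDeriv_adInv [T2Space G] (ξ η : GroupLieAlgebra 𝓘(ℝ, E) G) (b : ι) :
    leftDeriv η (adInv I b ξ : SmoothFun E U) =
      ∑ a, I.repr ⁅I a, η⁆ b • adInv I a ξ := by
  classical
  ext x
  obtain ⟨f, hf⟩ := exists_dual_functions I x
  have h := leftDeriv_rightDeriv_comm I ξ η (f b)
  have hd : ∀ F : ι → SmoothFun E U, leftDeriv η (∑ a, F a) = ∑ a, leftDeriv η (F a) :=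
    fun F => map_sum (leftDer η) F Finset.univ
  rw [hd] at h
  simp only [leftDeriv_mul] at h
  have hx := congrArg (evalAt x) h
  simp only [map_sum, map_add, map_mul, hf] at hx
  have hc : ∀ a, evalAt x (leftDeriv (I a) (leftDeriv η (f b))) =
      evalAt x (leftDeriv η (leftDeriv (I a) (f b))) + I.repr ⁅I a, η⁆ b := by
    intro a
    have h2 := congrArg (evalAt x) (leftDeriv_lie (I a) η (f b))
    rw [leftDeriv_eq_sum I] at h2
    simp only [map_sum, map_sub, map_smul, hf] at h2
    simp at h2
    linarith
  simp only [hc, mul_add, Finset.sum_add_distrib] at hx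
  rw [← evalAt_apply, ← evalAt_apply, map_sum]
  simp only [map_smul, smul_eq_mul]
  simp at hx
  rw [hx]
  exact Finset.sum_congr rfl fun a _ => mul_comm _ _

end GroupCalculus

section DifferentialOperators

variable {V : Type u} [CommRing V] [Algebra ℂ V] (D : Derivation ℂ V V)

theorem shift_eq (p : V[X]) :
    shift D p = Polynomial.X * p
      + Polynomial.lsum (fun n => (Polynomial.monomial n).restrictScalars ℂ ∘ₗ (D : V →ₗ[ℂ] V)) p :=
  rfl

/-- The operator `λ + ∂` as a linear map. -/
def shiftL : Module.End ℂ V[X] where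
  toFun := shift D
  map_add' p q := by simp only [shift_eq, map_add, mul_add]; abel
  map_smul' r p := by
    simp only [shift_eq, map_smul, smul_add, RingHom.id_apply, Algebra.mul_smul_comm]

theorem shiftL_pow (n : ℕ) (p : V[X]) : (shiftL D ^ n) p = (shift D)^[n] p := by
  rw [Module.End.pow_apply]; rfl

theorem shift_add (p q : V[X]) : shift D (p + q) = shift D p + shift D q := map_add (shiftL D) p q

theorem shift_sum {κ : Type*} (s : Finset κ) (p : κ → V[X]) :
    shift D (∑ k ∈ s, p k) = ∑ k ∈ s, shift D (p k) := map_sum (shiftL D) p s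

theorem shift_neg (p : V[X]) : shift D (-p) = -shift D p := map_neg (shiftL D) p

theorem shift_sub (p q : V[X]) : shift D (p - q) = shift D p - shift D q := map_sub (shiftL D) p q

theorem shift_zero : shift D (0 : V[X]) = 0 := map_zero (shiftL D)

theorem shift_monomial (n : ℕ) (v : V) :
    shift D (Polynomial.monomial n v)
      = Polynomial.monomial (n + 1) v + Polynomial.monomial n (D v) := by
  rw [shift_eq, Polynomial.X_mul_monomial, Polynomial.lsum_apply,
    Polynomial.sum_monomial_index _ _ (by simp)]
  rfl

theorem shift_C (v : V) : shift D (Polynomial.C v) = Polynomial.C v * Polynomial.X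
    + Polynomial.C (D v) := by
  rw [← Polynomial.monomial_zero_left, shift_monomial, ← Polynomial.C_mul_X_pow_eq_monomial,
    Polynomial.monomial_zero_left]
  simp

theorem shift_C_mul (v : V) (p : V[X]) :
    shift D (Polynomial.C v * p) = Polynomial.C v * shift D p + Polynomial.C (D v) * p := by
  induction p using Polynomial.induction_on' with
  | add p q hp hq => rw [mul_add, shift_add, hp, hq, shift_add]; ring
  | monomial n w =>
    simp only [Polynomial.C_mul_monomial, shift_monomial, mul_add, Derivation.leibniz, smul_eq_mul,
      map_add]
    rw [mul_comm w (D v)]; abel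

theorem shift_mul_X (p : V[X]) :
    shift D (p * Polynomial.X) = shift D p * Polynomial.X := by
  induction p using Polynomial.induction_on' with
  | add p q hp hq => rw [add_mul, shift_add, hp, hq, shift_add]; ring
  | monomial n w => simp only [Polynomial.monomial_mul_X, shift_monomial, add_mul]

theorem shift_iterate_mul_X (n : ℕ) (p : V[X]) :
    (shift D)^[n] (p * Polynomial.X) = (shift D)^[n] p * Polynomial.X := by
  induction n generalizing p with
  | zero => rfl
  | succ n ih => rw [Function.iterate_succ_apply, shift_mul_X, ih, Function.iterate_succ_apply]

theorem shift_one : shift D (1 : V[X]) = Polynomial.X := by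
  have := shift_C D (1 : V)
  simpa using this

theorem shift_iterate_one (n : ℕ) : (shift D)^[n] (1 : V[X]) = Polynomial.X ^ n := by
  induction n with
  | zero => simp
  | succ n ih =>
    rw [Function.iterate_succ_apply, shift_one, ← one_mul Polynomial.X, shift_iterate_mul_X, ih,
      pow_succ, one_mul]

theorem act_eq (p q : V[X]) : act D p q =
    Polynomial.lsum (fun n => (LinearMap.mulRight ℂ ((shift D)^[n] q)) ∘ₗ
      (Polynomial.CAlgHom (R := ℂ) (A := V)).toLinearMap) p := rfl

theorem act_add_left (p p' q : V[X]) : act D (p + p') q = act D p q + act D p' q := by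
  simp only [act_eq, map_add]

theorem act_smul_left (r : ℂ) (p q : V[X]) : act D (r • p) q = r • act D p q := by
  simp only [act_eq, map_smul]

theorem act_monomial (n : ℕ) (v : V) (q : V[X]) :
    act D (Polynomial.monomial n v) q = Polynomial.C v * (shift D)^[n] q := by
  rw [act, Polynomial.sum_monomial_index _ _ (by simp)]

theorem act_add_right (p q q' : V[X]) : act D p (q + q') = act D p q + act D p q' := by
  induction p using Polynomial.induction_on' with
  | add p p' hp hq => simp only [act_add_left, hp, hq]; abel
  | monomial n w => simp only [act_monomial, ← shiftL_pow, map_add, mul_add]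

theorem act_smul_right (r : ℂ) (p q : V[X]) : act D p (r • q) = r • act D p q := by
  induction p using Polynomial.induction_on' with
  | add p p' hp hq => simp only [act_add_left, hp, hq, smul_add]
  | monomial n w => simp only [act_monomial, ← shiftL_pow, map_smul, Algebra.mul_smul_comm]

/-- Composition of differential operators, as a bilinear map. -/
def actL : V[X] →ₗ[ℂ] V[X] →ₗ[ℂ] V[X] :=
  LinearMap.mk₂ ℂ (act D) (act_add_left D) (act_smul_left D) (act_add_right D) (act_smul_right D)

theorem act_neg_left (p q : V[X]) : act D (-p) q = -act D p q := (actL D).map_neg₂ p q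

theorem act_neg_right (p q : V[X]) : act D p (-q) = -act D p q := (actL D p).map_neg q

theorem act_zero_left (q : V[X]) : act D 0 q = 0 := (actL D).map_zero₂ q

theorem act_zero_right (p : V[X]) : act D p 0 = 0 := (actL D p).map_zero

theorem act_sum_right {κ : Type*} (s : Finset κ) (p : κ → V[X]) (q : V[X]) :
    act D q (∑ k ∈ s, p k) = ∑ k ∈ s, act D q (p k) := map_sum (actL D q) p s

theorem act_C (v : V) (q : V[X]) : act D (Polynomial.C v) q = Polynomial.C v * q := by
  rw [← Polynomial.monomial_zero_left, act_monomial]; rfl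

theorem act_one_left (q : V[X]) : act D 1 q = q := by
  have := act_C D (1 : V) q
  simpa using this

theorem act_one_right (p : V[X]) : act D p 1 = p := by
  induction p using Polynomial.induction_on' with
  | add p p' hp hq => rw [act_add_left, hp, hq]
  | monomial n w => rw [act_monomial, shift_iterate_one, Polynomial.C_mul_X_pow_eq_monomial]

theorem act_mul_X_left (p q : V[X]) : act D (p * Polynomial.X) q = act D p (shift D q) := by
  induction p using Polynomial.induction_on' with
  | add p p' hp hq => rw [add_mul, act_add_left, act_add_left, hp, hq]
  | monomial n w =>
    rw [Polynomial.monomial_mul_X, act_monomial, act_monomial, Function.iterate_succ_apply]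

theorem act_C_mul (v : V) (p q : V[X]) :
    act D (Polynomial.C v * p) q = Polynomial.C v * act D p q := by
  induction p using Polynomial.induction_on' with
  | add p p' hp hq => rw [mul_add, act_add_left, act_add_left, hp, hq, mul_add]
  | monomial n w =>
    rw [Polynomial.C_mul_monomial, act_monomial, act_monomial, map_mul, mul_assoc]

theorem act_shift (p q : V[X]) : act D (shift D p) q = shift D (act D p q) := by
  induction p using Polynomial.induction_on' with
  | add p p' hp hq => rw [shift_add, act_add_left, act_add_left, shift_add, hp, hq]
  | monomial n w =>
    rw [shift_monomial, act_add_left, act_monomial, act_monomial, act_monomial, shift_C_mul,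
      Function.iterate_succ_apply']

theorem act_shift_iterate (n : ℕ) (p q : V[X]) :
    act D ((shift D)^[n] p) q = (shift D)^[n] (act D p q) := by
  induction n generalizing p with
  | zero => rfl
  | succ n ih => rw [Function.iterate_succ_apply, ih, act_shift, Function.iterate_succ_apply]

theorem act_assoc (p q r : V[X]) : act D (act D p q) r = act D p (act D q r) := by
  induction p using Polynomial.induction_on' with
  | add p p' hp hq => rw [act_add_left, act_add_left, hp, hq, act_add_left]
  | monomial n w => rw [act_monomial, act_monomial, act_C_mul, act_shift_iterate]

/-- The adjoint of a differential operator, as a linear map. -/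
def adjL : Module.End ℂ V[X] :=
  Polynomial.lsum fun n => (LinearMap.mulLeft ℂ ((-1 : V[X]) ^ n)) ∘ₗ (shiftL D ^ n) ∘ₗ
    (Polynomial.CAlgHom (R := ℂ) (A := V)).toLinearMap

theorem adjL_apply (p : V[X]) : adjL D p = adj D p := by
  rw [adjL, Polynomial.lsum_apply, adj]
  simp only [LinearMap.comp_apply, LinearMap.mulLeft_apply, shiftL_pow]
  rfl

theorem adj_add (p q : V[X]) : adj D (p + q) = adj D p + adj D q := by
  simp only [← adjL_apply, map_add]

theorem adj_neg (p : V[X]) : adj D (-p) = -adj D p := by simp only [← adjL_apply, map_neg]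

theorem adj_sub (p q : V[X]) : adj D (p - q) = adj D p - adj D q := by
  simp only [← adjL_apply, map_sub]

theorem adj_zero : adj D (0 : V[X]) = 0 := by simp only [← adjL_apply, map_zero]

theorem adj_sum {κ : Type*} (s : Finset κ) (p : κ → V[X]) :
    adj D (∑ k ∈ s, p k) = ∑ k ∈ s, adj D (p k) := by simp only [← adjL_apply, map_sum]

theorem adj_smul (r : ℂ) (p : V[X]) : adj D (r • p) = r • adj D p := by
  simp only [← adjL_apply, map_smul]

theorem adj_monomial (n : ℕ) (v : V) :
    adj D (Polynomial.monomial n v) = (-1) ^ n * (shift D)^[n] (Polynomial.C v) := by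
  rw [adj, Polynomial.sum_monomial_index]
  rw [map_zero, ← shiftL_pow, map_zero, mul_zero]

theorem adj_C (v : V) : adj D (Polynomial.C v) = Polynomial.C v := by
  rw [← Polynomial.monomial_zero_left, adj_monomial]; simp

theorem shift_neg_one_pow_mul (n m : ℕ) (p : V[X]) :
    (shift D)^[m] ((-1) ^ n * p) = (-1) ^ n * (shift D)^[m] p := by
  rcases neg_one_pow_eq_or V[X] n with h | h <;> simp [h, ← shiftL_pow]

theorem adj_neg_one_pow_mul (n : ℕ) (p : V[X]) :
    adj D ((-1) ^ n * p) = (-1) ^ n * adj D p := by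
  rcases neg_one_pow_eq_or V[X] n with h | h <;> simp [h, adj_neg]

theorem act_neg_one_pow_mul_left (n : ℕ) (p q : V[X]) :
    act D ((-1) ^ n * p) q = (-1) ^ n * act D p q := by
  rcases neg_one_pow_eq_or V[X] n with h | h <;> simp [h, act_neg_left]

theorem act_neg_one_pow_mul_right (n : ℕ) (p q : V[X]) :
    act D p ((-1) ^ n * q) = (-1) ^ n * act D p q := by
  rcases neg_one_pow_eq_or V[X] n with h | h <;> simp [h, act_neg_right]

theorem adj_C_mul (v : V) (p : V[X]) :
    adj D (Polynomial.C v * p) = act D (adj D p) (Polynomial.C v) := by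
  induction p using Polynomial.induction_on' with
  | add p q hp hq => rw [mul_add, adj_add, hp, hq, adj_add, act_add_left]
  | monomial n w =>
    rw [Polynomial.C_mul_monomial, adj_monomial, adj_monomial, act_neg_one_pow_mul_left,
      act_shift_iterate, act_C, mul_comm v w, map_mul]

theorem adj_shift (p : V[X]) : adj D (shift D p) = -(adj D p * Polynomial.X) := by
  induction p using Polynomial.induction_on' with
  | add p q hp hq => rw [shift_add, adj_add, hp, hq, adj_add]; ring
  | monomial n w =>
    rw [shift_monomial, adj_add, adj_monomial, adj_monomial, adj_monomial,
      Function.iterate_succ_apply, shift_C,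
      ← shiftL_pow, map_add, shiftL_pow, shiftL_pow, shift_iterate_mul_X, pow_succ]
    ring

theorem adj_shift_iterate (n : ℕ) (p : V[X]) :
    adj D ((shift D)^[n] p) = (-1) ^ n * (adj D p * Polynomial.X ^ n) := by
  induction n generalizing p with
  | zero => simp
  | succ n ih => rw [Function.iterate_succ_apply, ih, adj_shift]; ring

theorem adj_mul_X (p : V[X]) : adj D (p * Polynomial.X) = -shift D (adj D p) := by
  induction p using Polynomial.induction_on' with
  | add p q hp hq => rw [add_mul, adj_add, hp, hq, adj_add, shift_add]; ring
  | monomial n w =>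
    have h := shift_neg_one_pow_mul D n 1 ((shift D)^[n] (Polynomial.C w))
    simp only [Function.iterate_one] at h
    rw [Polynomial.monomial_mul_X, adj_monomial, adj_monomial, h,
      Function.iterate_succ_apply', pow_succ]
    ring

theorem act_mul_X_pow_left (n : ℕ) (p q : V[X]) :
    act D (p * Polynomial.X ^ n) q = act D p ((shift D)^[n] q) := by
  induction n generalizing q with
  | zero => simp
  | succ n ih => rw [pow_succ, ← mul_assoc, act_mul_X_left, ih, Function.iterate_succ_apply]

theorem adj_act (p q : V[X]) : adj D (act D p q) = act D (adj D q) (adj D p) := by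
  induction p using Polynomial.induction_on' with
  | add p p' hp hq => rw [act_add_left, adj_add, hp, hq, adj_add, act_add_right]
  | monomial n w =>
    rw [act_monomial, adj_C_mul, adj_shift_iterate, act_neg_one_pow_mul_left, adj_monomial,
      act_neg_one_pow_mul_right, act_mul_X_pow_left]

theorem adj_adj (p : V[X]) : adj D (adj D p) = p := by
  induction p using Polynomial.induction_on' with
  | add p q hp hq => rw [adj_add, adj_add, hp, hq]
  | monomial n w =>
    rw [adj_monomial, adj_neg_one_pow_mul, adj_shift_iterate, adj_C,
      Polynomial.C_mul_X_pow_eq_monomial, ← mul_assoc, ← mul_pow]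
    simp

theorem shift_coeff_zero (p : V[X]) : (shift D p).coeff 0 = D (p.coeff 0) := by
  induction p using Polynomial.induction_on' with
  | add p q hp hq => rw [shift_add, Polynomial.coeff_add, hp, hq, Polynomial.coeff_add, map_add]
  | monomial n w =>
    rw [shift_monomial, Polynomial.coeff_add, Polynomial.coeff_monomial, Polynomial.coeff_monomial,
      Polynomial.coeff_monomial]
    rcases n with - | n <;> simp

theorem shift_iterate_coeff_zero (n : ℕ) (p : V[X]) :
    ((shift D)^[n] p).coeff 0 = D^[n] (p.coeff 0) := by
  induction n generalizing p with
  | zero => rfl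
  | succ n ih => rw [Function.iterate_succ_apply, ih, shift_coeff_zero, Function.iterate_succ_apply]

theorem act_coeff_zero (p q : V[X]) :
    (act D p q).coeff 0 = p.sum fun n v => v * D^[n] (q.coeff 0) := by
  rw [act, Polynomial.sum, Polynomial.sum, Polynomial.finsetSum_coeff]
  simp [shift_iterate_coeff_zero]

section Map

variable {V' : Type v} [CommRing V'] [Algebra ℂ V'] (D' : Derivation ℂ V' V') (σ : V →+* V')
  (hσ : ∀ f, σ (D f) = D' (σ f))
include hσ

theorem map_shift (p : V[X]) : (shift D p).map σ = shift D' (p.map σ) := by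
  induction p using Polynomial.induction_on' with
  | add p q hp hq =>
    rw [shift_add, Polynomial.map_add, hp, hq, Polynomial.map_add, shift_add]
  | monomial n w =>
    simp only [shift_monomial, Polynomial.map_add, Polynomial.map_monomial, hσ]

theorem map_shift_iterate (n : ℕ) (p : V[X]) :
    ((shift D)^[n] p).map σ = (shift D')^[n] (p.map σ) := by
  induction n generalizing p with
  | zero => rfl
  | succ n ih =>
    rw [Function.iterate_succ_apply, ih, map_shift D D' σ hσ, Function.iterate_succ_apply]

theorem map_act (p q : V[X]) : (act D p q).map σ = act D' (p.map σ) (q.map σ) := by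
  induction p using Polynomial.induction_on' with
  | add p p' hp hq =>
    rw [act_add_left, Polynomial.map_add, hp, hq, Polynomial.map_add, act_add_left]
  | monomial n w =>
    rw [act_monomial, Polynomial.map_mul, map_shift_iterate D D' σ hσ, Polynomial.map_monomial,
      act_monomial, Polynomial.map_C]

theorem map_adj (p : V[X]) : (adj D p).map σ = adj D' (p.map σ) := by
  induction p using Polynomial.induction_on' with
  | add p p' hp hq =>
    rw [adj_add, Polynomial.map_add, hp, hq, Polynomial.map_add, adj_add]
  | monomial n w =>
    rw [adj_monomial, Polynomial.map_mul, map_shift_iterate D D' σ hσ, Polynomial.map_monomial,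
      adj_monomial, Polynomial.map_C]
    simp

end Map

end DifferentialOperators

section OperatorEvaluation

variable {V : Type u} [CommRing V] [Algebra ℂ V]

/-- Evaluation `∑ vₙ λⁿ ↦ ∑ Tⁿ vₙ` of a polynomial at an operator. -/
def opEval (T : Module.End ℂ V) : V[X] →ₗ[ℂ] V := Polynomial.lsum fun n => T ^ n

theorem opEval_monomial (T : Module.End ℂ V) (n : ℕ) (v : V) :
    opEval T (Polynomial.monomial n v) = (T ^ n) v := by
  rw [opEval, Polynomial.lsum_apply, Polynomial.sum_monomial_index _ _ (by simp)]

/-- Multiplication by a scalar. -/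
abbrev scal (V : Type u) [CommRing V] [Algebra ℂ V] (s : ℂ) : Module.End ℂ V := s • 1

theorem scal_pow (s : ℂ) (n : ℕ) (v : V) : (scal V s ^ n) v = s ^ n • v := by
  rw [scal, smul_pow, one_pow]; rfl

theorem opEval_scal (s : ℂ) (p : V[X]) : opEval (scal V s) p = p.eval (algebraMap ℂ V s) := by
  induction p using Polynomial.induction_on' with
  | add p q hp hq => rw [map_add, hp, hq, Polynomial.eval_add]
  | monomial n v =>
    rw [opEval_monomial, scal_pow, Polynomial.eval_monomial, ← map_pow, Algebra.smul_def, mul_comm]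

theorem opEval_X_mul (T : Module.End ℂ V) (p : V[X]) :
    opEval T (Polynomial.X * p) = T (opEval T p) := by
  induction p using Polynomial.induction_on' with
  | add p q hp hq => rw [mul_add, map_add, hp, hq, map_add, map_add]
  | monomial n v =>
    rw [Polynomial.X_mul_monomial, opEval_monomial, opEval_monomial, pow_succ', Module.End.mul_apply]

theorem opEval_C_mul (s : ℂ) (v : V) (p : V[X]) :
    opEval (scal V s) (Polynomial.C v * p) = v * opEval (scal V s) p := by
  rw [opEval_scal, opEval_scal, Polynomial.eval_mul, Polynomial.eval_C]

theorem opEval_C (T : Module.End ℂ V) (v : V) : opEval T (Polynomial.C v) = v := by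
  rw [← Polynomial.monomial_zero_left, opEval_monomial]; simp

theorem eq_zero_of_forall_eval (p : V[X]) (h : ∀ s : ℂ, p.eval (algebraMap ℂ V s) = 0) :
    p = 0 := by
  ext n
  rw [Polynomial.coeff_zero, ← Module.forall_dual_apply_eq_zero_iff ℂ]
  intro ℓ
  let q : ℂ[X] := ∑ k ∈ Finset.range (p.natDegree + 1), Polynomial.monomial k (ℓ (p.coeff k))
  have hq : q = 0 := by
    refine Polynomial.funext fun s => ?_
    have h1 := congrArg ℓ (h s)
    rw [Polynomial.eval_eq_sum_range, map_sum, map_zero] at h1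
    rw [Polynomial.eval_finsetSum, Polynomial.eval_zero, ← h1]
    refine Finset.sum_congr rfl fun k _ => ?_
    rw [Polynomial.eval_monomial, ← map_pow, mul_comm, mul_comm (p.coeff k), ← Algebra.smul_def,
      map_smul, smul_eq_mul]
  have h2 : q.coeff n = 0 := by rw [hq, Polynomial.coeff_zero]
  by_cases hn : n < p.natDegree + 1
  · simpa [q, Polynomial.finsetSum_coeff, Polynomial.coeff_monomial, hn] using h2
  · rw [Polynomial.coeff_eq_zero_of_natDegree_lt (by omega), map_zero]

theorem eq_zero_of_forall_opEval (p : V[X]) (h : ∀ s : ℂ, opEval (scal V s) p = 0) : p = 0 :=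
  eq_zero_of_forall_eval p fun s => by rw [← opEval_scal, h]

/-- A linear map acting on the coefficients of a polynomial. -/
def coeffMap (L : Module.End ℂ V) : V[X] →ₗ[ℂ] V[X] :=
  Polynomial.lsum fun n => (Polynomial.monomial n).restrictScalars ℂ ∘ₗ L

theorem coeffMap_monomial (L : Module.End ℂ V) (n : ℕ) (v : V) :
    coeffMap L (Polynomial.monomial n v) = Polynomial.monomial n (L v) := by
  rw [coeffMap, Polynomial.lsum_apply, Polynomial.sum_monomial_index _ _ (by simp)]; rfl

theorem map_opEval (L T T' : Module.End ℂ V) (h : ∀ v, L (T v) = T' (L v)) (p : V[X]) :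
    L (opEval T p) = opEval T' (coeffMap L p) := by
  have hn : ∀ (n : ℕ) v, L ((T ^ n) v) = (T' ^ n) (L v) := by
    intro n
    induction n with
    | zero => intro v; simp
    | succ n ih => intro v; rw [pow_succ, Module.End.mul_apply, ih, h, pow_succ, Module.End.mul_apply]
  induction p using Polynomial.induction_on' with
  | add p q hp hq => rw [map_add, map_add, hp, hq, map_add, map_add]
  | monomial n v => rw [opEval_monomial, coeffMap_monomial, opEval_monomial, hn]

theorem opEval_translate (T : Module.End ℂ V) (s : ℂ) (p : V[X]) :
    opEval T (p.comp (Polynomial.X + Polynomial.C (algebraMap ℂ V s))) =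
      opEval (T + scal V s) p := by
  have h1 : ∀ q : V[X], opEval T (q * (Polynomial.X + Polynomial.C (algebraMap ℂ V s))) =
      (T + scal V s) (opEval T q) := by
    intro q
    rw [mul_add, map_add, mul_comm q, opEval_X_mul, mul_comm q, ← Polynomial.smul_eq_C_mul,
      algebraMap_smul, map_smul]
    simp [scal]
  induction p using Polynomial.induction_on' with
  | add p q hp hq => rw [Polynomial.add_comp, map_add, hp, hq, map_add]
  | monomial n v =>
    rw [Polynomial.monomial_comp, opEval_monomial]
    induction n with
    | zero => simp [opEval_C]
    | succ n ih => rw [pow_succ, ← mul_assoc, h1, ih, pow_succ', Module.End.mul_apply]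

variable (D : Derivation ℂ V V)

theorem opEval_shift (s : ℂ) (p : V[X]) :
    opEval (scal V s) (shift D p) = s • opEval (scal V s) p + D (opEval (scal V s) p) := by
  induction p using Polynomial.induction_on' with
  | add p q hp hq => rw [shift_add, map_add, hp, hq, map_add, map_add, smul_add]; abel
  | monomial n v =>
    rw [shift_monomial, map_add, opEval_monomial, opEval_monomial, opEval_monomial, scal_pow,
      scal_pow, scal_pow, D.map_smul, pow_succ', mul_smul]

theorem opEval_adj (s : ℂ) (p : V[X]) :
    opEval (scal V s) (adj D p) = opEval (-(scal V s + (D : V →ₗ[ℂ] V))) p := by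
  induction p using Polynomial.induction_on' with
  | add p q hp hq => rw [adj_add, map_add, hp, hq, map_add]
  | monomial n v =>
    rw [adj_monomial, opEval_monomial]
    induction n with
    | zero => simp [opEval_C]
    | succ n ih =>
      rw [pow_succ', Function.iterate_succ_apply', mul_assoc, ← Function.iterate_one (shift D),
        ← shift_neg_one_pow_mul, Function.iterate_one, neg_one_mul, map_neg, opEval_shift, ih,
        pow_succ', Module.End.mul_apply]
      rfl

end OperatorEvaluation

/-- A skew-symmetric `λ`-bracket satisfying sesquilinearity and the Leibniz rule. -/
structure PreBracket (V : Type u) [CommRing V] [Algebra ℂ V] where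
  D : Derivation ℂ V V
  br : V →ₗ[ℂ] V →ₗ[ℂ] V[X]
  br_D_left : ∀ f g, br (D f) g = -(Polynomial.X * br f g)
  br_D_right : ∀ f g, br f (D g) = shift D (br f g)
  br_mul : ∀ f g h, br f (g * h) = Polynomial.C g * br f h + Polynomial.C h * br f g
  br_skew : ∀ f g, br g f = -adj D (br f g)

/-- An induction principle: `Ω` generates `V` as a differential ring. -/
def Generates {V : Type u} [CommRing V] [Algebra ℂ V] (D : Derivation ℂ V V) (Ω : Set V) : Prop :=
  ∀ q : V → Prop, (∀ x ∈ Ω, q x) → (∀ x y, q x → q y → q (x + y)) →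
    (∀ x y, q x → q y → q (x * y)) → (∀ x, q x → q (D x)) → ∀ x, q x

namespace PreBracket

variable {V : Type u} [CommRing V] [Algebra ℂ V] (B : PreBracket V)

/-- The bracket with a numerical value of `λ`. -/
def bs (s : ℂ) : V →ₗ[ℂ] V →ₗ[ℂ] V := B.br.compr₂ (opEval (scal V s))

theorem bs_apply (s : ℂ) (f g : V) : B.bs s f g = opEval (scal V s) (B.br f g) := rfl

theorem bs_D_left (s : ℂ) (f g : V) : B.bs s (B.D f) g = -(s • B.bs s f g) := by
  rw [bs_apply, bs_apply, B.br_D_left, map_neg, opEval_X_mul]; rfl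

theorem bs_D_right (s : ℂ) (f g : V) : B.bs s f (B.D g) = s • B.bs s f g + B.D (B.bs s f g) := by
  rw [bs_apply, bs_apply, B.br_D_right, opEval_shift]

theorem bs_mul (s : ℂ) (f g h : V) : B.bs s f (g * h) = g * B.bs s f h + h * B.bs s f g := by
  simp only [bs_apply, B.br_mul, map_add, opEval_C_mul]

theorem bs_skew (s : ℂ) (f g : V) :
    B.bs s g f = -opEval (-(scal V s + (B.D : V →ₗ[ℂ] V))) (B.br f g) := by
  rw [bs_apply, B.br_skew, map_neg, opEval_adj]

/-- The Jacobiator. -/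
def jac (s t : ℂ) (f g h : V) : V :=
  B.bs s f (B.bs t g h) - B.bs t g (B.bs s f h) - B.bs (s + t) (B.bs s f g) h

theorem jac_add (s t : ℂ) (f g h k : V) :
    B.jac s t f g (h + k) = B.jac s t f g h + B.jac s t f g k := by
  simp only [jac, map_add]; abel

theorem jac_mul (s t : ℂ) (f g h k : V) :
    B.jac s t f g (h * k) = h * B.jac s t f g k + k * B.jac s t f g h := by
  simp only [jac, map_add, bs_mul]; ring

theorem jac_D (s t : ℂ) (f g h : V) :
    B.jac s t f g (B.D h) = (s + t) • B.jac s t f g h + B.D (B.jac s t f g h) := by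
  simp only [jac, map_add, bs_D_right, map_sub, map_smul]
  module

theorem jac_swap_left (s t : ℂ) (f g h : V) : B.jac s t f g h = -B.jac t s g f h := by
  have key : B.bs (s + t) (B.bs s f g) h = -B.bs (s + t) (B.bs t g f) h := by
    rw [bs_skew B s g f, map_neg, LinearMap.neg_apply]
    have h1 := map_opEval ((B.bs (s + t)).flip h) (-(scal V s + (B.D : V →ₗ[ℂ] V))) (scal V t)
      (fun v => by
        simp only [LinearMap.flip_apply, LinearMap.neg_apply, LinearMap.add_apply, map_neg, map_add]
        change -(B.bs (s + t) (s • v) h + B.bs (s + t) (B.D v) h) = t • B.bs (s + t) v h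
        rw [bs_D_left, map_smul, LinearMap.smul_apply]; module) (B.br g f)
    have h2 := map_opEval ((B.bs (s + t)).flip h) (scal V t) (scal V t)
      (fun v => by
        change (B.bs (s + t) (t • v)) h = t • B.bs (s + t) v h
        rw [map_smul, LinearMap.smul_apply]) (B.br g f)
    rw [LinearMap.flip_apply] at h1 h2
    rw [h1, bs_apply B t, h2]
  rw [jac, jac, key, add_comm t s]
  abel

theorem jac_swap_right (s : ℂ) (f g h : V) (hJ : ∀ u, B.jac s u f h g = 0) (t : ℂ) :
    B.jac s t f g h = 0 := by
  set p₁ := coeffMap (B.bs s f) (B.br h g)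
  set p₂ := B.br h (B.bs s f g)
  set p₃ := B.br (B.bs s f h) g
  have hscal : ∀ u : ℂ, B.bs s f (B.bs u h g) = opEval (scal V u) p₁ := fun u =>
    map_opEval (B.bs s f) (scal V u) (scal V u) (fun v => (B.bs s f).map_smul u v) _
  have hz : p₁ - p₂ - p₃.comp (Polynomial.X + Polynomial.C (algebraMap ℂ V s)) = 0 := by
    refine eq_zero_of_forall_opEval _ fun u => ?_
    rw [map_sub, map_sub, opEval_translate, ← hJ u, jac, hscal, bs_apply, bs_apply B (s + u),
      ← add_smul, add_comm s u]
  set T : Module.End ℂ V := -(scal V (s + t) + (B.D : V →ₗ[ℂ] V))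
  have hT := congrArg (opEval T) hz
  rw [map_sub, map_sub, opEval_translate, map_zero] at hT
  have e1 : B.bs s f (B.bs t g h) = -opEval T p₁ := by
    rw [bs_skew B t h g, map_neg]
    rw [map_opEval (B.bs s f) _ T (fun v => by
      change B.bs s f (-(t • v + B.D v)) = -((s + t) • B.bs s f v + B.D (B.bs s f v))
      rw [map_neg, map_add, bs_D_right, map_smul]; module)]
  have e2 : B.bs t g (B.bs s f h) = -opEval (T + scal V s) p₃ := by
    rw [bs_skew B t _ g]
    congr 3
    simp only [T, scal]; module
  have e3 : B.bs (s + t) (B.bs s f g) h = -opEval T p₂ := by rw [bs_skew]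
  rw [jac, e1, e2, e3]
  linear_combination -hT

theorem jac_of_generates {Ω : Set V} (hΩ : Generates B.D Ω)
    (h : ∀ x ∈ Ω, ∀ y ∈ Ω, ∀ z ∈ Ω, ∀ s t, B.jac s t x y z = 0) (s t : ℂ) (x y z : V) :
    B.jac s t x y z = 0 := by
  have ext3 : ∀ x y, (∀ z ∈ Ω, ∀ s t, B.jac s t x y z = 0) → ∀ z s t, B.jac s t x y z = 0 := by
    intro x y hz z
    refine hΩ (fun z => ∀ s t, B.jac s t x y z = 0) hz ?_ ?_ ?_ z
    · intro a b ha hb s t; rw [jac_add, ha, hb, add_zero]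
    · intro a b ha hb s t; rw [jac_mul, ha, hb, mul_zero, mul_zero, add_zero]
    · intro a ha s t; rw [jac_D, ha, smul_zero, map_zero, add_zero]
  have h1 : ∀ x ∈ Ω, ∀ y ∈ Ω, ∀ z s t, B.jac s t x y z = 0 := fun x hx y hy =>
    ext3 x y (h x hx y hy)
  have h2 : ∀ x ∈ Ω, ∀ y z s t, B.jac s t x y z = 0 := fun x hx y =>
    ext3 x y fun z hz s t => jac_swap_right B s x y z (fun u => h1 x hx z hz y s u) t
  have h3 : ∀ x y, ∀ z ∈ Ω, ∀ s t, B.jac s t x y z = 0 := fun x y z hz s t =>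
    jac_swap_right B s x y z (fun u => by rw [jac_swap_left, h2 z hz, neg_zero]) t
  exact ext3 x y (h3 x y) z s t

theorem jacobi_eval (f g h : V) (s t : ℂ) :
    Polynomial.eval (algebraMap ℂ V s) (Polynomial.eval (algebraMap ℂ V[X] t)
      (((B.br g h).sum fun n v => Polynomial.C (B.br f v) * Polynomial.X ^ n)
      - ((B.br f h).sum fun n v =>
          (B.br g v).map (Polynomial.C : V →+* V[X]) * Polynomial.C (Polynomial.X ^ n))
      - (B.br f g).sum fun n v =>
        Polynomial.C (Polynomial.X ^ n) *
          (B.br v h).eval₂ ((Polynomial.C : V[X] →+* V[X][X]).comp Polynomial.C)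
            (Polynomial.C Polynomial.X + Polynomial.X))) = B.jac s t f g h := by
  have hC : (algebraMap ℂ V[X] t) = Polynomial.C (algebraMap ℂ V t) := rfl
  have hsum : ∀ (u : ℂ) (L : V →ₗ[ℂ] V) (p : V[X]), L (opEval (scal V u) p) =
      p.sum fun n v => (algebraMap ℂ V u) ^ n * L v := by
    intro u L p
    rw [opEval, Polynomial.lsum_apply, Polynomial.sum, Polynomial.sum, map_sum]
    refine Finset.sum_congr rfl fun n _ => ?_
    rw [scal_pow, map_smul, ← map_pow, Algebra.smul_def]
  rw [Polynomial.eval_sub, Polynomial.eval_sub, Polynomial.eval_sub, Polynomial.eval_sub, jac]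
  congr 1
  · congr 1
    · rw [bs_apply B t, hsum, Polynomial.sum, Polynomial.sum, Polynomial.eval_finsetSum,
        Polynomial.eval_finsetSum]
      refine Finset.sum_congr rfl fun n _ => ?_
      rw [bs_apply, opEval_scal, hC, Polynomial.eval_mul, Polynomial.eval_C, Polynomial.eval_pow,
        Polynomial.eval_X, Polynomial.eval_mul, Polynomial.eval_pow, Polynomial.eval_C, mul_comm]
    · rw [bs_apply B s, hsum, Polynomial.sum, Polynomial.sum, Polynomial.eval_finsetSum,
        Polynomial.eval_finsetSum]
      refine Finset.sum_congr rfl fun n _ => ?_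
      rw [bs_apply, opEval_scal, hC, Polynomial.eval_mul, Polynomial.eval_mul,
        Polynomial.eval_map, Polynomial.eval₂_at_apply, Polynomial.eval_C, Polynomial.eval_C,
        Polynomial.eval_pow, Polynomial.eval_X, mul_comm]
  · have h3 := hsum s ((B.bs (s + t)).flip h) (B.br f g)
    rw [LinearMap.flip_apply] at h3
    rw [bs_apply B s, h3, Polynomial.sum, Polynomial.sum, Polynomial.eval_finsetSum,
        Polynomial.eval_finsetSum]
    refine Finset.sum_congr rfl fun n _ => ?_
    have h4 : ∀ p : V[X], Polynomial.eval (algebraMap ℂ V s) (Polynomial.eval (algebraMap ℂ V[X] t)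
        (p.eval₂ ((Polynomial.C : V[X] →+* V[X][X]).comp Polynomial.C)
            (Polynomial.C Polynomial.X + Polynomial.X))) = p.eval (algebraMap ℂ V (s + t)) := by
      intro p
      rw [hC]
      induction p using Polynomial.induction_on' with
      | add p q hp hq => simp only [Polynomial.eval₂_add, Polynomial.eval_add, hp, hq]
      | monomial n v => simp
    rw [Polynomial.eval_mul, Polynomial.eval_mul, h4, LinearMap.flip_apply, bs_apply, opEval_scal]
    simp

/-- A skew bracket with vanishing Jacobiator is a local Poisson algebra. -/
def toPVA (hJ : ∀ s t f g h, B.jac s t f g h = 0) : PVA V where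
  D := B.D
  br := B.br
  br_D_left := B.br_D_left
  br_D_right := B.br_D_right
  br_mul := B.br_mul
  br_skew := B.br_skew
  br_jacobi f g h := by
    rw [← sub_eq_zero]
    refine eq_zero_of_forall_eval _ fun t => eq_zero_of_forall_eval _ fun s => ?_
    rw [jacobi_eval, hJ]

end PreBracket

namespace PVA

variable {V : Type u} [CommRing V] [Algebra ℂ V] (P : PVA V)

/-- The underlying bracket of a local Poisson algebra. -/
def toPre : PreBracket V where
  D := P.D
  br := P.br
  br_D_left := P.br_D_left
  br_D_right := P.br_D_right
  br_mul := P.br_mul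
  br_skew := P.br_skew

theorem jac_eq_zero (s t : ℂ) (f g h : V) : P.toPre.jac s t f g h = 0 := by
  rw [← PreBracket.jacobi_eval]
  have := sub_eq_zero.2 (P.br_jacobi f g h)
  change Polynomial.eval _ (Polynomial.eval _ (_ - _ - _)) = 0
  erw [this]
  simp

theorem ext_of {P P' : PVA V} (hD : P.D = P'.D) (hbr : ∀ f g, P.br f g = P'.br f g) : P = P' := by
  cases P; cases P'
  obtain rfl := hD
  obtain rfl := LinearMap.ext₂ hbr
  rfl

end PVA

section Agreement

variable {V : Type u} [CommRing V] [Algebra ℂ V] {D : Derivation ℂ V V}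
  {V' : Type v} [CommRing V'] [Algebra ℂ V'] {D' : Derivation ℂ V' V'}

/-- Two skew brackets with values in `V'[λ]`, which are derivations along `σ : V → V'`, agree if
they agree on generators. -/
theorem bracket_ext {Ω : Set V} (hΩ : Generates D Ω) (σ : V →+* V') (T T' : V → V → V'[X])
    (hadd : ∀ f g h, T f (g + h) = T f g + T f h) (hadd' : ∀ f g h, T' f (g + h) = T' f g + T' f h)
    (hmul : ∀ f g h, T f (g * h) = Polynomial.C (σ g) * T f h + Polynomial.C (σ h) * T f g)
    (hmul' : ∀ f g h, T' f (g * h) = Polynomial.C (σ g) * T' f h + Polynomial.C (σ h) * T' f g)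
    (hD : ∀ f g, T f (D g) = shift D' (T f g)) (hD' : ∀ f g, T' f (D g) = shift D' (T' f g))
    (hs : ∀ f g, T g f = -adj D' (T f g)) (hs' : ∀ f g, T' g f = -adj D' (T' f g))
    (h : ∀ x ∈ Ω, ∀ y ∈ Ω, T x y = T' x y) (x y : V) : T x y = T' x y := by
  have ext2 : ∀ x, (∀ y ∈ Ω, T x y = T' x y) → ∀ y, T x y = T' x y := by
    intro x hy
    refine hΩ _ hy ?_ ?_ ?_
    · intro a b ha hb; rw [hadd, hadd', ha, hb]
    · intro a b ha hb; rw [hmul, hmul', ha, hb]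
    · intro a ha; rw [hD, hD', ha]
  refine ext2 x (fun y hy => ?_) y
  rw [hs y x, hs' y x, ext2 y (h y hy)]

end Agreement

section LieAlgebra

variable {𝔤 : Type v} [LieRing 𝔤] [LieAlgebra ℝ 𝔤] {ι : Type w} [Fintype ι]
  (I : Module.Basis ι ℝ 𝔤)

/-- The opposite of the Killing form. -/
def kform (ξ η : 𝔤) : ℝ := -killingForm ℝ 𝔤 ξ η

theorem kform_symm (ξ η : 𝔤) : kform ξ η = kform η ξ := by
  rw [kform, kform, LieModule.traceForm_comm]

theorem kform_lie (ξ η ζ : 𝔤) : kform ⁅ξ, η⁆ ζ = kform ξ ⁅η, ζ⁆ := by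
  rw [kform, kform, LieModule.traceForm_apply_lie_apply]

theorem kap_symm (a b : ι) : kap I a b = kap I b a := kform_symm _ _

theorem kform_sum_left (c : ι → ℝ) (η : 𝔤) :
    kform (∑ a, c a • I a) η = ∑ a, c a * kform (I a) η := by
  simp [kform, map_sum, LinearMap.sum_apply, Finset.sum_neg_distrib]

theorem kform_eq_sum (ξ : 𝔤) (b : ι) : kform ξ (I b) = ∑ a, I.repr ξ a * kap I a b := by
  conv_lhs => rw [← I.sum_repr ξ]
  rw [kform_sum_left]; rfl

variable {V : Type u} [CommRing V] [Algebra ℂ V]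

theorem comp_add (F : ι → V) (ξ η : 𝔤) : comp I F (ξ + η) = comp I F ξ + comp I F η := by
  simp [comp, add_smul, Finset.sum_add_distrib]

theorem comp_smul (F : ι → V) (r : ℝ) (ξ : 𝔤) : comp I F (r • ξ) = (r : ℂ) • comp I F ξ := by
  simp [comp, mul_smul, Finset.smul_sum]

theorem comp_neg (F : ι → V) (ξ : 𝔤) : comp I F (-ξ) = -comp I F ξ := by
  simp [comp, neg_smul, Finset.sum_neg_distrib]

theorem comp_zero (F : ι → V) : comp I F (0 : 𝔤) = 0 := by simp [comp]

theorem comp_sum {κ : Type*} (s : Finset κ) (F : ι → V) (ξ : κ → 𝔤) :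
    comp I F (∑ k ∈ s, ξ k) = ∑ k ∈ s, comp I F (ξ k) := by
  classical
  induction s using Finset.induction_on with
  | empty => simp [comp_zero]
  | insert k s hk ih => rw [Finset.sum_insert hk, Finset.sum_insert hk, comp_add, ih]

theorem comp_add_left (F F' : ι → V) (ξ : 𝔤) : comp I (F + F') ξ = comp I F ξ + comp I F' ξ := by
  simp [comp, Finset.sum_add_distrib]

theorem comp_smul_left (F : ι → V) (r : ℂ) (ξ : 𝔤) : comp I (r • F) ξ = r • comp I F ξ := by
  simp [comp, Finset.smul_sum, smul_comm r]

theorem comp_zero_left (ξ : 𝔤) : comp I (0 : ι → V) ξ = 0 := by simp [comp]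

theorem comp_basis [DecidableEq ι] (F : ι → V) (a : ι) : comp I F (I a) = F a := by
  simp [comp, Finsupp.single_apply, Finset.sum_ite_eq]

theorem map_comp {V' : Type*} [CommRing V'] [Algebra ℂ V'] (σ : V →ₗ[ℂ] V') (F : ι → V) (ξ : 𝔤) :
    σ (comp I F ξ) = comp I (fun a => σ (F a)) ξ := by
  simp [comp, map_sum]

variable [DecidableEq ι] [LieAlgebra.IsSemisimple ℝ 𝔤]

theorem isUnit_kap_det : IsUnit (Matrix.of (kap I)).det := by
  have : Module.Finite ℝ 𝔤 := Module.Finite.of_basis I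
  have hn := LieAlgebra.IsKilling.killingForm_nondegenerate ℝ 𝔤
  have h := (LinearMap.BilinForm.nondegenerate_iff_det_ne_zero I).1 hn
  have e : Matrix.of (kap I) = -(LinearMap.BilinForm.toMatrix I (killingForm ℝ 𝔤)) := by
    ext a b; simp [kap, LinearMap.BilinForm.toMatrix_apply]
  rw [e, Matrix.det_neg]
  exact (((isUnit_one.neg).pow _).mul (isUnit_iff_ne_zero.2 h))

theorem kinv_mul_kap (a c : ι) : ∑ b, kinv I a b * kap I b c = if a = c then 1 else 0 := by
  have h := Matrix.nonsing_inv_mul (Matrix.of (kap I)) (isUnit_kap_det I)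
  have := congrFun (congrFun h a) c
  rw [Matrix.mul_apply, Matrix.one_apply] at this
  exact this

theorem kap_mul_kinv (a c : ι) : ∑ b, kap I a b * kinv I b c = if a = c then 1 else 0 := by
  have h := Matrix.mul_nonsing_inv (Matrix.of (kap I)) (isUnit_kap_det I)
  have := congrFun (congrFun h a) c
  rw [Matrix.mul_apply, Matrix.one_apply] at this
  exact this

theorem kinv_symm (a b : ι) : kinv I a b = kinv I b a := by
  have h : (Matrix.of (kap I)).transpose = Matrix.of (kap I) := by
    ext a b; exact kap_symm I b a
  have h2 := Matrix.transpose_nonsing_inv (Matrix.of (kap I))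
  rw [h] at h2
  exact congrFun (congrFun h2 b) a

/-- Lowering and raising an index. -/
theorem sum_kinv_kap_smul (F : ι → V) (a : ι) :
    ∑ b, ((kinv I a b : ℝ) : ℂ) • ∑ c, ((kap I b c : ℝ) : ℂ) • F c = F a := by
  simp only [Finset.smul_sum, smul_smul, ← Complex.ofReal_mul]
  rw [Finset.sum_comm]
  simp only [← Finset.sum_smul, ← Complex.ofReal_sum, kinv_mul_kap]
  simp

theorem sum_kap_kinv_smul (F : ι → V) (a : ι) :
    ∑ b, ((kap I a b : ℝ) : ℂ) • ∑ c, ((kinv I b c : ℝ) : ℂ) • F c = F a := by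
  simp only [Finset.smul_sum, smul_smul, ← Complex.ofReal_mul]
  rw [Finset.sum_comm]
  simp only [← Finset.sum_smul, ← Complex.ofReal_sum, kap_mul_kinv]
  simp

end LieAlgebra

section GaugedAlgebra

variable {A : Type*} [CommRing A] [Algebra ℂ A]
  {E : Type u} [NormedAddCommGroup E] [NormedSpace ℝ E]
  {G : Type v} [TopologicalSpace G] [ChartedSpace E G]
  {U : TopologicalSpace.Opens G} {ι : Type w}

/-- `h ↦ h(g)` as a ring homomorphism. -/
def fnHom : SmoothFun E U →+* GaugedAlg A E U ι :=
  ((Algebra.TensorProduct.includeRight : CotAlg E U ι →ₐ[ℝ] GaugedAlg A E U ι) :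
    CotAlg E U ι →+* GaugedAlg A E U ι).comp MvPolynomial.C

theorem fn_add (h k : SmoothFun E U) : (fn (h + k) : GaugedAlg A E U ι) = fn h + fn k :=
  map_add fnHom h k

theorem fn_mul (h k : SmoothFun E U) : (fn (h * k) : GaugedAlg A E U ι) = fn h * fn k :=
  map_mul fnHom h k

theorem fn_sub (h k : SmoothFun E U) : (fn (h - k) : GaugedAlg A E U ι) = fn h - fn k :=
  map_sub fnHom h k

theorem fn_neg (h : SmoothFun E U) : (fn (-h) : GaugedAlg A E U ι) = -fn h := map_neg fnHom h

theorem fn_sum {κ : Type*} (s : Finset κ) (h : κ → SmoothFun E U) :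
    (fn (∑ k ∈ s, h k) : GaugedAlg A E U ι) = ∑ k ∈ s, fn (h k) := map_sum fnHom h s

theorem fn_algebraMap (r : ℝ) :
    (fn (algebraMap ℝ (SmoothFun E U) r) : GaugedAlg A E U ι) = algebraMap ℂ _ (r : ℂ) := by
  have h1 : (MvPolynomial.C (algebraMap ℝ (SmoothFun E U) r) : CotAlg E U ι) = r • 1 := by
    rw [Algebra.smul_def, mul_one]; rfl
  rw [fn, h1, TensorProduct.tmul_smul, TensorProduct.smul_tmul', Algebra.algebraMap_eq_smul_one,
    Algebra.TensorProduct.one_def, TensorProduct.smul_tmul']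
  rfl

theorem fn_smul (r : ℝ) (h : SmoothFun E U) :
    (fn (r • h) : GaugedAlg A E U ι) = (r : ℂ) • fn h := by
  rw [Algebra.smul_def, fn_mul, fn_algebraMap]
  exact (Algebra.smul_def _ _).symm

theorem gauged_induction {q : GaugedAlg A E U ι → Prop} (hA : ∀ f, q (inA f)) (hR : ∀ h, q (fn h))
    (hj : ∀ a n, q (jv a n)) (hX : ∀ a n, q (Xv a n)) (hadd : ∀ x y, q x → q y → q (x + y))
    (hmul : ∀ x y, q x → q y → q (x * y)) (x : GaugedAlg A E U ι) : q x := by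
  have hC : ∀ p : CotAlg E U ι, q (1 ⊗ₜ p) := by
    intro p
    induction p using MvPolynomial.induction_on with
    | C h => exact hR h
    | add p p' hp hp' => rw [TensorProduct.tmul_add]; exact hadd _ _ hp hp'
    | mul_X p i hp =>
      have : (1 : A) ⊗ₜ[ℝ] (p * MvPolynomial.X i) = (1 ⊗ₜ p) * (1 ⊗ₜ MvPolynomial.X i) := by
        rw [Algebra.TensorProduct.tmul_mul_tmul, one_mul]
      rw [this]
      refine hmul _ _ hp ?_
      rcases i with ⟨a, n⟩ | ⟨a, n⟩
      · exact hj a n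
      · exact hX a n
  induction x using TensorProduct.induction_on with
  | zero => rw [← map_zero (inA : A →ₐ[ℂ] GaugedAlg A E U ι)]; exact hA 0
  | tmul f p =>
    have : f ⊗ₜ[ℝ] p = inA f * (1 ⊗ₜ p) := by
      rw [inA, Algebra.TensorProduct.includeLeft_apply, Algebra.TensorProduct.tmul_mul_tmul, one_mul,
        mul_one]
    rw [this]
    exact hmul _ _ (hA f) (hC p)
  | add x y hx hy => exact hadd _ _ hx hy

section Lift

variable {B : Type*} [CommRing B] [Algebra ℂ B] (α : A →ₐ[ℂ] B) (β : SmoothFun E U →+* B)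
  (hβ : ∀ r : ℝ, β (algebraMap ℝ _ r) = algebraMap ℂ B r) (γ : Jet ι → B)

/-- The algebra homomorphism out of `𝒜 ⊗ 𝒜_{G₀}` with given values on generators. -/
def gaugedLift : GaugedAlg A E U ι →ₐ[ℂ] B :=
  Algebra.TensorProduct.lift α
    { MvPolynomial.eval₂Hom β γ with
      commutes' := fun r => by
        have h1 : (algebraMap ℝ (CotAlg E U ι) r) =
          MvPolynomial.C (algebraMap ℝ (SmoothFun E U) r) := rfl
        change MvPolynomial.eval₂Hom β γ (algebraMap ℝ (CotAlg E U ι) r) = _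
        rw [h1, MvPolynomial.eval₂Hom_C, hβ]
        rfl }
    (fun _ _ => Commute.all _ _)

theorem gaugedLift_inA (f : A) : gaugedLift α β hβ γ (inA f) = α f := by
  simp [gaugedLift, inA]

theorem gaugedLift_fn (h : SmoothFun E U) : gaugedLift α β hβ γ (fn h) = β h := by
  simp only [gaugedLift, fn, Algebra.TensorProduct.lift_tmul, map_one, one_mul]
  exact MvPolynomial.eval₂Hom_C β γ h

theorem gaugedLift_jet (i : Jet ι) :
    gaugedLift α β hβ γ ((1 : A) ⊗ₜ[ℝ] (MvPolynomial.X i : CotAlg E U ι)) = γ i := by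
  simp only [gaugedLift, Algebra.TensorProduct.lift_tmul, map_one, one_mul]
  exact MvPolynomial.eval₂Hom_X' β γ i

end Lift

end GaugedAlgebra

section LiftDerivation

variable {A : Type*} [CommRing A] [Algebra ℂ A] {R : Type*} [CommRing R] [Algebra ℝ R] {κ : Type*}
  {V : Type u} [CommRing V] [Algebra ℂ V] {M : Type u} [AddCommGroup M] [Module ℂ M]
  [Module V M] [Module Vᵐᵒᵖ M] [IsCentralScalar V M] [IsScalarTower ℂ V M]

/-- Derivations are constructed from their values on generators, by means of algebra homomorphisms
to a square-zero extension. -/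
theorem exists_derivation_of_lift (iA : A →ₐ[ℂ] V) (iR : R →+* V) (x : κ → V)
    (hind : ∀ L : V →ₐ[ℂ] V, (∀ f, L (iA f) = iA f) → (∀ h, L (iR h) = iR h) →
      (∀ i, L (x i) = x i) → ∀ v, L v = v)
    (hconst : ∀ r : ℝ, iR (algebraMap ℝ R r) = algebraMap ℂ V r)
    (hlift : ∀ (α : A →ₐ[ℂ] TrivSqZeroExt V M) (β : R →+* TrivSqZeroExt V M)
      (γ : κ → TrivSqZeroExt V M), (∀ r : ℝ, β (algebraMap ℝ R r) = algebraMap ℂ _ (r : ℂ)) →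
      ∃ L : V →ₐ[ℂ] TrivSqZeroExt V M,
        (∀ f, L (iA f) = α f) ∧ (∀ h, L (iR h) = β h) ∧ ∀ i, L (x i) = γ i)
    (dA : A →ₗ[ℂ] M) (hdA : ∀ f g, dA (f * g) = iA f • dA g + iA g • dA f)
    (dR : R →+ M) (hdR : ∀ f g, dR (f * g) = iR f • dR g + iR g • dR f)
    (hdR_const : ∀ r : ℝ, dR (algebraMap ℝ _ r) = 0) (dJ : κ → M) :
    ∃ d : Derivation ℂ V M, (∀ f, d (iA f) = dA f) ∧ (∀ h, d (iR h) = dR h) ∧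
      ∀ i, d (x i) = dJ i := by
  have hA1 : dA 1 = 0 := by
    have h := hdA 1 1
    rw [mul_one, map_one iA, one_smul] at h
    simpa using h
  have hR1 : dR 1 = 0 := by
    have := hdR_const 1
    rwa [map_one] at this
  let α : A →ₐ[ℂ] TrivSqZeroExt V M := AlgHom.ofLinearMap
    { toFun := fun f => TrivSqZeroExt.inl (iA f) + TrivSqZeroExt.inr (dA f)
      map_add' := fun f g => by ext <;> simp
      map_smul' := fun r f => by ext <;> simp }
    (by ext <;> simp [hA1])
    (fun f g => by ext <;> simp [hdA])
  let β : R →+* TrivSqZeroExt V M :=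
    { toFun := fun h => TrivSqZeroExt.inl (iR h) + TrivSqZeroExt.inr (dR h)
      map_one' := by ext <;> simp [hR1]
      map_zero' := by ext <;> simp
      map_add' := fun f g => by ext <;> simp
      map_mul' := fun f g => by ext <;> simp [hdR] }
  have hβ : ∀ r : ℝ, β (algebraMap ℝ _ r) = algebraMap ℂ _ (r : ℂ) := fun r => by
    change TrivSqZeroExt.inl (iR _) + TrivSqZeroExt.inr (dR _) = TrivSqZeroExt.inl _
    rw [hconst, hdR_const]; simp
  obtain ⟨L, hLA, hLR, hLJ⟩ := hlift α β
    (fun i => TrivSqZeroExt.inl (x i) + TrivSqZeroExt.inr (dJ i)) hβ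
  have hL : ∀ v, (L v).fst = v := by
    refine hind ((TrivSqZeroExt.fstHom ℂ V M).comp L) ?_ ?_ ?_
    · intro f; simp [hLA, α]
    · intro h; simp [hLR, β]
    · intro i; simp [hLJ]
  refine ⟨Derivation.mk'
    { toFun := fun v => (L v).snd
      map_add' := fun v w => by rw [map_add, TrivSqZeroExt.snd_add]
      map_smul' := fun r v => by rw [map_smul, TrivSqZeroExt.snd_smul]; rfl }
    (fun v w => ?_), ?_, ?_, ?_⟩
  · change (L (v * w)).snd = v • (L w).snd + w • (L v).snd
    rw [map_mul, TrivSqZeroExt.snd_mul, hL, hL, op_smul_eq_smul]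
  · intro f; change (L (iA f)).snd = _; simp [hLA, α]
  · intro h; change (L (iR h)).snd = _; simp [hLR, β]
  · intro i; change (L _).snd = _; simp [hLJ]

end LiftDerivation

section GaugedAlgebra

variable {A : Type*} [CommRing A] [Algebra ℂ A]
  {E : Type u} [NormedAddCommGroup E] [NormedSpace ℝ E]
  {G : Type v} [TopologicalSpace G] [ChartedSpace E G]
  {U : TopologicalSpace.Opens G} {ι : Type w}

/-- The generators `∂ⁿ j^a` and `∂ⁿ X_a`. -/
def jet : Jet ι → GaugedAlg A E U ι := fun i => 1 ⊗ₜ MvPolynomial.X i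

theorem gauged_lift_exists {B : Type*} [CommRing B] [Algebra ℂ B] (α : A →ₐ[ℂ] B)
    (β : SmoothFun E U →+* B) (γ : Jet ι → B)
    (hβ : ∀ r : ℝ, β (algebraMap ℝ _ r) = algebraMap ℂ B (r : ℂ)) :
    ∃ L : GaugedAlg A E U ι →ₐ[ℂ] B,
      (∀ f, L (inA f) = α f) ∧ (∀ h, L (fnHom h) = β h) ∧ ∀ i, L (jet i) = γ i :=
  ⟨gaugedLift α β hβ γ, gaugedLift_inA α β hβ γ, gaugedLift_fn α β hβ γ, gaugedLift_jet α β hβ γ⟩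

end GaugedAlgebra

/-- A differential algebra of fields generated by an algebra `A`, by functions `R` of a group-valued
field, and by two families of jets, together with the left-invariant derivatives on `R`. -/
structure FieldAlg (A : Type*) [CommRing A] [Algebra ℂ A] (R : Type*) [CommRing R] [Algebra ℝ R]
    (V : Type u) [CommRing V] [Algebra ℂ V] (ι : Type*) [Fintype ι]
    {𝔤 : Type v} [LieRing 𝔤] [LieAlgebra ℝ 𝔤] (I : Module.Basis ι ℝ 𝔤) where
  iA : A →ₐ[ℂ] V
  iR : R →+* V
  jet : Jet ι → V
  der : 𝔤 → R →+ R
  const : ∀ r : ℝ, iR (algebraMap ℝ R r) = algebraMap ℂ V r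
  ind : ∀ q : V → Prop, (∀ f, q (iA f)) → (∀ h, q (iR h)) → (∀ i, q (jet i)) →
    (∀ x y, q x → q y → q (x + y)) → (∀ x y, q x → q y → q (x * y)) → ∀ x, q x
  lift : ∀ (B : Type u) [CommRing B] [Algebra ℂ B] (α : A →ₐ[ℂ] B) (β : R →+* B)
    (γ : Jet ι → B), (∀ r : ℝ, β (algebraMap ℝ R r) = algebraMap ℂ B (r : ℂ)) →
    ∃ L : V →ₐ[ℂ] B, (∀ f, L (iA f) = α f) ∧ (∀ h, L (iR h) = β h) ∧ ∀ i, L (jet i) = γ i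
  der_mul : ∀ ξ f g, der ξ (f * g) = f * der ξ g + g * der ξ f
  der_const : ∀ ξ r, der ξ (algebraMap ℝ R r) = 0
  der_sum : ∀ (c : ι → ℝ) f, der (∑ a, c a • I a) f = ∑ a, c a • der (I a) f
  der_lie : ∀ ξ η f, der ⁅ξ, η⁆ f = der ξ (der η f) - der η (der ξ f)

namespace FieldAlg

variable {A : Type*} [CommRing A] [Algebra ℂ A] {R : Type*} [CommRing R] [Algebra ℝ R]
    {V : Type u} [CommRing V] [Algebra ℂ V] {ι : Type*} [Fintype ι]
    {𝔤 : Type v} [LieRing 𝔤] [LieAlgebra ℝ 𝔤] {I : Module.Basis ι ℝ 𝔤}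
    (𝔉 : FieldAlg A R V ι I)

/-- `∂ⁿ j^a`. -/
def j (a : ι) (n : ℕ) : V := 𝔉.jet (Sum.inl (a, n))

/-- `∂ⁿ X_a`. -/
def X (a : ι) (n : ℕ) : V := 𝔉.jet (Sum.inr (a, n))

theorem iR_smul (r : ℝ) (h : R) : 𝔉.iR (r • h) = (r : ℂ) • 𝔉.iR h := by
  rw [Algebra.smul_def, map_mul, 𝔉.const, Algebra.smul_def]

theorem exists_derivation {M : Type u} [AddCommGroup M] [Module ℂ M]
    [Module V M] [Module Vᵐᵒᵖ M] [IsCentralScalar V M] [IsScalarTower ℂ V M]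
    (dA : A →ₗ[ℂ] M) (hdA : ∀ f g, dA (f * g) = 𝔉.iA f • dA g + 𝔉.iA g • dA f)
    (dR : R →+ M) (hdR : ∀ f g, dR (f * g) = 𝔉.iR f • dR g + 𝔉.iR g • dR f)
    (hdR_const : ∀ r : ℝ, dR (algebraMap ℝ _ r) = 0) (dj dX : ι → ℕ → M) :
    ∃ d : Derivation ℂ V M, (∀ f, d (𝔉.iA f) = dA f) ∧ (∀ h, d (𝔉.iR h) = dR h) ∧
      (∀ a n, d (𝔉.j a n) = dj a n) ∧ ∀ a n, d (𝔉.X a n) = dX a n := by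
  obtain ⟨d, h1, h2, h3⟩ := exists_derivation_of_lift 𝔉.iA 𝔉.iR 𝔉.jet
    (fun L hA hR hJ v => 𝔉.ind (fun v => L v = v) hA hR hJ
      (fun x y hx hy => by rw [map_add, hx, hy]) (fun x y hx hy => by rw [map_mul, hx, hy]) v)
    𝔉.const (fun α β γ hβ => 𝔉.lift _ α β γ hβ) dA hdA dR hdR hdR_const
    (Sum.elim (fun p => dj p.1 p.2) (fun p => dX p.1 p.2))
  exact ⟨d, h1, h2, fun a n => h3 _, fun a n => h3 _⟩

theorem derivation_ext {M : Type*} [AddCommGroup M] [Module ℂ M] [Module V M]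
    {d d' : V → M} (hd : ∀ x y, d (x + y) = d x + d y) (hd' : ∀ x y, d' (x + y) = d' x + d' y)
    (hm : ∀ x y, d (x * y) = x • d y + y • d x) (hm' : ∀ x y, d' (x * y) = x • d' y + y • d' x)
    (hA : ∀ f, d (𝔉.iA f) = d' (𝔉.iA f)) (hR : ∀ h, d (𝔉.iR h) = d' (𝔉.iR h))
    (hj : ∀ a n, d (𝔉.j a n) = d' (𝔉.j a n)) (hX : ∀ a n, d (𝔉.X a n) = d' (𝔉.X a n)) (v : V) :
    d v = d' v := by
  refine 𝔉.ind (fun v => d v = d' v) hA hR ?_ ?_ ?_ v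
  · rintro (⟨a, n⟩ | ⟨a, n⟩)
    exacts [hj a n, hX a n]
  · intro x y hx hy; rw [hd, hd', hx, hy]
  · intro x y hx hy; rw [hm, hm', hx, hy]

/-- The spatial derivative of the canonical fields. -/
structure IsDeriv (P : PVA A) (D : Derivation ℂ V V) : Prop where
  iA : ∀ f, D (𝔉.iA f) = 𝔉.iA (P.D f)
  iR : ∀ h, D (𝔉.iR h) = ∑ a, 𝔉.iR (𝔉.der (I a) h) * 𝔉.j a 0
  j : ∀ a n, D (𝔉.j a n) = 𝔉.j a (n + 1)
  X : ∀ a n, D (𝔉.X a n) = 𝔉.X a (n + 1)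

theorem exists_isDeriv (P : PVA A) : ∃ D : Derivation ℂ V V, 𝔉.IsDeriv P D := by
  obtain ⟨D, h1, h2, h3, h4⟩ := 𝔉.exists_derivation (M := V)
    (𝔉.iA.toLinearMap ∘ₗ (P.D : A →ₗ[ℂ] A))
    (fun f g => by simp)
    { toFun := fun h => ∑ a, 𝔉.iR (𝔉.der (I a) h) * 𝔉.j a 0
      map_zero' := by simp
      map_add' := fun f g => by simp [add_mul, Finset.sum_add_distrib] }
    (fun f g => by
      simp only [AddMonoidHom.coe_mk, ZeroHom.coe_mk, 𝔉.der_mul, map_add, map_mul, add_mul,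
        Finset.sum_add_distrib, smul_eq_mul, Finset.mul_sum, mul_assoc])
    (fun r => by simp [𝔉.der_const])
    (fun a n => 𝔉.j a (n + 1)) (fun a n => 𝔉.X a (n + 1))
  exact ⟨D, h1, h2, h3, h4⟩

variable {P : PVA A} {D : Derivation ℂ V V} (hD : 𝔉.IsDeriv P D)

theorem smul_poly (x : V) (p : V[X]) : x • p = Polynomial.C x * p := Polynomial.smul_eq_C_mul x

include hD in
/-- A derivation to `V[λ]` commutes with `∂` if it does so on the generators. -/
theorem derivation_D (d : V → V[X]) (hadd : ∀ x y, d (x + y) = d x + d y)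
    (hm : ∀ x y, d (x * y) = x • d y + y • d x)
    (hA : ∀ f, d (D (𝔉.iA f)) = shift D (d (𝔉.iA f)))
    (hR : ∀ h, d (D (𝔉.iR h)) = shift D (d (𝔉.iR h)))
    (hj : ∀ a n, d (𝔉.j a n) = (shift D)^[n] (d (𝔉.j a 0)))
    (hX : ∀ a n, d (𝔉.X a n) = (shift D)^[n] (d (𝔉.X a 0))) (v : V) :
    d (D v) = shift D (d v) := by
  refine 𝔉.ind (fun v => d (D v) = shift D (d v)) hA hR ?_ ?_ ?_ v
  · rintro (⟨a, n⟩ | ⟨a, n⟩)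
    · change d (D (𝔉.j a n)) = shift D (d (𝔉.j a n))
      rw [hD.j, hj, hj a n, Function.iterate_succ_apply']
    · change d (D (𝔉.X a n)) = shift D (d (𝔉.X a n))
      rw [hD.X, hX, hX a n, Function.iterate_succ_apply']
  · intro x y hx hy; rw [map_add, hadd, hx, hy, hadd, shift_add]
  · intro x y hx hy
    rw [D.leibniz, smul_eq_mul, smul_eq_mul, hadd, hm, hm, hm, hx, hy, shift_add, smul_poly,
      smul_poly, smul_poly, smul_poly, smul_poly, smul_poly, shift_C_mul, shift_C_mul]
    ring

end FieldAlg

section ASector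

variable {A : Type*} [CommRing A] [Algebra ℂ A]

theorem PVA.br_mul_left (P : PVA A) (f g h : A) :
    P.br (f * g) h = act P.D (P.br f h) (Polynomial.C g) + act P.D (P.br g h) (Polynomial.C f) := by
  rw [P.br_skew h (f * g), P.br_mul, adj_add, adj_C_mul, adj_C_mul, P.br_skew f h, P.br_skew g h,
    adj_neg, adj_neg, adj_adj, adj_adj, act_neg_left, act_neg_left]
  ring

end ASector

namespace FieldAlg

variable {A : Type*} [CommRing A] [Algebra ℂ A] {R : Type*} [CommRing R] [Algebra ℝ R]
    {V : Type u} [CommRing V] [Algebra ℂ V] {ι : Type*} [Fintype ι]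
    {𝔤 : Type v} [LieRing 𝔤] [LieAlgebra ℝ 𝔤] {I : Module.Basis ι ℝ 𝔤}
    (𝔉 : FieldAlg A R V ι I) {P : PVA A} {D : Derivation ℂ V V} (hD : 𝔉.IsDeriv P D)

/-- The polynomial with coefficients in `V` defined by a polynomial with coefficients in `A`. -/
def mapA : A[X] →ₗ[ℂ] V[X] := (Polynomial.mapAlgHom 𝔉.iA).toLinearMap

theorem mapA_apply (p : A[X]) : 𝔉.mapA p = p.map (𝔉.iA : A →+* V) := rfl

theorem mapA_C_mul (f : A) (p : A[X]) : 𝔉.mapA (Polynomial.C f * p) = 𝔉.iA f • 𝔉.mapA p := by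
  rw [mapA_apply, Polynomial.map_mul, Polynomial.map_C, ← Polynomial.smul_eq_C_mul]; rfl

include hD in
theorem mapA_adj (p : A[X]) : 𝔉.mapA (adj P.D p) = adj D (𝔉.mapA p) :=
  map_adj P.D D (𝔉.iA : A →+* V) (fun f => (hD.iA f).symm) p

include hD in
theorem mapA_act (p q : A[X]) : 𝔉.mapA (act P.D p q) = act D (𝔉.mapA p) (𝔉.mapA q) :=
  map_act P.D D (𝔉.iA : A →+* V) (fun f => (hD.iA f).symm) p q

theorem exists_rowA (P : PVA A) (f : A) : ∃ d : Derivation ℂ V V[X],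
    (∀ g, d (𝔉.iA g) = 𝔉.mapA (P.br f g)) ∧ (∀ h, d (𝔉.iR h) = 0) ∧
      (∀ a n, d (𝔉.j a n) = 0) ∧ ∀ a n, d (𝔉.X a n) = 0 := by
  refine 𝔉.exists_derivation (M := V[X]) (𝔉.mapA ∘ₗ P.br f) (fun g h => ?_) 0 (by simp) (by simp)
    (fun _ _ => 0) (fun _ _ => 0)
  simp only [LinearMap.comp_apply, P.br_mul, map_add, mapA_C_mul]

/-- `{f_λ ·}` for `f ∈ A`. -/
def rowA (P : PVA A) (f : A) : Derivation ℂ V V[X] := (𝔉.exists_rowA P f).choose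

theorem rowA_iA (f g : A) : 𝔉.rowA P f (𝔉.iA g) = 𝔉.mapA (P.br f g) :=
  (𝔉.exists_rowA P f).choose_spec.1 g

theorem rowA_iR (f : A) (h : R) : 𝔉.rowA P f (𝔉.iR h) = 0 := (𝔉.exists_rowA P f).choose_spec.2.1 h

theorem rowA_j (f : A) (a : ι) (n : ℕ) : 𝔉.rowA P f (𝔉.j a n) = 0 :=
  (𝔉.exists_rowA P f).choose_spec.2.2.1 a n

theorem rowA_X (f : A) (a : ι) (n : ℕ) : 𝔉.rowA P f (𝔉.X a n) = 0 :=
  (𝔉.exists_rowA P f).choose_spec.2.2.2 a n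

theorem rowA_add (f g : A) (G : V) : 𝔉.rowA P (f + g) G = 𝔉.rowA P f G + 𝔉.rowA P g G := by
  refine 𝔉.derivation_ext (d' := fun G => 𝔉.rowA P f G + 𝔉.rowA P g G)
    (fun x y => map_add _ x y) (fun x y => ?_) (fun x y => (𝔉.rowA P (f + g)).leibniz x y)
    (fun x y => ?_) ?_ ?_ ?_ ?_ G
  · simp only [map_add]; abel
  · simp only [Derivation.leibniz, smul_add]; abel
  all_goals simp [rowA_iA, rowA_iR, rowA_j, rowA_X]

theorem rowA_smul (r : ℂ) (f : A) (G : V) : 𝔉.rowA P (r • f) G = r • 𝔉.rowA P f G := by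
  refine 𝔉.derivation_ext (d' := fun G => r • 𝔉.rowA P f G)
    (fun x y => map_add _ x y) (fun x y => ?_) (fun x y => (𝔉.rowA P (r • f)).leibniz x y)
    (fun x y => ?_) ?_ ?_ ?_ ?_ G
  · simp only [map_add, smul_add]
  · simp only [Derivation.leibniz, smul_add, smul_comm r]
  all_goals simp [rowA_iA, rowA_iR, rowA_j, rowA_X]

theorem act_smul_poly (x : V) (p q : V[X]) : act D (x • p) q = x • act D p q := by
  rw [smul_poly, smul_poly, act_C_mul]

include hD in
theorem rowA_mul (f g : A) (G : V) : 𝔉.rowA P (f * g) G =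
    act D (𝔉.rowA P f G) (Polynomial.C (𝔉.iA g))
      + act D (𝔉.rowA P g G) (Polynomial.C (𝔉.iA f)) := by
  refine 𝔉.derivation_ext (d' := fun G => act D (𝔉.rowA P f G) (Polynomial.C (𝔉.iA g))
      + act D (𝔉.rowA P g G) (Polynomial.C (𝔉.iA f)))
    (fun x y => map_add _ x y) (fun x y => ?_) (fun x y => (𝔉.rowA P (f * g)).leibniz x y)
    (fun x y => ?_) ?_ ?_ ?_ ?_ G
  · simp only [map_add, act_add_left]; abel
  · simp only [Derivation.leibniz, act_add_left, act_smul_poly, smul_add]; abel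
  · intro k
    have hC : ∀ f : A, Polynomial.C (𝔉.iA f) = 𝔉.mapA (Polynomial.C f) := fun f => by
      rw [mapA_apply, Polynomial.map_C]; rfl
    simp only [rowA_iA, P.br_mul_left, map_add, mapA_act 𝔉 hD, hC]
  all_goals simp [rowA_iR, rowA_j, rowA_X, act_zero_left]

include hD in
theorem rowA_D_left (f : A) (G : V) : 𝔉.rowA P (P.D f) G = -(𝔉.rowA P f G * Polynomial.X) := by
  refine 𝔉.derivation_ext (d' := fun G => -(𝔉.rowA P f G * Polynomial.X))
    (fun x y => map_add _ x y) (fun x y => ?_) (fun x y => (𝔉.rowA P (P.D f)).leibniz x y)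
    (fun x y => ?_) ?_ ?_ ?_ ?_ G
  · simp only [map_add, add_mul]; abel
  · simp only [Derivation.leibniz, smul_poly]; ring
  · intro k
    rw [rowA_iA, rowA_iA, P.br_D_left, map_neg, mapA_apply, Polynomial.map_mul, Polynomial.map_X,
      ← mapA_apply, mul_comm]
  all_goals simp [rowA_iR, rowA_j, rowA_X]

theorem adj_smul_poly (x : V) (p : V[X]) :
    adj D (x • p) = act D (adj D p) (Polynomial.C x) := by rw [smul_poly, adj_C_mul]

include hD in
theorem exists_brA (G : V) : ∃ d : Derivation ℂ V V[X],
    (∀ f, d (𝔉.iA f) = -adj D (𝔉.rowA P f G)) ∧ (∀ h, d (𝔉.iR h) = 0) ∧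
      (∀ a n, d (𝔉.j a n) = 0) ∧ ∀ a n, d (𝔉.X a n) = 0 := by
  refine 𝔉.exists_derivation (M := V[X])
    { toFun := fun f => -adj D (𝔉.rowA P f G)
      map_add' := fun f g => by rw [rowA_add, adj_add, neg_add]
      map_smul' := fun r f => by rw [rowA_smul, adj_smul, smul_neg]; rfl } (fun f g => ?_) 0
    (by simp) (by simp) (fun _ _ => 0) (fun _ _ => 0)
  change -adj D (𝔉.rowA P (f * g) G) = 𝔉.iA f • -adj D (𝔉.rowA P g G)
    + 𝔉.iA g • -adj D (𝔉.rowA P f G)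
  rw [rowA_mul 𝔉 hD, adj_add, adj_act, adj_act, adj_C, adj_C, act_C, act_C, smul_poly, smul_poly]
  ring

end FieldAlg

section OfSkew

variable {V : Type u} [CommRing V] [Algebra ℂ V]

/-- A skew-symmetric family of derivations commuting with `∂` defines a bracket. -/
def PreBracket.ofSkew (D : Derivation ℂ V V) (T : V → Derivation ℂ V V[X])
    (hD : ∀ f g, T f (D g) = shift D (T f g)) (hs : ∀ f g, T g f = -adj D (T f g)) :
    PreBracket V where
  D := D
  br := LinearMap.mk₂ ℂ (fun f g => T f g)
    (fun f f' g => by rw [hs g, map_add, adj_add, neg_add, ← hs, ← hs])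
    (fun r f g => by rw [hs g, Derivation.map_smul, adj_smul, ← smul_neg, ← hs])
    (fun f g g' => map_add _ _ _) (fun r f g => (T f).map_smul r g)
  br_D_left f g := by
    change T (D f) g = -(Polynomial.X * T f g)
    rw [hs g, hD, adj_shift, hs g f]
    ring
  br_D_right := hD
  br_mul f g h := by
    change T f (g * h) = Polynomial.C g * T f h + Polynomial.C h * T f g
    rw [Derivation.leibniz, Polynomial.smul_eq_C_mul, Polynomial.smul_eq_C_mul]
  br_skew f g := hs f g

theorem PreBracket.ofSkew_br (D : Derivation ℂ V V) (T : V → Derivation ℂ V V[X])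
    (hD : ∀ f g, T f (D g) = shift D (T f g)) (hs : ∀ f g, T g f = -adj D (T f g)) (f g : V) :
    (PreBracket.ofSkew D T hD hs).br f g = T f g := rfl

/-- `p ↦ p(λ+∂) q`, which is linear over `V`. -/
def actRight (D : Derivation ℂ V V) (q : V[X]) : V[X] →ₗ[V] V[X] where
  toFun p := act D p q
  map_add' p p' := act_add_left D p p' q
  map_smul' x p := by
    rw [Polynomial.smul_eq_C_mul, act_C_mul, RingHom.id_apply, Polynomial.smul_eq_C_mul]

end OfSkew

namespace FieldAlg

variable {A : Type*} [CommRing A] [Algebra ℂ A] {R : Type*} [CommRing R] [Algebra ℝ R]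
    {V : Type u} [CommRing V] [Algebra ℂ V] {ι : Type*} [Fintype ι]
    {𝔤 : Type v} [LieRing 𝔤] [LieAlgebra ℝ 𝔤] {I : Module.Basis ι ℝ 𝔤}
    (𝔉 : FieldAlg A R V ι I) {P : PVA A} {D : Derivation ℂ V V} (hD : 𝔉.IsDeriv P D)

/-- The bracket of `A`, extended by zero to the other generators. -/
def brA (G : V) : Derivation ℂ V V[X] := (𝔉.exists_brA hD G).choose

theorem brA_iA (G : V) (f : A) : 𝔉.brA hD G (𝔉.iA f) = -adj D (𝔉.rowA P f G) :=
  (𝔉.exists_brA hD G).choose_spec.1 f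

theorem brA_iR (G : V) (h : R) : 𝔉.brA hD G (𝔉.iR h) = 0 := (𝔉.exists_brA hD G).choose_spec.2.1 h

theorem brA_j (G : V) (a : ι) (n : ℕ) : 𝔉.brA hD G (𝔉.j a n) = 0 :=
  (𝔉.exists_brA hD G).choose_spec.2.2.1 a n

theorem brA_X (G : V) (a : ι) (n : ℕ) : 𝔉.brA hD G (𝔉.X a n) = 0 :=
  (𝔉.exists_brA hD G).choose_spec.2.2.2 a n

theorem derivation_ext' {d d' : Derivation ℂ V V[X]} (hA : ∀ f, d (𝔉.iA f) = d' (𝔉.iA f))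
    (hR : ∀ h, d (𝔉.iR h) = d' (𝔉.iR h)) (hj : ∀ a n, d (𝔉.j a n) = d' (𝔉.j a n))
    (hX : ∀ a n, d (𝔉.X a n) = d' (𝔉.X a n)) : d = d' :=
  Derivation.ext (𝔉.derivation_ext (map_add d) (map_add d') d.leibniz d'.leibniz hA hR hj hX)

theorem brA_iA_left (f : A) : 𝔉.brA hD (𝔉.iA f) = 𝔉.rowA P f := by
  refine 𝔉.derivation_ext' (fun g => ?_) ?_ ?_ ?_
  · rw [brA_iA, rowA_iA, rowA_iA, ← mapA_adj 𝔉 hD, ← map_neg, ← P.br_skew]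
  all_goals simp [brA_iR, brA_j, brA_X, rowA_iR, rowA_j, rowA_X]

theorem brA_eq_zero (G : V) (hG : ∀ f, 𝔉.rowA P f G = 0) : 𝔉.brA hD G = 0 := by
  refine 𝔉.derivation_ext' (fun g => ?_) ?_ ?_ ?_
  · rw [brA_iA, hG, adj_zero, neg_zero]; rfl
  all_goals simp [brA_iR, brA_j, brA_X]

theorem brA_add_left (x y : V) : 𝔉.brA hD (x + y) = 𝔉.brA hD x + 𝔉.brA hD y := by
  refine 𝔉.derivation_ext' (fun g => ?_) ?_ ?_ ?_
  · rw [Derivation.add_apply, brA_iA, brA_iA, brA_iA, map_add, adj_add, neg_add]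
  all_goals simp [brA_iR, brA_j, brA_X]

theorem brA_mul_left (x y : V) : 𝔉.brA hD (x * y) =
    (actRight D (Polynomial.C y)).compDer (𝔉.brA hD x)
      + (actRight D (Polynomial.C x)).compDer (𝔉.brA hD y) := by
  refine 𝔉.derivation_ext' (fun g => ?_) ?_ ?_ ?_
  · change _ = act D (𝔉.brA hD x (𝔉.iA g)) _ + act D (𝔉.brA hD y (𝔉.iA g)) _
    rw [brA_iA, brA_iA, brA_iA, Derivation.leibniz, adj_add, adj_smul_poly, adj_smul_poly,
      act_neg_left, act_neg_left]
    ring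
  all_goals simp [brA_iR, brA_j, brA_X]

theorem brA_skew (F G : V) : 𝔉.brA hD G F = -adj D (𝔉.brA hD F G) := by
  refine 𝔉.ind (fun G => 𝔉.brA hD G F = -adj D (𝔉.brA hD F G)) ?_ ?_ ?_ ?_ ?_ G
  · intro f; rw [brA_iA_left, brA_iA, adj_neg, adj_adj, neg_neg]
  · intro h; rw [brA_eq_zero _ _ _ fun f => 𝔉.rowA_iR f h, brA_iR, adj_zero, neg_zero]; rfl
  · rintro (⟨a, n⟩ | ⟨a, n⟩)
    · change 𝔉.brA hD (𝔉.j a n) F = -adj D (𝔉.brA hD F (𝔉.j a n))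
      rw [brA_eq_zero _ _ _ fun f => 𝔉.rowA_j f a n, brA_j, adj_zero, neg_zero]; rfl
    · change 𝔉.brA hD (𝔉.X a n) F = -adj D (𝔉.brA hD F (𝔉.X a n))
      rw [brA_eq_zero _ _ _ fun f => 𝔉.rowA_X f a n, brA_X, adj_zero, neg_zero]; rfl
  · intro x y hx hy
    rw [brA_add_left, Derivation.add_apply, hx, hy, map_add, adj_add, neg_add]
  · intro x y hx hy
    rw [brA_mul_left, Derivation.leibniz, adj_add, adj_smul_poly, adj_smul_poly]
    change act D (𝔉.brA hD x F) _ + act D (𝔉.brA hD y F) _ = _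
    rw [hx, hy, act_neg_left, act_neg_left]
    ring

theorem shift_iterate_zero (n : ℕ) : (shift D)^[n] (0 : V[X]) = 0 := by rw [← shiftL_pow, map_zero]

theorem brA_D (G F : V) : 𝔉.brA hD G (D F) = shift D (𝔉.brA hD G F) := by
  refine 𝔉.derivation_D hD (𝔉.brA hD G) (map_add _) (𝔉.brA hD G).leibniz ?_ ?_ ?_ ?_ F
  · intro f; rw [hD.iA, brA_iA, brA_iA, rowA_D_left 𝔉 hD, adj_neg, adj_mul_X, shift_neg, neg_neg]
  · intro h
    rw [hD.iR, brA_iR, shift_zero, map_sum]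
    refine Finset.sum_eq_zero fun a _ => ?_
    rw [Derivation.leibniz, brA_iR, brA_j, smul_zero, smul_zero, add_zero]
  · intro a n; rw [brA_j, brA_j, shift_iterate_zero]
  · intro a n; rw [brA_X, brA_X, shift_iterate_zero]

variable [DecidableEq ι]

theorem exists_momOp (a : ι) : ∃ d : Derivation ℂ V V[X],
    (∀ f, d (𝔉.iA f) = 0) ∧ (∀ h, d (𝔉.iR h) = 0) ∧
      (∀ b n, d (𝔉.j b n) = 0) ∧ ∀ b n, d (𝔉.X b n) = if a = b then Polynomial.X ^ n else 0 := by
  exact 𝔉.exists_derivation (M := V[X]) 0 (by simp) 0 (by simp) (by simp) (fun _ _ => 0)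
    (fun b n => if a = b then Polynomial.X ^ n else 0)

/-- The Fréchet derivative along `X_a`. -/
def momOp (a : ι) : Derivation ℂ V V[X] := (𝔉.exists_momOp a).choose

theorem momOp_iA (a : ι) (f : A) : 𝔉.momOp a (𝔉.iA f) = 0 := (𝔉.exists_momOp a).choose_spec.1 f

theorem momOp_iR (a : ι) (h : R) : 𝔉.momOp a (𝔉.iR h) = 0 := (𝔉.exists_momOp a).choose_spec.2.1 h

theorem momOp_j (a b : ι) (n : ℕ) : 𝔉.momOp a (𝔉.j b n) = 0 :=
  (𝔉.exists_momOp a).choose_spec.2.2.1 b n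

theorem momOp_X (a b : ι) (n : ℕ) :
    𝔉.momOp a (𝔉.X b n) = if a = b then Polynomial.X ^ n else 0 :=
  (𝔉.exists_momOp a).choose_spec.2.2.2 b n

include hD in
theorem momOp_D (a : ι) (F : V) : 𝔉.momOp a (D F) = shift D (𝔉.momOp a F) := by
  refine 𝔉.derivation_D hD (𝔉.momOp a) (map_add _) (𝔉.momOp a).leibniz ?_ ?_ ?_ ?_ F
  · intro f; rw [hD.iA, momOp_iA, momOp_iA, shift_zero]
  · intro h
    rw [hD.iR, momOp_iR, shift_zero, map_sum]
    refine Finset.sum_eq_zero fun b _ => ?_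
    rw [Derivation.leibniz, momOp_iR, momOp_j, smul_zero, smul_zero, add_zero]
  · intro b n; rw [momOp_j, momOp_j, shift_iterate_zero]
  · intro b n; rw [momOp_X, momOp_X, pow_zero]
    split_ifs
    · rw [shift_iterate_one]
    · rw [shift_iterate_zero]

/-- The linear combination of the `j^a` with coefficients `α(I_a)`. -/
def jl (α : Module.Dual ℝ 𝔤) : V := ∑ c, ((α (I c) : ℝ) : ℂ) • 𝔉.j c 0

/-- The linear combination of the `X_a` along `ξ`. -/
def Xl (ξ : 𝔤) : V := comp I (fun a => 𝔉.X a 0) ξ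

/-- The coadjoint action. -/
def coadj (α : Module.Dual ℝ 𝔤) (ξ : 𝔤) : Module.Dual ℝ 𝔤 :=
  -(α ∘ₗ (LieAlgebra.ad ℝ 𝔤 ξ : 𝔤 →ₗ[ℝ] 𝔤))

theorem coadj_apply (α : Module.Dual ℝ 𝔤) (ξ η : 𝔤) : coadj α ξ η = α ⁅η, ξ⁆ := by
  rw [coadj, LinearMap.neg_apply, LinearMap.comp_apply, LieAlgebra.ad_apply, ← map_neg, lie_skew]

theorem jl_sub (α β : Module.Dual ℝ 𝔤) : 𝔉.jl (α - β) = 𝔉.jl α - 𝔉.jl β := by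
  simp [jl, sub_smul, Finset.sum_sub_distrib]

theorem jl_coord (a : ι) : 𝔉.jl (I.coord a) = 𝔉.j a 0 := by
  simp [jl, Finsupp.single_apply, eq_comm]

theorem der_eq_sum (ξ : 𝔤) (h : R) : 𝔉.der ξ h = ∑ a, I.repr ξ a • 𝔉.der (I a) h := by
  conv_lhs => rw [← I.sum_repr ξ]
  rw [𝔉.der_sum]

theorem sum_iR_der_mul_j (ξ : 𝔤) (h : R) :
    ∑ b, 𝔉.iR (𝔉.der (I b) h) * 𝔉.jl (coadj (I.coord b) ξ)
      = ∑ c, 𝔉.iR (𝔉.der ⁅I c, ξ⁆ h) * 𝔉.j c 0 := by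
  simp only [jl, coadj_apply, Finset.mul_sum, 𝔉.der_eq_sum ⁅_, ξ⁆ h, map_sum, iR_smul,
    Finset.sum_mul, Module.Basis.coord_apply]
  rw [Finset.sum_comm]
  simp

include D in
theorem exists_rotOp (a : ι) : ∃ d : Derivation ℂ V V[X],
    (∀ f, d (𝔉.iA f) = 0) ∧ (∀ h, d (𝔉.iR h) = Polynomial.C (𝔉.iR (𝔉.der (I a) h))) ∧
      (∀ b n, d (𝔉.j b n) = (shift D)^[n] (Polynomial.C (𝔉.jl (coadj (I.coord b) (I a)))
        + Polynomial.C (algebraMap ℂ V ((I.coord b (I a) : ℝ) : ℂ)) * Polynomial.X)) ∧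
      ∀ b n, d (𝔉.X b n) = (shift D)^[n] (Polynomial.C (𝔉.Xl ⁅I a, I b⁆)) := by
  exact 𝔉.exists_derivation (M := V[X]) 0 (by simp)
    { toFun := fun h => Polynomial.C (𝔉.iR (𝔉.der (I a) h))
      map_zero' := by simp
      map_add' := fun f g => by simp }
    (fun f g => by simp [𝔉.der_mul, Polynomial.smul_eq_C_mul]) (fun r => by simp [𝔉.der_const]) _ _

/-- `{X_a, ·}`. -/
def rotOp (D : Derivation ℂ V V) (a : ι) : Derivation ℂ V V[X] :=
  (𝔉.exists_rotOp (D := D) a).choose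

theorem rotOp_iA (a : ι) (f : A) : 𝔉.rotOp D a (𝔉.iA f) = 0 := (𝔉.exists_rotOp a).choose_spec.1 f

theorem rotOp_iR (a : ι) (h : R) :
    𝔉.rotOp D a (𝔉.iR h) = Polynomial.C (𝔉.iR (𝔉.der (I a) h)) :=
  (𝔉.exists_rotOp a).choose_spec.2.1 h

theorem rotOp_j (a b : ι) (n : ℕ) :
    𝔉.rotOp D a (𝔉.j b n) = (shift D)^[n] (Polynomial.C (𝔉.jl (coadj (I.coord b) (I a)))
        + Polynomial.C (algebraMap ℂ V ((I.coord b (I a) : ℝ) : ℂ)) * Polynomial.X) :=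
  (𝔉.exists_rotOp a).choose_spec.2.2.1 b n

theorem rotOp_X (a b : ι) (n : ℕ) :
    𝔉.rotOp D a (𝔉.X b n) = (shift D)^[n] (Polynomial.C (𝔉.Xl ⁅I a, I b⁆)) :=
  (𝔉.exists_rotOp a).choose_spec.2.2.2 b n

theorem rotOp_j_zero (a b : ι) :
    𝔉.rotOp D a (𝔉.j b 0) = Polynomial.C (𝔉.jl (coadj (I.coord b) (I a)))
        + Polynomial.C (algebraMap ℂ V ((I.coord b (I a) : ℝ) : ℂ)) * Polynomial.X :=
  𝔉.rotOp_j a b 0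

theorem rotOp_X_zero (a b : ι) : 𝔉.rotOp D a (𝔉.X b 0) = Polynomial.C (𝔉.Xl ⁅I a, I b⁆) :=
  𝔉.rotOp_X a b 0

include hD in
theorem rotOp_D (a : ι) (F : V) : 𝔉.rotOp D a (D F) = shift D (𝔉.rotOp D a F) := by
  refine 𝔉.derivation_D hD (𝔉.rotOp D a) (map_add _) (𝔉.rotOp D a).leibniz ?_ ?_ ?_ ?_ F
  · intro f; rw [hD.iA, rotOp_iA, rotOp_iA, shift_zero]
  · intro h
    rw [hD.iR, rotOp_iR, shift_C, map_sum, hD.iR]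
    simp only [Derivation.leibniz, rotOp_iR, rotOp_j_zero, smul_add, Finset.sum_add_distrib,
      Polynomial.smul_eq_C_mul, ← mul_assoc, ← Polynomial.C_mul]
    rw [← Finset.sum_mul]
    simp only [← map_sum, sum_iR_der_mul_j, 𝔉.der_lie, map_sub, sub_mul, Finset.sum_sub_distrib]
    have h1 : ∑ b, 𝔉.iR (𝔉.der (I b) h) * algebraMap ℂ V ((I.coord b (I a) : ℝ) : ℂ)
        = 𝔉.iR (𝔉.der (I a) h) := by
      rw [Finset.sum_eq_single a]
      · simp
      · intro b _ hb; simp [hb.symm]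
      · simp
    have h2 : ∑ b, 𝔉.j b 0 * 𝔉.iR (𝔉.der (I a) (𝔉.der (I b) h))
        = ∑ b, 𝔉.iR (𝔉.der (I a) (𝔉.der (I b) h)) * 𝔉.j b 0 :=
      Finset.sum_congr rfl fun b _ => mul_comm _ _
    rw [h1, h2]
    ring
  · intro b n; rw [rotOp_j, rotOp_j_zero]
  · intro b n; rw [rotOp_X, rotOp_X_zero]

/-- The canonical bracket of the fields on the cotangent bundle. -/
def brC (D : Derivation ℂ V V) (F : V) : Derivation ℂ V V[X] :=
  ∑ a, (actRight D (adj D (𝔉.momOp a F))).compDer (𝔉.rotOp D a)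
    - ∑ a, (actRight D (adj D (𝔉.rotOp D a F))).compDer (𝔉.momOp a)
    - ∑ a, ∑ b, (actRight D (act D (Polynomial.C (𝔉.Xl ⁅I a, I b⁆))
        (adj D (𝔉.momOp a F)))).compDer (𝔉.momOp b)

theorem derivation_sum_apply {κ : Type*} (s : Finset κ) (d : κ → Derivation ℂ V V[X]) (x : V) :
    (∑ k ∈ s, d k) x = ∑ k ∈ s, d k x :=
  map_sum (⟨⟨fun d : Derivation ℂ V V[X] => d x, rfl⟩, fun _ _ => rfl⟩ :
    Derivation ℂ V V[X] →+ V[X]) d s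

theorem brC_apply (F G : V) : 𝔉.brC D F G =
    ∑ a, act D (𝔉.rotOp D a G) (adj D (𝔉.momOp a F))
    - ∑ a, act D (𝔉.momOp a G) (adj D (𝔉.rotOp D a F))
    - ∑ a, ∑ b, act D (𝔉.momOp b G) (act D (Polynomial.C (𝔉.Xl ⁅I a, I b⁆))
        (adj D (𝔉.momOp a F))) := by
  rw [brC, Derivation.sub_apply, Derivation.sub_apply, derivation_sum_apply, derivation_sum_apply,
    derivation_sum_apply]
  simp only [derivation_sum_apply]
  rfl

theorem brC_skew (F G : V) : 𝔉.brC D G F = -adj D (𝔉.brC D F G) := by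
  rw [brC_apply, brC_apply, adj_sub, adj_sub, adj_sum, adj_sum, adj_sum]
  simp only [adj_sum, adj_act, adj_adj, adj_C, act_assoc]
  rw [Finset.sum_comm (f := fun a b => act D (𝔉.momOp b F)
    (act D (Polynomial.C (𝔉.Xl ⁅I a, I b⁆)) (adj D (𝔉.momOp a G))))]
  have h : ∀ a b, act D (𝔉.momOp a F)
      (act D (Polynomial.C (𝔉.Xl ⁅I b, I a⁆)) (adj D (𝔉.momOp b G)))
      = -act D (𝔉.momOp a F)
      (act D (Polynomial.C (𝔉.Xl ⁅I a, I b⁆)) (adj D (𝔉.momOp b G))) := by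
    intro a b
    rw [← lie_skew, Xl, comp_neg, map_neg, act_neg_left, act_neg_right]; rfl
  simp only [h, Finset.sum_neg_distrib]
  ring

include hD in
theorem brC_D (F G : V) : 𝔉.brC D F (D G) = shift D (𝔉.brC D F G) := by
  rw [brC_apply, brC_apply]
  simp only [momOp_D 𝔉 hD, rotOp_D 𝔉 hD, act_shift, shift_sum, shift_sub]

/-- The bracket of the fields. -/
def pre : PreBracket V :=
  PreBracket.ofSkew D (fun F => 𝔉.brA hD F + 𝔉.brC D F)
    (fun f g => by
      rw [Derivation.add_apply, brA_D, brC_D 𝔉 hD, Derivation.add_apply, shift_add])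
    (fun f g => by
      rw [Derivation.add_apply, Derivation.add_apply, brA_skew, brC_skew, adj_add, neg_add])

theorem pre_br (F G : V) : (𝔉.pre hD).br F G = 𝔉.brA hD F G + 𝔉.brC D F G := by
  rw [pre, PreBracket.ofSkew_br, Derivation.add_apply]

theorem br_X (a : ι) (G : V) : (𝔉.pre hD).br (𝔉.X a 0) G = 𝔉.rotOp D a G := by
  rw [pre_br, brA_eq_zero _ _ _ fun f => 𝔉.rowA_X f a 0, Derivation.zero_apply, zero_add, brC_apply]
  have hadj : ∀ b, adj D (𝔉.momOp b (𝔉.X a 0)) = if b = a then 1 else 0 := by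
    intro b
    rw [momOp_X, pow_zero, apply_ite (adj D), adj_zero, ← map_one Polynomial.C, adj_C]
  simp only [hadj, rotOp_X_zero, adj_C, apply_ite (act D _), act_zero_right, act_one_right,
    Finset.sum_ite_eq', Finset.mem_univ, if_true]
  rw [Finset.sum_comm]
  simp only [Finset.sum_ite_eq', Finset.mem_univ, if_true]
  have h : ∀ b, act D (𝔉.momOp b G) (Polynomial.C (𝔉.Xl ⁅I b, I a⁆))
      = -act D (𝔉.momOp b G) (Polynomial.C (𝔉.Xl ⁅I a, I b⁆)) := by
    intro b
    rw [← lie_skew, Xl, comp_neg, map_neg, act_neg_right]; rfl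
  simp only [h, Finset.sum_neg_distrib]
  ring

theorem br_iR (h : R) (G : V) : (𝔉.pre hD).br (𝔉.iR h) G =
    -∑ a, act D (𝔉.momOp a G) (Polynomial.C (𝔉.iR (𝔉.der (I a) h))) := by
  rw [pre_br, brA_eq_zero _ _ _ fun f => 𝔉.rowA_iR f h, Derivation.zero_apply, zero_add, brC_apply]
  simp only [momOp_iR, rotOp_iR, adj_zero, adj_C, act_zero_right, Finset.sum_const_zero]
  ring

theorem br_iA (f : A) (G : V) : (𝔉.pre hD).br (𝔉.iA f) G = 𝔉.rowA P f G := by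
  rw [pre_br, brA_iA_left, brC_apply]
  simp only [momOp_iA, rotOp_iA, adj_zero, act_zero_right, Finset.sum_const_zero]
  ring

theorem br_iR_iR (h k : R) : (𝔉.pre hD).br (𝔉.iR h) (𝔉.iR k) = 0 := by
  simp [br_iR, momOp_iR, act_zero_left]

theorem br_iR_j (h : R) (a : ι) : (𝔉.pre hD).br (𝔉.iR h) (𝔉.j a 0) = 0 := by
  simp [br_iR, momOp_j, act_zero_left]

theorem br_j_j (a b : ι) : (𝔉.pre hD).br (𝔉.j a 0) (𝔉.j b 0) = 0 := by
  rw [pre_br, brA_eq_zero _ _ _ fun f => 𝔉.rowA_j f a 0, Derivation.zero_apply, zero_add, brC_apply]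
  simp only [momOp_j, adj_zero, act_zero_left, act_zero_right, Finset.sum_const_zero]
  ring

end FieldAlg

namespace FieldAlg

variable {A : Type*} [CommRing A] [Algebra ℂ A] {R : Type*} [CommRing R] [Algebra ℝ R]
    {V : Type u} [CommRing V] [Algebra ℂ V] {ι : Type*} [Fintype ι]
    {𝔤 : Type v} [LieRing 𝔤] [LieAlgebra ℝ 𝔤] {I : Module.Basis ι ℝ 𝔤}
    (𝔉 : FieldAlg A R V ι I) {P : PVA A} {D : Derivation ℂ V V} (hD : 𝔉.IsDeriv P D)
    [DecidableEq ι]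

theorem Xl_add (ξ η : 𝔤) : 𝔉.Xl (ξ + η) = 𝔉.Xl ξ + 𝔉.Xl η := comp_add I _ ξ η

theorem Xl_neg (ξ : 𝔤) : 𝔉.Xl (-ξ) = -𝔉.Xl ξ := comp_neg I _ ξ

theorem Xl_basis (a : ι) : 𝔉.Xl (I a) = 𝔉.X a 0 := comp_basis I _ a

theorem Xl_eq_sum (ξ : 𝔤) : 𝔉.Xl ξ = ∑ a, ((I.repr ξ a : ℝ) : ℂ) • 𝔉.X a 0 := rfl

theorem sum_Xl_lie (ξ η : 𝔤) :
    ∑ a, ((I.repr ξ a : ℝ) : ℂ) • 𝔉.Xl ⁅I a, η⁆ = 𝔉.Xl ⁅ξ, η⁆ := by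
  conv_rhs => rw [← I.sum_repr ξ, sum_lie]
  rw [Xl, comp_sum]
  simp only [smul_lie, comp_smul, Xl]

theorem sum_Xl_lie_right (ξ η : 𝔤) :
    ∑ a, ((I.repr η a : ℝ) : ℂ) • 𝔉.Xl ⁅ξ, I a⁆ = 𝔉.Xl ⁅ξ, η⁆ := by
  rw [← lie_skew, Xl_neg, ← sum_Xl_lie, ← Finset.sum_neg_distrib]
  refine Finset.sum_congr rfl fun a _ => ?_
  rw [← lie_skew, Xl_neg, smul_neg]

theorem br_Xl_iR (ξ : 𝔤) (h : R) :
    (𝔉.pre hD).br (𝔉.Xl ξ) (𝔉.iR h) = Polynomial.C (𝔉.iR (𝔉.der ξ h)) := by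
  rw [Xl_eq_sum, map_sum, LinearMap.sum_apply, 𝔉.der_eq_sum ξ, map_sum, map_sum]
  refine Finset.sum_congr rfl fun a _ => ?_
  rw [map_smul, LinearMap.smul_apply, br_X, rotOp_iR, iR_smul, Polynomial.smul_C]

theorem br_Xl_Xl (ξ η : 𝔤) :
    (𝔉.pre hD).br (𝔉.Xl ξ) (𝔉.Xl η) = Polynomial.C (𝔉.Xl ⁅ξ, η⁆) := by
  rw [Xl_eq_sum 𝔉 ξ, map_sum, LinearMap.sum_apply, ← sum_Xl_lie, map_sum]
  refine Finset.sum_congr rfl fun a _ => ?_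
  rw [map_smul, LinearMap.smul_apply, Xl_eq_sum 𝔉 η, map_sum, ← Polynomial.smul_C,
    ← sum_Xl_lie_right, map_sum]
  congr 1
  refine Finset.sum_congr rfl fun b _ => ?_
  rw [map_smul, br_X, rotOp_X_zero, Polynomial.smul_C]

theorem jl_coadj_eq_sum (α : Module.Dual ℝ 𝔤) (ξ : 𝔤) :
    𝔉.jl (coadj α ξ) = ∑ c, ((α (I c) : ℝ) : ℂ) • 𝔉.jl (coadj (I.coord c) ξ) := by
  simp only [jl, coadj_apply, Finset.smul_sum, smul_smul]
  rw [Finset.sum_comm]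
  refine Finset.sum_congr rfl fun b _ => ?_
  rw [← Finset.sum_smul]
  congr 1
  conv_lhs => rw [← I.sum_repr ⁅I b, ξ⁆, map_sum]
  simp only [map_smul, smul_eq_mul, Module.Basis.coord_apply]
  push_cast
  exact Finset.sum_congr rfl fun c _ => mul_comm _ _

theorem br_X_jl (a : ι) (α : Module.Dual ℝ 𝔤) :
    (𝔉.pre hD).br (𝔉.X a 0) (𝔉.jl α) = Polynomial.C (𝔉.jl (coadj α (I a)))
      + Polynomial.C (algebraMap ℂ V ((α (I a) : ℝ) : ℂ)) * Polynomial.X := by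
  rw [jl, map_sum, jl_coadj_eq_sum, map_sum]
  simp only [map_smul, br_X, rotOp_j_zero, smul_add, Finset.sum_add_distrib, Polynomial.smul_C]
  congr 1
  rw [Finset.sum_eq_single a]
  · rw [Module.Basis.coord_apply, Module.Basis.repr_self, Finsupp.single_eq_same,
      Complex.ofReal_one, map_one, map_one, one_mul, Algebra.algebraMap_eq_smul_one,
      ← Polynomial.smul_C, map_one, smul_mul_assoc, one_mul]
  · intro b _ hb; simp [hb.symm]
  · simp

theorem jl_coadj_eq_sum' (α : Module.Dual ℝ 𝔤) (ξ : 𝔤) :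
    𝔉.jl (coadj α ξ) = ∑ a, ((I.repr ξ a : ℝ) : ℂ) • 𝔉.jl (coadj α (I a)) := by
  simp only [jl, coadj_apply, Finset.smul_sum, smul_smul]
  rw [Finset.sum_comm]
  refine Finset.sum_congr rfl fun b _ => ?_
  rw [← Finset.sum_smul]
  congr 1
  conv_lhs => rw [← I.sum_repr ξ, lie_sum, map_sum]
  simp

theorem br_Xl_jl (ξ : 𝔤) (α : Module.Dual ℝ 𝔤) :
    (𝔉.pre hD).br (𝔉.Xl ξ) (𝔉.jl α) = Polynomial.C (𝔉.jl (coadj α ξ))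
      + Polynomial.C (algebraMap ℂ V ((α ξ : ℝ) : ℂ)) * Polynomial.X := by
  rw [Xl_eq_sum, map_sum, LinearMap.sum_apply, jl_coadj_eq_sum', map_sum]
  simp only [map_smul, LinearMap.smul_apply, br_X_jl, smul_add, Finset.sum_add_distrib,
    Polynomial.smul_C]
  congr 1
  conv_rhs => rw [← I.sum_repr ξ, map_sum]
  simp [Finset.sum_mul, Algebra.algebraMap_eq_smul_one, mul_smul, Polynomial.smul_C,
    ← smul_mul_assoc]

theorem br_jl_Xl (ξ : 𝔤) (α : Module.Dual ℝ 𝔤) :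
    (𝔉.pre hD).br (𝔉.jl α) (𝔉.Xl ξ) = -Polynomial.C (𝔉.jl (coadj α ξ))
      + Polynomial.C (algebraMap ℂ V ((α ξ : ℝ) : ℂ)) * Polynomial.X := by
  rw [(𝔉.pre hD).br_skew, br_Xl_jl, adj_add, adj_C, adj_mul_X, adj_C, shift_C]
  simp
  ring

theorem br_iR_Xl (ξ : 𝔤) (h : R) :
    (𝔉.pre hD).br (𝔉.iR h) (𝔉.Xl ξ) = -Polynomial.C (𝔉.iR (𝔉.der ξ h)) := by
  rw [(𝔉.pre hD).br_skew, br_Xl_iR, adj_C]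

theorem br_iA_iA (f g : A) :
    (𝔉.pre hD).br (𝔉.iA f) (𝔉.iA g) = 𝔉.mapA (P.br f g) := by rw [br_iA, rowA_iA]

theorem br_iA_iR (f : A) (h : R) : (𝔉.pre hD).br (𝔉.iA f) (𝔉.iR h) = 0 := by rw [br_iA, rowA_iR]

theorem br_iA_jl (f : A) (α : Module.Dual ℝ 𝔤) : (𝔉.pre hD).br (𝔉.iA f) (𝔉.jl α) = 0 := by
  simp [br_iA, jl, rowA_j]

theorem br_iA_Xl (f : A) (ξ : 𝔤) : (𝔉.pre hD).br (𝔉.iA f) (𝔉.Xl ξ) = 0 := by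
  simp [br_iA, Xl_eq_sum, rowA_X]

theorem br_zero_swap {x y : V} (h : (𝔉.pre hD).br x y = 0) : (𝔉.pre hD).br y x = 0 := by
  rw [(𝔉.pre hD).br_skew, h, adj_zero, neg_zero]

theorem br_iR_jl (h : R) (α : Module.Dual ℝ 𝔤) : (𝔉.pre hD).br (𝔉.iR h) (𝔉.jl α) = 0 := by
  simp [jl, br_iR_j]

theorem br_jl_jl (α β : Module.Dual ℝ 𝔤) : (𝔉.pre hD).br (𝔉.jl α) (𝔉.jl β) = 0 := by
  simp [jl, br_j_j]

theorem br_algebraMap (x : V) (r : ℂ) : (𝔉.pre hD).br x (algebraMap ℂ V r) = 0 := by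
  rw [pre_br, Derivation.map_algebraMap, Derivation.map_algebraMap, add_zero]

/-- The generators of the algebra of fields. -/
def gens : Set V := {x | (∃ f, x = 𝔉.iA f) ∨ (∃ h, x = 𝔉.iR h) ∨ (∃ α, x = 𝔉.jl α) ∨
  ∃ ξ, x = 𝔉.Xl ξ}

include hD in
theorem generates_gens : Generates D 𝔉.gens := by
  intro q hq hadd hmul hDq x
  refine 𝔉.ind q (fun f => hq _ (Or.inl ⟨f, rfl⟩)) (fun h => hq _ (Or.inr (Or.inl ⟨h, rfl⟩))) ?_
    hadd hmul x
  rintro (⟨a, n⟩ | ⟨a, n⟩)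
  · induction n with
    | zero => exact hq _ (Or.inr (Or.inr (Or.inl ⟨I.coord a, (𝔉.jl_coord a).symm⟩)))
    | succ n ih =>
      have h : q (D (𝔉.j a n)) := hDq _ ih
      rw [hD.j] at h
      exact h
  · induction n with
    | zero => exact hq _ (Or.inr (Or.inr (Or.inr ⟨I a, (𝔉.Xl_basis a).symm⟩)))
    | succ n ih =>
      have h : q (D (𝔉.X a n)) := hDq _ ih
      rw [hD.X] at h
      exact h

theorem bs_iA_iA (s : ℂ) (f g : A) :
    (𝔉.pre hD).bs s (𝔉.iA f) (𝔉.iA g) = 𝔉.iA (P.toPre.bs s f g) := by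
  rw [PreBracket.bs_apply, PreBracket.bs_apply, br_iA_iA, opEval_scal, opEval_scal, mapA_apply,
    Polynomial.eval_map, Polynomial.eval₂_eq_eval_map]
  have : algebraMap ℂ V s = (𝔉.iA : A →+* V) (algebraMap ℂ A s) := (𝔉.iA.commutes s).symm
  rw [this, Polynomial.eval_map, Polynomial.eval₂_at_apply]
  rfl

theorem jac_gens (s t : ℂ) : ∀ x ∈ 𝔉.gens, ∀ y ∈ 𝔉.gens, ∀ z ∈ 𝔉.gens,
    (𝔉.pre hD).jac s t x y z = 0 := by
  have hXX : ∀ s ξ η, (𝔉.pre hD).bs s (𝔉.Xl ξ) (𝔉.Xl η) = 𝔉.Xl ⁅ξ, η⁆ := fun s ξ η => by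
    rw [PreBracket.bs_apply, br_Xl_Xl, opEval_C]
  have hXR : ∀ s ξ h, (𝔉.pre hD).bs s (𝔉.Xl ξ) (𝔉.iR h) = 𝔉.iR (𝔉.der ξ h) := fun s ξ h => by
    rw [PreBracket.bs_apply, br_Xl_iR, opEval_C]
  have hRX : ∀ s ξ h, (𝔉.pre hD).bs s (𝔉.iR h) (𝔉.Xl ξ) = -𝔉.iR (𝔉.der ξ h) := fun s ξ h => by
    rw [PreBracket.bs_apply, br_iR_Xl, map_neg, opEval_C]
  have hXj : ∀ s ξ α, (𝔉.pre hD).bs s (𝔉.Xl ξ) (𝔉.jl α) =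
      𝔉.jl (coadj α ξ) + algebraMap ℂ V (s * (α ξ : ℝ)) := fun s ξ α => by
    rw [PreBracket.bs_apply, br_Xl_jl, map_add, opEval_C, opEval_scal, Polynomial.eval_mul,
      Polynomial.eval_C, Polynomial.eval_X, map_mul, mul_comm]
  have hjX : ∀ s ξ α, (𝔉.pre hD).bs s (𝔉.jl α) (𝔉.Xl ξ) =
      -𝔉.jl (coadj α ξ) + algebraMap ℂ V (s * (α ξ : ℝ)) := fun s ξ α => by
    rw [PreBracket.bs_apply, br_jl_Xl, map_add, map_neg, opEval_C, opEval_scal,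
      Polynomial.eval_mul, Polynomial.eval_C, Polynomial.eval_X, map_mul, mul_comm]
  have hz : ∀ s x y, (𝔉.pre hD).br x y = 0 → (𝔉.pre hD).bs s x y = 0 := fun s x y h => by
    rw [PreBracket.bs_apply, h, map_zero]
  have hAR := fun s f h => hz s _ _ (𝔉.br_iA_iR hD f h)
  have hAj := fun s f h => hz s _ _ (𝔉.br_iA_jl hD f h)
  have hAX := fun s f h => hz s _ _ (𝔉.br_iA_Xl hD f h)
  have hRA := fun s f h => hz s _ _ (𝔉.br_zero_swap hD (𝔉.br_iA_iR hD f h))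
  have hjA := fun s f h => hz s _ _ (𝔉.br_zero_swap hD (𝔉.br_iA_jl hD f h))
  have hXA := fun s f h => hz s _ _ (𝔉.br_zero_swap hD (𝔉.br_iA_Xl hD f h))
  have hRR := fun s h k => hz s _ _ (𝔉.br_iR_iR hD h k)
  have hRj := fun s h k => hz s _ _ (𝔉.br_iR_jl hD h k)
  have hjR := fun s h k => hz s _ _ (𝔉.br_zero_swap hD (𝔉.br_iR_jl hD h k))
  have hjj := fun s h k => hz s _ _ (𝔉.br_jl_jl hD h k)
  have hc := fun s x r => hz s _ _ (𝔉.br_algebraMap hD x r)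
  have hc' := fun s x r => hz s _ _ (𝔉.br_zero_swap hD (𝔉.br_algebraMap hD x r))
  have hAA := 𝔉.bs_iA_iA hD
  have hco : ∀ α ξ η, 𝔉.jl (coadj (coadj α η) ξ) - 𝔉.jl (coadj (coadj α ξ) η)
      = 𝔉.jl (coadj α ⁅ξ, η⁆) := by
    intro α ξ η
    rw [← jl_sub]
    congr 1
    ext ζ
    rw [LinearMap.sub_apply, coadj_apply, coadj_apply, coadj_apply, coadj_apply, coadj_apply,
      ← map_sub]
    congr 1
    rw [leibniz_lie ζ ξ η, ← lie_skew ξ ⁅ζ, η⁆]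
    abel
  rintro x (⟨f₁, rfl⟩ | ⟨h₁, rfl⟩ | ⟨α₁, rfl⟩ | ⟨ξ₁, rfl⟩) y
    (⟨f₂, rfl⟩ | ⟨h₂, rfl⟩ | ⟨α₂, rfl⟩ | ⟨ξ₂, rfl⟩) z
    (⟨f₃, rfl⟩ | ⟨h₃, rfl⟩ | ⟨α₃, rfl⟩ | ⟨ξ₃, rfl⟩)
  · have := congrArg 𝔉.iA (P.jac_eq_zero s t f₁ f₂ f₃)
    simpa [PreBracket.jac, hAA] using this
  all_goals
    simp only [PreBracket.jac, hXX, hXR, hRX, hXj, hjX, hAR, hAj, hAX, hRA, hjA, hXA, hRR, hRj, hjR,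
      hjj, hc, hc', hAA, map_zero, map_add, map_neg, LinearMap.zero_apply, LinearMap.add_apply,
      LinearMap.neg_apply, add_zero, neg_zero, sub_self]
  · rw [𝔉.der_lie, map_sub]; ring
  · rw [← hco, coadj_apply, coadj_apply, ← lie_skew ξ₂ ξ₃]
    simp only [map_neg, map_mul, map_add, Complex.ofReal_neg]; ring
  · rw [𝔉.der_lie, map_sub]; ring
  · rw [← hco, coadj_apply, coadj_apply, ← lie_skew ξ₁ ξ₃]
    simp only [map_neg, map_mul, map_add, Complex.ofReal_neg]; ring
  · rw [𝔉.der_lie, map_sub]; ring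
  · rw [← hco, coadj_apply, coadj_apply, ← lie_skew ξ₁ ξ₂]
    simp only [map_neg, map_mul, map_add, Complex.ofReal_neg]; ring
  · rw [leibniz_lie ξ₁, Xl_add]; ring

/-- The local Poisson algebra of the fields. -/
def pva : PVA V :=
  (𝔉.pre hD).toPVA fun s t => (𝔉.pre hD).jac_of_generates (𝔉.generates_gens hD)
    (fun x hx y hy z hz s t => 𝔉.jac_gens hD s t x hx y hy z hz) s t

end FieldAlg

section Existence

variable {A : Type*} [CommRing A] [Algebra ℂ A]
  {E : Type u} [NormedAddCommGroup E] [NormedSpace ℝ E] [FiniteDimensional ℝ E]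
  {G : Type v} [TopologicalSpace G] [ChartedSpace E G] [Group G] [LieGroup 𝓘(ℝ, E) ∞ G]
  {U : TopologicalSpace.Opens G} {ι : Type w} [Fintype ι] [DecidableEq ι]

/-- The algebra `𝒜 ⊗ 𝒜_{G₀}` as an algebra of fields. -/
def gaugedFields (A : Type*) [CommRing A] [Algebra ℂ A] (U : TopologicalSpace.Opens G)
    (I : Module.Basis ι ℝ (GroupLieAlgebra 𝓘(ℝ, E) G)) :
    FieldAlg A (SmoothFun E U) (GaugedAlg A E U ι) ι I where
  iA := inA
  iR := fnHom
  jet := jet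
  der ξ := ⟨⟨fun f => leftDeriv ξ f, (leftDer ξ).map_zero⟩, leftDeriv_add ξ⟩
  const := fn_algebraMap
  ind _ hA hR hJ hadd hmul := gauged_induction hA hR (fun _ _ => hJ _) (fun _ _ => hJ _) hadd hmul
  lift _ _ _ α β γ hβ := gauged_lift_exists α β γ hβ
  der_mul := leftDeriv_mul
  der_const := leftDeriv_const
  der_sum c f := leftDeriv_sum I f c
  der_lie := leftDeriv_lie

theorem comp_fieldj (I : Module.Basis ι ℝ (GroupLieAlgebra 𝓘(ℝ, E) G))
    (ξ : GroupLieAlgebra 𝓘(ℝ, E) G) :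
    comp I (fieldj I : ι → GaugedAlg A E U ι) ξ
      = ∑ c, ((kform ξ (I c) : ℝ) : ℂ) • (jv c 0 : GaugedAlg A E U ι) := by
  simp only [comp, fieldj, Finset.smul_sum, smul_smul, kform_eq_sum I ξ]
  rw [Finset.sum_comm]
  push_cast
  simp only [Finset.sum_smul]

theorem fieldj_eq_jl (I : Module.Basis ι ℝ (GroupLieAlgebra 𝓘(ℝ, E) G)) (b : ι) :
    (fieldj I b : GaugedAlg A E U ι) = (gaugedFields A U I).jl (-killingForm ℝ _ (I b)) := rfl

theorem exists_isTensorBracket (I : Module.Basis ι ℝ (GroupLieAlgebra 𝓘(ℝ, E) G)) (P : PVA A) :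
    ∃ Pt : PVA (GaugedAlg A E U ι), IsTensorBracket I P Pt := by
  obtain ⟨D, hD⟩ := (gaugedFields A U I).exists_isDeriv P
  refine ⟨(gaugedFields A U I).pva hD, ?_⟩
  constructor
  · exact hD.iA
  · exact hD.iR
  · exact hD.j
  · exact hD.X
  · exact (gaugedFields A U I).br_iA_iA hD
  · exact (gaugedFields A U I).br_iA_iR hD
  · intro f a; exact ((gaugedFields A U I).br_iA hD f _).trans ((gaugedFields A U I).rowA_j f a 0)
  · intro f a; exact ((gaugedFields A U I).br_iA hD f _).trans ((gaugedFields A U I).rowA_X f a 0)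
  · exact (gaugedFields A U I).br_iR_iR hD
  · exact (gaugedFields A U I).br_iR_j hD
  · exact (gaugedFields A U I).br_j_j hD
  · intro a h
    exact ((gaugedFields A U I).br_X hD a _).trans ((gaugedFields A U I).rotOp_iR a h)
  · intro a b
    exact ((gaugedFields A U I).br_X hD a _).trans ((gaugedFields A U I).rotOp_X_zero a b)
  · intro a b
    rw [fieldj_eq_jl]
    refine ((gaugedFields A U I).br_X_jl hD a _).trans ?_
    have h1 : (gaugedFields A U I).jl (FieldAlg.coadj (-killingForm ℝ _ (I b)) (I a))
        = comp I (fieldj I : ι → GaugedAlg A E U ι) ⁅I a, I b⁆ := by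
      rw [comp_fieldj]
      refine Finset.sum_congr rfl fun c _ => ?_
      rw [FieldAlg.coadj_apply, kform_lie, kform_symm, kform_lie]
      rfl
    have h2 : (-killingForm ℝ _ (I b)) (I a) = kap I a b := kap_symm I b a
    rw [h1, h2]

end Existence

section Uniqueness

variable {A : Type*} [CommRing A] [Algebra ℂ A]
  {E : Type u} [NormedAddCommGroup E] [NormedSpace ℝ E] [FiniteDimensional ℝ E]
  {G : Type v} [TopologicalSpace G] [ChartedSpace E G] [Group G] [LieGroup 𝓘(ℝ, E) ∞ G]
  [LieAlgebra.IsSemisimple ℝ (GroupLieAlgebra 𝓘(ℝ, E) G)]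
  {U : TopologicalSpace.Opens G} {ι : Type w} [Fintype ι] [DecidableEq ι]
  {I : Module.Basis ι ℝ (GroupLieAlgebra 𝓘(ℝ, E) G)} {P : PVA A}
  {Pt : PVA (GaugedAlg A E U ι)}

theorem inA_algebraMap (r : ℂ) :
    (inA (algebraMap ℂ A r) : GaugedAlg A E U ι) = algebraMap ℂ _ r :=
  (inA : A →ₐ[ℂ] GaugedAlg A E U ι).commutes r

theorem smul_eq_inA_mul (r : ℂ) (x : GaugedAlg A E U ι) :
    r • x = inA (algebraMap ℂ A r) * x := by
  rw [inA_algebraMap]; exact Algebra.smul_def r x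

variable (A U) in
/-- The generators `F ∈ 𝒜`, `h(g)`, `j` and `X`. -/
def gaugedGens (I : Module.Basis ι ℝ (GroupLieAlgebra 𝓘(ℝ, E) G)) : Set (GaugedAlg A E U ι) :=
  {x | (∃ f, x = inA f) ∨ (∃ h, x = fn h) ∨ (∃ a, x = fieldj I a) ∨ ∃ a, x = Xv a 0}

theorem jv_eq_sum (I : Module.Basis ι ℝ (GroupLieAlgebra 𝓘(ℝ, E) G)) (a : ι) :
    (jv a 0 : GaugedAlg A E U ι) = ∑ b, ((kinv I a b : ℝ) : ℂ) • fieldj I b :=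
  (sum_kinv_kap_smul I (fun c => (jv c 0 : GaugedAlg A E U ι)) a).symm

theorem sum_mem_of {V : Type*} [AddCommMonoid V] {q : V → Prop} (h0 : q 0)
    (hadd : ∀ x y, q x → q y → q (x + y)) {κ : Type*} (s : Finset κ) (f : κ → V)
    (hf : ∀ k ∈ s, q (f k)) : q (∑ k ∈ s, f k) :=
  Finset.sum_induction f q (fun x y => hadd x y) h0 hf

namespace IsTensorBracket

variable (ht : IsTensorBracket I P Pt)
include ht

theorem generates : Generates Pt.D (gaugedGens A U I) := by
  intro q hq hadd hmul hDq x
  have hA : ∀ f, q (inA f) := fun f => hq _ (Or.inl ⟨f, rfl⟩)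
  refine gauged_induction hA (fun h => hq _ (Or.inr (Or.inl ⟨h, rfl⟩))) ?_ ?_
    hadd hmul x
  · intro a n
    induction n with
    | zero =>
      rw [jv_eq_sum I]
      refine sum_mem_of (map_zero (inA : A →ₐ[ℂ] GaugedAlg A E U ι) ▸ hA 0) hadd _ _ fun b _ => ?_
      rw [smul_eq_inA_mul]
      exact hmul _ _ (hA _) (hq _ (Or.inr (Or.inr (Or.inl ⟨b, rfl⟩))))
    | succ n ih => rw [← ht.D_j]; exact hDq _ ih
  · intro a n
    induction n with
    | zero => exact hq _ (Or.inr (Or.inr (Or.inr ⟨a, rfl⟩)))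
    | succ n ih => rw [← ht.D_X]; exact hDq _ ih

theorem swap_zero {x y : GaugedAlg A E U ι} (h : Pt.br x y = 0) : Pt.br y x = 0 := by
  rw [Pt.br_skew, h, adj_zero, neg_zero]

theorem br_eq_zero_of_jv {x : GaugedAlg A E U ι} (h : ∀ a, Pt.br x (jv a 0) = 0) (a : ι) :
    Pt.br x (fieldj I a) = 0 := by
  rw [fieldj, map_sum]
  exact Finset.sum_eq_zero fun b _ => by rw [map_smul, h, smul_zero]

theorem br_inA_fieldj (f : A) (a : ι) : Pt.br (inA f) (fieldj I a) = 0 :=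
  ht.br_eq_zero_of_jv (ht.br_inA_j f) a

theorem br_fn_fieldj (h : SmoothFun E U) (a : ι) : Pt.br (fn h) (fieldj I a) = 0 :=
  ht.br_eq_zero_of_jv (ht.br_fn_j h) a

theorem br_fieldj_fieldj (a b : ι) : Pt.br (fieldj I a) (fieldj I b) = 0 :=
  ht.br_eq_zero_of_jv (fun c => ht.swap_zero (ht.br_eq_zero_of_jv (ht.br_j_j c) a)) b

theorem br_fn_inA (f : A) (h : SmoothFun E U) : Pt.br (fn h) (inA f) = 0 :=
  ht.swap_zero (ht.br_inA_fn f h)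

theorem br_fieldj_inA (f : A) (a : ι) : Pt.br (fieldj I a) (inA f) = 0 :=
  ht.swap_zero (ht.br_inA_fieldj f a)

theorem br_X_inA (f : A) (a : ι) : Pt.br (Xv a 0) (inA f) = 0 :=
  ht.swap_zero (ht.br_inA_X f a)

theorem br_fieldj_fn (h : SmoothFun E U) (a : ι) : Pt.br (fieldj I a) (fn h) = 0 :=
  ht.swap_zero (ht.br_fn_fieldj h a)

theorem br_fn_X (h : SmoothFun E U) (a : ι) :
    Pt.br (fn h) (Xv a 0) = -Polynomial.C (fn (leftDeriv (I a) h)) := by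
  rw [Pt.br_skew, ht.br_X_fn, adj_C]

theorem br_fieldj_X (a b : ι) : Pt.br (fieldj I a) (Xv b 0) =
    Polynomial.C (comp I (fieldj I) ⁅I a, I b⁆)
      + Polynomial.C (algebraMap ℂ _ ((kap I a b : ℝ) : ℂ)) * Polynomial.X := by
  rw [Pt.br_skew, ht.br_X_j, adj_add, adj_C, adj_mul_X, adj_C, shift_C, Derivation.map_algebraMap,
    ← lie_skew, comp_neg, kap_symm I b a, map_neg, map_zero]
  ring

theorem D_eq {P' : PVA (GaugedAlg A E U ι)} (ht' : IsTensorBracket I P P') : Pt.D = P'.D := by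
  refine Derivation.ext (gauged_induction ?_ ?_ ?_ ?_ ?_ ?_)
  · intro f; rw [ht.D_inA, ht'.D_inA]
  · intro f; rw [ht.D_fn, ht'.D_fn]
  · intro a n; rw [ht.D_j, ht'.D_j]
  · intro a n; rw [ht.D_X, ht'.D_X]
  · intro x y hx hy; rw [map_add, map_add, hx, hy]
  · intro x y hx hy; rw [Derivation.leibniz, Derivation.leibniz, hx, hy]

theorem unique {P' : PVA (GaugedAlg A E U ι)} (ht' : IsTensorBracket I P P') : Pt = P' := by
  have hD := ht.D_eq ht'
  refine PVA.ext_of hD (bracket_ext (D' := Pt.D) ht.generates (RingHom.id _) (fun x y => Pt.br x y)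
    (fun x y => P'.br x y)
    (fun f g h => map_add _ _ _) (fun f g h => map_add _ _ _) (fun f g h => Pt.br_mul f g h)
    (fun f g h => P'.br_mul f g h) (fun f g => Pt.br_D_right f g)
    (fun f g => by rw [hD]; exact P'.br_D_right f g)
    (fun f g => Pt.br_skew f g) (fun f g => by rw [hD]; exact P'.br_skew f g) ?_)
  rintro x (⟨f₁, rfl⟩ | ⟨h₁, rfl⟩ | ⟨a₁, rfl⟩ | ⟨b₁, rfl⟩) y
    (⟨f₂, rfl⟩ | ⟨h₂, rfl⟩ | ⟨a₂, rfl⟩ | ⟨b₂, rfl⟩)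
  · rw [ht.br_inA, ht'.br_inA]
  · rw [ht.br_inA_fn, ht'.br_inA_fn]
  · rw [ht.br_inA_fieldj, ht'.br_inA_fieldj]
  · rw [ht.br_inA_X, ht'.br_inA_X]
  · rw [ht.br_fn_inA, ht'.br_fn_inA]
  · rw [ht.br_fn_fn, ht'.br_fn_fn]
  · rw [ht.br_fn_fieldj, ht'.br_fn_fieldj]
  · rw [ht.br_fn_X, ht'.br_fn_X]
  · rw [ht.br_fieldj_inA, ht'.br_fieldj_inA]
  · rw [ht.br_fieldj_fn, ht'.br_fieldj_fn]
  · rw [ht.br_fieldj_fieldj, ht'.br_fieldj_fieldj]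
  · rw [ht.br_fieldj_X, ht'.br_fieldj_X]
  · rw [ht.br_X_inA, ht'.br_X_inA]
  · rw [ht.br_X_fn, ht'.br_X_fn]
  · rw [ht.br_X_j, ht'.br_X_j]
  · rw [ht.br_X_X, ht'.br_X_X]

end IsTensorBracket

theorem existsUnique_isTensorBracket (I : Module.Basis ι ℝ (GroupLieAlgebra 𝓘(ℝ, E) G))
    (P : PVA A) : ∃! Pt : PVA (GaugedAlg A E U ι), IsTensorBracket I P Pt := by
  obtain ⟨Pt, ht⟩ := exists_isTensorBracket (U := U) I P
  exact ⟨Pt, ht, fun P' ht' => ht'.unique ht⟩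

section Conjugation

variable {cj : A →+* A} (hs : ∀ (r : ℂ) (f : A), cj (r • f) = starRingEnd ℂ r • cj f)

theorem gaugedConj_inA (f : A) :
    gaugedConj cj hs (inA f : GaugedAlg A E U ι) = inA (cj f) := by
  simp [gaugedConj, inA]

theorem gaugedConj_one_tmul (p : CotAlg E U ι) :
    gaugedConj cj hs ((1 : A) ⊗ₜ[ℝ] p) = 1 ⊗ₜ p := by
  simp [gaugedConj]

theorem gaugedConj_fn (h : SmoothFun E U) :
    gaugedConj cj hs (fn h : GaugedAlg A E U ι) = fn h := gaugedConj_one_tmul hs _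

theorem gaugedConj_jv (a : ι) (n : ℕ) :
    gaugedConj cj hs (jv a n : GaugedAlg A E U ι) = jv a n := gaugedConj_one_tmul hs _

theorem gaugedConj_Xv (a : ι) (n : ℕ) :
    gaugedConj cj hs (Xv a n : GaugedAlg A E U ι) = Xv a n := gaugedConj_one_tmul hs _

theorem gaugedConj_fieldX (a : ι) :
    gaugedConj cj hs (fieldX a : GaugedAlg A E U ι) = fieldX a := gaugedConj_Xv hs a 0

theorem gaugedConj_smul (r : ℂ) (x : GaugedAlg A E U ι) :
    gaugedConj cj hs (r • x) = starRingEnd ℂ r • gaugedConj cj hs x := by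
  rw [smul_eq_inA_mul, map_mul, gaugedConj_inA, Algebra.algebraMap_eq_smul_one, hs, map_one,
    ← Algebra.algebraMap_eq_smul_one, ← smul_eq_inA_mul]

theorem gaugedConj_ofReal_smul (r : ℝ) (x : GaugedAlg A E U ι) :
    gaugedConj cj hs ((r : ℂ) • x) = (r : ℂ) • gaugedConj cj hs x := by
  rw [gaugedConj_smul, Complex.conj_ofReal]

theorem gaugedConj_fieldj (a : ι) :
    gaugedConj cj hs (fieldj I a : GaugedAlg A E U ι) = fieldj I a := by
  simp only [fieldj, map_sum, gaugedConj_ofReal_smul, gaugedConj_jv]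

theorem gaugedConj_comp (F : ι → GaugedAlg A E U ι) (ξ : GroupLieAlgebra 𝓘(ℝ, E) G) :
    gaugedConj cj hs (comp I F ξ) = comp I (fun a => gaugedConj cj hs (F a)) ξ := by
  simp only [comp, map_sum, gaugedConj_ofReal_smul]

theorem gaugedConj_algebraMap_ofReal (r : ℝ) :
    gaugedConj cj hs (algebraMap ℂ (GaugedAlg A E U ι) (r : ℂ)) = algebraMap ℂ _ (r : ℂ) := by
  rw [Algebra.algebraMap_eq_smul_one, gaugedConj_ofReal_smul, map_one]

theorem IsTensorBracket.isConjugation (ht : IsTensorBracket I P Pt) (hcj : P.IsConjugation cj) :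
    Pt.IsConjugation (gaugedConj cj hcj.smul) := by
  set σ := gaugedConj (E := E) (U := U) (ι := ι) cj hcj.smul with hσ
  have hD : ∀ f, σ (Pt.D f) = Pt.D (σ f) := by
    intro f
    refine gauged_induction (q := fun f => σ (Pt.D f) = Pt.D (σ f)) ?_ ?_ ?_ ?_ ?_ ?_ f
    · intro f; rw [ht.D_inA, gaugedConj_inA, hcj.D, gaugedConj_inA, ht.D_inA]
    · intro h; simp only [ht.D_fn, map_sum, map_mul, hσ, gaugedConj_fn, gaugedConj_jv]
    · intro a n; rw [ht.D_j, gaugedConj_jv, gaugedConj_jv, ht.D_j]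
    · intro a n; rw [ht.D_X, gaugedConj_Xv, gaugedConj_Xv, ht.D_X]
    · intro x y hx hy; rw [map_add, map_add, map_add, map_add, hx, hy]
    · intro x y hx hy
      rw [Derivation.leibniz, map_add, map_mul, Derivation.leibniz, smul_eq_mul, smul_eq_mul,
        map_mul, map_mul, hx, hy]; rfl
  refine ⟨gaugedConj_smul hcj.smul, ?_, hD, ?_⟩
  · refine gauged_induction ?_ ?_ ?_ ?_ ?_ ?_
    · intro f; rw [gaugedConj_inA, gaugedConj_inA, hcj.invol]
    · intro h; rw [gaugedConj_fn, gaugedConj_fn]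
    · intro a n; rw [gaugedConj_jv, gaugedConj_jv]
    · intro a n; rw [gaugedConj_Xv, gaugedConj_Xv]
    · intro x y hx hy; rw [map_add, map_add, hx, hy]
    · intro x y hx hy; rw [map_mul, map_mul, hx, hy]
  · refine bracket_ext (D' := Pt.D) ht.generates σ (fun x y => Pt.br (σ x) (σ y))
      (fun x y => (Pt.br x y).map σ) ?_ ?_ ?_ ?_ ?_ ?_ ?_ ?_ ?_
    · intro f g h; simp only [map_add]
    · intro f g h; simp only [map_add, Polynomial.map_add]
    · intro f g h; simp only [map_mul, Pt.br_mul]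
    · intro f g h; simp only [Pt.br_mul, Polynomial.map_add, Polynomial.map_mul, Polynomial.map_C]
    · intro f g; simp only [hD, Pt.br_D_right]
    · intro f g; simp only [Pt.br_D_right, map_shift Pt.D Pt.D σ hD]
    · intro f g; exact Pt.br_skew _ _
    · intro f g
      change (Pt.br g f).map σ = -adj Pt.D ((Pt.br f g).map σ)
      rw [Pt.br_skew f g, Polynomial.map_neg, map_adj Pt.D Pt.D σ hD]
    · rintro x (⟨f₁, rfl⟩ | ⟨h₁, rfl⟩ | ⟨a₁, rfl⟩ | ⟨b₁, rfl⟩) y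
        (⟨f₂, rfl⟩ | ⟨h₂, rfl⟩ | ⟨a₂, rfl⟩ | ⟨b₂, rfl⟩)
      · simp only [hσ, gaugedConj_inA, ht.br_inA, hcj.br, Polynomial.map_map]
        congr 1
      all_goals simp only [hσ, gaugedConj_inA, gaugedConj_fn, gaugedConj_fieldj, gaugedConj_Xv,
        ht.br_inA_fn, ht.br_inA_fieldj, ht.br_inA_X, ht.br_fn_inA, ht.br_fn_fn, ht.br_fn_fieldj,
        ht.br_fn_X, ht.br_fieldj_inA, ht.br_fieldj_fn, ht.br_fieldj_fieldj, ht.br_fieldj_X,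
        ht.br_X_inA, ht.br_X_fn, ht.br_X_j, ht.br_X_X, Polynomial.map_zero, Polynomial.map_neg,
        Polynomial.map_C, Polynomial.map_add, Polynomial.map_mul, Polynomial.map_X, gaugedConj_comp,
        gaugedConj_algebraMap_ofReal, gaugedConj_fieldX]

end Conjugation

end Uniqueness

section Generic

variable {V : Type u} [CommRing V] [Algebra ℂ V]

theorem sum_smul_C_algebraMap_mul_X {κ : Type*} (s : Finset κ) (f g : κ → ℂ) :
    ∑ b ∈ s, f b • (Polynomial.C (algebraMap ℂ V (g b)) * (Polynomial.X : V[X]))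
      = Polynomial.C (algebraMap ℂ V (∑ b ∈ s, f b * g b)) * Polynomial.X := by
  rw [map_sum, map_sum, Finset.sum_mul]
  refine Finset.sum_congr rfl fun b _ => ?_
  rw [← smul_mul_assoc, Polynomial.smul_C, map_mul, Algebra.smul_def]

theorem smul_C_algebraMap (r s : ℂ) : r • Polynomial.C (algebraMap ℂ V s)
    = Polynomial.C (algebraMap ℂ V (r * s)) := by
  rw [Polynomial.smul_C, map_mul, Algebra.smul_def]

theorem half_smul_add_half_smul (l k : ℂ) :
    Polynomial.C (algebraMap ℂ V (l * k)) = (l / 2) • Polynomial.C (algebraMap ℂ V k)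
      + (l / 2) • Polynomial.C (algebraMap ℂ V k) := by
  rw [← add_smul, add_halves, smul_C_algebraMap]

end Generic

section WZCurrents

variable {A : Type*} [CommRing A] [Algebra ℂ A]
  {E : Type u} [NormedAddCommGroup E] [NormedSpace ℝ E] [FiniteDimensional ℝ E]
  {G : Type v} [TopologicalSpace G] [ChartedSpace E G] [Group G] [LieGroup 𝓘(ℝ, E) ∞ G]
  [LieAlgebra.IsSemisimple ℝ (GroupLieAlgebra 𝓘(ℝ, E) G)]
  {U : TopologicalSpace.Opens G} {ι : Type w} [Fintype ι] [DecidableEq ι]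
  {I : Module.Basis ι ℝ (GroupLieAlgebra 𝓘(ℝ, E) G)} {P : PVA A}
  {Pt : PVA (GaugedAlg A E U ι)} (ht : IsTensorBracket I P Pt) {B : ι → ι → SmoothFun E U}

namespace IsTensorBracket

include ht

theorem br_jv_eq_zero {x : GaugedAlg A E U ι} (h : ∀ a, Pt.br x (fieldj I a) = 0) (a : ι) :
    Pt.br x (jv a 0) = 0 := by
  rw [jv_eq_sum I, map_sum]
  exact Finset.sum_eq_zero fun b _ => by rw [map_smul, h, smul_zero]

theorem br_fieldj_jv (a b : ι) : Pt.br (fieldj I a) (jv b 0) = 0 :=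
  ht.br_jv_eq_zero (ht.br_fieldj_fieldj a) b

theorem br_W_eq_zero {x : GaugedAlg A E U ι} (h : ∀ a, Pt.br x (jv a 0) = 0)
    (h' : ∀ f, Pt.br x (fn f) = 0) (a : ι) : Pt.br x (fieldW B a) = 0 := by
  rw [fieldW, map_sum]
  exact Finset.sum_eq_zero fun b _ => by rw [Pt.br_mul, h, h', mul_zero, mul_zero, add_zero]

theorem br_inA_W (f : A) (a : ι) : Pt.br (inA f) (fieldW B a) = 0 :=
  ht.br_W_eq_zero (ht.br_inA_j f) (ht.br_inA_fn f) a

theorem br_fn_W (f : SmoothFun E U) (a : ι) : Pt.br (fn f) (fieldW B a) = 0 :=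
  ht.br_W_eq_zero (ht.br_fn_j f) (ht.br_fn_fn f) a

theorem br_fieldj_W (a b : ι) : Pt.br (fieldj I a) (fieldW B b) = 0 :=
  ht.br_W_eq_zero (ht.br_fieldj_jv a) (fun f => ht.br_fieldj_fn f a) b

theorem br_W_fieldj (a b : ι) : Pt.br (fieldW B a) (fieldj I b) = 0 :=
  ht.swap_zero (ht.br_fieldj_W b a)

theorem br_W_W (a b : ι) : Pt.br (fieldW B a) (fieldW B b) = 0 :=
  ht.br_W_eq_zero (fun c => ht.swap_zero (ht.br_W_eq_zero (ht.br_j_j c)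
    (fun f => ht.swap_zero (ht.br_fn_j f c)) a)) (fun f => ht.swap_zero (ht.br_fn_W f a)) b

theorem br_X_jv (a c : ι) : Pt.br (Xv a 0) (jv c 0) =
    Polynomial.C (∑ e, ((I.repr ⁅I e, I a⁆ c : ℝ) : ℂ) • jv e 0)
      + if a = c then Polynomial.X else 0 := by
  rw [jv_eq_sum I c, map_sum]
  simp only [map_smul, ht.br_X_j, smul_add, Finset.sum_add_distrib, Polynomial.smul_C]
  congr 1
  · rw [← map_sum]
    congr 1
    simp only [comp_fieldj, Finset.smul_sum, smul_smul]
    rw [Finset.sum_comm]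
    refine Finset.sum_congr rfl fun e _ => ?_
    rw [← Finset.sum_smul]
    congr 1
    have h1 : ∀ b, kform ⁅I a, I b⁆ (I e) = ∑ f, I.repr ⁅I e, I a⁆ f * kap I f b := by
      intro b
      rw [← kform_eq_sum, kform_symm, ← kform_lie]
    have h2 : ∑ b, kinv I c b * kform ⁅I a, I b⁆ (I e) = I.repr ⁅I e, I a⁆ c := by
      simp only [h1, Finset.mul_sum]
      rw [Finset.sum_comm, Finset.sum_eq_single c]
      · have h3 : ∑ b, kinv I c b * kap I c b = 1 := by
          have := kinv_mul_kap I c c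
          rw [if_pos rfl] at this
          rw [← this]
          exact Finset.sum_congr rfl fun b _ => by rw [kap_symm]
        simp only [mul_left_comm (kinv I c _), ← Finset.mul_sum, h3, mul_one]
      · intro f _ hf
        have h3 : ∑ b, kinv I c b * kap I f b = 0 := by
          have := kinv_mul_kap I c f
          rw [if_neg hf.symm] at this
          rw [← this]
          exact Finset.sum_congr rfl fun b _ => by rw [kap_symm]
        simp only [mul_left_comm (kinv I c _), ← Finset.mul_sum, h3, mul_zero]
      · simp
    exact_mod_cast h2
  · rw [sum_smul_C_algebraMap_mul_X]
    have h2 : ∑ b, kinv I c b * kap I a b = if c = a then 1 else 0 := by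
      rw [← kinv_mul_kap I c a]
      exact Finset.sum_congr rfl fun b _ => by rw [kap_symm]
    have h3 : ∑ b, ((kinv I c b : ℝ) : ℂ) * ((kap I a b : ℝ) : ℂ) = if c = a then 1 else 0 := by
      have h4 := congrArg (fun r : ℝ => (r : ℂ)) h2
      simp only [Complex.ofReal_sum, Complex.ofReal_mul] at h4
      rw [h4]
      split_ifs <;> simp
    rw [h3]
    by_cases h : a = c
    · rw [if_pos h, if_pos h.symm, map_one, map_one, one_mul]
    · rw [if_neg h, if_neg (Ne.symm h), map_zero, map_zero, zero_mul]

theorem br_X_W (a b : ι) : Pt.br (Xv a 0) (fieldW B b) =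
    Polynomial.C (∑ e, (∑ c, ((I.repr ⁅I e, I a⁆ c : ℝ) : ℂ) • fn (B b c)
      + fn (leftDeriv (I a) (B b e))) * jv e 0) + Polynomial.C (fn (B b a)) * Polynomial.X := by
  rw [fieldW, map_sum]
  simp only [Pt.br_mul, ht.br_X_jv, ht.br_X_fn, mul_add, add_mul, Finset.sum_add_distrib, map_add,
    mul_ite, mul_zero, Finset.sum_ite_eq, Finset.mem_univ, if_true, ← map_mul, ← map_sum,
    Finset.mul_sum, Finset.sum_mul]
  rw [Finset.sum_comm]
  simp only [mul_smul_comm, smul_mul_assoc, mul_comm (jv _ 0)]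
  ring

theorem br_W_X (a b : ι) : Pt.br (fieldW B a) (Xv b 0) =
    -Polynomial.C (∑ e, (∑ c, ((I.repr ⁅I e, I b⁆ c : ℝ) : ℂ) • fn (B a c)
      + fn (leftDeriv (I b) (B a e))) * jv e 0) + (Polynomial.C (fn (B a b)) * Polynomial.X
        + Polynomial.C (∑ e, fn (leftDeriv (I e) (B a b)) * jv e 0)) := by
  rw [Pt.br_skew, ht.br_X_W, adj_add, adj_C, adj_mul_X, adj_C, shift_C, ht.D_fn]
  ring

theorem br_X_W_add (hB : IsWZPotential I B) (a b : ι) :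
    Pt.br (Xv a 0) (fieldW B b) + Pt.br (fieldW B a) (Xv b 0) =
      Polynomial.C (comp I (fieldW B) ⁅I a, I b⁆ - comp I (fieldj I) ⁅I a, I b⁆) := by
  have key : ∀ e, (∑ c, ((I.repr ⁅I e, I a⁆ c : ℝ) : ℂ) • fn (B b c) : GaugedAlg A E U ι)
      + fn (leftDeriv (I a) (B b e))
      - (∑ c, ((I.repr ⁅I e, I b⁆ c : ℝ) : ℂ) • fn (B a c) + fn (leftDeriv (I b) (B a e)))
      + fn (leftDeriv (I e) (B a b))
      = ∑ c, ((I.repr ⁅I a, I b⁆ c : ℝ) : ℂ) • fn (B c e)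
        - ((kform ⁅I a, I b⁆ (I e) : ℝ) : ℂ) • 1 := by
    intro e
    have h := congrArg (fn : SmoothFun E U → GaugedAlg A E U ι) (hB.d_eq a b e)
    have hneg : leftDeriv (I b) (B a e) = -leftDeriv (I b) (B e a) := by
      rw [hB.antisymm a e]; exact (leftDer (I b)).map_neg (B e a)
    have hn2 : ∀ c, (fn (B a c) : GaugedAlg A E U ι) = -fn (B c a) := fun c => by
      rw [hB.antisymm a c, fn_neg]
    have hn3 : ∀ c, (fn (B b c) : GaugedAlg A E U ι) = -fn (B c b) := fun c => by
      rw [hB.antisymm b c, fn_neg]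
    have hl : ∀ c, I.repr ⁅I b, I e⁆ c = -I.repr ⁅I e, I b⁆ c := fun c => by
      rw [← lie_skew, map_neg]; rfl
    simp only [fn_sub, fn_add, fn_sum, fn_smul, fn_algebraMap, Finset.sum_add_distrib, hl,
      neg_smul, Finset.sum_neg_distrib, fn_neg] at h
    rw [Algebra.algebraMap_eq_smul_one] at h
    simp only [hneg, fn_neg, hn2, hn3, smul_neg, Finset.sum_neg_distrib, kform,
      Complex.ofReal_neg, neg_smul]
    linear_combination h
  rw [ht.br_X_W, ht.br_W_X, hB.antisymm b a, fn_neg, map_neg]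
  have h2 : comp I (fieldW B) ⁅I a, I b⁆ - comp I (fieldj I) ⁅I a, I b⁆ =
      ∑ e, (∑ c, ((I.repr ⁅I a, I b⁆ c : ℝ) : ℂ) • fn (B c e)
        - ((kform ⁅I a, I b⁆ (I e) : ℝ) : ℂ) • 1) * (jv e 0 : GaugedAlg A E U ι) := by
    rw [comp_fieldj]
    simp only [comp, fieldW, Finset.smul_sum, sub_mul, Finset.sum_mul, Finset.sum_sub_distrib,
      smul_mul_assoc, one_mul]
    rw [Finset.sum_comm]
  rw [h2]
  simp only [← key, sub_mul, add_mul, Finset.sum_add_distrib, Finset.sum_sub_distrib, map_add,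
    map_sub]
  ring

end IsTensorBracket

/-- The current `X + ½ ℓ (W + j)`. -/
def wzCurrent (I : Module.Basis ι ℝ (GroupLieAlgebra 𝓘(ℝ, E) G)) (B : ι → ι → SmoothFun E U)
    (l : ℂ) : ι → GaugedAlg A E U ι :=
  fieldX + (l / 2) • fieldW B + (l / 2) • fieldj I

theorem wzCurrent_apply (l : ℂ) (a : ι) : (wzCurrent I B l a : GaugedAlg A E U ι) =
    Xv a 0 + (l / 2) • fieldW B a + (l / 2) • fieldj I a := rfl

namespace IsTensorBracket

include ht

theorem br_wzCurrent_wzCurrent {l : ℂ} (hB : l ≠ 0 → IsWZPotential I B) (a b : ι) :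
    Pt.br (wzCurrent I B l a) (wzCurrent I B l b) =
      Polynomial.C (comp I (wzCurrent I B l) ⁅I a, I b⁆)
        + Polynomial.C (algebraMap ℂ _ (l * (kap I a b : ℝ))) * Polynomial.X := by
  have h1 : (l / 2) • (Pt.br (Xv a 0) (fieldW B b) + Pt.br (fieldW B a) (Xv b 0)) =
      (l / 2) • Polynomial.C (comp I (fieldW B) ⁅I a, I b⁆ - comp I (fieldj I) ⁅I a, I b⁆) := by
    by_cases hl : l = 0
    · simp [hl]
    · rw [ht.br_X_W_add (hB hl)]
  simp only [wzCurrent_apply, map_add, map_smul, LinearMap.add_apply, LinearMap.smul_apply,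
    ht.br_X_X, ht.br_X_j, ht.br_fieldj_X, ht.br_W_W, ht.br_W_fieldj, ht.br_fieldj_W,
    ht.br_fieldj_fieldj, smul_zero, add_zero]
  rw [wzCurrent, comp_add_left, comp_add_left, comp_smul_left, comp_smul_left]
  rw [half_smul_add_half_smul]
  simp only [map_add, map_sub, smul_add, smul_sub, ← Polynomial.smul_C, add_mul, smul_mul_assoc] at h1 ⊢
  linear_combination (exp := 1) h1

theorem br_wzCurrent_fieldj (l : ℂ) (a b : ι) :
    Pt.br (wzCurrent I B l a) (fieldj I b) = Polynomial.C (comp I (fieldj I) ⁅I a, I b⁆)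
      + Polynomial.C (algebraMap ℂ _ ((kap I a b : ℝ) : ℂ)) * Polynomial.X := by
  simp only [wzCurrent_apply, map_add, map_smul, LinearMap.add_apply, LinearMap.smul_apply,
    ht.br_X_j, ht.br_W_fieldj, ht.br_fieldj_fieldj, smul_zero, add_zero]

theorem br_fieldj_wzCurrent (l : ℂ) (a b : ι) :
    Pt.br (fieldj I a) (wzCurrent I B l b) = Polynomial.C (comp I (fieldj I) ⁅I a, I b⁆)
      + Polynomial.C (algebraMap ℂ _ ((kap I a b : ℝ) : ℂ)) * Polynomial.X := by
  simp only [wzCurrent_apply, map_add, map_smul,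
    ht.br_fieldj_X, ht.br_fieldj_W, ht.br_fieldj_fieldj, smul_zero, add_zero]

theorem br_inA_wzCurrent (l : ℂ) (f : A) (b : ι) :
    Pt.br (inA f) (wzCurrent I B l b) = 0 := by
  simp only [wzCurrent_apply, map_add, map_smul,
    ht.br_inA_X, ht.br_inA_W, ht.br_inA_fieldj, smul_zero, add_zero]

theorem br_wzCurrent_fn (l : ℂ) (h : SmoothFun E U) (b : ι) :
    Pt.br (wzCurrent I B l b) (fn h) = Polynomial.C (fn (leftDeriv (I b) h)) := by
  have hW : Pt.br (fieldW B b) (fn h) = 0 := ht.swap_zero (ht.br_fn_W h b)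
  simp only [wzCurrent_apply, map_add, map_smul, LinearMap.add_apply, LinearMap.smul_apply,
    ht.br_X_fn, hW, ht.br_fieldj_fn, smul_zero, add_zero]

end IsTensorBracket

end WZCurrents

section Modes

/-- The coefficients of the transformation of the modes. -/
def mobCoeff (a b c d : ℝ) (z : ℂ) (p k : ℕ) : ℂ :=
  if p = 0 then (if k = 0 then 1 else 0) else if k < p then 0 else
    ((k - 1).choose (p - 1) : ℂ) * (-(c : ℂ)) ^ (k - p) * ((a : ℂ) * d - b * c) ^ p
        / ((c : ℂ) * z + d) ^ (p + k)

theorem mobMode_eq {W : Type*} [AddCommGroup W] [Module ℂ W] (a b c d : ℝ) (z : ℂ) {m : ℕ}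
    (hm : 0 < m) (x : ℕ → W) (p : ℕ) :
    mobMode a b c d z m x p = ∑ k ∈ Finset.range m, mobCoeff a b c d z p k • x k := by
  rw [mobMode]
  by_cases hp : p = 0
  · simp [hp, mobCoeff, hm]
  · rw [if_neg hp, Finset.range_eq_Ico]
    refine Finset.sum_subset_zero_on_sdiff (Finset.Ico_subset_Ico_left (Nat.zero_le p)) ?_ ?_
    · intro k hk
      simp only [Finset.mem_sdiff, Finset.mem_Ico] at hk
      rw [mobCoeff, if_neg hp, if_pos (by omega), zero_smul]
    · intro k hk
      rw [Finset.mem_Ico] at hk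
      rw [mobCoeff, if_neg hp, if_neg (by omega)]

theorem mobCoeff_eq_coeff (a b c d : ℝ) (z : ℂ) (p k : ℕ) :
    mobCoeff a b c d z p k = PowerSeries.coeff k
      (PowerSeries.X ^ p * (PowerSeries.C ((((a : ℂ) * d - b * c) / ((c : ℂ) * z + d) ^ 2) ^ p) *
        PowerSeries.rescale (-(c : ℂ) / ((c : ℂ) * z + d))
          (PowerSeries.invOneSubPow ℂ p).val)) := by
  rw [PowerSeries.coeff_X_pow_mul', mobCoeff]
  by_cases hp : p = 0
  · subst hp
    simp [PowerSeries.invOneSubPow_zero, PowerSeries.coeff_one]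
  · rw [if_neg hp]
    by_cases hk : k < p
    · rw [if_pos hk, if_neg (by omega)]
    · rw [if_neg hk, if_pos (by omega), PowerSeries.coeff_C_mul, PowerSeries.coeff_rescale,
        PowerSeries.invOneSubPow_val_eq_mk_sub_one_add_choose_of_pos _ _ (by omega),
        PowerSeries.coeff_mk, show p - 1 + (k - p) = k - 1 by omega]
      obtain ⟨n, rfl⟩ := Nat.exists_eq_add_of_le (not_lt.1 hk)
      rw [Nat.add_sub_cancel_left, div_pow, div_pow, ← pow_mul, ← add_assoc, ← two_mul, pow_add]
      simp only [div_eq_mul_inv, mul_inv]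
      ring

theorem mobCoeff_convolution (a b c d : ℝ) (z : ℂ) (p q r : ℕ) :
    ∑ x ∈ Finset.HasAntidiagonal.antidiagonal r, mobCoeff a b c d z p x.1 * mobCoeff a b c d z q x.2
      = mobCoeff a b c d z (p + q) r := by
  simp only [mobCoeff_eq_coeff]
  rw [← PowerSeries.coeff_mul, PowerSeries.invOneSubPow_add, Units.val_mul, map_mul (PowerSeries.rescale _), pow_add,
    pow_add, map_mul PowerSeries.C]
  congr 1
  exact (mul_mul_mul_comm _ _ _ _).trans (congrArg _ (mul_mul_mul_comm _ _ _ _))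

theorem mobCoeff_of_lt (a b c d : ℝ) (z : ℂ) {p k : ℕ} (h : k < p) : mobCoeff a b c d z p k = 0 := by
  rw [mobCoeff, if_neg (by omega), if_pos h]

theorem sum_convolution {W : Type*} [AddCommGroup W] [Module ℂ W] (m : ℕ) (f g : ℕ → ℂ)
    (x : ℕ → W) :
    ∑ k ∈ Finset.range m, ∑ l ∈ Finset.range m, (f k * g l) • (if k + l < m then x (k + l) else 0)
      = ∑ r ∈ Finset.range m, (∑ y ∈ Finset.HasAntidiagonal.antidiagonal r, f y.1 * g y.2) • x r := by
  simp only [Finset.sum_smul, smul_ite, smul_zero]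
  rw [← Finset.sum_product', ← Finset.sum_filter]
  rw [Finset.sum_sigma' (Finset.range m) (fun r => Finset.HasAntidiagonal.antidiagonal r)
    (fun r y => (f y.1 * g y.2) • x r)]
  refine Finset.sum_bij' (fun y _ => ⟨y.1 + y.2, y⟩) (fun y _ => y.2) ?_ ?_ ?_ ?_ ?_
  · rintro ⟨k, l⟩ h
    simp only [Finset.mem_filter, Finset.mem_product, Finset.mem_range] at h
    simp [h.2]
  · rintro ⟨r, k, l⟩ h
    simp only [Finset.mem_sigma, Finset.mem_range, Finset.HasAntidiagonal.mem_antidiagonal] at h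
    simp only [Finset.mem_filter, Finset.mem_product, Finset.mem_range]
    omega
  · rintro ⟨k, l⟩ h; rfl
  · rintro ⟨r, k, l⟩ h
    simp only [Finset.mem_sigma, Finset.mem_range, Finset.HasAntidiagonal.mem_antidiagonal] at h
    obtain ⟨h1, rfl⟩ := h
    rfl
  · rintro ⟨k, l⟩ h; rfl

theorem mobMode_conj {W : Type*} [AddCommGroup W] [Module ℂ W] (σ : W →+ W)
    (hσ : ∀ (r : ℂ) x, σ (r • x) = starRingEnd ℂ r • σ x) (a b c d : ℝ) (z : ℂ) {m : ℕ}
    (hm : 0 < m) (x y : ℕ → W) (hxy : ∀ p < m, y p = σ (x p)) (p : ℕ) :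
    mobMode a b c d (starRingEnd ℂ z) m y p = σ (mobMode a b c d z m x p) := by
  rw [mobMode_eq _ _ _ _ _ hm, mobMode_eq _ _ _ _ _ hm, map_sum]
  refine Finset.sum_congr rfl fun k hk => ?_
  rw [hσ, hxy k (Finset.mem_range.1 hk)]
  congr 1
  simp only [mobCoeff]
  split_ifs <;> simp

end Modes

section MobiusAlgebra

variable {a b c d : ℝ}

theorem mobius_sub_mobius {z z' : ℂ} (h : (c : ℂ) * z + d ≠ 0) (h' : (c : ℂ) * z' + d ≠ 0) :
    mobius a b c d z - mobius a b c d z'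
      = ((a : ℂ) * d - b * c) * (z - z') / (((c : ℂ) * z + d) * ((c : ℂ) * z' + d)) := by
  rw [mobius, mobius, div_sub_div _ _ h h']
  congr 1
  ring

theorem mobius_sub_pole (hc : c ≠ 0) {z : ℂ} (h : (c : ℂ) * z + d ≠ 0) :
    mobius a b c d z - (a : ℂ) / c = -((a : ℂ) * d - b * c) / (c * ((c : ℂ) * z + d)) := by
  have hc' : (c : ℂ) ≠ 0 := Complex.ofReal_ne_zero.2 hc
  rw [mobius, div_sub_div _ _ h hc', mul_comm (c : ℂ) (_ + _)]
  congr 1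
  ring

theorem mobCoeff_resum (hdet : (a : ℂ) * d - b * c ≠ 0) {z z' : ℂ} (h : (c : ℂ) * z + d ≠ 0)
    (h' : (c : ℂ) * z' + d ≠ 0) (hz : z ≠ z') {m k : ℕ} (hk : k < m) :
    ((a : ℂ) * d - b * c) / ((c : ℂ) * z + d) ^ 2 *
      ∑ p ∈ Finset.range m, ((mobius a b c d z - mobius a b c d z') ^ (p + 1))⁻¹ *
        mobCoeff a b c d z' p k
      = ((z - z') ^ (k + 1))⁻¹ - if k = 0 then (c : ℂ) / (c * z + d) else 0 := by
  have ht : z - z' ≠ 0 := sub_ne_zero.2 hz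
  rw [mobius_sub_mobius h h']
  set Δ := (a : ℂ) * d - b * c with hΔ
  set t := z - z' with ht'
  set s := (c : ℂ) * z' + d with hs
  have hy : (c : ℂ) * z + d = s + c * t := by rw [hs, ht']; ring
  rw [hy] at h ⊢
  rcases k with _ | k
  · rw [Finset.sum_eq_single 0]
    · simp only [mobCoeff, if_true, zero_add, pow_one, mul_one, inv_div]
      field_simp
      ring
    · intro p _ hp
      rw [mobCoeff_of_lt _ _ _ _ _ (Nat.pos_of_ne_zero hp), mul_zero]
    · intro h0; exact absurd (Finset.mem_range.2 hk) h0
  · rw [if_neg (Nat.succ_ne_zero k), sub_zero]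
    have h1 : ∑ p ∈ Finset.range m, ((Δ * t / ((s + c * t) * s)) ^ (p + 1))⁻¹ *
        mobCoeff a b c d z' p (k + 1)
        = ∑ p ∈ Finset.range (k + 1), ((Δ * t / ((s + c * t) * s)) ^ (p + 2))⁻¹ *
          mobCoeff a b c d z' (p + 1) (k + 1) := by
      rw [← Finset.sum_subset (Finset.range_mono hk), Finset.sum_range_succ']
      · simp [mobCoeff]
      · intro p _ hp
        rw [mobCoeff_of_lt _ _ _ _ _ (by simpa using hp), mul_zero]
    rw [h1]
    have h2 : ∀ p ∈ Finset.range (k + 1), ((Δ * t / ((s + c * t) * s)) ^ (p + 2))⁻¹ *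
          mobCoeff a b c d z' (p + 1) (k + 1) =
        (Δ)⁻¹ * (s + c * t) ^ 2 * (s ^ k)⁻¹ * (t ^ (k + 2))⁻¹ *
          ((s + c * t) ^ p * (-(c : ℂ) * t) ^ (k - p) * (k.choose p : ℂ)) := by
      intro p hp
      have hpk : p ≤ k := by simpa [Nat.lt_succ_iff] using hp
      obtain ⟨n, rfl⟩ := Nat.exists_eq_add_of_le hpk
      rw [mobCoeff, if_neg (by omega), if_neg (by omega), ← hs, ← hΔ]
      simp only [Nat.add_sub_cancel, Nat.add_sub_add_right, Nat.add_sub_cancel_left]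
      rw [mul_pow, div_pow, mul_pow, mul_pow, inv_div]
      field_simp
      ring
    rw [Finset.sum_congr rfl h2, ← Finset.mul_sum, ← add_pow]
    have h3 : s + c * t + -(c : ℂ) * t = s := by ring
    rw [h3]
    field_simp

theorem mobMode_resum {W : Type*} [AddCommGroup W] [Module ℂ W]
    (hdet : (a : ℂ) * d - b * c ≠ 0) {z z' : ℂ} (h : (c : ℂ) * z + d ≠ 0)
    (h' : (c : ℂ) * z' + d ≠ 0) (hz : z ≠ z') {m : ℕ} (hm : 0 < m) (x : ℕ → W) :
    (((a : ℂ) * d - b * c) / ((c : ℂ) * z + d) ^ 2) •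
      ∑ p ∈ Finset.range m, ((mobius a b c d z - mobius a b c d z') ^ (p + 1))⁻¹ •
        mobMode a b c d z' m x p
      = ∑ k ∈ Finset.range m, ((z - z') ^ (k + 1))⁻¹ • x k - ((c : ℂ) / (c * z + d)) • x 0 := by
  simp only [mobMode_eq _ _ _ _ _ hm, Finset.smul_sum, smul_smul]
  rw [Finset.sum_comm]
  have h1 : ((c : ℂ) / (c * z + d)) • x 0
      = ∑ k ∈ Finset.range m, (if k = 0 then (c : ℂ) / (c * z + d) else 0) • x k := by
    simp [hm]
  rw [h1, ← Finset.sum_sub_distrib]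
  refine Finset.sum_congr rfl fun k hk => ?_
  rw [← Finset.sum_smul, ← sub_smul, ← mobCoeff_resum hdet h h' hz (Finset.mem_range.1 hk),
    Finset.mul_sum]

end MobiusAlgebra

section GaugedModel

variable {A : Type*} [CommRing A] [Algebra ℂ A]
  {E : Type u} [NormedAddCommGroup E] [NormedSpace ℝ E] [FiniteDimensional ℝ E]
  {G : Type v} [TopologicalSpace G] [ChartedSpace E G] [Group G] [LieGroup 𝓘(ℝ, E) ∞ G]
  [LieAlgebra.IsSemisimple ℝ (GroupLieAlgebra 𝓘(ℝ, E) G)]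
  {U : TopologicalSpace.Opens G} {ι : Type w} [Fintype ι] [DecidableEq ι]
  {I : Module.Basis ι ℝ (GroupLieAlgebra 𝓘(ℝ, E) G)} {P : PVA A}
  {Pt : PVA (GaugedAlg A E U ι)} {B : ι → ι → SmoothFun E U}
  {cj : A →+* A}
  {S : Type*} [Fintype S] [DecidableEq S] {𝒢 : GaudinData S ι A}
  {linf : ℝ} {a b c d : ℝ}

theorem newJ_none_zero : (newJ I B a b c d linf 𝒢 none 0 : ι → GaugedAlg A E U ι) =
    wzCurrent I B (newLev a b c d linf 𝒢 none 0) := rfl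

theorem newJ_none_succ (p : ℕ) : (newJ I B a b c d linf 𝒢 none (p + 1) : ι → GaugedAlg A E U ι) =
    newLev a b c d linf 𝒢 none 1 • fieldj I := rfl

theorem newLev_none_zero : newLev a b c d linf 𝒢 none 0 = -∑ α, 𝒢.lev α 0 := rfl

theorem newLev_none_succ (p : ℕ) : newLev a b c d linf 𝒢 none (p + 1) =
    -(linf * ((a : ℂ) * d - b * c)) / (c : ℂ) ^ 2 := rfl

theorem sum_newLev_zero :
    ∑ α, (gaugedData I B a b c d linf 𝒢 : GaudinData _ _ (GaugedAlg A E U ι)).lev α 0 = 0 := by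
  rw [Fintype.sum_option]
  change -∑ α, 𝒢.lev α 0 + ∑ α, mobMode a b c d (𝒢.z α) (𝒢.m α) (𝒢.lev α) 0 = 0
  simp [mobMode]

theorem sumZeroModes_gaugedData (e : ι) :
    sumZeroModes (gaugedData I B a b c d linf 𝒢 : GaudinData _ _ (GaugedAlg A E U ι)) e
      = wzCurrent I B (-∑ α, 𝒢.lev α 0) e + inA (sumZeroModes 𝒢 e) := by
  rw [sumZeroModes, Fintype.sum_option, sumZeroModes, map_sum]
  rfl

theorem ofReal_det_ne_zero (hdet : a * d - b * c ≠ 0) : (a : ℂ) * d - b * c ≠ 0 := by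
  exact_mod_cast hdet

/-- The transformation of a function with poles at the sites. -/
theorem sum_sites_resum {W : Type*} [AddCommGroup W] [Module ℂ W]
    (hdet : a * d - b * c ≠ 0) (hc : c ≠ 0) (hsites : ∀ α, (c : ℂ) * 𝒢.z α + d ≠ 0)
    (hm : ∀ α, 0 < 𝒢.m α)
    {z : ℂ} (hz : ∀ α, z ≠ 𝒢.z α) (h : (c : ℂ) * z + d ≠ 0) (x : S → ℕ → W) (y₀ y₁ : W) :
    (((a : ℂ) * d - b * c) / ((c : ℂ) * z + d) ^ 2) •
      (((mobius a b c d z - a / c) ^ 1)⁻¹ • y₀ + ((mobius a b c d z - a / c) ^ 2)⁻¹ •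
          (-(linf * ((a : ℂ) * d - b * c)) / (c : ℂ) ^ 2) • y₁ +
        ∑ α, ∑ p ∈ Finset.range (𝒢.m α),
        ((mobius a b c d z - mobius a b c d (𝒢.z α)) ^ (p + 1))⁻¹ •
        mobMode a b c d (𝒢.z α) (𝒢.m α) (x α) p)
      = ∑ α, ∑ k ∈ Finset.range (𝒢.m α), ((z - 𝒢.z α) ^ (k + 1))⁻¹ • x α k
        - (linf : ℂ) • y₁ - ((c : ℂ) / (c * z + d)) • (y₀ + ∑ α, x α 0) := by
  have hdet' := ofReal_det_ne_zero hdet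
  have hc' : (c : ℂ) ≠ 0 := Complex.ofReal_ne_zero.2 hc
  rw [smul_add, Finset.smul_sum]
  have h1 : ∀ α, (((a : ℂ) * d - b * c) / ((c : ℂ) * z + d) ^ 2) •
      ∑ p ∈ Finset.range (𝒢.m α), ((mobius a b c d z - mobius a b c d (𝒢.z α)) ^ (p + 1))⁻¹ •
        mobMode a b c d (𝒢.z α) (𝒢.m α) (x α) p = _ := fun α =>
    mobMode_resum hdet' h (hsites α) (hz α) (hm α) (x α)
  rw [Finset.sum_congr rfl fun α _ => h1 α, Finset.sum_sub_distrib, ← Finset.smul_sum]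
  rw [mobius_sub_pole hc h, smul_add, smul_smul, smul_smul, smul_smul, smul_add]
  have h2 : ((a : ℂ) * d - b * c) / ((c : ℂ) * z + d) ^ 2 *
      ((-((a : ℂ) * d - b * c) / (c * ((c : ℂ) * z + d))) ^ 1)⁻¹ = -(c / (c * z + d)) := by
    rw [pow_one, inv_div]
    field_simp
  have h3 : ((a : ℂ) * d - b * c) / ((c : ℂ) * z + d) ^ 2 *
      (((-((a : ℂ) * d - b * c) / (c * ((c : ℂ) * z + d))) ^ 2)⁻¹ *
      (-(linf * ((a : ℂ) * d - b * c)) / (c : ℂ) ^ 2)) = -linf := by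
    rw [div_pow, inv_div]
    field_simp
  rw [h2, mul_assoc, h3]
  module

theorem gaudinLax_gaugedData 
    (hdet : a * d - b * c ≠ 0) (hc : c ≠ 0) (hsites : ∀ α, (c : ℂ) * 𝒢.z α + d ≠ 0)
    (hm : ∀ α, 0 < 𝒢.m α)
    {z : ℂ} (hz : ∀ α, z ≠ 𝒢.z α) (h : (c : ℂ) * z + d ≠ 0) (e : ι) :
    (((a : ℂ) * d - b * c) / ((c : ℂ) * z + d) ^ 2) •
      gaudinLax (gaugedData I B a b c d linf 𝒢 : GaudinData _ _ (GaugedAlg A E U ι))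
        (mobius a b c d z) e
    = inA (gaudinLax 𝒢 z e) - (linf : ℂ) • fieldj I e
      - ((c : ℂ) / (c * z + d)) •
        sumZeroModes (gaugedData I B a b c d linf 𝒢 : GaudinData _ _ (GaugedAlg A E U ι)) e := by
  have key := sum_sites_resum (linf := linf) (𝒢 := 𝒢) hdet hc hsites hm hz h
    (fun α k => (inA (𝒢.J α k e) : GaugedAlg A E U ι))
    (wzCurrent I B (-∑ α, 𝒢.lev α 0) e) (fieldj I e)
  rw [sumZeroModes_gaugedData, sumZeroModes, gaudinLax, gaudinLax, map_sum, map_sum,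
    Fintype.sum_option]
  simp only [map_sum, map_smul]
  rw [← key]
  congr 2
  · change ∑ p ∈ Finset.range 2, ((mobius a b c d z - a / c) ^ (p + 1))⁻¹ •
      newJ I B a b c d linf 𝒢 none p e = _
    rw [Finset.sum_range_succ, Finset.sum_range_one]
    rfl
  · refine Finset.sum_congr rfl fun α _ => Finset.sum_congr rfl fun p _ => ?_
    change _ • inA (mobMode a b c d (𝒢.z α) (𝒢.m α) (fun k => 𝒢.J α k e) p) = _
    rw [mobMode_eq _ _ _ _ _ (hm α), mobMode_eq _ _ _ _ _ (hm α), map_sum]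
    simp only [map_smul]
    rfl

theorem twist₀_gaugedData 
    (hdet : a * d - b * c ≠ 0) (hc : c ≠ 0) (hsites : ∀ α, (c : ℂ) * 𝒢.z α + d ≠ 0)
    (hm : ∀ α, 0 < 𝒢.m α)
    {z : ℂ} (hz : ∀ α, z ≠ 𝒢.z α) (h : (c : ℂ) * z + d ≠ 0) :
    (((a : ℂ) * d - b * c) / ((c : ℂ) * z + d) ^ 2) *
      twist₀ (gaugedData I B a b c d linf 𝒢 : GaudinData _ _ (GaugedAlg A E U ι))
        (mobius a b c d z) = twist linf 𝒢 z := by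
  have key := sum_sites_resum (linf := linf) (𝒢 := 𝒢) hdet hc hsites hm hz h
    (fun α k => 𝒢.lev α k) (-∑ α, 𝒢.lev α 0) 1
  simp only [smul_eq_mul, neg_add_cancel, mul_zero, sub_zero, mul_one] at key
  rw [twist, twist₀, twist₀, Fintype.sum_option]
  generalize ((a : ℂ) * d - b * c) / ((c : ℂ) * z + d) ^ 2 = r at key ⊢
  simp only [div_eq_inv_mul _ ((_ : ℂ) ^ (_ + 1))]
  rw [← key]
  congr 2
  change ∑ p ∈ Finset.range 2, ((mobius a b c d z - a / c) ^ (p + 1))⁻¹ *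
      newLev a b c d linf 𝒢 none p = _
  rw [Finset.sum_range_succ, Finset.sum_range_one]
  rfl

theorem mobius_inv (hdet : a * d - b * c ≠ 0) (hc : c ≠ 0) {w : ℂ} (hw : w ≠ (a : ℂ) / c) :
    mobius a b c d (-((d : ℂ) * w - b) / (c * w - a)) = w ∧
      (c : ℂ) * (-((d : ℂ) * w - b) / (c * w - a)) + d
        = -((a : ℂ) * d - b * c) / (c * w - a) ∧ (c : ℂ) * w - a ≠ 0 := by
  have hc' : (c : ℂ) ≠ 0 := Complex.ofReal_ne_zero.2 hc
  have hdet' := ofReal_det_ne_zero hdet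
  have h1 : (c : ℂ) * w - a ≠ 0 := by
    intro h
    apply hw
    rw [eq_div_iff hc', ← sub_eq_zero, ← h]; ring
  have h2 : (c : ℂ) * (-((d : ℂ) * w - b) / (c * w - a)) + d
        = -((a : ℂ) * d - b * c) / (c * w - a) := by
    field_simp
    ring
  refine ⟨?_, h2, h1⟩
  rw [mobius, h2, div_eq_iff (div_ne_zero (neg_ne_zero.2 hdet') h1), ← mul_div_assoc,
    ← mul_div_assoc, eq_div_iff h1, add_mul, div_mul_cancel₀ _ h1]
  ring

theorem mobTwist_eq_twist₀ 
    (hdet : a * d - b * c ≠ 0) (hc : c ≠ 0) (hsites : ∀ α, (c : ℂ) * 𝒢.z α + d ≠ 0)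
    (hm : ∀ α, 0 < 𝒢.m α) {w : ℂ}
    (hw : ∀ α, w ≠ (gaugedData I B a b c d linf 𝒢 : GaudinData _ _ (GaugedAlg A E U ι)).z α) :
    mobTwist a b c d (twist linf 𝒢) w =
      twist₀ (gaugedData I B a b c d linf 𝒢 : GaudinData _ _ (GaugedAlg A E U ι)) w := by
  have hdet' := ofReal_det_ne_zero hdet
  obtain ⟨h1, h2, h3⟩ := mobius_inv (b := b) (d := d) hdet hc (hw none)
  have hy : (c : ℂ) * (-((d : ℂ) * w - b) / (c * w - a)) + d ≠ 0 := by
    rw [h2]; exact div_ne_zero (neg_ne_zero.2 hdet') h3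
  have hz : ∀ α, (-((d : ℂ) * w - b) / (c * w - a)) ≠ 𝒢.z α := by
    intro α h
    apply hw (some α)
    change w = mobius a b c d (𝒢.z α)
    rw [← h, h1]
  have key := twist₀_gaugedData (I := I) (B := B) (U := U) (linf := linf) hdet hc hsites hm hz hy
  rw [h1, h2] at key
  rw [mobTwist, ← key, ← mul_assoc]
  have h4 : ((a : ℂ) * d - b * c) / (c * w - a) ^ 2 *
      (((a : ℂ) * d - b * c) / (-((a : ℂ) * d - b * c) / (c * w - a)) ^ 2) = 1 := by
    field_simp
  rw [h4, one_mul]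

theorem mobTwist_mobius (hdet : a * d - b * c ≠ 0) (φ : ℂ → ℂ) {z : ℂ}
    (h : (c : ℂ) * z + d ≠ 0) : mobTwist a b c d φ (mobius a b c d z) =
      ((c : ℂ) * z + d) ^ 2 / ((a : ℂ) * d - b * c) * φ z := by
  have hdet' := ofReal_det_ne_zero hdet
  have h1 : (c : ℂ) * mobius a b c d z - a = -((a : ℂ) * d - b * c) / (c * z + d) := by
    rw [mobius]; field_simp; ring
  have h2 : -((d : ℂ) * mobius a b c d z - b) = -(((a : ℂ) * d - b * c) * z) / (c * z + d) := by
    rw [mobius, eq_div_iff h]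
    have h3 := div_mul_cancel₀ ((a : ℂ) * z + b) h
    linear_combination (-(d : ℂ)) * h3
  rw [mobTwist, h1, h2]
  congr 1
  · field_simp
  · congr 1
    field_simp

end GaugedModel

section TakiffModes

variable {A : Type*} [CommRing A] [Algebra ℂ A] {ι : Type w} [Fintype ι] [DecidableEq ι]
  {𝔤 : Type v} [LieRing 𝔤] [LieAlgebra ℝ 𝔤] {I : Module.Basis ι ℝ 𝔤}

/-- The transformation of the modes preserves the Takiff algebra of a site. -/
theorem br_mobMode (P : PVA A) (a b c d : ℝ) (z : ℂ) {m : ℕ} (hm : 0 < m) (J : ℕ → ι → A)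
    (lev : ℕ → ℂ)
    (h : ∀ p < m, ∀ q < m, ∀ e e', P.br (J p e) (J q e') = if p + q < m then
        Polynomial.C (comp I (J (p + q)) ⁅I e, I e'⁆)
          + Polynomial.C (algebraMap ℂ A (lev (p + q) * (kap I e e' : ℝ))) * Polynomial.X
      else 0) (p q : ℕ) (e e' : ι) :
    P.br (mobMode a b c d z m (fun k => J k e) p) (mobMode a b c d z m (fun k => J k e') q) =
      if p + q < m then
        Polynomial.C (comp I (fun f => mobMode a b c d z m (fun k => J k f) (p + q)) ⁅I e, I e'⁆)
          + Polynomial.C (algebraMap ℂ A (mobMode a b c d z m lev (p + q) * (kap I e e' : ℝ)))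
            * Polynomial.X
      else 0 := by
  have h1 : P.br (mobMode a b c d z m (fun k => J k e) p)
      (mobMode a b c d z m (fun k => J k e') q) =
      ∑ r ∈ Finset.range m, mobCoeff a b c d z (p + q) r •
        (Polynomial.C (comp I (J r) ⁅I e, I e'⁆)
          + Polynomial.C (algebraMap ℂ A (lev r * (kap I e e' : ℝ))) * Polynomial.X) := by
    simp only [← mobCoeff_convolution]
    rw [← sum_convolution, mobMode_eq _ _ _ _ _ hm, mobMode_eq _ _ _ _ _ hm, LinearMap.map_sum₂]
    refine Finset.sum_congr rfl fun k hk => ?_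
    rw [map_sum]
    refine Finset.sum_congr rfl fun l hl => ?_
    rw [map_smul, map_smul, LinearMap.smul_apply, smul_smul, mul_comm,
      h k (Finset.mem_range.1 hk) l (Finset.mem_range.1 hl)]
  rw [h1]
  by_cases hpq : p + q < m
  · rw [if_pos hpq]
    simp only [smul_add, Finset.sum_add_distrib, Polynomial.smul_C]
    congr 1
    · rw [← map_sum]
      congr 1
      simp only [comp, mobMode_eq _ _ _ _ _ hm, Finset.smul_sum]
      rw [Finset.sum_comm]
      exact Finset.sum_congr rfl fun _ _ => Finset.sum_congr rfl fun _ _ => smul_comm _ _ _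
    · rw [sum_smul_C_algebraMap_mul_X, mobMode_eq _ _ _ _ _ hm, Finset.sum_mul]
      simp only [smul_eq_mul, mul_assoc]
  · rw [if_neg hpq]
    refine Finset.sum_eq_zero fun r hr => ?_
    rw [mobCoeff_of_lt _ _ _ _ _ (lt_of_lt_of_le (Finset.mem_range.1 hr) (not_lt.1 hpq)), zero_smul]

end TakiffModes

section GaugedModel

variable {A : Type*} [CommRing A] [Algebra ℂ A]
  {E : Type u} [NormedAddCommGroup E] [NormedSpace ℝ E] [FiniteDimensional ℝ E]
  {G : Type v} [TopologicalSpace G] [ChartedSpace E G] [Group G] [LieGroup 𝓘(ℝ, E) ∞ G]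
  [LieAlgebra.IsSemisimple ℝ (GroupLieAlgebra 𝓘(ℝ, E) G)]
  {U : TopologicalSpace.Opens G} {ι : Type w} [Fintype ι] [DecidableEq ι]
  {I : Module.Basis ι ℝ (GroupLieAlgebra 𝓘(ℝ, E) G)} {P : PVA A}
  {Pt : PVA (GaugedAlg A E U ι)} {B : ι → ι → SmoothFun E U}
  {cj : A →+* A}
  {S : Type*} [Fintype S] [DecidableEq S] {𝒢 : GaudinData S ι A}
  {linf : ℝ} {a b c d : ℝ}

theorem IsRealisation.conj_sum_lev (h𝒢 : IsRealisation I P cj 𝒢) :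
    starRingEnd ℂ (∑ α, 𝒢.lev α 0) = ∑ α, 𝒢.lev α 0 := by
  rw [map_sum]
  refine (Finset.sum_congr rfl fun α _ => (h𝒢.lev_bar α 0 (h𝒢.m_pos α)).symm).trans ?_
  exact Equiv.sum_comp (Function.Involutive.toPerm 𝒢.bar h𝒢.bar_bar) fun α => 𝒢.lev α 0

theorem gaugedConj_W (hs : ∀ (r : ℂ) (f : A), cj (r • f) = starRingEnd ℂ r • cj f) (e : ι) :
    gaugedConj cj hs (fieldW B e : GaugedAlg A E U ι) = fieldW B e := by
  simp only [fieldW, map_sum, map_mul, gaugedConj_fn, gaugedConj_jv]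

theorem gaugedConj_wzCurrent (hs : ∀ (r : ℂ) (f : A), cj (r • f) = starRingEnd ℂ r • cj f)
    {l : ℂ} (hl : starRingEnd ℂ l = l) (e : ι) :
    gaugedConj cj hs (wzCurrent I B l e : GaugedAlg A E U ι) = wzCurrent I B l e := by
  simp only [wzCurrent_apply, map_add, gaugedConj_smul, gaugedConj_Xv, gaugedConj_W,
    gaugedConj_fieldj, map_div₀, hl, map_ofNat]

theorem br_inA_inA_comp (ht : IsTensorBracket I P Pt) {f g : A} {F : ι → A}
    {ξ : GroupLieAlgebra 𝓘(ℝ, E) G} {r : ℂ}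
    (h : P.br f g = Polynomial.C (comp I F ξ) + Polynomial.C (algebraMap ℂ A r) * Polynomial.X) :
    Pt.br (inA f) (inA g) = Polynomial.C (comp I (fun e => inA (F e)) ξ)
      + Polynomial.C (algebraMap ℂ _ r) * Polynomial.X := by
  rw [ht.br_inA, h, Polynomial.map_add, Polynomial.map_mul, Polynomial.map_C, Polynomial.map_C,
    Polynomial.map_X, ← inA_algebraMap]
  congr 2
  exact map_comp I (inA : A →ₐ[ℂ] GaugedAlg A E U ι).toLinearMap F ξ

theorem IsTensorBracket.isRealisation (ht : IsTensorBracket I P Pt) (hcj : P.IsConjugation cj)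
    (h𝒢 : IsRealisation I P cj 𝒢) (hlinf : linf ≠ 0)
    (hB : (∑ α, 𝒢.lev α 0) ≠ 0 → IsWZPotential I B)
    (hdet : a * d - b * c ≠ 0) (hc : c ≠ 0) (hsites : ∀ α, (c : ℂ) * 𝒢.z α + d ≠ 0) :
    IsRealisation I Pt (gaugedConj cj hcj.smul) (gaugedData I B a b c d linf 𝒢) := by
  have hdet' := ofReal_det_ne_zero hdet
  have hc' : (c : ℂ) ≠ 0 := Complex.ofReal_ne_zero.2 hc
  have hl : -∑ α, 𝒢.lev α 0 ≠ 0 → IsWZPotential I B := fun h => hB fun h' => h (by rw [h', neg_zero])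
  constructor
  · rintro (_ | α)
    · rfl
    · exact congrArg some (h𝒢.bar_bar α)
  · rintro (_ | α)
    · exact two_pos
    · exact h𝒢.m_pos α
  · rintro (_ | α)
    · rfl
    · exact h𝒢.m_bar α
  · rintro (_ | α) (_ | β) h
    · rfl
    · exfalso
      replace h : (a : ℂ) / c = mobius a b c d (𝒢.z β) := h
      have h1 := mobius_sub_pole (a := a) (b := b) hc (hsites β)
      rw [sub_eq_zero.2 h.symm] at h1
      exact div_ne_zero (neg_ne_zero.2 hdet') (mul_ne_zero hc' (hsites β)) h1.symm
    · exfalso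
      replace h : mobius a b c d (𝒢.z α) = (a : ℂ) / c := h
      have h1 := mobius_sub_pole (a := a) (b := b) hc (hsites α)
      rw [sub_eq_zero.2 h] at h1
      exact div_ne_zero (neg_ne_zero.2 hdet') (mul_ne_zero hc' (hsites α)) h1.symm
    · replace h : mobius a b c d (𝒢.z α) = mobius a b c d (𝒢.z β) := h
      have h1 := mobius_sub_mobius (a := a) (b := b) (hsites α) (hsites β)
      rw [sub_eq_zero.2 h] at h1
      rw [eq_comm, div_eq_zero_iff, mul_eq_zero] at h1
      rcases h1 with (h1 | h1) | h1
      · exact absurd h1 hdet'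
      · rw [h𝒢.z_inj (sub_eq_zero.1 h1)]
      · exact absurd h1 (mul_ne_zero (hsites α) (hsites β))
  · rintro (_ | α)
    · change (a : ℂ) / c = starRingEnd ℂ ((a : ℂ) / c)
      simp
    · change mobius a b c d (𝒢.z (𝒢.bar α)) = starRingEnd ℂ (mobius a b c d (𝒢.z α))
      rw [h𝒢.z_bar]
      simp [mobius]
  · rintro (_ | α)
    · change -(linf * ((a : ℂ) * d - b * c)) / (c : ℂ) ^ 2 ≠ 0
      exact div_ne_zero (neg_ne_zero.2 (mul_ne_zero (Complex.ofReal_ne_zero.2 hlinf) hdet'))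
        (pow_ne_zero 2 hc')
    · change mobMode a b c d (𝒢.z α) (𝒢.m α) (𝒢.lev α) (𝒢.m α - 1) ≠ 0
      have hm := h𝒢.m_pos α
      rw [mobMode_eq _ _ _ _ _ hm, Finset.sum_eq_single (𝒢.m α - 1)]
      · refine mul_ne_zero ?_ (h𝒢.lev_top α)
        rw [mobCoeff]
        split_ifs with h0 h1
        · exact one_ne_zero
        · exact absurd h1 (lt_irrefl _)
        · rw [Nat.choose_self, Nat.sub_self, pow_zero, Nat.cast_one, one_mul, one_mul]
          exact div_ne_zero (pow_ne_zero _ hdet') (pow_ne_zero _ (hsites α))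
      · intro k hk hne
        rw [Finset.mem_range] at hk
        rw [mobCoeff_of_lt _ _ _ _ _ (by omega), zero_smul]
      · intro h; exact absurd (Finset.mem_range.2 (by omega)) h
  · rintro (_ | α) p hp
    · rcases p with _ | p
      · change -∑ α, 𝒢.lev α 0 = starRingEnd ℂ (-∑ α, 𝒢.lev α 0)
        rw [map_neg, h𝒢.conj_sum_lev]
      · change -(linf * ((a : ℂ) * d - b * c)) / (c : ℂ) ^ 2 =
          starRingEnd ℂ (-(linf * ((a : ℂ) * d - b * c)) / (c : ℂ) ^ 2)
        simp
    · change mobMode a b c d (𝒢.z (𝒢.bar α)) (𝒢.m (𝒢.bar α)) (𝒢.lev (𝒢.bar α)) p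
        = starRingEnd ℂ (mobMode a b c d (𝒢.z α) (𝒢.m α) (𝒢.lev α) p)
      rw [h𝒢.z_bar, h𝒢.m_bar]
      exact mobMode_conj (starRingEnd ℂ : ℂ →+ ℂ) (fun r x => by simp) _ _ _ _ _ (h𝒢.m_pos α) _ _
        (h𝒢.lev_bar α) p
  · rintro (_ | α) p hp e
    · rcases p with _ | p
      · exact (gaugedConj_wzCurrent hcj.smul (by rw [newLev_none_zero, map_neg, h𝒢.conj_sum_lev])
          e).symm
      · change newLev a b c d linf 𝒢 none 1 • fieldj I e
          = gaugedConj cj hcj.smul (newLev a b c d linf 𝒢 none 1 • fieldj I e)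
        rw [gaugedConj_smul, gaugedConj_fieldj]
        congr 1
        rw [newLev_none_succ]
        simp
    · change inA (mobMode a b c d (𝒢.z (𝒢.bar α)) (𝒢.m (𝒢.bar α)) _ p)
        = gaugedConj cj hcj.smul (inA (mobMode a b c d (𝒢.z α) (𝒢.m α) _ p))
      rw [h𝒢.z_bar, h𝒢.m_bar, gaugedConj_inA]
      congr 1
      exact mobMode_conj (cj : A →+ A) hcj.smul _ _ _ _ _ (h𝒢.m_pos α) _ _
        (fun k hk => h𝒢.J_bar α k hk e) p
  · rintro (_ | α) (_ | β) p hp q hq e e'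
    · simp only [true_and]
      rcases p with _ | p <;> rcases q with _ | q
      · rw [if_pos (by change 0 + 0 < 2; omega)]
        exact ht.br_wzCurrent_wzCurrent hl e e'
      · change q + 1 < 2 at hq
        obtain rfl : q = 0 := by omega
        rw [if_pos (by change 0 + (0 + 1) < 2; omega)]
        change Pt.br (wzCurrent I B _ e) (newLev a b c d linf 𝒢 none 1 • fieldj I e') =
          Polynomial.C (comp I (newLev a b c d linf 𝒢 none 1 • fieldj I) _) +
          Polynomial.C (algebraMap ℂ _ (newLev a b c d linf 𝒢 none 1 * _)) * _
        rw [map_smul, ht.br_wzCurrent_fieldj, comp_smul_left, smul_add, Polynomial.smul_C,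
          ← smul_mul_assoc, smul_C_algebraMap]
      · change p + 1 < 2 at hp
        obtain rfl : p = 0 := by omega
        rw [if_pos (by change 0 + 1 + 0 < 2; omega)]
        change Pt.br (newLev a b c d linf 𝒢 none 1 • fieldj I e) (wzCurrent I B _ e') =
          Polynomial.C (comp I (newLev a b c d linf 𝒢 none 1 • fieldj I) _) +
          Polynomial.C (algebraMap ℂ _ (newLev a b c d linf 𝒢 none 1 * _)) * _
        rw [map_smul, LinearMap.smul_apply, ht.br_fieldj_wzCurrent, comp_smul_left, smul_add,
          Polynomial.smul_C, ← smul_mul_assoc, smul_C_algebraMap]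
      · rw [if_neg (by change ¬ (p + 1 + (q + 1) < 2); omega)]
        change Pt.br (newLev a b c d linf 𝒢 none 1 • fieldj I e)
          (newLev a b c d linf 𝒢 none 1 • fieldj I e') = 0
        rw [map_smul, map_smul, LinearMap.smul_apply, ht.br_fieldj_fieldj, smul_zero, smul_zero]
    · rw [if_neg (by simp)]
      refine ht.swap_zero ?_
      rcases p with _ | p
      · exact ht.br_inA_wzCurrent _ _ e
      · change Pt.br (inA _) (newLev a b c d linf 𝒢 none 1 • fieldj I e) = 0
        rw [map_smul, ht.br_inA_fieldj, smul_zero]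
    · rw [if_neg (by simp)]
      rcases q with _ | q
      · exact ht.br_inA_wzCurrent _ _ e'
      · change Pt.br (inA _) (newLev a b c d linf 𝒢 none 1 • fieldj I e') = 0
        rw [map_smul, ht.br_inA_fieldj, smul_zero]
    · by_cases hαβ : α = β
      · subst hαβ
        simp only [true_and]
        have key := br_mobMode (I := I) P a b c d (𝒢.z α) (h𝒢.m_pos α) (𝒢.J α) (𝒢.lev α)
          (fun p hp q hq e e' => by simpa using h𝒢.takiff α α p hp q hq e e') p q e e'
        by_cases hpq : p + q < 𝒢.m α
        · rw [if_pos hpq] at key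
          rw [if_pos (by exact hpq)]
          exact br_inA_inA_comp ht key
        · rw [if_neg hpq] at key
          rw [if_neg (by exact hpq)]
          refine (ht.br_inA _ _).trans ?_
          rw [key, Polynomial.map_zero]
      · rw [if_neg (by simp [hαβ])]
        refine (ht.br_inA _ _).trans ?_
        have : P.br (mobMode a b c d (𝒢.z α) (𝒢.m α) (fun k => 𝒢.J α k e) p)
            (mobMode a b c d (𝒢.z β) (𝒢.m β) (fun k => 𝒢.J β k e') q) = 0 := by
          rw [mobMode_eq _ _ _ _ _ (h𝒢.m_pos α), mobMode_eq _ _ _ _ _ (h𝒢.m_pos β),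
            LinearMap.map_sum₂]
          refine Finset.sum_eq_zero fun k hk => ?_
          rw [map_sum]
          refine Finset.sum_eq_zero fun l hl => ?_
          rw [map_smul, map_smul, LinearMap.smul_apply,
            h𝒢.takiff α β k (Finset.mem_range.1 hk) l (Finset.mem_range.1 hl),
            if_neg (by simp [hαβ]), smul_zero, smul_zero]
        rw [this, Polynomial.map_zero]

end GaugedModel

section ZeroModes

variable {V : Type u} [CommRing V] [Algebra ℂ V] {ι : Type w} [Fintype ι] [DecidableEq ι]
  {𝔤 : Type v} [LieRing 𝔤] [LieAlgebra ℝ 𝔤] {I : Module.Basis ι ℝ 𝔤} {P : PVA V} {cj : V →+* V}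
  {S : Type*} [Fintype S] [DecidableEq S] {𝒢 : GaudinData S ι V}

/-- The Takiff currents transform in the adjoint representation under the diagonal symmetry. -/
theorem IsRealisation.br_sumZeroModes_J (h𝒢 : IsRealisation I P cj 𝒢) (α : S) {p : ℕ}
    (hp : p < 𝒢.m α) (e e' : ι) :
    P.br (sumZeroModes 𝒢 e) (𝒢.J α p e') = Polynomial.C (comp I (𝒢.J α p) ⁅I e, I e'⁆)
      + Polynomial.C (algebraMap ℂ V (𝒢.lev α p * (kap I e e' : ℝ))) * Polynomial.X := by
  rw [sumZeroModes, map_sum, LinearMap.sum_apply, Finset.sum_eq_single α]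
  · rw [h𝒢.takiff α α 0 (h𝒢.m_pos α) p hp, zero_add, if_pos ⟨rfl, hp⟩]
  · intro β _ hβ
    rw [h𝒢.takiff β α 0 (h𝒢.m_pos β) p hp, if_neg (fun h => hβ h.1)]
  · simp

theorem IsRealisation.br_sumZeroModes (h𝒢 : IsRealisation I P cj 𝒢) (e e' : ι) :
    P.br (sumZeroModes 𝒢 e) (sumZeroModes 𝒢 e') =
      Polynomial.C (comp I (sumZeroModes 𝒢) ⁅I e, I e'⁆)
      + Polynomial.C (algebraMap ℂ V ((∑ α, 𝒢.lev α 0) * (kap I e e' : ℝ))) * Polynomial.X := by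
  have h1 : sumZeroModes 𝒢 e' = ∑ α, 𝒢.J α 0 e' := rfl
  rw [h1, map_sum, Finset.sum_congr rfl fun α _ => h𝒢.br_sumZeroModes_J α (h𝒢.m_pos α) e e',
    Finset.sum_add_distrib, ← map_sum, ← Finset.sum_mul, ← map_sum, ← map_sum, ← Finset.sum_mul]
  congr 2
  simp only [comp, sumZeroModes, Finset.smul_sum]
  rw [Finset.sum_comm]

end ZeroModes

section Transport

variable {V : Type u} [CommRing V] [Algebra ℂ V] {V' : Type v} [CommRing V'] [Algebra ℂ V']

/-- Transport of the spatial derivative. -/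
def transportD (D : Derivation ℂ V V) (Φ : V ≃ₐ[ℂ] V') : Derivation ℂ V' V' :=
  Derivation.mk' (Φ.toLinearMap ∘ₗ (D : V →ₗ[ℂ] V) ∘ₗ Φ.symm.toLinearMap) fun x y => by
    simp only [LinearMap.comp_apply, AlgEquiv.toLinearMap_apply, map_mul, Derivation.coeFn_coe,
      Derivation.leibniz, smul_eq_mul, map_add, AlgEquiv.apply_symm_apply]

theorem transportD_apply (D : Derivation ℂ V V) (Φ : V ≃ₐ[ℂ] V') (x : V) :
    transportD D Φ (Φ x) = Φ (D x) := by
  change Φ (D (Φ.symm (Φ x))) = _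
  rw [AlgEquiv.symm_apply_apply]

theorem transport_map_shift (D : Derivation ℂ V V) (Φ : V ≃ₐ[ℂ] V') (p : V[X]) :
    (shift D p).map (Φ : V →+* V') = shift (transportD D Φ) (p.map (Φ : V →+* V')) :=
  map_shift D _ (Φ : V →+* V') (fun f => (transportD_apply D Φ f).symm) p

theorem transport_map_adj (D : Derivation ℂ V V) (Φ : V ≃ₐ[ℂ] V') (p : V[X]) :
    (adj D p).map (Φ : V →+* V') = adj (transportD D Φ) (p.map (Φ : V →+* V')) :=
  map_adj D _ (Φ : V →+* V') (fun f => (transportD_apply D Φ f).symm) p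

/-- Transport of the bracket of a local Poisson algebra. -/
def transportPre (P : PVA V) (Φ : V ≃ₐ[ℂ] V') : PreBracket V' where
  D := transportD P.D Φ
  br := LinearMap.mk₂ ℂ (fun f g => (P.br (Φ.symm f) (Φ.symm g)).map (Φ : V →+* V'))
    (fun f f' g => by simp only [map_add, LinearMap.add_apply, Polynomial.map_add])
    (fun r f g => by
      rw [map_smul, map_smul, LinearMap.smul_apply]
      exact map_smul (Polynomial.mapAlgHom Φ.toAlgHom) r _)
    (fun f g g' => by simp only [map_add, Polynomial.map_add])
    (fun r f g => by
      rw [map_smul, map_smul]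
      exact map_smul (Polynomial.mapAlgHom Φ.toAlgHom) r _)
  br_D_left f g := by
    obtain ⟨f, rfl⟩ := Φ.surjective f
    rw [transportD_apply, LinearMap.mk₂_apply, LinearMap.mk₂_apply, AlgEquiv.symm_apply_apply,
      AlgEquiv.symm_apply_apply, P.br_D_left, Polynomial.map_neg, Polynomial.map_mul,
      Polynomial.map_X]
  br_D_right f g := by
    obtain ⟨g, rfl⟩ := Φ.surjective g
    rw [transportD_apply, LinearMap.mk₂_apply, LinearMap.mk₂_apply, AlgEquiv.symm_apply_apply,
      AlgEquiv.symm_apply_apply, P.br_D_right, transport_map_shift]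
  br_mul f g h := by
    simp only [LinearMap.mk₂_apply, map_mul, P.br_mul, Polynomial.map_add, Polynomial.map_mul,
      Polynomial.map_C]
    simp
  br_skew f g := by
    rw [LinearMap.mk₂_apply, LinearMap.mk₂_apply, P.br_skew, Polynomial.map_neg, transport_map_adj]

theorem transportPre_br (P : PVA V) (Φ : V ≃ₐ[ℂ] V') (f g : V) :
    (transportPre P Φ).br (Φ f) (Φ g) = (P.br f g).map (Φ : V →+* V') := by
  change (P.br (Φ.symm (Φ f)) (Φ.symm (Φ g))).map _ = _
  rw [AlgEquiv.symm_apply_apply, AlgEquiv.symm_apply_apply]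

theorem opEval_scal_map (σ : V →ₐ[ℂ] V') (s : ℂ) (p : V[X]) :
    opEval (scal V' s) (p.map (σ : V →+* V')) = σ (opEval (scal V s) p) := by
  rw [opEval_scal, opEval_scal]
  have : algebraMap ℂ V' s = (σ : V →+* V') (algebraMap ℂ V s) := (σ.commutes s).symm
  rw [this, Polynomial.eval_map, Polynomial.eval₂_at_apply]
  rfl

/-- Transport of a local Poisson algebra. -/
def transportPVA (P : PVA V) (Φ : V ≃ₐ[ℂ] V') : PVA V' :=
  (transportPre P Φ).toPVA fun s t f g h => by
    have hbs : ∀ s f g, (transportPre P Φ).bs s (Φ f) (Φ g) = Φ (P.toPre.bs s f g) := by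
      intro s f g
      rw [PreBracket.bs_apply, transportPre_br, PreBracket.bs_apply]
      exact opEval_scal_map Φ.toAlgHom s _
    obtain ⟨f, rfl⟩ := Φ.surjective f
    obtain ⟨g, rfl⟩ := Φ.surjective g
    obtain ⟨h, rfl⟩ := Φ.surjective h
    have := congrArg Φ (P.jac_eq_zero s t f g h)
    rw [PreBracket.jac] at this ⊢
    simp only [hbs, ← map_sub, this, map_zero]

end Transport

section WeakEquality

variable {A : Type*} [CommRing A] [Algebra ℂ A]
  {E : Type u} [NormedAddCommGroup E] [NormedSpace ℝ E] [FiniteDimensional ℝ E]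
  {G : Type v} [TopologicalSpace G] [ChartedSpace E G] [Group G] [LieGroup 𝓘(ℝ, E) ∞ G]
  [LieAlgebra.IsSemisimple ℝ (GroupLieAlgebra 𝓘(ℝ, E) G)]
  {U : TopologicalSpace.Opens G} {ι : Type w} [Fintype ι] [DecidableEq ι]
  {I : Module.Basis ι ℝ (GroupLieAlgebra 𝓘(ℝ, E) G)} {P : PVA A}
  {Pt : PVA (GaugedAlg A E U ι)} {B : ι → ι → SmoothFun E U}

/-- The projection on the physical observables: `g ↦ Id`, `j ↦ 0`, `X ↦ -K`. -/
def physProj (hU : (1 : G) ∈ U) (P : PVA A) (K : ι → A) : GaugedAlg A E U ι →ₐ[ℂ] A :=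
  gaugedLift (AlgHom.id ℂ A)
    ((algebraMap ℂ A).comp (Complex.ofRealHom.comp (evalAt ⟨1, hU⟩ : SmoothFun E U →ₐ[ℝ] ℝ).toRingHom))
    (fun r => by
      change algebraMap ℂ A ((evalAt ⟨1, hU⟩ (algebraMap ℝ (SmoothFun E U) r) : ℝ) : ℂ) = _
      rw [AlgHom.commutes]; rfl)
    (Sum.elim (fun _ => 0) fun i => P.D^[i.2] (-K i.1))

variable (hU : (1 : G) ∈ U) (K : ι → A)

theorem physProj_inA (f : A) :
    physProj hU P K (inA f : GaugedAlg A E U ι) = f := gaugedLift_inA _ _ _ _ f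

theorem physProj_fn (h : SmoothFun E U) :
    physProj hU P K (fn h : GaugedAlg A E U ι) = algebraMap ℂ A ((h ⟨1, hU⟩ : ℝ) : ℂ) :=
  gaugedLift_fn _ _ _ _ h

theorem physProj_jv (a : ι) (n : ℕ) : physProj hU P K (jv a n : GaugedAlg A E U ι) = 0 :=
  gaugedLift_jet _ _ _ _ (Sum.inl (a, n))

theorem physProj_Xv (a : ι) (n : ℕ) :
    physProj hU P K (Xv a n : GaugedAlg A E U ι) = P.D^[n] (-K a) :=
  gaugedLift_jet _ _ _ _ (Sum.inr (a, n))

theorem physProj_fieldj (a : ι) : physProj hU P K (fieldj I a : GaugedAlg A E U ι) = 0 := by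
  simp only [fieldj, map_sum, map_smul, physProj_jv, smul_zero, Finset.sum_const_zero]

theorem physProj_W (a : ι) : physProj hU P K (fieldW B a : GaugedAlg A E U ι) = 0 := by
  simp only [fieldW, map_sum, map_mul, physProj_jv, mul_zero, Finset.sum_const_zero]

theorem physProj_wzCurrent (l : ℂ) (a : ι) :
    physProj hU P K (wzCurrent I B l a : GaugedAlg A E U ι) = -K a := by
  rw [wzCurrent_apply, map_add, map_add, map_smul, map_smul, physProj_W, physProj_fieldj,
    physProj_Xv, smul_zero, add_zero, add_zero]
  rfl

theorem physProj_D (ht : IsTensorBracket I P Pt) (F : GaugedAlg A E U ι) :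
    physProj hU P K (Pt.D F) = P.D (physProj hU P K F) := by
  refine gauged_induction (q := fun F => physProj hU P K (Pt.D F) = P.D (physProj hU P K F))
    ?_ ?_ ?_ ?_ ?_ ?_ F
  · intro f; rw [ht.D_inA, physProj_inA, physProj_inA]
  · intro h
    rw [ht.D_fn, physProj_fn, Derivation.map_algebraMap, map_sum]
    exact Finset.sum_eq_zero fun a _ => by rw [map_mul, physProj_jv, mul_zero]
  · intro a n; rw [ht.D_j, physProj_jv, physProj_jv, map_zero]
  · intro a n; rw [ht.D_X, physProj_Xv, physProj_Xv, Function.iterate_succ_apply']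
  · intro x y hx hy; simp only [map_add, hx, hy]
  · intro x y hx hy; simp only [Derivation.leibniz, map_add, map_mul, smul_eq_mul, hx, hy]

theorem physProj_D_iterate (ht : IsTensorBracket I P Pt) (n : ℕ) (F : GaugedAlg A E U ι) :
    physProj hU P K (Pt.D^[n] F) = P.D^[n] (physProj hU P K F) := by
  induction n with
  | zero => rfl
  | succ n ih => rw [Function.iterate_succ_apply', Function.iterate_succ_apply', physProj_D hU K ht, ih]

variable {C : ι → GaugedAlg A E U ι}

theorem C_mem_weakIdeal (Pt : PVA (GaugedAlg A E U ι)) (C : ι → GaugedAlg A E U ι) (a : ι) :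
    C a ∈ weakIdeal hU Pt C :=
  Ideal.subset_span (Or.inl ⟨0, a, rfl⟩)

theorem fn_sub_mem_weakIdeal (Pt : PVA (GaugedAlg A E U ι)) (C : ι → GaugedAlg A E U ι)
    (h : SmoothFun E U) :
    fn h - algebraMap ℂ _ ((h ⟨1, hU⟩ : ℝ) : ℂ) ∈ weakIdeal hU Pt C :=
  Ideal.subset_span (Or.inr ⟨0, h, rfl⟩)

theorem D_mem_weakIdeal {x : GaugedAlg A E U ι} (hx : x ∈ weakIdeal hU Pt C) :
    Pt.D x ∈ weakIdeal hU Pt C := by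
  refine Submodule.span_induction (p := fun x _ => Pt.D x ∈ weakIdeal hU Pt C) ?_ ?_ ?_ ?_ hx
  · rintro _ (⟨n, a, rfl⟩ | ⟨n, h, rfl⟩)
    · exact Ideal.subset_span (Or.inl ⟨n + 1, a, (Function.iterate_succ_apply' _ _ _).symm⟩)
    · exact Ideal.subset_span (Or.inr ⟨n + 1, h, (Function.iterate_succ_apply' _ _ _).symm⟩)
  · rw [map_zero]; exact zero_mem _
  · intro x y _ _ hx hy; rw [map_add]; exact add_mem hx hy
  · intro r x hx' hx
    rw [smul_eq_mul, Derivation.leibniz]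
    exact add_mem (Ideal.mul_mem_left _ _ hx) (Ideal.mul_mem_right _ _ hx')

variable [T2Space G]

theorem jv_mem_weakIdeal (ht : IsTensorBracket I P Pt) (a : ι) (n : ℕ) :
    jv a n ∈ weakIdeal hU Pt C := by
  induction n with
  | zero =>
    obtain ⟨f, hf⟩ := exists_dual_functions I (⟨1, hU⟩ : U)
    have h1 := D_mem_weakIdeal hU (fn_sub_mem_weakIdeal hU Pt C (f a))
    rw [map_sub, Derivation.map_algebraMap, sub_zero, ht.D_fn] at h1
    have h2 : ∑ b, (fn (leftDeriv (I b) (f a)) - algebraMap ℂ _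
        ((leftDeriv (I b) (f a) ⟨1, hU⟩ : ℝ) : ℂ)) * jv b 0 ∈ weakIdeal hU Pt C :=
      Ideal.sum_mem _ fun b _ => Ideal.mul_mem_right _ _ (fn_sub_mem_weakIdeal hU Pt C _)
    have h3 := sub_mem h1 h2
    rw [← Finset.sum_sub_distrib] at h3
    simp only [← sub_mul, sub_sub_cancel] at h3
    rw [Finset.sum_eq_single a] at h3
    · have h4 : leftDeriv (I a) (f a) ⟨1, hU⟩ = 1 := (hf a a).trans (if_pos rfl)
      rw [h4, Complex.ofReal_one, map_one, one_mul] at h3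
      exact h3
    · intro b _ hb
      have h4 : leftDeriv (I b) (f a) ⟨1, hU⟩ = 0 := (hf b a).trans (if_neg hb)
      rw [h4, Complex.ofReal_zero, map_zero, zero_mul]
    · simp
  | succ n ih => rw [← ht.D_j]; exact D_mem_weakIdeal hU ih

theorem smul_mem_weakIdeal (r : ℂ) {x : GaugedAlg A E U ι} (hx : x ∈ weakIdeal hU Pt C) :
    r • x ∈ weakIdeal hU Pt C := by
  rw [smul_eq_inA_mul]; exact Ideal.mul_mem_left _ _ hx

theorem fieldj_mem_weakIdeal (ht : IsTensorBracket I P Pt) (a : ι) :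
    fieldj I a ∈ weakIdeal hU Pt C :=
  Ideal.sum_mem _ fun b _ => smul_mem_weakIdeal hU _ (jv_mem_weakIdeal hU ht b 0)

theorem W_mem_weakIdeal (ht : IsTensorBracket I P Pt) (a : ι) :
    fieldW B a ∈ weakIdeal hU Pt C :=
  Ideal.sum_mem _ fun b _ => Ideal.mul_mem_left _ _ (jv_mem_weakIdeal hU ht b 0)

variable {K} {l : ℂ} (hC : ∀ e, C e = wzCurrent I B l e + inA (K e))
include hC

theorem sub_inA_mem_weakIdeal (ht : IsTensorBracket I P Pt) (F : GaugedAlg A E U ι) :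
    F - inA (physProj hU P K F) ∈ weakIdeal hU Pt C := by
  refine gauged_induction (q := fun F => F - inA (physProj hU P K F) ∈ weakIdeal hU Pt C)
    ?_ ?_ ?_ ?_ ?_ ?_ F
  · intro f; rw [physProj_inA, sub_self]; exact zero_mem _
  · intro h; rw [physProj_fn, inA_algebraMap]; exact fn_sub_mem_weakIdeal hU Pt C h
  · intro a n; rw [physProj_jv, map_zero, sub_zero]; exact jv_mem_weakIdeal hU ht a n
  · intro a n
    induction n with
    | zero =>
      have h1 := C_mem_weakIdeal hU Pt C a
      rw [hC, wzCurrent_apply] at h1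
      have h2 := sub_mem (sub_mem h1 (smul_mem_weakIdeal hU (l / 2) (fieldj_mem_weakIdeal hU ht a)))
        (smul_mem_weakIdeal hU (l / 2) (W_mem_weakIdeal (B := B) hU ht a))
      convert h2 using 1
      rw [physProj_Xv, Function.iterate_zero, id, map_neg]
      abel
    | succ n ih =>
      have h1 := D_mem_weakIdeal hU ih
      rw [map_sub, ht.D_inA, ht.D_X, ← physProj_D hU K ht, ht.D_X] at h1
      exact h1
  · intro x y hx hy
    have := add_mem hx hy
    rw [map_add, map_add]
    convert this using 1
    abel
  · intro x y hx hy
    have := add_mem (Ideal.mul_mem_right y _ hx) (Ideal.mul_mem_left _ (inA (physProj hU P K x)) hy)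
    rw [map_mul, map_mul]
    convert this using 1
    ring

theorem physProj_C (a : ι) : physProj hU P K (C a) = 0 := by
  rw [hC, map_add, physProj_wzCurrent, physProj_inA, neg_add_cancel]

theorem mem_weakIdeal_iff (ht : IsTensorBracket I P Pt) (F : GaugedAlg A E U ι) :
    F ∈ weakIdeal hU Pt C ↔ physProj hU P K F = 0 := by
  constructor
  · intro h
    have : weakIdeal hU Pt C ≤ RingHom.ker (physProj hU P K : GaugedAlg A E U ι →ₐ[ℂ] A) := by
      refine Ideal.span_le.2 ?_
      rintro _ (⟨n, a, rfl⟩ | ⟨n, h, rfl⟩)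
      · rw [SetLike.mem_coe, RingHom.mem_ker, physProj_D_iterate hU K ht, physProj_C hU hC]
        exact iterate_map_zero _ _
      · rw [SetLike.mem_coe, RingHom.mem_ker, physProj_D_iterate hU K ht, map_sub, physProj_fn,
          AlgHom.commutes, sub_self]
        exact iterate_map_zero _ _
    exact this h
  · intro h
    have h1 := sub_inA_mem_weakIdeal hU hC ht F
    rwa [h, map_zero, sub_zero] at h1

end WeakEquality

theorem sum_neg_poly {V : Type*} [CommRing V] {κ : Type*} (s : Finset κ) (p : κ → V[X]) :
    ∑ k ∈ s, -p k = -∑ k ∈ s, p k := by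
  rw [Finset.sum_neg_distrib]

theorem neg_adj_dirac {V : Type*} [CommRing V] [Algebra ℂ V] (D : Derivation ℂ V V) {κ : Type*}
    [Fintype κ] (b b' : V[X]) (hb : b' = -adj D b) (g g' c c' d d' : κ → V[X])
    (hc : ∀ k, c' k = -adj D (c k)) (hd : ∀ k, d' k = -adj D (d k)) :
    b' + ∑ a, act D (g a) (d' a) + ∑ a, act D (c' a) (adj D (g' a))
      = -adj D (b + ∑ a, act D (g' a) (c a) + ∑ a, act D (d a) (adj D (g a))) := by
  simp only [adj_add, adj_sum, adj_act, adj_adj, neg_add, ← Finset.sum_neg_distrib, hb, hc, hd,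
    act_neg_left, act_neg_right]
  abel

section GaugeFixing

variable {A : Type*} [CommRing A] [Algebra ℂ A]
  {E : Type u} [NormedAddCommGroup E] [NormedSpace ℝ E] [FiniteDimensional ℝ E]
  {G : Type v} [TopologicalSpace G] [ChartedSpace E G] [Group G] [LieGroup 𝓘(ℝ, E) ∞ G]
  [LieAlgebra.IsSemisimple ℝ (GroupLieAlgebra 𝓘(ℝ, E) G)]
  {U : TopologicalSpace.Opens G} {ι : Type w} [Fintype ι] [DecidableEq ι]
  {I : Module.Basis ι ℝ (GroupLieAlgebra 𝓘(ℝ, E) G)} {P : PVA A}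
  {Pt : PVA (GaugedAlg A E U ι)} {B : ι → ι → SmoothFun E U}

theorem momDeriv_tmul (a : ι) (n : ℕ) (f : A) (p : CotAlg E U ι) :
    momDeriv a n (f ⊗ₜ[ℝ] p : GaugedAlg A E U ι)
      = f ⊗ₜ MvPolynomial.pderiv (Sum.inr (a, n)) p := rfl

theorem momDeriv_mul (a : ι) (n : ℕ) (F F₂ : GaugedAlg A E U ι) :
    momDeriv a n (F * F₂) = F * momDeriv a n F₂ + F₂ * momDeriv a n F := by
  induction F using TensorProduct.induction_on with
  | zero => simp only [zero_mul, map_zero, mul_zero, add_zero]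
  | add x y hx hy => rw [add_mul, map_add, hx, hy, map_add]; ring
  | tmul f p =>
    induction F₂ using TensorProduct.induction_on with
    | zero => simp only [zero_mul, map_zero, mul_zero, add_zero]
    | add x y hx hy => rw [mul_add, map_add, hx, hy, map_add]; ring
    | tmul f' p' =>
      rw [Algebra.TensorProduct.tmul_mul_tmul, momDeriv_tmul, momDeriv_tmul, momDeriv_tmul,
        Algebra.TensorProduct.tmul_mul_tmul, Algebra.TensorProduct.tmul_mul_tmul, mul_comm f' f,
        Derivation.leibniz, TensorProduct.tmul_add]
      rfl

theorem momDeriv_inA (a : ι) (n : ℕ) (f : A) :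
    momDeriv a n (inA f : GaugedAlg A E U ι) = 0 := by
  change momDeriv a n (f ⊗ₜ[ℝ] (1 : CotAlg E U ι)) = 0
  rw [momDeriv_tmul, Derivation.map_one_eq_zero, TensorProduct.tmul_zero]

theorem momDeriv_fn (a : ι) (n : ℕ) (h : SmoothFun E U) :
    momDeriv a n (fn h : GaugedAlg A E U ι) = 0 := by
  rw [fn, momDeriv_tmul, MvPolynomial.pderiv_C, TensorProduct.tmul_zero]

theorem momDeriv_jv (a : ι) (n : ℕ) (b : ι) (m : ℕ) :
    momDeriv a n (jv b m : GaugedAlg A E U ι) = 0 := by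
  rw [jv, momDeriv_tmul, MvPolynomial.pderiv_X_of_ne (by simp), TensorProduct.tmul_zero]

theorem momDeriv_Xv (a : ι) (n : ℕ) (b : ι) (m : ℕ) :
    momDeriv a n (Xv b m : GaugedAlg A E U ι) = if a = b ∧ n = m then 1 else 0 := by
  rw [Xv, momDeriv_tmul, MvPolynomial.pderiv_X]
  split_ifs with h
  · rw [h.1, h.2, Pi.single_eq_same]; rfl
  · rw [Pi.single_eq_of_ne, TensorProduct.tmul_zero]
    intro h'
    rw [Sum.inr.injEq, Prod.mk.injEq] at h'
    exact h ⟨h'.1.symm, h'.2.symm⟩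

/-- The operator `g⁻¹ {g_λ ·}` is the opposite of the Fréchet derivative along `X`. -/
theorem gBracket_eq_neg_momOp (I : Module.Basis ι ℝ (GroupLieAlgebra 𝓘(ℝ, E) G)) (a : ι)
    (F : GaugedAlg A E U ι) : gBracket a F = -(gaugedFields A U I).momOp a F := by
  set 𝔉 := gaugedFields A U I
  suffices h : ∃ N : ℕ, (∀ n, N ≤ n → momDeriv a n F = 0) ∧
      ∑ n ∈ Finset.range N, Polynomial.monomial n (momDeriv a n F) = 𝔉.momOp a F by
    obtain ⟨N, h1, h2⟩ := h
    rw [gBracket, ← h2, finsum_eq_sum_of_support_subset]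
    intro n hn
    rw [Finset.coe_range, Set.mem_Iio]
    by_contra h3
    exact hn ((congrArg (Polynomial.monomial n) (h1 n (not_lt.1 h3))).trans
      (Polynomial.monomial_zero_right n))
  have mono : ∀ (x : GaugedAlg A E U ι) (N N' : ℕ), N ≤ N' → (∀ n, N ≤ n → momDeriv a n x = 0) →
      ∑ n ∈ Finset.range N, Polynomial.monomial n (momDeriv a n x)
        = ∑ n ∈ Finset.range N', Polynomial.monomial n (momDeriv a n x) := by
    intro x N N' hN h
    refine Finset.sum_subset (Finset.range_mono hN) fun n _ hn => ?_
    rw [h n (by simpa using hn), Polynomial.monomial_zero_right]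
  refine gauged_induction (q := fun F => ∃ N : ℕ, (∀ n, N ≤ n → momDeriv a n F = 0) ∧
      ∑ n ∈ Finset.range N, Polynomial.monomial n (momDeriv a n F) = 𝔉.momOp a F) ?_ ?_ ?_ ?_ ?_ ?_ F
  · exact fun f => ⟨0, fun n _ => momDeriv_inA a n f, (𝔉.momOp_iA a f).symm⟩
  · exact fun h => ⟨0, fun n _ => momDeriv_fn a n h, (𝔉.momOp_iR a h).symm⟩
  · exact fun b m => ⟨0, fun n _ => momDeriv_jv a n b m, (𝔉.momOp_j a b m).symm⟩
  · refine fun b m => ⟨m + 1, fun n hn => ?_, ?_⟩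
    · rw [momDeriv_Xv, if_neg]; omega
    · refine (Finset.sum_eq_single m (fun n _ hn => ?_)
      (fun h => absurd (Finset.mem_range.2 (Nat.lt_succ_self m)) h)).trans ?_
      · rw [momDeriv_Xv, if_neg (fun h => hn h.2), Polynomial.monomial_zero_right]
      · rw [momDeriv_Xv]
        refine Eq.trans ?_ (𝔉.momOp_X a b m).symm
        by_cases h : a = b
        · rw [if_pos ⟨h, rfl⟩, if_pos h, Polynomial.X_pow_eq_monomial]
        · rw [if_neg (fun h' => h h'.1), if_neg h, Polynomial.monomial_zero_right]
  · rintro x y ⟨N, h1, h2⟩ ⟨N', h1', h2'⟩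
    refine ⟨max N N', fun n hn => ?_, ?_⟩
    · rw [map_add, h1 n (le_of_max_le_left hn), h1' n (le_of_max_le_right hn), add_zero]
    · rw [map_add, ← h2, ← h2', mono x _ _ (le_max_left N N') h1, mono y _ _ (le_max_right N N') h1',
        ← Finset.sum_add_distrib]
      simp only [map_add]
  · rintro x y ⟨N, h1, h2⟩ ⟨N', h1', h2'⟩
    refine ⟨max N N', fun n hn => ?_, ?_⟩
    · rw [momDeriv_mul, h1 n (le_of_max_le_left hn), h1' n (le_of_max_le_right hn), mul_zero,
        mul_zero, add_zero]
    · rw [Derivation.leibniz, ← h2, ← h2', mono x _ _ (le_max_left N N') h1,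
        mono y _ _ (le_max_right N N') h1', Finset.smul_sum, Finset.smul_sum,
        ← Finset.sum_add_distrib]
      refine Finset.sum_congr rfl fun n _ => ?_
      rw [momDeriv_mul, map_add, Polynomial.smul_monomial, Polynomial.smul_monomial, smul_eq_mul,
        smul_eq_mul]

theorem gBracket_add (a : ι) (F F₂ : GaugedAlg A E U ι) (I : Module.Basis ι ℝ (GroupLieAlgebra 𝓘(ℝ, E) G)) :
    gBracket a (F + F₂) = gBracket a F + gBracket a F₂ := by
  simp only [gBracket_eq_neg_momOp I, map_add, neg_add]

theorem gBracket_mul (a : ι) (F F₂ : GaugedAlg A E U ι) (I : Module.Basis ι ℝ (GroupLieAlgebra 𝓘(ℝ, E) G)) :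
    gBracket a (F * F₂) = Polynomial.C F * gBracket a F₂ + Polynomial.C F₂ * gBracket a F := by
  simp only [gBracket_eq_neg_momOp I, Derivation.leibniz, Polynomial.smul_eq_C_mul]
  ring

theorem gBracket_sum {κ : Type*} (I : Module.Basis ι ℝ (GroupLieAlgebra 𝓘(ℝ, E) G)) (a : ι)
    (s : Finset κ) (F : κ → GaugedAlg A E U ι) :
    gBracket a (∑ k ∈ s, F k) = ∑ k ∈ s, gBracket a (F k) := by
  simp only [gBracket_eq_neg_momOp I, map_sum]
  exact (sum_neg_poly _ _).symm

theorem gBracket_smul (I : Module.Basis ι ℝ (GroupLieAlgebra 𝓘(ℝ, E) G)) (a : ι) (r : ℂ)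
    (F : GaugedAlg A E U ι) : gBracket a (r • F) = r • gBracket a F := by
  simp only [gBracket_eq_neg_momOp I, Derivation.map_smul]
  exact (smul_neg r ((gaugedFields A U I).momOp a F)).symm

theorem gBracket_inA (a : ι) (f : A) (I : Module.Basis ι ℝ (GroupLieAlgebra 𝓘(ℝ, E) G)) :
    gBracket a (inA f : GaugedAlg A E U ι) = 0 := by
  rw [gBracket_eq_neg_momOp I]; exact neg_eq_zero.2 ((gaugedFields A U I).momOp_iA a f)

theorem gBracket_fn (a : ι) (h : SmoothFun E U) (I : Module.Basis ι ℝ (GroupLieAlgebra 𝓘(ℝ, E) G)) :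
    gBracket a (fn h : GaugedAlg A E U ι) = 0 := by
  rw [gBracket_eq_neg_momOp I]; exact neg_eq_zero.2 ((gaugedFields A U I).momOp_iR a h)

theorem gBracket_jv (a b : ι) (n : ℕ) (I : Module.Basis ι ℝ (GroupLieAlgebra 𝓘(ℝ, E) G)) :
    gBracket a (jv b n : GaugedAlg A E U ι) = 0 := by
  rw [gBracket_eq_neg_momOp I]; exact neg_eq_zero.2 ((gaugedFields A U I).momOp_j a b n)

theorem gBracket_X (a b : ι) (I : Module.Basis ι ℝ (GroupLieAlgebra 𝓘(ℝ, E) G)) :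
    gBracket a (Xv b 0 : GaugedAlg A E U ι) = if a = b then -1 else 0 := by
  rw [gBracket_eq_neg_momOp I]
  refine (congrArg Neg.neg ((gaugedFields A U I).momOp_X a b 0)).trans ?_
  split_ifs
  · rw [pow_zero]
  · rw [neg_zero]

theorem gBracket_fieldj (a b : ι) : gBracket a (fieldj I b : GaugedAlg A E U ι) = 0 := by
  rw [fieldj, gBracket_sum I]
  exact Finset.sum_eq_zero fun c _ => by rw [gBracket_smul I, gBracket_jv a c 0 I, smul_zero]

theorem gBracket_W (a b : ι) (I : Module.Basis ι ℝ (GroupLieAlgebra 𝓘(ℝ, E) G)) :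
    gBracket a (fieldW B b : GaugedAlg A E U ι) = 0 := by
  rw [fieldW, gBracket_sum I]
  exact Finset.sum_eq_zero fun c _ => by
    rw [gBracket_mul _ _ _ I, gBracket_jv a c 0 I, gBracket_fn _ _ I, mul_zero, mul_zero, add_zero]

theorem gBracket_wzCurrent (l : ℂ) (a b : ι) :
    gBracket a (wzCurrent I B l b : GaugedAlg A E U ι) = if a = b then -1 else 0 := by
  rw [wzCurrent_apply, gBracket_add _ _ _ I, gBracket_add _ _ _ I, gBracket_smul I,
    gBracket_smul I, gBracket_W _ _ I, gBracket_fieldj, smul_zero, add_zero, add_zero]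
  exact gBracket_X a b I

theorem IsTensorBracket.isDeriv (ht : IsTensorBracket I P Pt) :
    (gaugedFields A U I).IsDeriv P Pt.D :=
  ⟨ht.D_inA, ht.D_fn, ht.D_j, ht.D_X⟩

theorem IsTensorBracket.gBracket_D (ht : IsTensorBracket I P Pt) (a : ι)
    (F : GaugedAlg A E U ι) : gBracket a (Pt.D F) = shift Pt.D (gBracket a F) := by
  rw [gBracket_eq_neg_momOp I, gBracket_eq_neg_momOp I,
    (gaugedFields A U I).momOp_D ht.isDeriv, shift_neg]

/-- The bracket with functions of `g` in terms of the Lie algebra valued bracket `g⁻¹ {g_λ ·}`. -/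
theorem IsTensorBracket.br_fn (ht : IsTensorBracket I P Pt) (h : SmoothFun E U)
    (F : GaugedAlg A E U ι) : Pt.br (fn h) F =
      ∑ e, act Pt.D (gBracket e F) (Polynomial.C (fn (leftDeriv (I e) h))) := by
  have hgen : F ∈ (Set.univ : Set (GaugedAlg A E U ι)) := trivial
  refine ht.generates (fun F => Pt.br (fn h) F =
      ∑ e, act Pt.D (gBracket e F) (Polynomial.C (fn (leftDeriv (I e) h)))) ?_ ?_ ?_ ?_ F
  · rintro x (⟨f, rfl⟩ | ⟨k, rfl⟩ | ⟨a, rfl⟩ | ⟨a, rfl⟩)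
    · rw [ht.br_fn_inA]
      exact (Finset.sum_eq_zero fun e _ => by rw [gBracket_inA _ _ I, act_zero_left]).symm
    · rw [ht.br_fn_fn]
      exact (Finset.sum_eq_zero fun e _ => by rw [gBracket_fn _ _ I, act_zero_left]).symm
    · rw [ht.br_fn_fieldj]
      exact (Finset.sum_eq_zero fun e _ => by rw [gBracket_fieldj, act_zero_left]).symm
    · rw [ht.br_fn_X, Finset.sum_eq_single a]
      · rw [gBracket_X _ _ I, if_pos rfl, act_neg_left, act_one_left]
      · intro b _ hb
        rw [gBracket_X _ _ I, if_neg hb, act_zero_left]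
      · simp
  · intro x y hx hy
    simp only [map_add, hx, hy, gBracket_add _ _ _ I, act_add_left, Finset.sum_add_distrib]
  · intro x y hx hy
    simp only [Pt.br_mul, hx, hy, gBracket_mul _ _ _ I, act_add_left, act_C_mul,
      Finset.sum_add_distrib, Finset.mul_sum]
  · intro x hx
    simp only [Pt.br_D_right, hx, ht.gBracket_D, act_shift, shift_sum]

/-! ### The Dirac bracket -/

theorem IsTensorBracket.dirac_add (Pt : PVA (GaugedAlg A E U ι)) (C : ι → GaugedAlg A E U ι)
    (I : Module.Basis ι ℝ (GroupLieAlgebra 𝓘(ℝ, E) G)) (F F₂ F₃ : GaugedAlg A E U ι) :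
    dirac Pt C F (F₂ + F₃) = dirac Pt C F F₂ + dirac Pt C F F₃ := by
  simp only [dirac, map_add, gBracket_add _ _ _ I, act_add_left, Finset.sum_add_distrib]
  abel

theorem IsTensorBracket.dirac_mul (Pt : PVA (GaugedAlg A E U ι)) (C : ι → GaugedAlg A E U ι)
    (I : Module.Basis ι ℝ (GroupLieAlgebra 𝓘(ℝ, E) G)) (F F₂ F₃ : GaugedAlg A E U ι) :
    dirac Pt C F (F₂ * F₃) =
      Polynomial.C F₂ * dirac Pt C F F₃ + Polynomial.C F₃ * dirac Pt C F F₂ := by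
  simp only [dirac, Pt.br_mul, gBracket_mul _ _ _ I, act_add_left, Finset.sum_add_distrib,
    act_C_mul, mul_add, Finset.mul_sum]
  abel

theorem dirac_skew (Pt : PVA (GaugedAlg A E U ι)) (C : ι → GaugedAlg A E U ι)
    (F F₂ : GaugedAlg A E U ι) : dirac Pt C F₂ F = -adj Pt.D (dirac Pt C F F₂) := by
  exact neg_adj_dirac Pt.D _ _ (Pt.br_skew F F₂) _ _ _ _ _ _ (fun a => Pt.br_skew F (C a))
    (fun a => Pt.br_skew (C a) F₂)

theorem IsTensorBracket.dirac_D (ht : IsTensorBracket I P Pt) (C : ι → GaugedAlg A E U ι)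
    (F F₂ : GaugedAlg A E U ι) : dirac Pt C F (Pt.D F₂) = shift Pt.D (dirac Pt C F F₂) := by
  simp only [dirac, Pt.br_D_right, ht.gBracket_D, act_shift, shift_add, shift_sum]

theorem IsTensorBracket.dirac_fn (ht : IsTensorBracket I P Pt) {C : ι → GaugedAlg A E U ι}
    (hCfn : ∀ e h, Pt.br (C e) (fn h) = Polynomial.C (fn (leftDeriv (I e) h)))
    (F : GaugedAlg A E U ι) (h : SmoothFun E U) : dirac Pt C F (fn h) = 0 := by
  simp only [dirac, gBracket_fn _ _ I, act_zero_left, Finset.sum_const_zero, add_zero, hCfn]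
  rw [Pt.br_skew (fn h) F, ht.br_fn, adj_sum]
  simp only [adj_act, adj_C]
  exact neg_add_cancel (∑ a, act Pt.D (Polynomial.C (fn (leftDeriv (I a) h)))
    (adj Pt.D (gBracket a F)))

end GaugeFixing

section PhysicalObservables

variable {A : Type*} [CommRing A] [Algebra ℂ A]
  {E : Type u} [NormedAddCommGroup E] [NormedSpace ℝ E] [FiniteDimensional ℝ E]
  {G : Type v} [TopologicalSpace G] [T2Space G] [ChartedSpace E G] [Group G] [LieGroup 𝓘(ℝ, E) ∞ G]
  [LieAlgebra.IsSemisimple ℝ (GroupLieAlgebra 𝓘(ℝ, E) G)]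
  {U : TopologicalSpace.Opens G} {ι : Type w} [Fintype ι] [DecidableEq ι]
  {I : Module.Basis ι ℝ (GroupLieAlgebra 𝓘(ℝ, E) G)} {P : PVA A}
  {Pt : PVA (GaugedAlg A E U ι)} {B : ι → ι → SmoothFun E U} {cj : A →+* A}

variable (hU : (1 : G) ∈ U) {K : ι → A} {C : ι → GaugedAlg A E U ι} {l : ℂ}
  (hC : ∀ e, C e = wzCurrent I B l e + inA (K e))

theorem gBracket_constraint (hC : ∀ e, C e = wzCurrent I B l e + inA (K e)) (a b : ι) :
    gBracket a (C b) = if a = b then -1 else 0 := by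
  rw [hC, gBracket_add _ _ _ I, gBracket_wzCurrent, gBracket_inA _ _ I, add_zero]

theorem map_inA_physProj (p : A[X]) :
    (p.map (inA : A →ₐ[ℂ] GaugedAlg A E U ι).toRingHom).map
      (physProj hU P K : GaugedAlg A E U ι →ₐ[ℂ] A).toRingHom = p := by
  rw [Polynomial.map_map]
  have : ((physProj hU P K : GaugedAlg A E U ι →ₐ[ℂ] A).toRingHom.comp
      (inA : A →ₐ[ℂ] GaugedAlg A E U ι).toRingHom) = RingHom.id A :=
    RingHom.ext fun f => physProj_inA hU K f
  rw [this, Polynomial.map_id]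

/-- The Dirac bracket with the constraint vanishes weakly. -/
theorem dirac_constraint {ρ : GaugedAlg A E U ι →ₐ[ℂ] A}
    (hρC : ∀ e, ρ (C e) = 0) (hρD : ∀ F, ρ (Pt.D F) = P.D (ρ F))
    (hg : ∀ a b, gBracket a (C b) = if a = b then -1 else 0)
    (hfc : ∀ e e₂, Pt.br (C e) (C e₂) = Polynomial.C (comp I C ⁅I e, I e₂⁆))
    (F : GaugedAlg A E U ι) (e : ι) : (dirac Pt C F (C e)).map ρ.toRingHom = 0 := by
  have hcomp : ∀ ξ, ρ (comp I C ξ) = 0 := by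
    intro ξ
    refine (map_comp I ρ.toLinearMap C ξ).trans ?_
    simp only [AlgHom.toLinearMap_apply, hρC]
    exact comp_zero_left I ξ
  have h1 : ∑ a, act Pt.D (gBracket a (C e)) (Pt.br F (C a)) = -Pt.br F (C e) := by
    rw [Finset.sum_eq_single e]
    · rw [hg, if_pos rfl, act_neg_left, act_one_left]
    · intro b _ hb; rw [hg, if_neg hb, act_zero_left]
    · simp
  rw [dirac, h1]
  have h2 : Pt.br F (C e) + -Pt.br F (C e) = 0 := add_neg_cancel (Pt.br F (C e))
  rw [h2, zero_add, Polynomial.map_sum]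
  refine Finset.sum_eq_zero fun a _ => ?_
  rw [map_act Pt.D P.D ρ.toRingHom (fun f => hρD f), hfc, Polynomial.map_C]
  have h3 : ρ.toRingHom (comp I C ⁅I a, I e⁆) = 0 := hcomp _
  rw [h3, Polynomial.C_0, act_zero_left]

/-- Modulo the weak equalities, the Dirac bracket is the bracket of the unconstrained model. -/
theorem map_dirac_physProj (ht : IsTensorBracket I P Pt)
    (hC : ∀ e, C e = wzCurrent I B l e + inA (K e))
    (hfc : ∀ e e₂, Pt.br (C e) (C e₂) = Polynomial.C (comp I C ⁅I e, I e₂⁆))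
    (hCfn : ∀ e h, Pt.br (C e) (fn h) = Polynomial.C (fn (leftDeriv (I e) h)))
    (F F₂ : GaugedAlg A E U ι) :
    (dirac Pt C F F₂).map (physProj hU P K : GaugedAlg A E U ι →ₐ[ℂ] A).toRingHom
      = P.br (physProj hU P K F) (physProj hU P K F₂) := by
  set ρ : GaugedAlg A E U ι →ₐ[ℂ] A := physProj hU P K with hρ
  have hρD : ∀ F, ρ (Pt.D F) = P.D (ρ F) := physProj_D hU K ht
  have hρC : ∀ e, ρ (C e) = 0 := physProj_C hU hC
  have hg := gBracket_constraint (A := A) hC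
  let Ω : Set (GaugedAlg A E U ι) :=
    {x | (∃ f, x = inA f) ∨ (∃ h, x = fn h) ∨ (∃ a, x = fieldj I a) ∨ ∃ a, x = C a}
  have hΩ : Generates Pt.D Ω := by
    intro q hq hadd hmul hD
    have hA : ∀ f, q (inA f) := fun f => hq _ (Or.inl ⟨f, rfl⟩)
    have hR : ∀ h, q (fn h) := fun h => hq _ (Or.inr (Or.inl ⟨h, rfl⟩))
    have hj : ∀ a, q (fieldj I a) := fun a => hq _ (Or.inr (Or.inr (Or.inl ⟨a, rfl⟩)))
    have hs : ∀ (r : ℂ) x, q x → q (r • x) := fun r x hx => by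
      rw [smul_eq_inA_mul]; exact hmul _ _ (hA _) hx
    have h0 : q 0 := map_zero (inA : A →ₐ[ℂ] GaugedAlg A E U ι) ▸ hA 0
    have hjv : ∀ a, q (jv a 0) := fun a => by
      rw [jv_eq_sum I]; exact sum_mem_of h0 hadd _ _ fun b _ => hs _ _ (hj b)
    have hW : ∀ a, q (fieldW B a) := fun a =>
      sum_mem_of h0 hadd _ _ fun b _ => hmul _ _ (hR _) (hjv b)
    refine ht.generates q ?_ hadd hmul hD
    rintro x (⟨f, rfl⟩ | ⟨h, rfl⟩ | ⟨a, rfl⟩ | ⟨a, rfl⟩)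
    · exact hA f
    · exact hR h
    · exact hj a
    · have h1 : (Xv a 0 : GaugedAlg A E U ι) = C a + ((-(l / 2)) • fieldW B a
          + ((-(l / 2)) • fieldj I a + inA (-K a))) := by
        rw [hC, wzCurrent_apply, map_neg, neg_smul, neg_smul]
        change fieldX a = _
        abel
      rw [h1]
      exact hadd _ _ (hq _ (Or.inr (Or.inr (Or.inr ⟨a, rfl⟩))))
        (hadd _ _ (hs _ _ (hW a)) (hadd _ _ (hs _ _ (hj a)) (hA _)))
  have hskew : ∀ F F₂, (dirac Pt C F₂ F).map ρ.toRingHom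
      = -adj P.D ((dirac Pt C F F₂).map ρ.toRingHom) := by
    intro F F₂
    rw [dirac_skew, ← map_adj Pt.D P.D ρ.toRingHom (fun f => hρD f)]
    exact Polynomial.map_neg _
  have hsz : ∀ F F₂, (dirac Pt C F F₂).map ρ.toRingHom = P.br (ρ F) (ρ F₂) →
      (dirac Pt C F₂ F).map ρ.toRingHom = P.br (ρ F₂) (ρ F) := by
    intro F F₂ h
    rw [hskew F F₂, h, ← P.br_skew]
  have hbr0 : ∀ f : A, ∀ r : ℂ, P.br f (algebraMap ℂ A r) = 0 := by
    intro f r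
    have h1 : P.br f (1 * 1) = _ := P.br_mul f 1 1
    rw [mul_one, Polynomial.C_1, one_mul] at h1
    rw [Algebra.algebraMap_eq_smul_one, map_smul, left_eq_add.1 h1, smul_zero]
  have hfn : ∀ F h, (dirac Pt C F (fn h)).map ρ.toRingHom = P.br (ρ F) (ρ (fn h)) := by
    intro F h
    rw [ht.dirac_fn hCfn, hρ, physProj_fn, hbr0]
    exact Polynomial.map_zero _
  have hCz : ∀ F a, (dirac Pt C F (C a)).map ρ.toRingHom = P.br (ρ F) (ρ (C a)) := by
    intro F a
    rw [dirac_constraint hρC hρD hg hfc, hρC, map_zero]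
  have hj0 : ∀ F a, Pt.br F (fieldj I a) = 0 → (fun c => gBracket c F) = (fun _ : ι => (0 : (GaugedAlg A E U ι)[X])) →
      (dirac Pt C F (fieldj I a)).map ρ.toRingHom = P.br (ρ F) (ρ (fieldj I a)) := by
    intro F a h1 h2
    rw [hρ, physProj_fieldj, map_zero]
    have h3 : ∀ b, gBracket b F = 0 := fun b => congrFun h2 b
    simp only [dirac, h1, gBracket_fieldj, act_zero_left, h3, adj_zero, act_zero_right,
      Finset.sum_const_zero, add_zero]
    exact Polynomial.map_zero _
  refine bracket_ext hΩ ρ.toRingHom (D' := P.D) (fun F F₂ => (dirac Pt C F F₂).map ρ.toRingHom)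
    (fun F F₂ => P.br (ρ F) (ρ F₂)) ?_ ?_ ?_ ?_ ?_ ?_ ?_ ?_ ?_ F F₂
  · intro f g h
    simp only [IsTensorBracket.dirac_add Pt C I, Polynomial.map_add]
  · intro f g h
    simp only [map_add]
  · intro f g h
    simp only [IsTensorBracket.dirac_mul Pt C I, Polynomial.map_add, Polynomial.map_mul,
      Polynomial.map_C]
  · intro f g h
    simp only [map_mul, P.br_mul]
    rfl
  · intro f g
    simp only [ht.dirac_D]
    exact map_shift Pt.D P.D ρ.toRingHom (fun f => hρD f) _
  · intro f g
    simp only [hρD, P.br_D_right]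
  · intro f g; exact hskew f g
  · intro f g; exact P.br_skew _ _
  · rintro x hx y (⟨g, rfl⟩ | ⟨k, rfl⟩ | ⟨b, rfl⟩ | ⟨b, rfl⟩)
    · rcases hx with ⟨f, rfl⟩ | ⟨h, rfl⟩ | ⟨a, rfl⟩ | ⟨a, rfl⟩
      · simp only [dirac, gBracket_inA _ _ I, act_zero_left, adj_zero, act_zero_right,
          Finset.sum_const_zero, add_zero, ht.br_inA]
        rw [hρ, physProj_inA, physProj_inA]
        exact map_inA_physProj hU _
      · exact hsz _ _ (hfn _ h)
      · exact hsz _ _ (hj0 _ a (ht.br_inA_fieldj g a) (funext fun c => gBracket_inA _ _ I))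
      · exact hsz _ _ (hCz _ a)
    · exact hfn _ k
    · rcases hx with ⟨f, rfl⟩ | ⟨h, rfl⟩ | ⟨a, rfl⟩ | ⟨a, rfl⟩
      · exact hj0 _ b (ht.br_inA_fieldj f b) (funext fun c => gBracket_inA _ _ I)
      · exact hsz _ _ (hfn _ h)
      · exact hj0 _ b (ht.br_fieldj_fieldj a b) (funext fun c => gBracket_fieldj _ _)
      · exact hsz _ _ (hCz _ a)
    · exact hCz _ b

/-- The isomorphism of the unconstrained algebra with the algebra of physical observables. -/
def physEquiv (ht : IsTensorBracket I P Pt) (hC : ∀ e, C e = wzCurrent I B l e + inA (K e)) :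
    A ≃ₐ[ℂ] (GaugedAlg A E U ι ⧸ weakIdeal hU Pt C) :=
  AlgEquiv.ofBijective ((Ideal.Quotient.mkₐ ℂ (weakIdeal hU Pt C)).comp inA) <| by
    constructor
    · rw [injective_iff_map_eq_zero]
      intro f hf
      have h1 : (inA f : GaugedAlg A E U ι) ∈ weakIdeal hU Pt C := Ideal.Quotient.eq_zero_iff_mem.1 hf
      rwa [mem_weakIdeal_iff hU hC ht, physProj_inA] at h1
    · intro x
      obtain ⟨F, rfl⟩ := Ideal.Quotient.mk_surjective x
      exact ⟨physProj hU P K F, (Ideal.Quotient.eq.2 (sub_inA_mem_weakIdeal hU hC ht F)).symm⟩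

theorem mk_eq_physEquiv (ht : IsTensorBracket I P Pt) (F : GaugedAlg A E U ι) :
    Ideal.Quotient.mk (weakIdeal hU Pt C) F = physEquiv hU ht hC (physProj hU P K F) :=
  Ideal.Quotient.eq.2 (sub_inA_mem_weakIdeal hU hC ht F)

/-- The real structure is compatible with the projection on the physical observables. -/
theorem physProj_conj (hcj : P.IsConjugation cj) (hK : ∀ a, cj (K a) = K a)
    (F : GaugedAlg A E U ι) :
    physProj hU P K (gaugedConj cj hcj.smul F) = cj (physProj hU P K F) := by
  refine gauged_induction (q := fun F =>
    physProj hU P K (gaugedConj cj hcj.smul F) = cj (physProj hU P K F)) ?_ ?_ ?_ ?_ ?_ ?_ F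
  · intro f; rw [gaugedConj_inA, physProj_inA, physProj_inA]
  · intro h
    rw [gaugedConj_fn, physProj_fn, Algebra.algebraMap_eq_smul_one, hcj.smul, map_one,
      Complex.conj_ofReal]
  · intro a n; rw [gaugedConj_jv, physProj_jv, map_zero]
  · intro a n
    rw [gaugedConj_Xv, physProj_Xv]
    have : ∀ n, cj (P.D^[n] (-K a)) = P.D^[n] (-K a) := by
      intro n
      induction n with
      | zero => rw [Function.iterate_zero, id, map_neg, hK]
      | succ n ih => rw [Function.iterate_succ_apply', hcj.D, ih]
    exact (this n).symm
  · intro x y hx hy; simp only [map_add, hx, hy]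
  · intro x y hx hy; simp only [map_mul, hx, hy]

end PhysicalObservables

section ScalarResidues

/-- `r` is the residue at `ζ` of the scalar one-form `f(z) dz`. -/
def ResAt (f : ℂ → ℂ) (ζ r : ℂ) : Prop :=
  ∀ᶠ ρ in 𝓝[>] (0 : ℝ), CircleIntegrable f ζ ρ ∧
    (∮ z in C(ζ, ρ), f z) = 2 * Real.pi * Complex.I * r

theorem eventually_sphere {p : ℂ → Prop} {ζ : ℂ} (h : ∀ᶠ z in 𝓝[≠] ζ, p z) :
    ∀ᶠ ρ in 𝓝[>] (0 : ℝ), 0 < ρ ∧ ∀ z ∈ Metric.closedBall ζ ρ, z ≠ ζ → p z := by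
  obtain ⟨ε, hε, hs⟩ := Metric.mem_nhdsWithin_iff.1 h
  filter_upwards [Ioo_mem_nhdsGT hε] with ρ hρ
  exact ⟨hρ.1, fun z hz hne => hs ⟨lt_of_le_of_lt hz hρ.2, hne⟩⟩

theorem ne_of_mem_sphere_pos {ζ z : ℂ} {ρ : ℝ} (hρ : 0 < ρ) (hz : z ∈ Metric.sphere ζ ρ) : z ≠ ζ :=
  Metric.ne_of_mem_sphere hz hρ.ne'

namespace ResAt

variable {f g : ℂ → ℂ} {ζ r s : ℂ}

theorem congr (hf : ResAt f ζ r) (h : ∀ᶠ z in 𝓝[≠] ζ, f z = g z) : ResAt g ζ r := by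
  filter_upwards [hf, eventually_sphere h] with ρ hρ h'
  have h1 : Set.EqOn f g (Metric.sphere ζ ρ) := fun z hz =>
    h'.2 z (Metric.sphere_subset_closedBall hz) (ne_of_mem_sphere_pos h'.1 hz)
  refine ⟨(circleIntegrable_congr (by rwa [abs_of_pos h'.1])).1 hρ.1, ?_⟩
  rw [← hρ.2, circleIntegral.integral_congr h'.1.le h1]

theorem add (hf : ResAt f ζ r) (hg : ResAt g ζ s) : ResAt (fun z => f z + g z) ζ (r + s) := by
  filter_upwards [hf, hg] with ρ h1 h2
  refine ⟨h1.1.add h2.1, ?_⟩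
  rw [circleIntegral.integral_add h1.1 h2.1, h1.2, h2.2]; ring

theorem const_mul (k : ℂ) (hf : ResAt f ζ r) : ResAt (fun z => k * f z) ζ (k * r) := by
  filter_upwards [hf] with ρ h1
  refine ⟨h1.1.const_smul (a := k), ?_⟩
  rw [circleIntegral.integral_const_mul, h1.2]; ring

theorem zero : ResAt (fun _ => 0) ζ 0 := by
  refine Filter.Eventually.of_forall fun ρ => ⟨circleIntegrable_const _ _ _, ?_⟩
  simp [circleIntegral]

theorem sum {κ : Type*} (t : Finset κ) {f : κ → ℂ → ℂ} {r : κ → ℂ}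
    (h : ∀ k ∈ t, ResAt (f k) ζ (r k)) : ResAt (fun z => ∑ k ∈ t, f k z) ζ (∑ k ∈ t, r k) := by
  classical
  induction t using Finset.induction_on with
  | empty => simpa using zero
  | insert a t ha ih =>
    simp only [Finset.sum_insert ha]
    exact (h a (Finset.mem_insert_self _ _)).add
      (ih fun k hk => h k (Finset.mem_insert_of_mem hk))

theorem of_simple_pole {h : ℂ → ℂ} (hh : AnalyticAt ℂ h ζ) :
    ResAt (fun z => (z - ζ)⁻¹ * h z) ζ (h ζ) := by
  have h1 : ∀ᶠ z in 𝓝[≠] ζ, DifferentiableAt ℂ h z :=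
    (hh.eventually_analyticAt.mono fun z hz => hz.differentiableAt).filter_mono nhdsWithin_le_nhds
  filter_upwards [eventually_sphere h1] with ρ hρ
  have hd : DifferentiableOn ℂ h (Metric.closedBall ζ ρ) := by
    intro z hz
    by_cases h2 : z = ζ
    · rw [h2]; exact hh.differentiableAt.differentiableWithinAt
    · exact (hρ.2 z hz h2).differentiableWithinAt
  constructor
  · refine ContinuousOn.circleIntegrable hρ.1.le (ContinuousOn.mul (ContinuousOn.inv₀ ?_ ?_) ?_)
    · fun_prop
    · exact fun z hz => sub_ne_zero.2 (ne_of_mem_sphere_pos hρ.1 hz)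
    · exact hd.continuousOn.mono Metric.sphere_subset_closedBall
  · have := hd.circleIntegral_sub_inv_smul (Metric.mem_ball_self hρ.1)
    simpa only [smul_eq_mul] using this

theorem zpow_of_ne {n : ℤ} (hn : n ≠ -1) : ResAt (fun z => (z - ζ) ^ n) ζ 0 := by
  filter_upwards [self_mem_nhdsWithin] with ρ hρ
  refine ⟨?_, by rw [circleIntegral.integral_sub_zpow_of_ne hn, mul_zero]⟩
  rw [circleIntegrable_sub_zpow_iff]
  refine Or.inr (Or.inr ?_)
  rw [Metric.mem_sphere, dist_self]
  exact (abs_pos.2 (ne_of_gt hρ)).ne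

end ResAt

theorem AnalyticAt.dslope_self {f : ℂ → ℂ} {z : ℂ} (hf : AnalyticAt ℂ f z) :
    AnalyticAt ℂ (dslope f z) z := by
  obtain ⟨p, hp⟩ := hf
  exact ⟨_, hp.has_fpower_series_dslope_fslope⟩

/-- A pole of any order has a residue. -/
theorem exists_resAt_pole {h : ℂ → ℂ} {ζ : ℂ} (hh : AnalyticAt ℂ h ζ) (n : ℕ) :
    ∃ r, ResAt (fun z => (z - ζ) ^ (-(n + 1 : ℤ)) * h z) ζ r := by
  induction n generalizing h with
  | zero =>
    refine ⟨h ζ, (ResAt.of_simple_pole hh).congr (Filter.Eventually.of_forall fun z => ?_)⟩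
    simp
  | succ n ih =>
    obtain ⟨r, hr⟩ := ih (AnalyticAt.dslope_self hh)
    refine ⟨h ζ * 0 + r, (((ResAt.zpow_of_ne (ζ := ζ) (n := -(n + 2 : ℤ)) (by omega)).const_mul
      (h ζ)).add hr).congr ?_⟩
    filter_upwards [self_mem_nhdsWithin] with z hz
    have hz' : z - ζ ≠ 0 := sub_ne_zero.2 hz
    have h1 : (z - ζ) ^ (-(n + 1 : ℤ)) = (z - ζ) ^ (-(n + 2 : ℤ)) * (z - ζ) := by
      rw [← zpow_add_one₀ hz']; congr 1
    have h2 : (z - ζ) * dslope h ζ z = h z - h ζ := by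
      have := sub_smul_dslope h ζ z
      rwa [smul_eq_mul] at this
    have h3 : (-(((n + 1 : ℕ) : ℤ) + 1)) = -(n + 2 : ℤ) := by push_cast; ring
    rw [h1, h3, mul_assoc, h2]
    ring

/-- The residue at a simple zero of the denominator. -/
theorem ResAt.div_simple_zero {g φ : ℂ → ℂ} {ζ : ℂ} (hg : AnalyticAt ℂ g ζ)
    (hφ : AnalyticAt ℂ φ ζ) (h0 : φ ζ = 0) (h1 : deriv φ ζ ≠ 0) :
    ResAt (fun z => (φ z)⁻¹ * g z) ζ ((deriv φ ζ)⁻¹ * g ζ) := by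
  have h2 := AnalyticAt.dslope_self hφ
  have h3 : dslope φ ζ ζ = deriv φ ζ := dslope_same _ _
  have h4 := ResAt.of_simple_pole ((h2.inv (by rwa [h3])).mul hg)
  rw [Pi.mul_apply, Pi.inv_apply, h3] at h4
  refine h4.congr (Filter.Eventually.of_forall fun z => ?_)
  have h5 : (z - ζ) * dslope φ ζ z = φ z := by
    have := sub_smul_dslope φ ζ z
    rwa [smul_eq_mul, h0, sub_zero] at this
  rw [← h5, Pi.mul_apply, Pi.inv_apply, mul_inv, mul_assoc]

section Vector

variable {W : Type*} [AddCommGroup W] [Module ℂ W] {W' : Type*} [AddCommGroup W'] [Module ℂ W']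

/-- `r` is the residue at `ζ` of the vector-valued one-form `F(z) dz`, which is integrable on small
circles. -/
def IsResidueAt (F : ℂ → W) (ζ : ℂ) (r : W) : Prop :=
  ∀ ℓ : Module.Dual ℂ W, ResAt (fun z => ℓ (F z)) ζ (ℓ r)

namespace IsResidueAt

variable {F F' : ℂ → W} {ζ : ℂ} {r r' : W}

theorem hasResidue (h : IsResidueAt F ζ r) : HasResidue F ζ r :=
  fun ℓ => (h ℓ).mono fun _ hρ => hρ.2

theorem map (T : W →ₗ[ℂ] W') (h : IsResidueAt F ζ r) : IsResidueAt (fun z => T (F z)) ζ (T r) :=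
  fun ℓ => h (ℓ ∘ₗ T)

theorem add (h : IsResidueAt F ζ r) (h' : IsResidueAt F' ζ r') :
    IsResidueAt (fun z => F z + F' z) ζ (r + r') := by
  intro ℓ
  simp only [map_add]
  exact (h ℓ).add (h' ℓ)

theorem congr (h : IsResidueAt F ζ r) (hF : ∀ᶠ z in 𝓝[≠] ζ, F z = F' z) : IsResidueAt F' ζ r :=
  fun ℓ => (h ℓ).congr (hF.mono fun _ hz => congrArg ℓ hz)

theorem of_sum {κ : Type*} (t : Finset κ) {g : κ → ℂ → ℂ} {r : κ → ℂ} {v : κ → W}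
    (hg : ∀ k ∈ t, ResAt (g k) ζ (r k)) :
    IsResidueAt (fun z => ∑ k ∈ t, g k z • v k) ζ (∑ k ∈ t, r k • v k) := by
  intro ℓ
  simp only [map_sum, map_smul, smul_eq_mul]
  refine ResAt.sum t fun k hk => ?_
  simp only [mul_comm _ (ℓ (v k))]
  exact (hg k hk).const_mul _

end IsResidueAt

end Vector

end ScalarResidues

section PartialFractions

variable {S : Type*} [Fintype S] [DecidableEq S] {M : ℕ} {ζ : Fin M → ℂ}

theorem eval_div_nodal (hζ : Function.Injective ζ) (N : ℂ[X]) (hN : N.degree < M) {z : ℂ}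
    (hz : ∀ i, z ≠ ζ i) : N.eval z / ∏ i, (z - ζ i) =
      ∑ i, N.eval (ζ i) / ((Polynomial.derivative (Lagrange.nodal Finset.univ ζ)).eval (ζ i)
        * (z - ζ i)) := by
  have h1 := Lagrange.eq_interpolate (s := Finset.univ) (v := ζ) (hζ.injOn) (f := N) (by simpa using hN)
  have h2 : ∏ i, (z - ζ i) ≠ 0 := Finset.prod_ne_zero_iff.2 fun i _ => sub_ne_zero.2 (hz i)
  rw [div_eq_iff h2]
  conv_lhs => rw [h1]
  rw [Lagrange.eval_interpolate_not_at_node _ (fun i _ => hz i), Lagrange.eval_nodal, mul_comm]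
  congr 1
  refine Finset.sum_congr rfl fun i hi => ?_
  rw [Lagrange.nodalWeight_eq_eval_derivative_nodal hi]
  field_simp

section Zeros

variable {ι : Type w} [Fintype ι] {V : Type u} [CommRing V] [Algebra ℂ V] {𝒢 : GaudinData S ι V}
  {linf : ℝ}

theorem eventually_ne_sites {z : ℂ} (hz : ∀ α, z ≠ 𝒢.z α) : ∀ᶠ x in 𝓝 z, ∀ α, x ≠ 𝒢.z α :=
  Filter.eventually_all.2 fun α => isOpen_ne.mem_nhds (hz α)

theorem analyticAt_pole {z z' : ℂ} (h : z ≠ z') (p : ℕ) :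
    AnalyticAt ℂ (fun x => ((x - z') ^ p)⁻¹) z :=
  ((analyticAt_id.sub analyticAt_const).pow p).inv (pow_ne_zero _ (sub_ne_zero.2 h))

theorem analyticAt_twist₀ {z : ℂ} (hz : ∀ α, z ≠ 𝒢.z α) : AnalyticAt ℂ (twist₀ 𝒢) z := by
  have : twist₀ 𝒢 = fun z => ∑ α, ∑ p ∈ Finset.range (𝒢.m α),
      𝒢.lev α p * ((z - 𝒢.z α) ^ (p + 1))⁻¹ := by
    funext z; simp only [twist₀, div_eq_mul_inv]
  rw [this]
  exact Finset.analyticAt_fun_sum _ fun α _ => Finset.analyticAt_fun_sum _ fun p _ =>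
    analyticAt_const.mul (analyticAt_pole (hz α) _)

theorem analyticAt_twist {z : ℂ} (hz : ∀ α, z ≠ 𝒢.z α) : AnalyticAt ℂ (twist linf 𝒢) z :=
  (analyticAt_twist₀ hz).sub analyticAt_const

theorem tendsto_mul_twist (hinj : Function.Injective 𝒢.z) (hm : ∀ α, 0 < 𝒢.m α) (α : S) :
    Filter.Tendsto (fun z => (z - 𝒢.z α) ^ 𝒢.m α * twist linf 𝒢 z) (𝓝[≠] (𝒢.z α))
      (𝓝 (𝒢.lev α (𝒢.m α - 1))) := by
  have h0 : Filter.Tendsto (fun z => (z - 𝒢.z α) ^ 𝒢.m α) (𝓝[≠] (𝒢.z α)) (𝓝 0) := by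
    have : ContinuousAt (fun z => (z - 𝒢.z α) ^ 𝒢.m α) (𝒢.z α) := by fun_prop
    have h := this.tendsto
    rw [sub_self, zero_pow (hm α).ne'] at h
    exact h.mono_left nhdsWithin_le_nhds
  have h1 : ∀ β, Filter.Tendsto (fun z => (z - 𝒢.z α) ^ 𝒢.m α * ∑ p ∈ Finset.range (𝒢.m β),
      𝒢.lev β p / (z - 𝒢.z β) ^ (p + 1)) (𝓝[≠] (𝒢.z α))
      (𝓝 (if β = α then 𝒢.lev α (𝒢.m α - 1) else 0)) := by
    intro β
    split_ifs with hβ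
    · subst hβ
      have h2 : ∀ p ∈ Finset.range (𝒢.m β), Filter.Tendsto
          (fun z => 𝒢.lev β p * (z - 𝒢.z β) ^ (𝒢.m β - 1 - p)) (𝓝[≠] (𝒢.z β))
          (𝓝 (if p = 𝒢.m β - 1 then 𝒢.lev β (𝒢.m β - 1) else 0)) := by
        intro p hp
        rw [Finset.mem_range] at hp
        have : ContinuousAt (fun z => 𝒢.lev β p * (z - 𝒢.z β) ^ (𝒢.m β - 1 - p)) (𝒢.z β) := by
          fun_prop
        have h := this.tendsto
        rw [sub_self] at h
        have h3 : 𝒢.lev β p * 0 ^ (𝒢.m β - 1 - p)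
            = if p = 𝒢.m β - 1 then 𝒢.lev β (𝒢.m β - 1) else 0 := by
          split_ifs with h4
          · rw [h4, Nat.sub_self, pow_zero, mul_one]
          · rw [zero_pow (by omega), mul_zero]
        rw [h3] at h
        exact h.mono_left nhdsWithin_le_nhds
      have h3 := tendsto_finsetSum _ h2
      rw [Finset.sum_ite_eq', if_pos (Finset.mem_range.2 (by have := hm β; omega))] at h3
      refine h3.congr' ?_
      filter_upwards [self_mem_nhdsWithin] with z hz
      have hz' : z - 𝒢.z β ≠ 0 := sub_ne_zero.2 hz
      rw [Finset.mul_sum]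
      refine Finset.sum_congr rfl fun p hp => ?_
      rw [Finset.mem_range] at hp
      have : 𝒢.m β = (𝒢.m β - 1 - p) + (p + 1) := by omega
      conv_rhs => rw [this, pow_add]
      field_simp
    · have : ContinuousAt (fun z => ∑ p ∈ Finset.range (𝒢.m β),
          𝒢.lev β p / (z - 𝒢.z β) ^ (p + 1)) (𝒢.z α) := by
        refine tendsto_finsetSum _ fun p _ => ?_
        refine ContinuousAt.div (by fun_prop) (by fun_prop) (pow_ne_zero _ (sub_ne_zero.2 ?_))
        exact fun h => hβ (hinj h).symm
      have h := h0.mul (this.tendsto.mono_left nhdsWithin_le_nhds)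
      rwa [zero_mul] at h
  have h2 := (tendsto_finsetSum Finset.univ fun β _ => h1 β).sub (h0.mul_const (linf : ℂ))
  rw [Finset.sum_ite_eq' , if_pos (Finset.mem_univ _), zero_mul, sub_zero] at h2
  refine h2.congr fun z => ?_
  rw [twist, twist₀, mul_sub, Finset.mul_sum]

variable (𝒢 linf ζ) in
/-- The `ζ i` are the zeros of the twist function. -/
def IsZeroSet : Prop := ∀ z : ℂ, (∀ α, z ≠ 𝒢.z α) →
  twist linf 𝒢 z = -(linf : ℂ) * (∏ i, (z - ζ i)) / ∏ α, (z - 𝒢.z α) ^ 𝒢.m α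

namespace IsZeroSet

variable (h : IsZeroSet ζ 𝒢 linf)
include h

theorem ne_site (hinj : Function.Injective 𝒢.z) (hm : ∀ α, 0 < 𝒢.m α)
    (htop : ∀ α, 𝒢.lev α (𝒢.m α - 1) ≠ 0) (i : Fin M) (α : S) : ζ i ≠ 𝒢.z α := by
  intro hi
  refine htop α (tendsto_nhds_unique (tendsto_mul_twist (linf := linf) hinj hm α) ?_)
  have h1 : ContinuousAt (fun z => -(linf : ℂ) * (∏ i, (z - ζ i)) /
      ∏ β ∈ Finset.univ.erase α, (z - 𝒢.z β) ^ 𝒢.m β) (𝒢.z α) := by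
    refine ContinuousAt.div (by fun_prop) (by fun_prop) (Finset.prod_ne_zero_iff.2 fun β hβ => ?_)
    refine pow_ne_zero _ (sub_ne_zero.2 fun h' => (Finset.mem_erase.1 hβ).1 (hinj h').symm)
  have h2 := h1.tendsto
  rw [Finset.prod_eq_zero (Finset.mem_univ i) (sub_eq_zero.2 hi.symm), mul_zero, zero_div] at h2
  refine (h2.mono_left nhdsWithin_le_nhds).congr' ?_
  have h3 : ∀ᶠ z in 𝓝[≠] (𝒢.z α), ∀ β, z ≠ 𝒢.z β := by
    refine Filter.eventually_all.2 fun β => ?_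
    by_cases hβ : β = α
    · rw [hβ]; exact self_mem_nhdsWithin
    · exact (isOpen_ne.mem_nhds fun h' => hβ (hinj h').symm : {x | x ≠ 𝒢.z β} ∈ 𝓝 (𝒢.z α)) |>
        fun h => mem_nhdsWithin_of_mem_nhds h
  filter_upwards [h3] with z hz
  rw [h z hz, ← Finset.mul_prod_erase Finset.univ _ (Finset.mem_univ α)]
  have h4 : z - 𝒢.z α ≠ 0 := sub_ne_zero.2 (hz α)
  field_simp

theorem eq_zero_iff (hlinf : linf ≠ 0) {z : ℂ} (hz : ∀ α, z ≠ 𝒢.z α) :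
    twist linf 𝒢 z = 0 ↔ ∃ i, z = ζ i := by
  have h1 : ∏ α, (z - 𝒢.z α) ^ 𝒢.m α ≠ 0 :=
    Finset.prod_ne_zero_iff.2 fun α _ => pow_ne_zero _ (sub_ne_zero.2 (hz α))
  rw [h z hz, div_eq_zero_iff, mul_eq_zero, neg_eq_zero, Complex.ofReal_eq_zero,
    Finset.prod_eq_zero_iff]
  simp [hlinf, h1, sub_eq_zero]

theorem deriv_eq {i : Fin M} (hi : ∀ α, ζ i ≠ 𝒢.z α) :
    deriv (twist linf 𝒢) (ζ i) = -(linf : ℂ) *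
      (Polynomial.derivative (Lagrange.nodal Finset.univ ζ)).eval (ζ i)
        / ∏ α, (ζ i - 𝒢.z α) ^ 𝒢.m α := by
  have h1 : twist linf 𝒢 =ᶠ[𝓝 (ζ i)] fun z => -(linf : ℂ) *
      (Lagrange.nodal Finset.univ ζ).eval z * (∏ α, (z - 𝒢.z α) ^ 𝒢.m α)⁻¹ := by
    filter_upwards [eventually_ne_sites hi] with z hz
    rw [h z hz, Lagrange.eval_nodal, div_eq_mul_inv]
  have h2 : DifferentiableAt ℂ (fun z => (∏ α, (z - 𝒢.z α) ^ 𝒢.m α)⁻¹) (ζ i) := by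
    refine DifferentiableAt.inv ?_ (Finset.prod_ne_zero_iff.2 fun α _ => pow_ne_zero _ (sub_ne_zero.2 (hi α)))
    fun_prop
  have h3 := (((Lagrange.nodal Finset.univ ζ).hasDerivAt (ζ i)).const_mul (-(linf : ℂ))).mul
    h2.hasDerivAt
  have h4 : (Lagrange.nodal Finset.univ ζ).eval (ζ i) = 0 := by
    rw [Lagrange.eval_nodal]; exact Finset.prod_eq_zero (Finset.mem_univ i) (sub_self _)
  rw [h1.deriv_eq]
  refine (h3.deriv).trans ?_
  rw [h4, mul_zero, zero_mul, add_zero, div_eq_mul_inv]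

theorem deriv_ne_zero (hlinf : linf ≠ 0) (hζ : Function.Injective ζ) {i : Fin M}
    (hi : ∀ α, ζ i ≠ 𝒢.z α) : deriv (twist linf 𝒢) (ζ i) ≠ 0 := by
  rw [h.deriv_eq hi]
  refine div_ne_zero (mul_ne_zero (neg_ne_zero.2 (Complex.ofReal_ne_zero.2 hlinf)) ?_)
    (Finset.prod_ne_zero_iff.2 fun α _ => pow_ne_zero _ (sub_ne_zero.2 (hi α)))
  have h1 := Lagrange.nodalWeight_ne_zero (s := Finset.univ) (v := ζ) hζ.injOn (Finset.mem_univ i)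
  rw [Lagrange.nodalWeight_eq_eval_derivative_nodal (Finset.mem_univ i)] at h1
  exact fun h2 => h1 (by rw [h2, inv_zero])

theorem partial_fractions (hlinf : linf ≠ 0) (hζ : Function.Injective ζ)
    (hne : ∀ i α, ζ i ≠ 𝒢.z α) (N : ℂ[X]) (hN : N.degree < M) {z : ℂ} (hz : ∀ α, z ≠ 𝒢.z α)
    (hz' : ∀ i, z ≠ ζ i) :
    (twist linf 𝒢 z)⁻¹ * (N.eval z / ∏ α, (z - 𝒢.z α) ^ 𝒢.m α) =
      ∑ i, (deriv (twist linf 𝒢) (ζ i) * (z - ζ i))⁻¹ *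
        (N.eval (ζ i) / ∏ α, (ζ i - 𝒢.z α) ^ 𝒢.m α) := by
  have hl : (linf : ℂ) ≠ 0 := Complex.ofReal_ne_zero.2 hlinf
  have h1 : ∏ α, (z - 𝒢.z α) ^ 𝒢.m α ≠ 0 :=
    Finset.prod_ne_zero_iff.2 fun α _ => pow_ne_zero _ (sub_ne_zero.2 (hz α))
  have h2 : ∏ i, (z - ζ i) ≠ 0 := Finset.prod_ne_zero_iff.2 fun i _ => sub_ne_zero.2 (hz' i)
  have h3 : (twist linf 𝒢 z)⁻¹ * (N.eval z / ∏ α, (z - 𝒢.z α) ^ 𝒢.m α)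
      = (-(linf : ℂ))⁻¹ * (N.eval z / ∏ i, (z - ζ i)) := by
    rw [h z hz]; field_simp
  rw [h3, eval_div_nodal hζ N hN hz', Finset.mul_sum]
  refine Finset.sum_congr rfl fun i _ => ?_
  have h4 : ∏ α, (ζ i - 𝒢.z α) ^ 𝒢.m α ≠ 0 :=
    Finset.prod_ne_zero_iff.2 fun α _ => pow_ne_zero _ (sub_ne_zero.2 (hne i α))
  rw [h.deriv_eq (hne i)]
  field_simp

theorem partial_fractions_pole (hlinf : linf ≠ 0) (hζ : Function.Injective ζ)
    (hne : ∀ i α, ζ i ≠ 𝒢.z α) (hM : M = ∑ α, 𝒢.m α) {z : ℂ} (hz : ∀ α, z ≠ 𝒢.z α)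
    (hz' : ∀ i, z ≠ ζ i) (α : S) {p : ℕ} (hp : p < 𝒢.m α) :
    (twist linf 𝒢 z)⁻¹ * ((z - 𝒢.z α) ^ (p + 1))⁻¹ =
      ∑ i, (deriv (twist linf 𝒢) (ζ i) * (z - ζ i))⁻¹ * ((ζ i - 𝒢.z α) ^ (p + 1))⁻¹ := by
  set N : ℂ[X] := (Polynomial.X - Polynomial.C (𝒢.z α)) ^ (𝒢.m α - (p + 1)) *
    ∏ β ∈ Finset.univ.erase α, (Polynomial.X - Polynomial.C (𝒢.z β)) ^ 𝒢.m β with hN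
  have hev : ∀ x : ℂ, (∀ α, x ≠ 𝒢.z α) →
      N.eval x / ∏ α, (x - 𝒢.z α) ^ 𝒢.m α = ((x - 𝒢.z α) ^ (p + 1))⁻¹ := by
    intro x hx
    have h1 : ∏ β ∈ Finset.univ.erase α, (x - 𝒢.z β) ^ 𝒢.m β ≠ 0 :=
      Finset.prod_ne_zero_iff.2 fun β _ => pow_ne_zero _ (sub_ne_zero.2 (hx β))
    have h2 := sub_ne_zero.2 (hx α)
    have h3 : (x - 𝒢.z α) ^ 𝒢.m α = (x - 𝒢.z α) ^ (𝒢.m α - (p + 1)) * (x - 𝒢.z α) ^ (p + 1) := by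
      rw [← pow_add]; congr 1; omega
    rw [← Finset.mul_prod_erase Finset.univ _ (Finset.mem_univ α), hN, h3]
    simp only [Polynomial.eval_mul, Polynomial.eval_pow, Polynomial.eval_sub, Polynomial.eval_X,
      Polynomial.eval_C, Polynomial.eval_prod]
    field_simp
  have hdeg : N.degree < M := by
    have h1 : (Polynomial.X - Polynomial.C (𝒢.z α)).Monic := Polynomial.monic_X_sub_C _
    have h2 : ∀ β ∈ Finset.univ.erase α,
        ((Polynomial.X - Polynomial.C (𝒢.z β)) ^ 𝒢.m β).Monic :=
      fun β _ => (Polynomial.monic_X_sub_C _).pow _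
    have h3 : N.Monic := (h1.pow _).mul (Polynomial.monic_prod_of_monic _ _ h2)
    rw [Polynomial.degree_eq_natDegree h3.ne_zero, hN,
      (h1.pow _).natDegree_mul (Polynomial.monic_prod_of_monic _ _ h2), h1.natDegree_pow,
      Polynomial.natDegree_prod_of_monic _ _ h2]
    simp only [(Polynomial.monic_X_sub_C _).natDegree_pow, Polynomial.natDegree_X_sub_C, mul_one]
    rw [hM, ← Finset.add_sum_erase Finset.univ _ (Finset.mem_univ α)]
    exact_mod_cast Nat.add_lt_add_right (by omega) _
  have key := h.partial_fractions hlinf hζ hne N hdeg hz hz'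
  rw [hev z hz] at key
  rw [key]
  exact Finset.sum_congr rfl fun i _ => by rw [hev _ (hne i)]

theorem partial_fractions_inv (hlinf : linf ≠ 0) (hζ : Function.Injective ζ)
    (hne : ∀ i α, ζ i ≠ 𝒢.z α) (hM : M = ∑ α, 𝒢.m α) {z : ℂ} (hz : ∀ α, z ≠ 𝒢.z α)
    (hz' : ∀ i, z ≠ ζ i) :
    (twist linf 𝒢 z)⁻¹ =
      -(linf : ℂ)⁻¹ + ∑ i, (deriv (twist linf 𝒢) (ζ i) * (z - ζ i))⁻¹ := by
  set Q : ℂ[X] := ∏ β, (Polynomial.X - Polynomial.C (𝒢.z β)) ^ 𝒢.m β with hQ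
  have hev : ∀ x, Q.eval x = ∏ α, (x - 𝒢.z α) ^ 𝒢.m α := by
    intro x
    simp only [hQ, Polynomial.eval_pow, Polynomial.eval_sub, Polynomial.eval_X,
      Polynomial.eval_C, Polynomial.eval_prod]
  have h2 : ∀ β ∈ Finset.univ,
      ((Polynomial.X - Polynomial.C (𝒢.z β)) ^ 𝒢.m β).Monic :=
    fun β _ => (Polynomial.monic_X_sub_C _).pow _
  have hQm : Q.Monic := Polynomial.monic_prod_of_monic _ _ h2
  have hQd : Q.degree = M := by
    rw [Polynomial.degree_eq_natDegree hQm.ne_zero, hQ, Polynomial.natDegree_prod_of_monic _ _ h2]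
    simp only [(Polynomial.monic_X_sub_C _).natDegree_pow, Polynomial.natDegree_X_sub_C, mul_one]
    rw [hM]
  have hnd : (Lagrange.nodal Finset.univ ζ).degree = M := by
    rw [Lagrange.degree_nodal, Finset.card_univ, Fintype.card_fin]
  have hdeg : (Q - Lagrange.nodal Finset.univ ζ).degree < M := by
    rw [← hQd]
    exact Polynomial.degree_sub_lt_left (hQd.trans hnd.symm) hQm.ne_zero
      (by rw [hQm.leadingCoeff, Lagrange.nodal_monic.leadingCoeff])
  have key := h.partial_fractions hlinf hζ hne _ hdeg hz hz'
  have h1 : ∏ α, (z - 𝒢.z α) ^ 𝒢.m α ≠ 0 :=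
    Finset.prod_ne_zero_iff.2 fun α _ => pow_ne_zero _ (sub_ne_zero.2 (hz α))
  have h3 : ∏ i, (z - ζ i) ≠ 0 := Finset.prod_ne_zero_iff.2 fun i _ => sub_ne_zero.2 (hz' i)
  have hl : (linf : ℂ) ≠ 0 := Complex.ofReal_ne_zero.2 hlinf
  have h4 : (twist linf 𝒢 z)⁻¹ * ((Q - Lagrange.nodal Finset.univ ζ).eval z /
      ∏ α, (z - 𝒢.z α) ^ 𝒢.m α) = (twist linf 𝒢 z)⁻¹ + (linf : ℂ)⁻¹ := by
    rw [Polynomial.eval_sub, hev, Lagrange.eval_nodal, sub_div, div_self h1, mul_sub, mul_one, h z hz]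
    field_simp
    ring
  have h5 : ∀ i, (Q - Lagrange.nodal Finset.univ ζ).eval (ζ i) /
      ∏ α, (ζ i - 𝒢.z α) ^ 𝒢.m α = 1 := by
    intro i
    have h6 : (Lagrange.nodal Finset.univ ζ).eval (ζ i) = 0 := by
      rw [Lagrange.eval_nodal]; exact Finset.prod_eq_zero (Finset.mem_univ i) (sub_self _)
    rw [Polynomial.eval_sub, hev, h6, sub_zero, div_self]
    exact Finset.prod_ne_zero_iff.2 fun α _ => pow_ne_zero _ (sub_ne_zero.2 (hne i α))
  rw [h4] at key
  simp only [h5, mul_one] at key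
  rw [← key]; ring

/-- Partial fractions for the Lax matrix. -/
theorem gaudinLax_div (hlinf : linf ≠ 0) (hζ : Function.Injective ζ)
    (hne : ∀ i α, ζ i ≠ 𝒢.z α) (hM : M = ∑ α, 𝒢.m α) {z : ℂ} (hz : ∀ α, z ≠ 𝒢.z α)
    (hz' : ∀ i, z ≠ ζ i) (e : ι) :
    (twist linf 𝒢 z)⁻¹ • gaudinLax 𝒢 z e =
      ∑ i, (deriv (twist linf 𝒢) (ζ i) * (z - ζ i))⁻¹ • gaudinLax 𝒢 (ζ i) e := by
  simp only [gaudinLax, Finset.smul_sum, smul_smul]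
  rw [Finset.sum_comm]
  refine Finset.sum_congr rfl fun α _ => ?_
  rw [Finset.sum_comm]
  refine Finset.sum_congr rfl fun p hp => ?_
  rw [h.partial_fractions_pole hlinf hζ hne hM hz hz' α (Finset.mem_range.1 hp), Finset.sum_smul]

end IsZeroSet
end Zeros

end PartialFractions

section MobiusZeros

variable {a b c d : ℝ} {φ : ℂ → ℂ}

theorem mobius_left_inv (hdet : a * d - b * c ≠ 0) {z : ℂ} (h : (c : ℂ) * z + d ≠ 0) :
    (c : ℂ) * mobius a b c d z - a = -((a : ℂ) * d - b * c) / (c * z + d) ∧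
    -((d : ℂ) * mobius a b c d z - b) / ((c : ℂ) * mobius a b c d z - a) = z := by
  have hdet' := ofReal_det_ne_zero hdet
  have h1 : (c : ℂ) * mobius a b c d z - a = -((a : ℂ) * d - b * c) / (c * z + d) := by
    rw [mobius, eq_div_iff h, sub_mul, mul_assoc, div_mul_cancel₀ _ h]; ring
  have h2 : -((d : ℂ) * mobius a b c d z - b) = -(((a : ℂ) * d - b * c) * z) / (c * z + d) := by
    rw [mobius, eq_div_iff h, neg_mul, sub_mul, mul_assoc, div_mul_cancel₀ _ h]; ring
  refine ⟨h1, ?_⟩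
  rw [h1, h2, div_div_div_cancel_right₀ h, neg_div_neg_eq, mul_div_cancel_left₀ _ hdet']

theorem hasDerivAt_mobius_inverse {w : ℂ} (hw : (c : ℂ) * w - a ≠ 0) :
    HasDerivAt (fun w : ℂ => -((d : ℂ) * w - b) / ((c : ℂ) * w - a))
      (((a : ℂ) * d - b * c) / ((c : ℂ) * w - a) ^ 2) w := by
  have h1 : HasDerivAt (fun w : ℂ => -((d : ℂ) * w - b)) (-(d : ℂ)) w := by
    exact ((((hasDerivAt_id' w).const_mul (d : ℂ)).sub_const (b : ℂ)).fun_neg).congr_deriv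
      (by rw [mul_one])
  have h2 : HasDerivAt (fun w : ℂ => (c : ℂ) * w - a) (c : ℂ) w := by
    simpa using ((hasDerivAt_id w).const_mul (c : ℂ)).sub_const (a : ℂ)
  refine (h1.div h2 hw).congr_deriv ?_
  ring

theorem hasDerivAt_mobTwist (hdet : a * d - b * c ≠ 0) {ζ : ℂ} (h : (c : ℂ) * ζ + d ≠ 0)
    (hφ : DifferentiableAt ℂ φ ζ) (h0 : φ ζ = 0) :
    HasDerivAt (mobTwist a b c d φ)
      (((c : ℂ) * ζ + d) ^ 4 / ((a : ℂ) * d - b * c) ^ 2 * deriv φ ζ) (mobius a b c d ζ) := by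
  have hdet' := ofReal_det_ne_zero hdet
  obtain ⟨h1, h2⟩ := mobius_left_inv hdet h
  have h3 : (c : ℂ) * mobius a b c d ζ - a ≠ 0 := by
    rw [h1]; exact div_ne_zero (neg_ne_zero.2 hdet') h
  have h4 : HasDerivAt φ (deriv φ ζ)
      (-((d : ℂ) * mobius a b c d ζ - b) / ((c : ℂ) * mobius a b c d ζ - a)) := by
    rw [h2]; exact hφ.hasDerivAt
  have h5 := HasDerivAt.comp (h₂ := φ)
    (h := fun w : ℂ => -((d : ℂ) * w - b) / ((c : ℂ) * w - a)) (mobius a b c d ζ) h4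
    (hasDerivAt_mobius_inverse h3)
  have h6 : DifferentiableAt ℂ (fun w : ℂ => ((a : ℂ) * d - b * c) / ((c : ℂ) * w - a) ^ 2)
      (mobius a b c d ζ) :=
    DifferentiableAt.div (by fun_prop) (by fun_prop) (pow_ne_zero _ h3)
  refine (h6.hasDerivAt.mul h5).congr_deriv ?_
  simp only [Function.comp_apply]
  rw [h2, h0, mul_zero, zero_add, h1]
  field_simp

theorem analyticAt_mobTwist (hdet : a * d - b * c ≠ 0) {ζ : ℂ} (h : (c : ℂ) * ζ + d ≠ 0)
    (hφ : AnalyticAt ℂ φ ζ) : AnalyticAt ℂ (mobTwist a b c d φ) (mobius a b c d ζ) := by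
  have hdet' := ofReal_det_ne_zero hdet
  obtain ⟨h1, h2⟩ := mobius_left_inv hdet h
  have h3 : (c : ℂ) * mobius a b c d ζ - a ≠ 0 := by
    rw [h1]; exact div_ne_zero (neg_ne_zero.2 hdet') h
  have h4 : AnalyticAt ℂ (fun w : ℂ => (c : ℂ) * w - a) (mobius a b c d ζ) := by fun_prop
  have h5 : AnalyticAt ℂ (fun w : ℂ => -((d : ℂ) * w - b) / ((c : ℂ) * w - a))
      (mobius a b c d ζ) := AnalyticAt.div (by fun_prop) h4 h3
  exact (analyticAt_const.div (h4.pow 2) (pow_ne_zero _ h3)).mul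
    (AnalyticAt.comp_of_eq hφ h5 h2)

/-- The coordinate `z` in terms of the coordinate `u = 1/f(z)` at infinity. -/
def mobiusAtInfty (a b c d : ℝ) (u : ℂ) : ℂ := -((d : ℂ) - b * u) / ((c : ℂ) - a * u)

theorem eventually_mobiusAtInfty_den (hc : c ≠ 0) :
    ∀ᶠ u : ℂ in 𝓝 0, (c : ℂ) - a * u ≠ 0 := by
  have : ContinuousAt (fun u : ℂ => (c : ℂ) - a * u) 0 := by fun_prop
  refine this.eventually_ne ?_
  rw [mul_zero, sub_zero]
  exact Complex.ofReal_ne_zero.2 hc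

theorem analyticAt_mobiusAtInfty (hc : c ≠ 0) : AnalyticAt ℂ (mobiusAtInfty a b c d) 0 := by
  refine AnalyticAt.div (by fun_prop) (by fun_prop) ?_
  rw [mul_zero, sub_zero]
  exact Complex.ofReal_ne_zero.2 hc

theorem mobiusAtInfty_zero : mobiusAtInfty a b c d 0 = -(d : ℂ) / c := by
  rw [mobiusAtInfty, mul_zero, mul_zero, sub_zero, sub_zero]

theorem mobiusAtInfty_sub (hc : c ≠ 0) {u : ℂ} (hu : (c : ℂ) - a * u ≠ 0) :
    mobiusAtInfty a b c d u - -(d : ℂ) / c = -((a : ℂ) * d - b * c) * u / (c * (c - a * u)) := by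
  have hc' : (c : ℂ) ≠ 0 := Complex.ofReal_ne_zero.2 hc
  rw [mobiusAtInfty, div_sub_div _ _ hu hc', div_eq_div_iff (mul_ne_zero hu hc') (mul_ne_zero hc' hu)]
  ring

theorem mobiusAtInfty_den {u : ℂ} (hu : (c : ℂ) - a * u ≠ 0) :
    (c : ℂ) * mobiusAtInfty a b c d u + d = -((a : ℂ) * d - b * c) * u / (c - a * u) := by
  rw [mobiusAtInfty, eq_div_iff hu, add_mul, mul_div_assoc', div_mul_cancel₀ _ hu]
  ring

theorem mobius_mobiusAtInfty (hdet : a * d - b * c ≠ 0) {u : ℂ}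
    (hu : (c : ℂ) - a * u ≠ 0) : mobius a b c d (mobiusAtInfty a b c d u) = u⁻¹ := by
  have hdet' := ofReal_det_ne_zero hdet
  have h1 : (a : ℂ) * mobiusAtInfty a b c d u + b = -((a : ℂ) * d - b * c) / (c - a * u) := by
    rw [mobiusAtInfty, eq_div_iff hu, add_mul, mul_div_assoc', div_mul_cancel₀ _ hu]; ring
  rw [mobius, mobiusAtInfty_den hu, h1, div_div_div_cancel_right₀ hu, neg_mul, neg_div_neg_eq,
    div_mul_eq_div_div, div_self hdet', one_div]

theorem hasDerivAt_mobiusAtInfty (hc : c ≠ 0) : HasDerivAt (mobiusAtInfty a b c d)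
    (-((a : ℂ) * d - b * c) / (c : ℂ) ^ 2) 0 := by
  have hc' : (c : ℂ) ≠ 0 := Complex.ofReal_ne_zero.2 hc
  have h1 : HasDerivAt (fun u : ℂ => -((d : ℂ) - b * u)) (b : ℂ) 0 := by
    exact ((((hasDerivAt_id' (0 : ℂ)).const_mul (b : ℂ)).const_sub (d : ℂ)).fun_neg).congr_deriv
      (by rw [mul_one, neg_neg])
  have h2 : HasDerivAt (fun u : ℂ => (c : ℂ) - a * u) (-(a : ℂ)) 0 := by
    simpa using ((hasDerivAt_id (0 : ℂ)).const_mul (a : ℂ)).const_sub (c : ℂ)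
  refine (h1.div h2 (by simpa using hc')).congr_deriv ?_
  simp only [mul_zero, sub_zero]
  ring

theorem mobTwist_inv (hdet : a * d - b * c ≠ 0) {u : ℂ} (hu0 : u ≠ 0)
    (hu : (c : ℂ) - a * u ≠ 0) :
    mobTwist a b c d φ u⁻¹ = ((a : ℂ) * d - b * c) * u ^ 2 / (c - a * u) ^ 2
      * φ (mobiusAtInfty a b c d u) := by
  have hdet' := ofReal_det_ne_zero hdet
  have h1 : (c : ℂ) * mobiusAtInfty a b c d u + d ≠ 0 := by
    rw [mobiusAtInfty_den hu]
    exact div_ne_zero (mul_ne_zero (neg_ne_zero.2 hdet') hu0) hu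
  have h2 := mobTwist_mobius hdet φ h1
  rw [mobius_mobiusAtInfty hdet hu, mobiusAtInfty_den hu] at h2
  rw [h2]
  congr 1
  field_simp

theorem coe_ne_mobiusSphere {z w : ℂ} : mobiusSphere a b c d z = (w : OnePoint ℂ) ↔
    (c : ℂ) * z + d ≠ 0 ∧ mobius a b c d z = w := by
  rw [mobiusSphere]
  split_ifs with h
  · simp [h]
  · simp [h]

theorem eq_neg_div_of_den (hc : c ≠ 0) {z : ℂ} (h : (c : ℂ) * z + d = 0) : z = -(d : ℂ) / c := by
  rw [eq_div_iff (Complex.ofReal_ne_zero.2 hc)]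
  linear_combination h

theorem isSimpleFormZero_mobiusSphere (hdet : a * d - b * c ≠ 0) (hc : c ≠ 0) {ζ : ℂ}
    (hφ : AnalyticAt ℂ φ ζ) (h0 : φ ζ = 0) (h1 : deriv φ ζ ≠ 0) :
    IsSimpleFormZero (mobTwist a b c d φ) (mobiusSphere a b c d ζ) := by
  have hdet' := ofReal_det_ne_zero hdet
  have hc' : (c : ℂ) ≠ 0 := Complex.ofReal_ne_zero.2 hc
  rw [mobiusSphere]
  split_ifs with h
  · have hz := eq_neg_div_of_den hc h
    refine ⟨((a : ℂ) * d - b * c) ^ 2 / (c : ℂ) ^ 4 * deriv φ ζ, mul_ne_zero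
      (div_ne_zero (pow_ne_zero _ hdet') (pow_ne_zero _ hc')) h1, ?_⟩
    have h2 : HasDerivAt (fun u => φ (mobiusAtInfty a b c d u))
        (deriv φ ζ * (-((a : ℂ) * d - b * c) / (c : ℂ) ^ 2)) 0 := by
      refine HasDerivAt.comp 0 ?_ (hasDerivAt_mobiusAtInfty hc)
      rw [mobiusAtInfty_zero, ← hz]
      exact hφ.differentiableAt.hasDerivAt
    have h3 := hasDerivAt_iff_tendsto_slope.1 h2
    have h4 : Filter.Tendsto (fun u : ℂ => -((a : ℂ) * d - b * c) / ((c : ℂ) - a * u) ^ 2) (𝓝[≠] 0)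
        (𝓝 (-((a : ℂ) * d - b * c) / (c : ℂ) ^ 2)) := by
      have : ContinuousAt (fun u : ℂ => -((a : ℂ) * d - b * c) / ((c : ℂ) - a * u) ^ 2) 0 :=
        ContinuousAt.div (by fun_prop) (by fun_prop) (by simpa using hc')
      have h5 := this.tendsto.mono_left (nhdsWithin_le_nhds (s := {0}ᶜ))
      rwa [mul_zero, sub_zero] at h5
    have h5 := h4.mul h3
    have h6 : -((a : ℂ) * d - b * c) / (c : ℂ) ^ 2 *
        (deriv φ ζ * (-((a : ℂ) * d - b * c) / (c : ℂ) ^ 2))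
          = ((a : ℂ) * d - b * c) ^ 2 / (c : ℂ) ^ 4 * deriv φ ζ := by field_simp
    rw [h6] at h5
    refine h5.congr' ?_
    filter_upwards [self_mem_nhdsWithin,
      (eventually_mobiusAtInfty_den (a := a) hc).filter_mono nhdsWithin_le_nhds] with u hu hu'
    have hu0 : u ≠ 0 := hu
    rw [mobTwist_inv hdet hu hu', slope_def_field, mobiusAtInfty_zero, ← hz, h0, sub_zero,
      sub_zero]
    field_simp
  · refine ⟨?_, ?_⟩
    · rw [mobTwist_mobius hdet φ h, h0, mul_zero]
    · rw [(hasDerivAt_mobTwist hdet h hφ.differentiableAt h0).deriv]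
      exact mul_ne_zero (div_ne_zero (pow_ne_zero _ h) (pow_ne_zero _ hdet')) h1

theorem tendsto_mobTwist_infty (hdet : a * d - b * c ≠ 0) (hc : c ≠ 0)
    (hφ : ContinuousAt φ (-(d : ℂ) / c)) :
    Filter.Tendsto (fun u : ℂ => -(u ^ 2)⁻¹ * mobTwist a b c d φ u⁻¹) (𝓝[≠] 0)
      (𝓝 (-((a : ℂ) * d - b * c) / (c : ℂ) ^ 2 * φ (-(d : ℂ) / c))) := by
  have hc' : (c : ℂ) ≠ 0 := Complex.ofReal_ne_zero.2 hc
  have h1 : ContinuousAt (fun u : ℂ => -((a : ℂ) * d - b * c) / ((c : ℂ) - a * u) ^ 2 *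
      φ (mobiusAtInfty a b c d u)) 0 := by
    refine ContinuousAt.mul (ContinuousAt.div (by fun_prop) (by fun_prop) (by simpa using hc')) ?_
    refine ContinuousAt.comp ?_ (analyticAt_mobiusAtInfty hc).continuousAt
    rwa [mobiusAtInfty_zero]
  have h2 := h1.tendsto.mono_left (nhdsWithin_le_nhds (s := {0}ᶜ))
  rw [mobiusAtInfty_zero, mul_zero, sub_zero] at h2
  refine h2.congr' ?_
  filter_upwards [self_mem_nhdsWithin,
      (eventually_mobiusAtInfty_den (a := a) hc).filter_mono nhdsWithin_le_nhds] with u hu hu'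
  have hu0 : u ≠ 0 := hu
  rw [mobTwist_inv hdet hu hu']
  field_simp

end MobiusZeros

section Pairing

variable {𝔤 : Type v} [LieRing 𝔤] [LieAlgebra ℝ 𝔤] {ι : Type w} [Fintype ι] [DecidableEq ι]
  (I : Module.Basis ι ℝ 𝔤) {V : Type u} [CommRing V] [Algebra ℂ V]

theorem pairing_add_left (F F' F₂ : ι → V) :
    pairing I (F + F') F₂ = pairing I F F₂ + pairing I F' F₂ := by
  simp only [pairing, Pi.add_apply, add_mul, smul_add, Finset.sum_add_distrib]

theorem pairing_smul_left (r : ℂ) (F F₂ : ι → V) :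
    pairing I (r • F) F₂ = r • pairing I F F₂ := by
  simp only [pairing, Pi.smul_apply, smul_mul_assoc, Finset.smul_sum, smul_comm r]

theorem pairing_add_right (F F₂ F₂' : ι → V) :
    pairing I F (F₂ + F₂') = pairing I F F₂ + pairing I F F₂' := by
  simp only [pairing, Pi.add_apply, mul_add, smul_add, Finset.sum_add_distrib]

theorem pairing_smul_right (r : ℂ) (F F₂ : ι → V) :
    pairing I F (r • F₂) = r • pairing I F F₂ := by
  simp only [pairing, Pi.smul_apply, mul_smul_comm, Finset.smul_sum, smul_comm r]

/-- The density `κ(F, F₂)` as a bilinear map. -/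
def pairingL : (ι → V) →ₗ[ℂ] (ι → V) →ₗ[ℂ] V :=
  LinearMap.mk₂ ℂ (pairing I) (pairing_add_left I) (pairing_smul_left I) (pairing_add_right I)
    (pairing_smul_right I)

theorem pairingL_apply (F F₂ : ι → V) : pairingL I F F₂ = pairing I F F₂ := rfl

theorem map_pairing {V' : Type*} [CommRing V'] [Algebra ℂ V'] (σ : V →ₐ[ℂ] V') (F F₂ : ι → V) :
    σ (pairing I F F₂) = pairing I (fun e => σ (F e)) (fun e => σ (F₂ e)) := by
  simp only [pairing, map_sum, map_smul, map_mul]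

variable [LieAlgebra.IsSemisimple ℝ 𝔤]

theorem pairing_comm (F F₂ : ι → V) : pairing I F F₂ = pairing I F₂ F := by
  rw [pairing, Finset.sum_comm, pairing]
  refine Finset.sum_congr rfl fun a _ => Finset.sum_congr rfl fun b _ => ?_
  rw [kinv_symm, mul_comm]

/-- Invariance of the inverse of `κ`. -/
theorem kinv_invariant (ξ : 𝔤) (b c : ι) :
    ∑ a, kinv I a b * I.repr ⁅ξ, I a⁆ c + ∑ a, kinv I c a * I.repr ⁅ξ, I a⁆ b = 0 := by
  set N : Matrix ι ι ℝ := Matrix.of fun a c => I.repr ⁅ξ, I a⁆ c with hN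
  set κ : Matrix ι ι ℝ := Matrix.of (kap I) with hκ
  have hsymm : κ.transpose = κ := by ext a b; exact kap_symm I b a
  have h1 : N * κ + κ * N.transpose = 0 := by
    ext a b
    have h2 : kform ⁅ξ, I a⁆ (I b) + kform (I a) ⁅ξ, I b⁆ = 0 := by
      rw [← kform_lie, ← lie_skew (I a) ξ]
      simp only [kform, map_neg, LinearMap.neg_apply, neg_neg, neg_add_cancel]
    rw [kform_eq_sum I, kform_symm, kform_eq_sum I] at h2
    rw [Matrix.add_apply, Matrix.mul_apply, Matrix.mul_apply, Matrix.zero_apply, ← h2]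
    congr 1
    exact Finset.sum_congr rfl fun c _ => by
      rw [Matrix.transpose_apply, mul_comm, hκ, Matrix.of_apply, hN, Matrix.of_apply, kap_symm]
  have hu : IsUnit κ.det := isUnit_kap_det I
  have h3 : κ⁻¹ * N + N.transpose * κ⁻¹ = 0 := by
    have h4 := congrArg (fun T => κ⁻¹ * T * κ⁻¹) h1
    simp only [mul_add, add_mul, mul_zero, zero_mul] at h4
    rw [← mul_assoc, mul_assoc (κ⁻¹ * N), Matrix.mul_nonsing_inv _ hu, mul_one, ← mul_assoc κ⁻¹ κ,
      Matrix.nonsing_inv_mul _ hu, one_mul] at h4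
    exact h4
  have h5 := congrFun (congrFun h3 b) c
  rw [Matrix.add_apply, Matrix.mul_apply, Matrix.mul_apply, Matrix.zero_apply] at h5
  rw [← h5]
  congr 1
  · exact Finset.sum_congr rfl fun a _ => by rw [kinv_symm]; rfl
  · exact Finset.sum_congr rfl fun a _ => by rw [kinv_symm, mul_comm]; rfl

theorem pairing_invariant (ξ : 𝔤) (F F₂ : ι → V) :
    pairing I (fun a => comp I F ⁅ξ, I a⁆) F₂ + pairing I F (fun a => comp I F₂ ⁅ξ, I a⁆) = 0 := by
  have h1 : pairing I (fun a => comp I F ⁅ξ, I a⁆) F₂ = ∑ c, ∑ b,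
      ((∑ a, kinv I a b * I.repr ⁅ξ, I a⁆ c : ℝ) : ℂ) • (F c * F₂ b) := by
    simp only [pairing, comp, Finset.sum_mul, Finset.smul_sum, smul_mul_assoc, smul_smul,
      Complex.ofReal_sum, Complex.ofReal_mul, Finset.sum_smul]
    rw [Finset.sum_comm]
    conv_rhs => rw [Finset.sum_comm]
    refine Finset.sum_congr rfl fun b _ => ?_
    rw [Finset.sum_comm]
  have h2 : pairing I F (fun a => comp I F₂ ⁅ξ, I a⁆) = ∑ c, ∑ b,
      ((∑ a, kinv I c a * I.repr ⁅ξ, I a⁆ b : ℝ) : ℂ) • (F c * F₂ b) := by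
    simp only [pairing, comp, Finset.mul_sum, Finset.smul_sum, mul_smul_comm, smul_smul,
      Complex.ofReal_sum, Complex.ofReal_mul, Finset.sum_smul]
    exact Finset.sum_congr rfl fun c _ => Finset.sum_comm
  rw [h1, h2, ← Finset.sum_add_distrib]
  refine Finset.sum_eq_zero fun c _ => ?_
  rw [← Finset.sum_add_distrib]
  refine Finset.sum_eq_zero fun b _ => ?_
  rw [← add_smul, ← Complex.ofReal_add, kinv_invariant, Complex.ofReal_zero, zero_smul]

theorem pairing_kap_left (e : ι) (F : ι → V) :
    pairing I (fun b => algebraMap ℂ V ((kap I e b : ℝ) : ℂ)) F = F e := by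
  rw [← sum_kap_kinv_smul I F e, pairing]
  refine Finset.sum_congr rfl fun a _ => ?_
  rw [Finset.smul_sum]
  refine Finset.sum_congr rfl fun b _ => ?_
  rw [← Algebra.smul_def, smul_comm]

end Pairing

section Equivariance

variable {𝔤 : Type v} [LieRing 𝔤] [LieAlgebra ℝ 𝔤] {ι : Type w} [Fintype ι] [DecidableEq ι]
  {I : Module.Basis ι ℝ 𝔤} {V : Type u} [CommRing V] [Algebra ℂ V] {P : PVA V} {K : ι → V}

variable (I P K) in
/-- The field `F` transforms under the symmetry of moment map density `K` as a current of
level `y`. -/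
def IsEquivariant (F : ι → V) (y : ℂ) : Prop :=
  ∀ e b, P.br (K e) (F b) = Polynomial.C (comp I F ⁅I e, I b⁆)
    + Polynomial.C (algebraMap ℂ V (y * (kap I e b : ℝ))) * Polynomial.X

namespace IsEquivariant

variable {F F₂ : ι → V} {y y₂ : ℂ}

theorem add (h : IsEquivariant I P K F y) (h₂ : IsEquivariant I P K F₂ y₂) :
    IsEquivariant I P K (F + F₂) (y + y₂) := by
  intro e b
  rw [Pi.add_apply, map_add, h e b, h₂ e b, comp_add_left, add_mul, map_add, map_add, map_add]
  ring

theorem smul (r : ℂ) (h : IsEquivariant I P K F y) : IsEquivariant I P K (r • F) (r * y) := by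
  intro e b
  rw [Pi.smul_apply, map_smul, h e b, comp_smul_left, smul_add, mul_assoc,
    map_mul (algebraMap ℂ V) r, ← Algebra.smul_def, ← Polynomial.smul_C, ← Polynomial.smul_C,
    smul_mul_assoc]

theorem zero : IsEquivariant I P K (0 : ι → V) 0 := by
  intro e b
  rw [Pi.zero_apply, map_zero, comp_zero_left, zero_mul, map_zero, map_zero, Polynomial.C_0,
    zero_mul, add_zero]

theorem sum {κ : Type*} (s : Finset κ) {F : κ → ι → V} {y : κ → ℂ}
    (h : ∀ k ∈ s, IsEquivariant I P K (F k) (y k)) :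
    IsEquivariant I P K (∑ k ∈ s, F k) (∑ k ∈ s, y k) := by
  classical
  induction s using Finset.induction_on with
  | empty => simpa using zero
  | insert a s ha ih =>
    rw [Finset.sum_insert ha, Finset.sum_insert ha]
    exact (h a (Finset.mem_insert_self _ _)).add
      (ih fun k hk => h k (Finset.mem_insert_of_mem hk))

variable [LieAlgebra.IsSemisimple ℝ 𝔤]

theorem br_pairing (h : IsEquivariant I P K F y) (h₂ : IsEquivariant I P K F₂ y₂) (e : ι) :
    P.br (K e) (pairing I F F₂) = Polynomial.C (y • F₂ e + y₂ • F e) * Polynomial.X := by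
  have h1 : P.br (K e) (pairing I F F₂) =
      Polynomial.C (pairing I (fun b => comp I F ⁅I e, I b⁆) F₂
        + pairing I F (fun b => comp I F₂ ⁅I e, I b⁆))
      + Polynomial.C (pairing I (fun b => algebraMap ℂ V (y * (kap I e b : ℝ))) F₂
        + pairing I F (fun b => algebraMap ℂ V (y₂ * (kap I e b : ℝ)))) * Polynomial.X := by
    simp only [pairing, map_sum, map_smul, P.br_mul, h e _, h₂ e _, ← Finset.sum_add_distrib,
      Finset.sum_mul]
    refine Finset.sum_congr rfl fun a _ => Finset.sum_congr rfl fun b _ => ?_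
    rw [← smul_add, ← smul_add, ← Polynomial.smul_C, ← Polynomial.smul_C, smul_mul_assoc,
      ← smul_add]
    congr 1
    simp only [map_add, map_mul]
    ring
  have h2 : ∀ (x : ℂ) (F : ι → V), pairing I (fun b => algebraMap ℂ V (x * (kap I e b : ℝ))) F
      = x • F e := by
    intro x F
    rw [← pairing_kap_left I e F, ← pairing_smul_left]
    congr 1
    funext b
    rw [Pi.smul_apply, map_mul, Algebra.smul_def]
  rw [h1, pairing_invariant, map_zero, zero_add, pairing_comm I F, h2, h2]

end IsEquivariant

theorem IsRealisation.isEquivariant_gaudinLax {S : Type*} [Fintype S] [DecidableEq S]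
    {cj : V →+* V} {𝒢 : GaudinData S ι V} (h𝒢 : IsRealisation I P cj 𝒢) (z : ℂ) :
    IsEquivariant I P (sumZeroModes 𝒢) (gaudinLax 𝒢 z) (twist₀ 𝒢 z) := by
  have h1 : gaudinLax 𝒢 z = ∑ α, ∑ p ∈ Finset.range (𝒢.m α),
      ((z - 𝒢.z α) ^ (p + 1))⁻¹ • 𝒢.J α p := by
    funext e
    simp only [gaudinLax, Finset.sum_apply, Pi.smul_apply]
  have h2 : twist₀ 𝒢 z = ∑ α, ∑ p ∈ Finset.range (𝒢.m α),
      ((z - 𝒢.z α) ^ (p + 1))⁻¹ * 𝒢.lev α p := by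
    simp only [twist₀, div_eq_mul_inv, mul_comm]
  rw [h1, h2]
  exact IsEquivariant.sum _ fun α _ => IsEquivariant.sum _ fun p hp => IsEquivariant.smul _
    fun e b => h𝒢.br_sumZeroModes_J α (Finset.mem_range.1 hp) e b

end Equivariance

section QuadraticResidues

variable {𝔤 : Type v} [LieRing 𝔤] [LieAlgebra ℝ 𝔤] {ι : Type w} [Fintype ι] [DecidableEq ι]
  {I : Module.Basis ι ℝ 𝔤} {V : Type u} [CommRing V] [Algebra ℂ V]

/-- The residue of `-κ(F(z), F(z)) / 2φ(z)` at a simple zero of `φ`. -/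
theorem isResidueAt_pairing {κ : Type*} (t : Finset κ) {r : κ → ℂ → ℂ} {v : κ → ι → V}
    {F : ℂ → ι → V} {φ : ℂ → ℂ} {ζ : ℂ} (hr : ∀ k ∈ t, AnalyticAt ℂ (r k) ζ)
    (hF : ∀ᶠ z in 𝓝 ζ, F z = ∑ k ∈ t, r k z • v k)
    (hφ : AnalyticAt ℂ φ ζ) (h0 : φ ζ = 0) (h1 : deriv φ ζ ≠ 0) :
    IsResidueAt (fun z => (-(2 * φ z)⁻¹) • pairing I (F z) (F z)) ζ
      ((-(2 * deriv φ ζ)⁻¹) • pairing I (F ζ) (F ζ)) := by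
  have hexp : ∀ z, F z = ∑ k ∈ t, r k z • v k → ∀ s : ℂ, (-(2 * s)⁻¹) • pairing I (F z) (F z) =
      ∑ x ∈ t ×ˢ t, (-(1 / 2 : ℂ) * (s⁻¹ * (r x.1 z * r x.2 z))) • pairing I (v x.1) (v x.2) := by
    intro z hz s
    rw [hz, ← pairingL_apply, LinearMap.map_sum₂, Finset.sum_product, Finset.smul_sum]
    refine Finset.sum_congr rfl fun k _ => ?_
    rw [LinearMap.map_smul₂, map_sum, Finset.smul_sum, Finset.smul_sum]
    refine Finset.sum_congr rfl fun k' _ => ?_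
    rw [map_smul, smul_smul, smul_smul, pairingL_apply]
    congr 1
    rw [mul_inv]; ring
  rw [hexp ζ hF.self_of_nhds]
  refine (IsResidueAt.of_sum _ (g := fun x z => -(1 / 2 : ℂ) * ((φ z)⁻¹ * (r x.1 z * r x.2 z)))
    (fun x hx => ?_)).congr ?_
  · rw [Finset.mem_product] at hx
    exact (ResAt.div_simple_zero ((hr _ hx.1).mul (hr _ hx.2)) hφ h0 h1).const_mul _
  · exact (hF.filter_mono nhdsWithin_le_nhds).mono fun z hz => (hexp z hz (φ z)).symm

theorem gaudinLax_eq_sum {S : Type*} [Fintype S] (𝒢 : GaudinData S ι V) (z : ℂ) :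
    gaudinLax 𝒢 z = ∑ x ∈ Finset.univ.sigma (fun α => Finset.range (𝒢.m α)),
      ((z - 𝒢.z x.1) ^ (x.2 + 1))⁻¹ • 𝒢.J x.1 x.2 := by
  rw [Finset.sum_sigma]
  funext e
  simp only [gaudinLax, Finset.sum_apply, Pi.smul_apply]

theorem hasResidue_quadQ {S : Type*} [Fintype S] {P : PVA V} {𝒢 : GaudinData S ι V} {φ : ℂ → ℂ}
    {ζ : ℂ} (hζ : ∀ α, ζ ≠ 𝒢.z α) (hφ : AnalyticAt ℂ φ ζ) (h0 : φ ζ = 0) (h1 : deriv φ ζ ≠ 0) :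
    HasResidue (quadQ I P φ 𝒢) ζ
      (P.int ((-(2 * deriv φ ζ)⁻¹) • pairing I (gaudinLax 𝒢 ζ) (gaudinLax 𝒢 ζ))) := by
  have h2 := (isResidueAt_pairing (I := I) (Finset.univ.sigma (fun α => Finset.range (𝒢.m α)))
    (r := fun x z => ((z - 𝒢.z x.1) ^ (x.2 + 1))⁻¹) (F := gaudinLax 𝒢)
    (fun x _ => analyticAt_pole (hζ x.1) _)
    (Filter.Eventually.of_forall fun z => gaudinLax_eq_sum 𝒢 z) hφ h0 h1).map P.int
  have h3 : quadQ I P φ 𝒢 = fun z => P.int ((-(2 * φ z)⁻¹) • pairing I (gaudinLax 𝒢 z) (gaudinLax 𝒢 z)) := by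
    funext z; rw [quadQ, map_smul]
  rw [h3]; exact h2.hasResidue

end QuadraticResidues

section ResidueAtInfinity

variable {𝔤 : Type v} [LieRing 𝔤] [LieAlgebra ℝ 𝔤] {ι : Type w} [Fintype ι] [DecidableEq ι]
  {V : Type u} [CommRing V] [Algebra ℂ V] {a b c d : ℝ} {M : ℕ}

open Classical in
/-- The field whose pairing with the constraint relates the quadratic charge attached to the zero
`ζ k` in the gauged model to the one in the original model. -/
def gaugeVec (c d : ℝ) (φ : ℂ → ℂ) (ζ : Fin M → ℂ) (F : ℂ → ι → V) (v : ι → V) (k : Fin M) :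
    ι → V :=
  if (c : ℂ) * ζ k + d = 0 then
    v + ∑ i ∈ Finset.univ.erase k, (deriv φ (ζ i) * (ζ k - ζ i))⁻¹ • F (ζ i)
  else ((c : ℂ) / (c * ζ k + d) * (deriv φ (ζ k))⁻¹) • F (ζ k)

variable (I : Module.Basis ι ℝ 𝔤)

/-- The density `-κ(F, F) / 2y + κ(L, C) + r κ(C, C)`. -/
def chargeDensity (y : ℂ) (F L C : ι → V) (r : ℂ) : V :=
  (-(2 * y)⁻¹) • pairing I F F + pairing I L C + r • pairing I C C

variable [LieAlgebra.IsSemisimple ℝ 𝔤]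

theorem pairing_sub_smul (s k : ℂ) (F C : ι → V) :
    (-(2 * s)⁻¹) • pairing I (F - k • C) (F - k • C) =
      (-(2 * s)⁻¹) • pairing I F F + pairing I ((k * s⁻¹) • F) C
        + (-(1 / 2 : ℂ) * (k ^ 2 * s⁻¹)) • pairing I C C := by
  have h1 : F - k • C = F + (-k) • C := by rw [neg_smul, sub_eq_add_neg]
  rw [h1, pairing_add_left, pairing_add_right, pairing_add_right, pairing_smul_left,
    pairing_smul_right, pairing_smul_left, pairing_smul_right, pairing_smul_left,
    pairing_comm I C F]
  simp only [smul_add, smul_smul, mul_inv]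
  rw [add_assoc, add_assoc, ← add_assoc (_ • pairing I F C), ← add_smul]
  congr 2
  · congr 1; ring
  · congr 1; ring

/-- The residue at infinity of the quadratic charge of the gauged model. -/
theorem exists_isResidueAt_infty (hdet : a * d - b * c ≠ 0) (hc : c ≠ 0) {ζ : Fin M → ℂ}
    (hζ : Function.Injective ζ) {φ : ℂ → ℂ} {k : Fin M} (hk : (c : ℂ) * ζ k + d = 0)
    (hφ : AnalyticAt ℂ φ (ζ k)) (h0 : φ (ζ k) = 0) (h1 : deriv φ (ζ k) ≠ 0)
    {κ : Type*} (t : Finset κ) {r : κ → ℂ → ℂ} {w : κ → ι → V} {F : ℂ → ι → V}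
    (hr : ∀ x ∈ t, AnalyticAt ℂ (r x) (ζ k)) (hF : ∀ z, F z = ∑ x ∈ t, r x z • w x) (v C : ι → V)
    (hpf : ∀ᶠ z in 𝓝[≠] (ζ k), (φ z)⁻¹ • F z =
      v + ∑ i, (deriv φ (ζ i) * (z - ζ i))⁻¹ • F (ζ i)) :
    ∃ R : ℂ, IsResidueAt (fun u =>
      (-(2 * (-(φ (mobiusAtInfty a b c d u) * ((c : ℂ) - a * u) ^ 2 / ((a : ℂ) * d - b * c))))⁻¹) •
        pairing I (F (mobiusAtInfty a b c d u)
          - ((c : ℂ) / (c * mobiusAtInfty a b c d u + d)) • C)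
          (F (mobiusAtInfty a b c d u) - ((c : ℂ) / (c * mobiusAtInfty a b c d u + d)) • C)) 0
      (chargeDensity I (deriv φ (ζ k)) (F (ζ k)) (gaugeVec c d φ ζ F v k) C R) := by
  have hdet' := ofReal_det_ne_zero hdet
  have hc' : (c : ℂ) ≠ 0 := Complex.ofReal_ne_zero.2 hc
  set Δ := (a : ℂ) * d - b * c with hΔ
  set T := mobiusAtInfty a b c d with hT
  have hT0 : T 0 = ζ k := by rw [hT, mobiusAtInfty_zero, eq_neg_div_of_den hc hk]
  have hTden : ∀ u : ℂ, (c : ℂ) - a * u ≠ 0 → (c : ℂ) * T u + d = -Δ * u / (c - a * u) :=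
    fun u hu => mobiusAtInfty_den hu
  have hTa : AnalyticAt ℂ T 0 := analyticAt_mobiusAtInfty hc
  set ψ : ℂ → ℂ := fun u => -(φ (T u) * ((c : ℂ) - a * u) ^ 2 / Δ) with hψ
  have hψa : AnalyticAt ℂ ψ 0 :=
    (((AnalyticAt.comp_of_eq hφ hTa hT0).mul (by fun_prop)).div_const).neg
  have hψ0 : ψ 0 = 0 := by simp only [hψ]; rw [hT0, h0]; simp
  have hψ' : deriv ψ 0 = deriv φ (ζ k) := by
    have h2 : HasDerivAt (fun u => φ (T u)) (deriv φ (ζ k) * (-Δ / (c : ℂ) ^ 2)) 0 := by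
      refine HasDerivAt.comp 0 ?_ (hasDerivAt_mobiusAtInfty hc)
      have := hφ.differentiableAt.hasDerivAt
      rwa [← hT0] at this ⊢
    have h3 : DifferentiableAt ℂ (fun u : ℂ => ((c : ℂ) - a * u) ^ 2) 0 := by fun_prop
    have h4 := ((h2.mul h3.hasDerivAt).div_const Δ).neg
    refine h4.deriv.trans ?_
    simp only [hT0, h0, mul_zero, sub_zero, zero_mul, add_zero]
    field_simp
  have hTsub : ∀ᶠ u in 𝓝[≠] (0 : ℂ), u ≠ 0 ∧ (c : ℂ) - a * u ≠ 0 ∧ T u ≠ ζ k ∧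
      T u - ζ k = -Δ * u / (c * (c - a * u)) := by
    filter_upwards [self_mem_nhdsWithin,
      (eventually_mobiusAtInfty_den (a := a) hc).filter_mono nhdsWithin_le_nhds] with u hu hu'
    have hu0 : u ≠ 0 := hu
    have h2 : T u - ζ k = -Δ * u / (c * (c - a * u)) := by
      rw [eq_neg_div_of_den hc hk]; exact mobiusAtInfty_sub hc hu'
    refine ⟨hu0, hu', fun h => ?_, h2⟩
    rw [h, sub_self, eq_comm, div_eq_zero_iff] at h2
    exact h2.elim (mul_ne_zero (neg_ne_zero.2 hdet') hu0) (mul_ne_zero hc' hu')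
  have hTt : Filter.Tendsto T (𝓝[≠] 0) (𝓝[≠] (ζ k)) := by
    refine tendsto_nhdsWithin_iff.2 ⟨?_, hTsub.mono fun u hu => hu.2.2.1⟩
    rw [← hT0]
    exact hTa.continuousAt.tendsto.mono_left nhdsWithin_le_nhds
  -- the three contributions
  have hcu : AnalyticAt ℂ (fun u : ℂ => (c : ℂ) / ((c : ℂ) - a * u)) 0 :=
    AnalyticAt.div (by fun_prop) (by fun_prop) (by simpa using hc')
  have p1 := isResidueAt_pairing (I := I) t (r := fun x u => r x (T u)) (v := w)
    (F := fun u => F (T u)) (φ := ψ) (ζ := 0)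
    (fun x hx => AnalyticAt.comp_of_eq (hr x hx) hTa hT0)
    (Filter.Eventually.of_forall fun u => hF (T u)) hψa hψ0 (by rwa [hψ'])
  rw [hψ', hT0] at p1
  have p2 : IsResidueAt (fun u => pairing I (((c : ℂ) / (c * T u + d) * (ψ u)⁻¹) • F (T u)) C) 0
      (pairing I (gaugeVec c d φ ζ F v k) C) := by
    have q1 := IsResidueAt.of_sum (ζ := 0) (Finset.univ : Finset (Option (Fin M)))
      (g := fun o u => o.elim ((u - 0)⁻¹ * ((c : ℂ) / (c - a * u)))
        fun i => ((u - 0)⁻¹ * ((c : ℂ) / (c - a * u))) * (deriv φ (ζ i) * (T u - ζ i))⁻¹)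
      (r := fun o => o.elim 1 fun i => if i = k then 0 else (deriv φ (ζ i) * (ζ k - ζ i))⁻¹)
      (v := fun o => o.elim v fun i => F (ζ i)) (by
        rintro (_ | i) _
        · have := ResAt.of_simple_pole hcu
          rwa [mul_zero, sub_zero, div_self hc'] at this
        · change ResAt _ 0 (if i = k then 0 else (deriv φ (ζ i) * (ζ k - ζ i))⁻¹)
          split_ifs with hi
          · subst hi
            have h2 := (ResAt.zpow_of_ne (ζ := 0) (n := -2) (by norm_num)).const_mul
              (-(c : ℂ) ^ 2 / (Δ * deriv φ (ζ i)))
            rw [mul_zero] at h2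
            refine h2.congr (hTsub.mono fun u hu => ?_)
            change _ = ((u - 0)⁻¹ * ((c : ℂ) / (c - a * u))) * (deriv φ (ζ i) * (T u - ζ i))⁻¹
            rw [hu.2.2.2, sub_zero, zpow_neg]
            have h3 := hu.1
            have h4 := hu.2.1
            have h5 : u ^ (2 : ℤ) = u ^ 2 := by norm_cast
            rw [h5]
            generalize (c : ℂ) - a * u = x at h4 ⊢
            field_simp
          · have h2 : AnalyticAt ℂ (fun u => (c : ℂ) / (c - a * u) *
                (deriv φ (ζ i) * (T u - ζ i))⁻¹) 0 := by
              by_cases h3 : deriv φ (ζ i) = 0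
              · simp only [h3, zero_mul, inv_zero, mul_zero]; exact analyticAt_const
              · refine hcu.mul ((analyticAt_const.mul (hTa.sub analyticAt_const)).inv ?_)
                exact mul_ne_zero h3 (sub_ne_zero.2 fun h => hi (hζ (hT0 ▸ h)).symm)
            have h3 := ResAt.of_simple_pole h2
            rw [mul_zero, sub_zero, div_self hc', one_mul, hT0] at h3
            exact h3.congr (Filter.Eventually.of_forall fun u => (mul_assoc _ _ _).symm))
    have q2 := q1.map ((pairingL I).flip C)
    have h2 : ∑ o : Option (Fin M), (o.elim (1 : ℂ) fun i => if i = k then 0 else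
        (deriv φ (ζ i) * (ζ k - ζ i))⁻¹) • (o.elim v fun i => F (ζ i))
        = gaugeVec c d φ ζ F v k := by
      rw [Fintype.sum_option, gaugeVec, if_pos hk]
      simp only [Option.elim, one_smul]
      congr 1
      rw [← Finset.add_sum_erase _ _ (Finset.mem_univ k), if_pos rfl, zero_smul, zero_add]
      exact Finset.sum_congr rfl fun i hi => by rw [if_neg (Finset.ne_of_mem_erase hi)]
    rw [h2] at q2
    refine q2.congr ?_
    filter_upwards [hTsub, hTt.eventually hpf] with u hu hu'
    change pairing I _ C = pairing I _ C
    congr 1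
    rw [Fintype.sum_option]
    have h3 : (c : ℂ) / (c * T u + d) * (ψ u)⁻¹ =
        ((u - 0)⁻¹ * ((c : ℂ) / (c - a * u))) * (φ (T u))⁻¹ := by
      rw [hTden u hu.2.1]
      simp only [hψ]
      have h4 := hu.1
      have h5 := hu.2.1
      by_cases h6 : φ (T u) = 0
      · rw [h6]; simp
      · generalize (c : ℂ) - a * u = x at h5 ⊢
        rw [sub_zero]
        field_simp
    rw [h3, mul_smul, hu', smul_add, Finset.smul_sum]
    simp only [Option.elim, smul_smul]
  obtain ⟨R, p3⟩ : ∃ R, ResAt (fun u => -(1 / 2 : ℂ) * (((c : ℂ) / (c * T u + d)) ^ 2 * (ψ u)⁻¹))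
      0 R := by
    have h2 := AnalyticAt.dslope_self hψa
    have h3 : dslope ψ 0 0 ≠ 0 := by rwa [dslope_same, hψ']
    have h4 : AnalyticAt ℂ (fun u => -(1 / 2 : ℂ) * ((c : ℂ) ^ 2 * (c - a * u) ^ 2 / Δ ^ 2 *
        (dslope ψ 0 u)⁻¹)) 0 :=
      analyticAt_const.mul (AnalyticAt.mul (by fun_prop) (h2.inv h3))
    obtain ⟨R, hR⟩ := exists_resAt_pole h4 2
    refine ⟨R, hR.congr (hTsub.mono fun u hu => ?_)⟩
    have h5 : u * dslope ψ 0 u = ψ u := by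
      have := sub_smul_dslope ψ 0 u
      rwa [smul_eq_mul, sub_zero, hψ0, sub_zero] at this
    rw [hTden u hu.2.1, ← h5, sub_zero, zpow_neg]
    have h6 : u ^ ((2 : ℕ) + 1 : ℤ) = u ^ 3 := by norm_cast
    have h7 := hu.1
    have h8 := hu.2.1
    rw [h6, mul_inv]
    field_simp
  refine ⟨R, ?_⟩
  have p4 := IsResidueAt.of_sum ({()} : Finset Unit) (ζ := 0) (v := fun _ => pairing I C C)
    (fun _ _ => p3)
  simp only [Finset.sum_singleton] at p4
  refine ((p1.add p2).add p4).congr (Filter.Eventually.of_forall fun u => ?_)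
  exact (pairing_sub_smul I (ψ u) ((c : ℂ) / (c * T u + d)) (F (T u)) C).symm

end ResidueAtInfinity

theorem quadQ_eq_of_gaudinLax {𝔤 : Type*} [LieRing 𝔤] [LieAlgebra ℝ 𝔤] {ι : Type*} [Fintype ι]
    [DecidableEq ι] {I : Module.Basis ι ℝ 𝔤} {V : Type*} [CommRing V] [Algebra ℂ V] {P : PVA V}
    {S : Type*} [Fintype S] {𝒢 : GaudinData S ι V} {φ : ℂ → ℂ} {z k : ℂ} {F : ι → V}
    (h : gaudinLax 𝒢 z = k • F) :
    quadQ I P φ 𝒢 z = P.int ((-(2 * φ z)⁻¹ * k ^ 2) • pairing I F F) := by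
  rw [quadQ, h, pairing_smul_left, pairing_smul_right, ← map_smul, smul_smul, smul_smul, pow_two,
    mul_assoc]

/-- The residues of the quadratic charges of a Möbius-transformed model. -/
theorem exists_hasSphereResidue {𝔤 : Type*} [LieRing 𝔤] [LieAlgebra ℝ 𝔤]
    [LieAlgebra.IsSemisimple ℝ 𝔤] {ι : Type*} [Fintype ι]
    [DecidableEq ι] {I : Module.Basis ι ℝ 𝔤} {V : Type*} [CommRing V] [Algebra ℂ V] {Pt : PVA V}
    {A : Type*} [CommRing A] [Algebra ℂ A] {S S' : Type*} [Fintype S] [DecidableEq S] [Fintype S']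
    {𝒢 : GaudinData S ι A} {linf a b c d : ℝ} (hdet : a * d - b * c ≠ 0) (hc : c ≠ 0)
    {M : ℕ} {ζ : Fin M → ℂ} (h : IsZeroSet ζ 𝒢 linf) (hlinf : linf ≠ 0)
    (hζ : Function.Injective ζ) (hne : ∀ i α, ζ i ≠ 𝒢.z α)
    {𝒢t : GaudinData S' ι V} {F : ℂ → ι → V} {v C : ι → V}
    (hlax : ∀ z, (∀ α, z ≠ 𝒢.z α) → (c : ℂ) * z + d ≠ 0 → gaudinLax 𝒢t (mobius a b c d z) =
      (((c : ℂ) * z + d) ^ 2 / ((a : ℂ) * d - b * c)) • (F z - ((c : ℂ) / (c * z + d)) • C))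
    (hpf : ∀ z, (∀ α, z ≠ 𝒢.z α) → (∀ i, z ≠ ζ i) → (twist linf 𝒢 z)⁻¹ • F z =
      v + ∑ i, (deriv (twist linf 𝒢) (ζ i) * (z - ζ i))⁻¹ • F (ζ i)) (i : Fin M)
    {κ : Type*} (t : Finset κ) {r : κ → ℂ → ℂ} {w : κ → ι → V}
    (hr : ∀ x ∈ t, AnalyticAt ℂ (r x) (ζ i)) (hF : ∀ z, F z = ∑ x ∈ t, r x z • w x)
    (hsite : (c : ℂ) * ζ i + d ≠ 0 → ∀ α, mobius a b c d (ζ i) ≠ 𝒢t.z α) :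
    ∃ R : ℂ, HasSphereResidue (quadQ I Pt (mobTwist a b c d (twist linf 𝒢)) 𝒢t)
      (mobiusSphere a b c d (ζ i))
      (Pt.int (chargeDensity I (deriv (twist linf 𝒢) (ζ i)) (F (ζ i))
        (gaugeVec c d (twist linf 𝒢) ζ F v i) C R)) := by
  have hdet' := ofReal_det_ne_zero hdet
  have hφ : AnalyticAt ℂ (twist linf 𝒢) (ζ i) := analyticAt_twist (hne i)
  have h0 : twist linf 𝒢 (ζ i) = 0 := (h.eq_zero_iff hlinf (hne i)).2 ⟨i, rfl⟩
  have h1 := h.deriv_ne_zero hlinf hζ (hne i)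
  rw [mobiusSphere]
  split_ifs with hi
  · have hpf' : ∀ᶠ z in 𝓝[≠] (ζ i), (twist linf 𝒢 z)⁻¹ • F z =
        v + ∑ i, (deriv (twist linf 𝒢) (ζ i) * (z - ζ i))⁻¹ • F (ζ i) := by
      have h2 : ∀ᶠ z in 𝓝[≠] (ζ i), ∀ k, z ≠ ζ k := by
        refine Filter.eventually_all.2 fun k => ?_
        by_cases hk : k = i
        · rw [hk]; exact self_mem_nhdsWithin
        · exact (isOpen_ne.eventually_mem fun h' => hk (hζ h').symm).filter_mono nhdsWithin_le_nhds
      filter_upwards [h2, (eventually_ne_sites (hne i)).filter_mono nhdsWithin_le_nhds] with z hz hz'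
      exact hpf z hz' hz
    obtain ⟨R, hR⟩ := exists_isResidueAt_infty (a := a) (b := b) I hdet hc hζ hi hφ h0 h1
      t hr hF v C hpf'
    refine ⟨R, ((hR.map Pt.int).congr ?_).hasResidue⟩
    have hT : ∀ᶠ u in 𝓝[≠] (0 : ℂ), ∀ α, mobiusAtInfty a b c d u ≠ 𝒢.z α := by
      have h2 := (analyticAt_mobiusAtInfty (a := a) (b := b) (d := d) hc).continuousAt.tendsto
      rw [mobiusAtInfty_zero, ← eq_neg_div_of_den hc hi] at h2
      exact (h2.eventually (eventually_ne_sites (hne i))).filter_mono nhdsWithin_le_nhds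
    filter_upwards [self_mem_nhdsWithin, hT,
      (eventually_mobiusAtInfty_den (a := a) hc).filter_mono nhdsWithin_le_nhds] with u hu hz hu'
    have hu0 : u ≠ 0 := hu
    have hden := mobiusAtInfty_den (b := b) (d := d) hu'
    have h3 : (c : ℂ) * mobiusAtInfty a b c d u + d ≠ 0 := by
      rw [hden]; exact div_ne_zero (mul_ne_zero (neg_ne_zero.2 hdet') hu0) hu'
    have h4 := hlax _ hz h3
    rw [mobius_mobiusAtInfty hdet hu'] at h4
    rw [quadQ_eq_of_gaudinLax h4, ← map_smul, smul_smul, mobTwist_inv hdet hu0 hu', hden]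
    refine congrArg Pt.int (congrArg (· • _) ?_)
    generalize (c : ℂ) - a * u = x at hu' ⊢
    generalize twist linf 𝒢 (mobiusAtInfty a b c d u) = y
    by_cases hy : y = 0
    · rw [hy]; simp
    · field_simp
  · refine ⟨-(1 / 2 : ℂ) * (((c : ℂ) / (c * ζ i + d)) ^ 2 * (deriv (twist linf 𝒢) (ζ i))⁻¹), ?_⟩
    have hd := hasDerivAt_mobTwist hdet hi hφ.differentiableAt h0
    have h2 := hasResidue_quadQ (I := I) (P := Pt) (𝒢 := 𝒢t)
      (φ := mobTwist a b c d (twist linf 𝒢)) (hsite hi) (analyticAt_mobTwist hdet hi hφ)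
      (by rw [mobTwist_mobius hdet _ hi, h0, mul_zero])
      (by rw [hd.deriv]; exact mul_ne_zero (div_ne_zero (pow_ne_zero _ hi) (pow_ne_zero _ hdet')) h1)
    refine Eq.mp ?_ h2
    change HasResidue _ _ _ = HasResidue _ _ _
    congr 2
    have h4 := hlax _ (hne i) hi
    rw [h4, pairing_smul_left, pairing_smul_right, smul_smul, smul_smul, chargeDensity,
      gaugeVec, if_neg hi, ← pairing_sub_smul, hd.deriv]
    refine congrArg (· • _) ?_
    generalize deriv (twist linf 𝒢) (ζ i) = y at h1 ⊢
    generalize (a : ℂ) * d - b * c = Δ at hdet' ⊢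
    field_simp

section GaugedCharges

variable {A : Type*} [CommRing A] [Algebra ℂ A]
  {E : Type u} [NormedAddCommGroup E] [NormedSpace ℝ E] [FiniteDimensional ℝ E]
  {G : Type v} [TopologicalSpace G] [ChartedSpace E G] [Group G] [LieGroup 𝓘(ℝ, E) ∞ G]
  [LieAlgebra.IsSemisimple ℝ (GroupLieAlgebra 𝓘(ℝ, E) G)]
  {U : TopologicalSpace.Opens G} {ι : Type w} [Fintype ι] [DecidableEq ι]
  {I : Module.Basis ι ℝ (GroupLieAlgebra 𝓘(ℝ, E) G)} {P : PVA A}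
  {Pt : PVA (GaugedAlg A E U ι)} {B : ι → ι → SmoothFun E U} {cj : A →+* A}
  {S : Type*} [Fintype S] [DecidableEq S] {𝒢 : GaudinData S ι A} {linf : ℝ} {a b c d : ℝ}

variable (U I linf 𝒢) in
/-- The part of the Gaudin Lax matrix of the gauged model which does not involve the constraint,
as a one-form in the coordinate of the original model. -/
def laxOne (z : ℂ) : ι → GaugedAlg A E U ι :=
  fun e => inA (gaudinLax 𝒢 z e) - (linf : ℂ) • fieldj I e

theorem laxOne_eq_sum (z : ℂ) : laxOne U I 𝒢 linf z =
    ∑ x ∈ Finset.insertNone (Finset.univ.sigma fun α => Finset.range (𝒢.m α)),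
      (x.elim 1 fun y : (Σ _ : S, ℕ) => ((z - 𝒢.z y.1) ^ (y.2 + 1))⁻¹) •
        (x.elim (-(linf : ℂ) • fieldj I) fun y e => inA (𝒢.J y.1 y.2 e) :
          ι → GaugedAlg A E U ι) := by
  rw [Finset.sum_insertNone]
  funext e
  rw [laxOne, gaudinLax_eq_sum]
  simp only [Option.elim, one_smul, Pi.add_apply, Finset.sum_apply, Pi.smul_apply, map_sum,
    map_smul, neg_smul]
  rw [sub_eq_add_neg, add_comm]
  rfl

theorem mobius_ne_site (hdet : a * d - b * c ≠ 0) (hc : c ≠ 0)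
    (hsites : ∀ α, (c : ℂ) * 𝒢.z α + d ≠ 0) {z : ℂ} (hz : ∀ α, z ≠ 𝒢.z α)
    (h : (c : ℂ) * z + d ≠ 0) (α : Option S) : mobius a b c d z ≠
      (gaugedData I B a b c d linf 𝒢 : GaudinData _ _ (GaugedAlg A E U ι)).z α := by
  have hdet' := ofReal_det_ne_zero hdet
  rcases α with _ | α
  · intro h2
    change mobius a b c d z = (a : ℂ) / c at h2
    have h3 := mobius_sub_pole (a := a) (b := b) hc h
    rw [h2, sub_self, eq_comm, div_eq_zero_iff] at h3
    exact h3.elim (neg_ne_zero.2 hdet') (mul_ne_zero (Complex.ofReal_ne_zero.2 hc) h)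
  · intro h2
    change mobius a b c d z = mobius a b c d (𝒢.z α) at h2
    have h3 := mobius_sub_mobius (a := a) (b := b) h (hsites α)
    rw [h2, sub_self, eq_comm, div_eq_zero_iff] at h3
    exact h3.elim (mul_ne_zero hdet' (sub_ne_zero.2 (hz α))) (mul_ne_zero h (hsites α))

theorem exists_laxOne_expansion {ζ : ℂ} (hne : ∀ α, ζ ≠ 𝒢.z α) :
    ∃ (t : Finset (Option (Σ _ : S, ℕ))) (r : Option (Σ _ : S, ℕ) → ℂ → ℂ)
      (w : Option (Σ _ : S, ℕ) → ι → GaugedAlg A E U ι), (∀ x ∈ t, AnalyticAt ℂ (r x) ζ) ∧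
      ∀ z, laxOne U I 𝒢 linf z = ∑ x ∈ t, r x z • w x := by
  refine ⟨_, fun x z => x.elim 1 fun y => ((z - 𝒢.z y.1) ^ (y.2 + 1))⁻¹, _, ?_,
    fun z => laxOne_eq_sum z⟩
  rintro (_ | x) _
  · exact analyticAt_const
  · exact analyticAt_pole (hne x.1) _

theorem laxOne_div {M : ℕ} {ζ : Fin M → ℂ} (h : IsZeroSet ζ 𝒢 linf) (hlinf : linf ≠ 0)
    (hζ : Function.Injective ζ) (hne : ∀ i α, ζ i ≠ 𝒢.z α) (hM : M = ∑ α, 𝒢.m α) {z : ℂ}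
    (hz : ∀ α, z ≠ 𝒢.z α) (hz' : ∀ i, z ≠ ζ i) :
    (twist linf 𝒢 z)⁻¹ • laxOne U I 𝒢 linf z =
      (fieldj I : ι → GaugedAlg A E U ι) +
        ∑ i, (deriv (twist linf 𝒢) (ζ i) * (z - ζ i))⁻¹ • laxOne U I 𝒢 linf (ζ i) := by
  have hl : (linf : ℂ) ≠ 0 := Complex.ofReal_ne_zero.2 hlinf
  funext e
  simp only [Pi.smul_apply, Pi.add_apply, Finset.sum_apply, laxOne, smul_sub,
    Finset.sum_sub_distrib]
  rw [← map_smul, h.gaudinLax_div hlinf hζ hne hM hz hz', map_sum]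
  simp only [map_smul, smul_smul]
  rw [← Finset.sum_smul, ← Finset.sum_mul, h.partial_fractions_inv hlinf hζ hne hM hz hz', add_mul,
    add_smul, neg_mul, inv_mul_cancel₀ hl, neg_smul, one_smul]
  abel

theorem gaudinLax_gaugedData_eq (hdet : a * d - b * c ≠ 0) (hc : c ≠ 0)
    (hsites : ∀ α, (c : ℂ) * 𝒢.z α + d ≠ 0) (hm : ∀ α, 0 < 𝒢.m α)
    {z : ℂ} (hz : ∀ α, z ≠ 𝒢.z α) (h : (c : ℂ) * z + d ≠ 0) :
    gaudinLax (gaugedData I B a b c d linf 𝒢 : GaudinData _ _ (GaugedAlg A E U ι))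
        (mobius a b c d z)
      = (((c : ℂ) * z + d) ^ 2 / ((a : ℂ) * d - b * c)) • (laxOne U I 𝒢 linf z -
          ((c : ℂ) / (c * z + d)) •
            sumZeroModes (gaugedData I B a b c d linf 𝒢 : GaudinData _ _ (GaugedAlg A E U ι))) := by
  have hdet' := ofReal_det_ne_zero hdet
  funext e
  rw [Pi.smul_apply, Pi.sub_apply, Pi.smul_apply, laxOne,
    ← gaudinLax_gaugedData hdet hc hsites hm hz h, smul_smul]
  have : ((c : ℂ) * z + d) ^ 2 / ((a : ℂ) * d - b * c) *
      (((a : ℂ) * d - b * c) / ((c : ℂ) * z + d) ^ 2) = 1 := by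
    rw [div_mul_div_comm, mul_comm, div_self (mul_ne_zero hdet' (pow_ne_zero _ h))]
  rw [this, one_smul]

variable {K : ι → A} {C : ι → GaugedAlg A E U ι} {l : ℂ}

theorem isEquivariant_fieldj (ht : IsTensorBracket I P Pt)
    (hC : ∀ e, C e = wzCurrent I B l e + inA (K e)) :
    IsEquivariant I Pt C (fieldj I) 1 := by
  intro e b
  rw [hC, map_add, LinearMap.add_apply, ht.br_wzCurrent_fieldj, ht.br_inA_fieldj, add_zero, one_mul]

theorem isEquivariant_inA (ht : IsTensorBracket I P Pt)
    (hC : ∀ e, C e = wzCurrent I B l e + inA (K e)) {F : ι → A} {y : ℂ}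
    (hF : IsEquivariant I P K F y) : IsEquivariant I Pt C (fun e => inA (F e)) y := by
  intro e b
  have h1 : Pt.br (wzCurrent I B l e) (inA (F b)) = 0 := ht.swap_zero (ht.br_inA_wzCurrent _ _ _)
  rw [hC, map_add, LinearMap.add_apply, h1, zero_add, ht.br_inA, hF e b, Polynomial.map_add,
    Polynomial.map_mul, Polynomial.map_C, Polynomial.map_C, Polynomial.map_X]
  congr 2
  exact map_comp I (inA : A →ₐ[ℂ] GaugedAlg A E U ι).toLinearMap F _

theorem isEquivariant_laxOne (ht : IsTensorBracket I P Pt) (h𝒢 : IsRealisation I P cj 𝒢)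
    (hC : ∀ e, C e = wzCurrent I B l e + inA (sumZeroModes 𝒢 e)) (z : ℂ) :
    IsEquivariant I Pt C (laxOne U I 𝒢 linf z) (twist linf 𝒢 z) := by
  have h1 := (isEquivariant_inA ht hC (h𝒢.isEquivariant_gaudinLax z)).add
    ((isEquivariant_fieldj ht hC).smul (-(linf : ℂ)))
  rw [mul_one, ← sub_eq_add_neg] at h1
  refine Eq.mp ?_ h1
  congr 1
  funext e
  rw [Pi.add_apply, Pi.smul_apply, neg_smul, ← sub_eq_add_neg, laxOne]

theorem physProj_laxOne (hU : (1 : G) ∈ U) (K : ι → A) (z : ℂ) (e : ι) :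
    physProj hU P K (laxOne U I 𝒢 linf z e) = gaudinLax 𝒢 z e := by
  rw [laxOne, map_sub, map_smul, physProj_fieldj, smul_zero, sub_zero, physProj_inA]

theorem gBracket_laxOne (z : ℂ) (x e : ι) : gBracket x (laxOne U I 𝒢 linf z e) = 0 := by
  have : laxOne U I 𝒢 linf z e = inA (gaudinLax 𝒢 z e) + (-(linf : ℂ)) • fieldj I e := by
    rw [neg_smul, ← sub_eq_add_neg, laxOne]
  rw [this, gBracket_add _ _ _ I, gBracket_inA _ _ I, gBracket_smul I, gBracket_fieldj, smul_zero,
    add_zero]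

end GaugedCharges

section Functionals

variable {V : Type u} [CommRing V] [Algebra ℂ V] {V' : Type v} [CommRing V'] [Algebra ℂ V']
  {P : PVA V} {P' : PVA V'}

theorem PVA.flow_int (f g : V) : P.flow (P.int f) g = (P.br f g).coeff 0 := rfl

theorem PVA.int_eq_iff {x y : V} : P.int x = P.int y ↔ ∃ t, P.D t = x - y := by
  rw [PVA.int, Submodule.mkQ_apply, Submodule.mkQ_apply, Submodule.Quotient.eq]
  rfl

theorem PVA.int_map_congr (σ : V →ₗ[ℂ] V') (hσ : ∀ x, σ (P.D x) = P'.D (σ x)) {x y : V}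
    (h : P.int x = P.int y) : P'.int (σ x) = P'.int (σ y) := by
  obtain ⟨t, ht⟩ := PVA.int_eq_iff.1 h
  exact PVA.int_eq_iff.2 ⟨σ t, by rw [← hσ, ht, map_sub]⟩

theorem PVA.flow_D (H : P.Fun) (x : V) : P.flow H (P.D x) = P.D (P.flow H x) := by
  obtain ⟨f, rfl⟩ := Submodule.mkQ_surjective _ H
  change (P.br f (P.D x)).coeff 0 = P.D ((P.br f x).coeff 0)
  rw [P.br_D_right, shift_coeff_zero]

theorem PVA.flow_mul (H : P.Fun) (x y : V) :
    P.flow H (x * y) = x * P.flow H y + y * P.flow H x := by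
  obtain ⟨f, rfl⟩ := Submodule.mkQ_surjective _ H
  change (P.br f (x * y)).coeff 0 = x * (P.br f y).coeff 0 + y * (P.br f x).coeff 0
  rw [P.br_mul, Polynomial.coeff_add, Polynomial.coeff_C_mul, Polynomial.coeff_C_mul]

theorem PVA.int_flow_eq_zero {H : P.Fun} {x y : V} (h : P.int x = P.int y)
    (hy : P.flow H y = 0) : P.int (P.flow H x) = 0 := by
  rw [PVA.int_map_congr (P' := P) (P.flow H) (P.flow_D H) h, hy, map_zero]

theorem PVA.br_coeff_zero_of_skew {f g v : V} (h : P.br f g = Polynomial.C v * Polynomial.X) :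
    (P.br g f).coeff 0 = P.D v := by
  rw [P.br_skew f g, h, adj_mul_X, neg_neg, shift_coeff_zero, adj_C, Polynomial.coeff_C_zero]

variable {D : Derivation ℂ V V}

theorem act_coeff_zero_congr (p : V[X]) {q q' : V[X]} (h : q.coeff 0 = q'.coeff 0) :
    (act D p q).coeff 0 = (act D p q').coeff 0 := by
  rw [act_coeff_zero, act_coeff_zero, h]

theorem act_coeff_zero_eq_zero (p : V[X]) {q : V[X]} (h : q.coeff 0 = 0) :
    (act D p q).coeff 0 = 0 := by
  rw [act_coeff_zero_congr p (q' := 0) (by rw [h, Polynomial.coeff_zero]), act_zero_right,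
    Polynomial.coeff_zero]

end Functionals

section Reduction

variable {𝔤 : Type*} [LieRing 𝔤] [LieAlgebra ℝ 𝔤] {ι : Type w} [Fintype ι] [DecidableEq ι]
  {I : Module.Basis ι ℝ 𝔤} {V : Type u} [CommRing V] [Algebra ℂ V]
  {V' : Type v} [CommRing V'] [Algebra ℂ V'] {P : PVA V} {P' : PVA V'}
  {ρ : V →ₐ[ℂ] V'} {C : ι → V} {γ : ι → V → V[X]}

theorem totalFlow_eq (h : V) (μ : ι → V) (O : V) :
    totalFlow I P C (P.int h) μ O = (P.br h O).coeff 0 +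
      ∑ a, (act P.D (P.br (C a) O)
        (Polynomial.C (∑ b, ((kinv I a b : ℝ) : ℂ) • μ b))).coeff 0 := by
  rw [totalFlow, PVA.flow_int]
  congr 1
  refine Finset.sum_congr rfl fun a _ => ?_
  rw [map_sum, act_sum_right, Polynomial.finsetSum_coeff]
  refine Finset.sum_congr rfl fun b _ => ?_
  rw [← Polynomial.smul_C, act_smul_right, Polynomial.coeff_smul]

/-- The flow of a Hamiltonian preserving the constraint `C`, with a Lagrange multiplier, compared
to the flow of the reduced Hamiltonian for the Dirac bracket. -/
theorem map_totalFlow (hρD : ∀ F, ρ (P.D F) = P'.D (ρ F))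
    (hdir : ∀ F F₂, (P.br F F₂ + ∑ a, act P.D (γ a F₂) (P.br F (C a))
      + ∑ a, act P.D (P.br (C a) F₂) (adj P.D (γ a F))).map ρ.toRingHom = P'.br (ρ F) (ρ F₂))
    {h : V} (hh : ∀ a, ρ ((P.br h (C a)).coeff 0) = 0) (μ : ι → V) (O : V) :
    ρ (totalFlow I P C (P.int h) μ O) = P'.flow (P'.int (ρ h)) (ρ O) +
      ∑ a, (act P'.D ((P.br (C a) O).map ρ.toRingHom)
        (Polynomial.C (∑ b, ((kinv I a b : ℝ) : ℂ) • ρ (μ b)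
          - ρ ((adj P.D (γ a h)).coeff 0)))).coeff 0 := by
  have hm : ∀ p : V[X], ρ (p.coeff 0) = (p.map ρ.toRingHom).coeff 0 :=
    fun p => (Polynomial.coeff_map ρ.toRingHom 0).symm
  have hact : ∀ p q : V[X], (act P.D p q).map ρ.toRingHom =
      act P'.D (p.map ρ.toRingHom) (q.map ρ.toRingHom) :=
    fun p q => map_act P.D P'.D ρ.toRingHom hρD p q
  rw [totalFlow_eq, PVA.flow_int, ← hdir, Polynomial.map_add, Polynomial.map_add,
    Polynomial.coeff_add, Polynomial.coeff_add, map_add, map_sum, Polynomial.map_sum,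
    Polynomial.map_sum, Polynomial.finsetSum_coeff, Polynomial.finsetSum_coeff, ← hm]
  have h1 : ∑ a, ((act P.D (γ a O) (P.br h (C a))).map ρ.toRingHom).coeff 0 = 0 :=
    Finset.sum_eq_zero fun a _ => by
      rw [hact]
      exact act_coeff_zero_eq_zero _ (by rw [← hm, hh])
  rw [h1, add_zero, add_assoc, ← Finset.sum_add_distrib]
  congr 1
  refine Finset.sum_congr rfl fun a _ => ?_
  rw [hm, hact, hact, Polynomial.map_C, map_sub, sub_eq_add_neg, act_add_right,
    Polynomial.coeff_add, act_neg_right, Polynomial.coeff_neg,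
    act_coeff_zero_congr _ (q := (adj P.D (γ a h)).map ρ.toRingHom)
      (q' := Polynomial.C (ρ ((adj P.D (γ a h)).coeff 0)))
      (by rw [← hm, Polynomial.coeff_C_zero])]
  have h2 : ρ.toRingHom (∑ b, ((kinv I a b : ℝ) : ℂ) • μ b)
      = ∑ b, ((kinv I a b : ℝ) : ℂ) • ρ (μ b) := by
    refine (map_sum ρ _ _).trans (Finset.sum_congr rfl fun b _ => map_smul ρ _ _)
  rw [h2]
  ring

end Reduction

section Charges

variable {𝔤 : Type*} [LieRing 𝔤] [LieAlgebra ℝ 𝔤] {ι : Type w} [Fintype ι] [DecidableEq ι]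
  {I : Module.Basis ι ℝ 𝔤} {V : Type u} [CommRing V] [Algebra ℂ V]
  {V' : Type v} [CommRing V'] [Algebra ℂ V'] {P : PVA V}
  {ρ : V →ₐ[ℂ] V'} {C F L : ι → V}

theorem pairing_zero_right (F : ι → V) : pairing I F 0 = 0 := (pairingL I F).map_zero

theorem map_chargeDensity (hρC : ∀ e, ρ (C e) = 0) (y r : ℂ) :
    ρ (chargeDensity I y F L C r) =
      (-(2 * y)⁻¹) • pairing I (fun e => ρ (F e)) (fun e => ρ (F e)) := by
  have h0 : (fun e => ρ (C e)) = 0 := funext hρC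
  rw [chargeDensity, map_add, map_add, map_smul, map_smul, map_pairing, map_pairing, map_pairing,
    h0, pairing_zero_right, pairing_zero_right, smul_zero, add_zero, add_zero]

theorem map_gaugeVec {M : ℕ} (c d : ℝ) (φ : ℂ → ℂ) (ζ : Fin M → ℂ) (F : ℂ → ι → V) (v : ι → V)
    (k : Fin M) (e : ι) : ρ (gaugeVec c d φ ζ F v k e) =
      gaugeVec c d φ ζ (fun z e => ρ (F z e)) (fun e => ρ (v e)) k e := by
  rw [gaugeVec, gaugeVec]
  split_ifs
  · simp only [Pi.add_apply, Finset.sum_apply, Pi.smul_apply, map_add, map_sum, map_smul]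
  · simp only [Pi.smul_apply, map_smul]

theorem exists_isEquivariant_gaugeVec {K : ι → V} {M : ℕ} {c d : ℝ} {φ : ℂ → ℂ} {ζ : Fin M → ℂ}
    {F : ℂ → ι → V} {v : ι → V} {y : ℂ → ℂ} {x : ℂ} (hF : ∀ z, IsEquivariant I P K (F z) (y z))
    (hv : IsEquivariant I P K v x) (k : Fin M) :
    ∃ s, IsEquivariant I P K (gaugeVec c d φ ζ F v k) s := by
  rw [gaugeVec]
  split_ifs
  · exact ⟨_, hv.add (IsEquivariant.sum _ fun i _ => (hF _).smul _)⟩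
  · exact ⟨_, (hF _).smul _⟩

variable [LieAlgebra.IsSemisimple ℝ 𝔤]

/-- The derivative of a charge along the momentum conjugate to the constraint. -/
theorem derivation_chargeDensity (δ : Derivation ℂ V V[X]) (x : ι) (hF : ∀ e, δ (F e) = 0)
    (hL : ∀ e, δ (L e) = 0) (hC : ∀ e, δ (C e) = if x = e then 1 else 0) (y r : ℂ) :
    δ (chargeDensity I y F L C r) =
      Polynomial.C (∑ b, ((kinv I x b : ℝ) : ℂ) • (L b + (2 * r) • C b)) := by
  have h1 : ∀ F F₂ : ι → V, δ (pairing I F F₂) =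
      ∑ a, ∑ b, ((kinv I a b : ℝ) : ℂ) • (F a • δ (F₂ b) + F₂ b • δ (F a)) := by
    intro F F₂
    simp only [pairing, map_sum, Derivation.map_smul, Derivation.leibniz]
  have h2 : ∀ F : ι → V, ∑ a, ∑ b, ((kinv I a b : ℝ) : ℂ) • F a • δ (C b) =
      Polynomial.C (∑ b, ((kinv I x b : ℝ) : ℂ) • F b) := by
    intro F
    rw [map_sum]
    refine Finset.sum_congr rfl fun a _ => ?_
    rw [Finset.sum_eq_single x]
    · rw [hC, if_pos rfl, kinv_symm, Polynomial.smul_eq_C_mul, mul_one, Polynomial.smul_C]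
    · intro b _ hb; rw [hC, if_neg hb.symm, smul_zero, smul_zero]
    · simp
  have h3 : ∑ a, ∑ b, ((kinv I a b : ℝ) : ℂ) • C b • δ (C a) =
      Polynomial.C (∑ b, ((kinv I x b : ℝ) : ℂ) • C b) := by
    rw [← h2, Finset.sum_comm]
    exact Finset.sum_congr rfl fun a _ => Finset.sum_congr rfl fun b _ => by rw [kinv_symm]
  have h4 : δ (pairing I F F) = 0 := by
    rw [h1]
    simp only [hF, smul_zero, add_zero, Finset.sum_const_zero]
  have h5 : δ (pairing I L C) = Polynomial.C (∑ b, ((kinv I x b : ℝ) : ℂ) • L b) := by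
    rw [h1, ← h2]
    simp only [hL, smul_zero, add_zero]
  have h6 : δ (pairing I C C) = (2 : ℂ) • Polynomial.C (∑ b, ((kinv I x b : ℝ) : ℂ) • C b) := by
    rw [h1]
    simp only [smul_add, Finset.sum_add_distrib]
    rw [h2, h3, two_smul]
  rw [chargeDensity, map_add, map_add, Derivation.map_smul, Derivation.map_smul, h4, h5, h6,
    smul_zero, zero_add, smul_smul, Polynomial.smul_C, ← map_add, Finset.smul_sum,
    ← Finset.sum_add_distrib]
  refine congrArg Polynomial.C (Finset.sum_congr rfl fun b _ => ?_)
  rw [smul_add, smul_comm, mul_comm]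

theorem br_chargeDensity {s : ℂ} (hF : IsEquivariant I P C F 0) (hL : IsEquivariant I P C L s)
    (hC : IsEquivariant I P C C 0) (e : ι) (y r : ℂ) :
    P.br (C e) (chargeDensity I y F L C r) = Polynomial.C (s • C e) * Polynomial.X := by
  rw [chargeDensity, map_add, map_add, map_smul, map_smul, hF.br_pairing hF, hL.br_pairing hC,
    hC.br_pairing hC]
  simp only [zero_smul, add_zero, Polynomial.C_0, zero_mul, smul_zero, zero_add]

/-- The flow of the total Hamiltonian of a gauged model, for Hamiltonians built from quadratic
charges. -/
theorem map_totalFlow_charges {P' : PVA V'} {δ : ι → Derivation ℂ V V[X]} {γ : ι → V → V[X]}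
    (hγ : ∀ a F, γ a F = -δ a F)
    (hρD : ∀ F, ρ (P.D F) = P'.D (ρ F)) (hρC : ∀ e, ρ (C e) = 0)
    (hdir : ∀ F F₂, (P.br F F₂ + ∑ a, act P.D (γ a F₂) (P.br F (C a))
      + ∑ a, act P.D (P.br (C a) F₂) (adj P.D (γ a F))).map ρ.toRingHom = P'.br (ρ F) (ρ F₂))
    {κ : Type*} (t : Finset κ) {F L : κ → ι → V} {y r s eps : κ → ℂ}
    (hδF : ∀ a, ∀ k ∈ t, ∀ e, δ a (F k e) = 0) (hδL : ∀ a, ∀ k ∈ t, ∀ e, δ a (L k e) = 0)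
    (hδC : ∀ a e, δ a (C e) = if a = e then 1 else 0)
    (hF : ∀ k ∈ t, IsEquivariant I P C (F k) 0) (hL : ∀ k ∈ t, IsEquivariant I P C (L k) (s k))
    (hC : IsEquivariant I P C C 0) (μ : ι → V) (O : V) :
    ρ (totalFlow I P C (P.int (∑ k ∈ t, eps k • chargeDensity I (y k) (F k) (L k) C (r k))) μ O) =
      P'.flow (P'.int (∑ k ∈ t, eps k • ((-(2 * y k)⁻¹) •
        pairing I (fun e => ρ (F k e)) (fun e => ρ (F k e))))) (ρ O) +
      ∑ a, (act P'.D ((P.br (C a) O).map ρ.toRingHom)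
        (Polynomial.C (∑ b, ((kinv I a b : ℝ) : ℂ) •
          (ρ (μ b) + ∑ k ∈ t, eps k • ρ (L k b))))).coeff 0 := by
  set h := ∑ k ∈ t, eps k • chargeDensity I (y k) (F k) (L k) C (r k) with hh
  have h1 : ∀ a, ρ ((P.br h (C a)).coeff 0) = 0 := by
    intro a
    have h2 : P.br (C a) h = Polynomial.C (∑ k ∈ t, eps k • s k • C a) * Polynomial.X := by
      rw [hh, map_sum, map_sum, Finset.sum_mul]
      refine Finset.sum_congr rfl fun k hk => ?_
      rw [map_smul, br_chargeDensity (hF k hk) (hL k hk) hC, ← smul_mul_assoc, Polynomial.smul_C]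
    rw [PVA.br_coeff_zero_of_skew h2, hρD, map_sum]
    simp only [map_smul, hρC, smul_zero, Finset.sum_const_zero, map_zero]
  have h2 : ∀ a, ρ ((adj P.D (γ a h)).coeff 0) =
      -∑ b, ((kinv I a b : ℝ) : ℂ) • ∑ k ∈ t, eps k • ρ (L k b) := by
    intro a
    have h3 : δ a h = Polynomial.C (∑ k ∈ t, eps k • ∑ b, ((kinv I a b : ℝ) : ℂ) •
        (L k b + (2 * r k) • C b)) := by
      rw [hh, map_sum, map_sum]
      refine Finset.sum_congr rfl fun k hk => ?_
      rw [Derivation.map_smul, derivation_chargeDensity (δ a) a (hδF a k hk) (hδL a k hk) (hδC a),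
        Polynomial.smul_C]
    rw [hγ, h3, adj_neg, adj_C, Polynomial.coeff_neg, Polynomial.coeff_C_zero, map_neg, map_sum]
    refine congrArg Neg.neg ?_
    simp only [map_smul, map_sum, map_add, hρC, smul_zero, add_zero, Finset.smul_sum]
    rw [Finset.sum_comm]
    exact Finset.sum_congr rfl fun b _ => Finset.sum_congr rfl fun k _ => smul_comm _ _ _
  rw [map_totalFlow hρD hdir h1]
  have h4 : ρ h = ∑ k ∈ t, eps k • ((-(2 * y k)⁻¹) •
        pairing I (fun e => ρ (F k e)) (fun e => ρ (F k e))) := by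
    rw [hh, map_sum]
    exact Finset.sum_congr rfl fun k _ => by rw [map_smul, map_chargeDensity hρC]
  rw [h4]
  congr 1
  refine Finset.sum_congr rfl fun a _ => ?_
  rw [h2, sub_neg_eq_add, ← Finset.sum_add_distrib]
  simp only [smul_add]

end Charges

section Multiplier

variable {𝔤 : Type*} [LieRing 𝔤] [LieAlgebra ℝ 𝔤] [LieAlgebra.IsSemisimple ℝ 𝔤] {ι : Type w}
  [Fintype ι] [DecidableEq ι] {I : Module.Basis ι ℝ 𝔤} {V : Type u} [CommRing V] [Algebra ℂ V]

theorem forall_sum_dual_eq_zero_iff {H : Type*} {ev : H → ι → ℂ} {f : ι → H}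
    (hf : ∀ a b, ev (f b) a = if a = b then 1 else 0) (n : ι → V) :
    (∀ h, ∑ a, ev h a • ∑ b, ((kinv I a b : ℝ) : ℂ) • n b = 0) ↔ ∀ b, n b = 0 := by
  constructor
  · intro h
    have h1 : ∀ a, ∑ b, ((kinv I a b : ℝ) : ℂ) • n b = 0 := by
      intro a
      have h2 := h (f a)
      rw [Finset.sum_eq_single a] at h2
      · rwa [hf, if_pos rfl, one_smul] at h2
      · intro b _ hb; rw [hf, if_neg hb, zero_smul]
      · simp
    intro b
    rw [← sum_kap_kinv_smul I n b]
    exact Finset.sum_eq_zero fun a _ => by rw [h1, smul_zero]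
  · intro h k
    simp only [h, smul_zero, Finset.sum_const_zero]

theorem derivation_gaugeVec {𝔪 : Type*} [AddCommGroup 𝔪] [Module ℂ 𝔪] [Module V 𝔪]
    (δ : Derivation ℂ V 𝔪) {M : ℕ} {c d : ℝ} {φ : ℂ → ℂ} {ζ : Fin M → ℂ} {F : ℂ → ι → V}
    {v : ι → V} (hF : ∀ z e, δ (F z e) = 0) (hv : ∀ e, δ (v e) = 0) (k : Fin M) (e : ι) :
    δ (gaugeVec c d φ ζ F v k e) = 0 := by
  rw [gaugeVec]
  split_ifs
  · simp only [Pi.add_apply, Finset.sum_apply, Pi.smul_apply, map_add, map_sum,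
      Derivation.map_smul, hF, hv, smul_zero, Finset.sum_const_zero, add_zero]
  · simp only [Pi.smul_apply, Derivation.map_smul, hF, smul_zero]

end Multiplier

section LaxPair

variable {ι : Type w} [Fintype ι] {A : Type v} [CommRing A] [Algebra ℂ A] {V : Type u}
  [CommRing V] [Algebra ℂ V] {S S' : Type*} [Fintype S] [DecidableEq S] [Fintype S']
  {𝒢 : GaudinData S ι A} {𝒢t : GaudinData S' ι V} {linf a b c d : ℝ} {M : ℕ} {ζ : Fin M → ℂ}
  {ρ : V →ₗ[ℂ] A}

theorem map_laxTerm (hdet : a * d - b * c ≠ 0) {φ : ℂ → ℂ}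
    {ζ z : ℂ} (hφ : DifferentiableAt ℂ φ ζ) (h0 : φ ζ = 0) (h1 : deriv φ ζ ≠ 0) (hz : z ≠ ζ)
    (hcζ : (c : ℂ) * ζ + d ≠ 0) (hcz : (c : ℂ) * z + d ≠ 0) {e : ι} {Γ : A}
    (hlax : ρ (gaudinLax 𝒢t (mobius a b c d ζ) e) =
      (((c : ℂ) * ζ + d) ^ 2 / ((a : ℂ) * d - b * c)) • Γ) :
    ρ (laxTerm (mobTwist a b c d φ) 𝒢t (mobius a b c d ζ) (mobius a b c d z) e) =
      ((deriv φ ζ * (z - ζ))⁻¹ + (c : ℂ) / (c * ζ + d) * (deriv φ ζ)⁻¹) • Γ := by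
  have hdet' := ofReal_det_ne_zero hdet
  rw [laxTerm, Pi.smul_apply, map_smul, hlax, smul_smul, (hasDerivAt_mobTwist hdet hcζ hφ h0).deriv,
    mobius_sub_mobius hcz hcζ]
  congr 1
  have hs : z - ζ ≠ 0 := sub_ne_zero.2 hz
  have h2 : (c : ℂ) * z + d = c * (z - ζ) + (c * ζ + d) := by ring
  rw [h2] at hcz ⊢
  generalize (c : ℂ) * ζ + d = x at *
  generalize z - ζ = s at *
  generalize (a : ℂ) * d - b * c = Δ at *
  generalize deriv φ ζ = y at *
  field_simp
  ring

theorem map_laxL (hdet : a * d - b * c ≠ 0) {φ : ℂ → ℂ} {z : ℂ} (hcz : (c : ℂ) * z + d ≠ 0) {e : ι}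
    {Γ : A} (hlax : ρ (gaudinLax 𝒢t (mobius a b c d z) e) =
      (((c : ℂ) * z + d) ^ 2 / ((a : ℂ) * d - b * c)) • Γ) :
    ρ (laxL (mobTwist a b c d φ) 𝒢t (mobius a b c d z) e) = (φ z)⁻¹ • Γ := by
  rw [laxL, Pi.smul_apply, map_smul, hlax, mobTwist_mobius hdet _ hcz, smul_smul, mul_inv,
    mul_right_comm, inv_mul_cancel₀ (div_ne_zero (pow_ne_zero 2 hcz) (ofReal_det_ne_zero hdet)),
    one_mul]

/-- The temporal components of the Lax pairs of the two models. -/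
theorem map_laxM [DecidableEq ι] (hdet : a * d - b * c ≠ 0) (hc : c ≠ 0)
    (h : IsZeroSet ζ 𝒢 linf) (hlinf : linf ≠ 0)
    (hζ : Function.Injective ζ) (hne : ∀ i α, ζ i ≠ 𝒢.z α) (hM : M = ∑ α, 𝒢.m α)
    (hlax : ∀ z, (∀ α, z ≠ 𝒢.z α) → (c : ℂ) * z + d ≠ 0 → ∀ e,
      ρ (gaudinLax 𝒢t (mobius a b c d z) e) =
        (((c : ℂ) * z + d) ^ 2 / ((a : ℂ) * d - b * c)) • gaudinLax 𝒢 z e)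
    {μ : ι → V} {eps : Fin M → ℂ}
    (hμ : ∀ e, ρ (μ e) + ∑ i, eps i • gaugeVec c d (twist linf 𝒢) ζ (gaudinLax 𝒢) 0 i e = 0)
    {z : ℂ} (hz : ∀ α, z ≠ 𝒢.z α) (hz' : ∀ i, z ≠ ζ i) (hcz : (c : ℂ) * z + d ≠ 0) (e : ι) :
    ρ (laxM (mobTwist a b c d (twist linf 𝒢)) 𝒢t (fun i => mobiusSphere a b c d (ζ i)) eps μ
      (mobius a b c d z) e) =
    laxM (twist linf 𝒢) 𝒢 (fun i => (ζ i : OnePoint ℂ)) eps 0 z e := by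
  have hdet' := ofReal_det_ne_zero hdet
  have h0 : ∀ i, twist linf 𝒢 (ζ i) = 0 := fun i => (h.eq_zero_iff hlinf (hne i)).2 ⟨i, rfl⟩
  have h1 : ∀ i, deriv (twist linf 𝒢) (ζ i) ≠ 0 := fun i => h.deriv_ne_zero hlinf hζ (hne i)
  have hterm : ∀ i, (c : ℂ) * ζ i + d ≠ 0 → ρ (laxTerm (mobTwist a b c d (twist linf 𝒢)) 𝒢t
      (mobius a b c d (ζ i)) (mobius a b c d z) e) =
      (deriv (twist linf 𝒢) (ζ i) * (z - ζ i))⁻¹ • gaudinLax 𝒢 (ζ i) e +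
        ((c : ℂ) / (c * ζ i + d) * (deriv (twist linf 𝒢) (ζ i))⁻¹) • gaudinLax 𝒢 (ζ i) e := by
    intro i hi
    rw [map_laxTerm hdet (analyticAt_twist (hne i)).differentiableAt (h0 i) (h1 i) (hz' i) hi hcz
      (hlax _ (hne i) hi e), add_smul]
  have hT : ∀ i, ρ ((mobiusSphere a b c d (ζ i)).elim
      (laxL (mobTwist a b c d (twist linf 𝒢)) 𝒢t (mobius a b c d z) -
        ∑ k, (mobiusSphere a b c d (ζ k)).elim 0 fun x =>
          laxTerm (mobTwist a b c d (twist linf 𝒢)) 𝒢t x (mobius a b c d z))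
      (fun x => laxTerm (mobTwist a b c d (twist linf 𝒢)) 𝒢t x (mobius a b c d z)) e) =
      (deriv (twist linf 𝒢) (ζ i) * (z - ζ i))⁻¹ • gaudinLax 𝒢 (ζ i) e +
        gaugeVec c d (twist linf 𝒢) ζ (gaudinLax 𝒢) 0 i e := by
    intro i
    rw [gaugeVec]
    by_cases hi : (c : ℂ) * ζ i + d = 0
    · have hoth : ∀ k ∈ Finset.univ.erase i, (c : ℂ) * ζ k + d ≠ 0 := by
        intro k hk hk'
        exact Finset.ne_of_mem_erase hk
          (hζ ((eq_neg_div_of_den hc hk').trans (eq_neg_div_of_den hc hi).symm))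
      have hL : ρ (laxL (mobTwist a b c d (twist linf 𝒢)) 𝒢t (mobius a b c d z) e) =
          ∑ k, (deriv (twist linf 𝒢) (ζ k) * (z - ζ k))⁻¹ • gaudinLax 𝒢 (ζ k) e := by
        rw [← h.gaudinLax_div hlinf hζ hne hM hz hz' e, map_laxL hdet hcz (hlax z hz hcz e)]
      have hi' : mobiusSphere a b c d (ζ i) = OnePoint.infty := by rw [mobiusSphere, if_pos hi]
      rw [if_pos hi, hi']
      change ρ (laxL (mobTwist a b c d (twist linf 𝒢)) 𝒢t (mobius a b c d z) e -
        (∑ k, (mobiusSphere a b c d (ζ k)).elim 0 fun x =>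
          laxTerm (mobTwist a b c d (twist linf 𝒢)) 𝒢t x (mobius a b c d z)) e) = _
      rw [map_sub, hL, Finset.sum_apply, map_sum, ← Finset.add_sum_erase _ _ (Finset.mem_univ i),
        ← Finset.add_sum_erase _ (fun k => ρ _) (Finset.mem_univ i), hi']
      have h2 : ρ ((OnePoint.infty : OnePoint ℂ).elim (0 : ι → V)
          (fun x => laxTerm (mobTwist a b c d (twist linf 𝒢)) 𝒢t x (mobius a b c d z)) e) = 0 :=
        map_zero ρ
      rw [h2, zero_add, add_sub_assoc, ← Finset.sum_sub_distrib, zero_add, Finset.sum_apply]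
      congr 1
      refine Finset.sum_congr rfl fun k hk => ?_
      have hk' := hoth k hk
      have h3 : mobiusSphere a b c d (ζ k) = (mobius a b c d (ζ k) : OnePoint ℂ) := by
        rw [mobiusSphere, if_neg hk']
      rw [h3]
      refine (congrArg (_ - ·) (hterm k hk')).trans ?_
      rw [sub_add_cancel_left, Pi.smul_apply, ← neg_smul]
      congr 1
      have h4 : ζ i - ζ k = -(c * ζ k + d) / c := by
        have hc' : (c : ℂ) ≠ 0 := Complex.ofReal_ne_zero.2 hc
        rw [eq_neg_div_of_den hc hi]; field_simp; ring
      rw [h4, mul_inv, inv_div, div_neg, mul_comm, mul_neg]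
    · have hi' : mobiusSphere a b c d (ζ i) = (mobius a b c d (ζ i) : OnePoint ℂ) := by
        rw [mobiusSphere, if_neg hi]
      rw [if_neg hi, hi']
      exact hterm i hi
  have hR : laxM (twist linf 𝒢) 𝒢 (fun i => (ζ i : OnePoint ℂ)) eps 0 z e =
      ∑ i, eps i • (deriv (twist linf 𝒢) (ζ i) * (z - ζ i))⁻¹ • gaudinLax 𝒢 (ζ i) e := by
    rw [laxM, add_zero, Finset.sum_apply]
    rfl
  rw [hR, laxM, Pi.add_apply, Finset.sum_apply, map_add, map_sum]
  simp only [Pi.smul_apply, map_smul, hT, smul_add, Finset.sum_add_distrib]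
  rw [add_assoc, add_comm _ (ρ (μ e)), hμ, add_zero]

end LaxPair

section GaugedFlow

variable {A : Type*} [CommRing A] [Algebra ℂ A]
  {E : Type u} [NormedAddCommGroup E] [NormedSpace ℝ E] [FiniteDimensional ℝ E]
  {G : Type v} [TopologicalSpace G] [T2Space G] [ChartedSpace E G] [Group G]
  [LieGroup 𝓘(ℝ, E) ∞ G]
  [LieAlgebra.IsSemisimple ℝ (GroupLieAlgebra 𝓘(ℝ, E) G)]
  {U : TopologicalSpace.Opens G} {ι : Type w} [Fintype ι] [DecidableEq ι]
  {I : Module.Basis ι ℝ (GroupLieAlgebra 𝓘(ℝ, E) G)} {P : PVA A}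
  {Pt : PVA (GaugedAlg A E U ι)} {B : ι → ι → SmoothFun E U} {cj : A →+* A}
  {S : Type*} [Fintype S] [DecidableEq S] {𝒢 : GaudinData S ι A} {linf : ℝ} {c d : ℝ}

theorem physProj_totalFlow (hU : (1 : G) ∈ U) (ht : IsTensorBracket I P Pt)
    (h𝒢 : IsRealisation I P cj 𝒢) {l : ℂ} {C : ι → GaugedAlg A E U ι}
    (hC : ∀ e, C e = wzCurrent I B l e + inA (sumZeroModes 𝒢 e))
    (hfc : ∀ e e₂, Pt.br (C e) (C e₂) = Polynomial.C (comp I C ⁅I e, I e₂⁆))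
    (hCfn : ∀ e h, Pt.br (C e) (fn h) = Polynomial.C (fn (leftDeriv (I e) h)))
    {M : ℕ} {ζ : Fin M → ℂ} (h0 : ∀ i, twist linf 𝒢 (ζ i) = 0) (eps R : Fin M → ℂ)
    (μ : ι → GaugedAlg A E U ι) (O : GaugedAlg A E U ι) :
    physProj hU P (sumZeroModes 𝒢) (totalFlow I Pt C (Pt.int (∑ i, eps i •
      chargeDensity I (deriv (twist linf 𝒢) (ζ i)) (laxOne U I 𝒢 linf (ζ i))
        (gaugeVec c d (twist linf 𝒢) ζ (laxOne U I 𝒢 linf) (fieldj I) i) C (R i))) μ O) =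
    P.flow (P.int (∑ i, eps i • ((-(2 * deriv (twist linf 𝒢) (ζ i))⁻¹) •
        pairing I (gaudinLax 𝒢 (ζ i)) (gaudinLax 𝒢 (ζ i)))))
      (physProj hU P (sumZeroModes 𝒢) O) +
    ∑ x, (act P.D ((Pt.br (C x) O).map
        (physProj hU P (sumZeroModes 𝒢) : GaugedAlg A E U ι →ₐ[ℂ] A).toRingHom)
      (Polynomial.C (∑ y, ((kinv I x y : ℝ) : ℂ) • (physProj hU P (sumZeroModes 𝒢) (μ y)
        + ∑ i, eps i • gaugeVec c d (twist linf 𝒢) ζ (gaudinLax 𝒢) 0 i y)))).coeff 0 := by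
  have hF : ∀ z, IsEquivariant I Pt C (laxOne U I 𝒢 linf z) (twist linf 𝒢 z) :=
    isEquivariant_laxOne ht h𝒢 hC
  choose s hs using exists_isEquivariant_gaugeVec (c := c) (d := d) (φ := twist linf 𝒢) (ζ := ζ) hF
    (isEquivariant_fieldj ht hC)
  have hCC : IsEquivariant I Pt C C 0 := by
    intro e e₂
    rw [hfc, zero_mul, map_zero, Polynomial.C_0, zero_mul, add_zero]
  have hδ : ∀ x F, gBracket x F = 0 → (gaugedFields A U I).momOp x F = 0 := by
    intro x F h
    rw [gBracket_eq_neg_momOp I] at h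
    exact neg_eq_zero.1 h
  have hδF : ∀ x z e, (gaugedFields A U I).momOp x (laxOne U I 𝒢 linf z e) = 0 :=
    fun x z e => hδ _ _ (gBracket_laxOne z x e)
  have hδL : ∀ x i e, (gaugedFields A U I).momOp x
      (gaugeVec c d (twist linf 𝒢) ζ (laxOne U I 𝒢 linf) (fieldj I) i e) = 0 := by
    exact fun x i e => derivation_gaugeVec _ (hδF x) (fun e => hδ _ _ (gBracket_fieldj x e)) i e
  have key := map_totalFlow_charges (P := Pt) (P' := P) (I := I) (C := C)
    (ρ := (physProj hU P (sumZeroModes 𝒢) : GaugedAlg A E U ι →ₐ[ℂ] A))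
    (δ := fun x => (gaugedFields A U I).momOp x) (γ := gBracket)
    (fun x F => gBracket_eq_neg_momOp I x F) (physProj_D hU _ ht) (physProj_C hU hC)
    (map_dirac_physProj hU ht hC hfc hCfn) Finset.univ
    (F := fun i => laxOne U I 𝒢 linf (ζ i))
    (L := gaugeVec c d (twist linf 𝒢) ζ (laxOne U I 𝒢 linf) (fieldj I))
    (y := fun i => deriv (twist linf 𝒢) (ζ i)) (r := R) (s := s) (eps := eps)
    (fun x i _ e => hδF x (ζ i) e) (fun x i _ e => hδL x i e) (by
      intro x e
      have h1 := gBracket_constraint (I := I) hC x e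
      rw [gBracket_eq_neg_momOp I] at h1
      refine (neg_eq_iff_eq_neg.1 h1).trans ?_
      split_ifs
      · exact neg_neg _
      · exact neg_zero)
    (fun i _ => by rw [← h0 i]; exact hF (ζ i)) (fun i _ => hs i) hCC μ O
  have hρF : ∀ z, (fun e => physProj hU P (sumZeroModes 𝒢) (laxOne U I 𝒢 linf z e)) =
      gaudinLax 𝒢 z := fun z => funext fun e => physProj_laxOne hU _ z e
  have hρL : ∀ i y, physProj hU P (sumZeroModes 𝒢)
      (gaugeVec c d (twist linf 𝒢) ζ (laxOne U I 𝒢 linf) (fieldj I) i y) =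
      gaugeVec c d (twist linf 𝒢) ζ (gaudinLax 𝒢) 0 i y := by
    intro i y
    rw [map_gaugeVec]
    congr 1
    · exact funext hρF
    · exact funext fun e => physProj_fieldj hU _ e
  rw [key]
  simp only [hρF, hρL]

theorem flow_algebraMap (H : P.Fun) (r : ℂ) : P.flow H (algebraMap ℂ A r) = 0 := by
  have h1 : P.flow H (1 * 1) = _ := P.flow_mul H 1 1
  rw [mul_one, one_mul] at h1
  rw [Algebra.algebraMap_eq_smul_one, map_smul, left_eq_add.1 h1, smul_zero]

/-- The condition on the Lagrange multiplier for the preservation of the gauge fixing. -/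
theorem forall_flow_fn_eq_zero_iff (hU : (1 : G) ∈ U) {K : ι → A} {C : ι → GaugedAlg A E U ι}
    (hCfn : ∀ e h, Pt.br (C e) (fn h) = Polynomial.C (fn (leftDeriv (I e) h)))
    {T : GaugedAlg A E U ι → A} {H : P.Fun} {n : ι → A}
    (hT : ∀ O, T O = P.flow H (physProj hU P K O) +
      ∑ x, (act P.D ((Pt.br (C x) O).map
        (physProj hU P K : GaugedAlg A E U ι →ₐ[ℂ] A).toRingHom)
      (Polynomial.C (∑ y, ((kinv I x y : ℝ) : ℂ) • n y))).coeff 0) :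
    (∀ h, T (fn h) = 0) ↔ ∀ b, n b = 0 := by
  obtain ⟨f, hf⟩ := exists_dual_functions I (⟨1, hU⟩ : U)
  rw [← forall_sum_dual_eq_zero_iff (I := I)
    (ev := fun (h : SmoothFun E U) a => ((leftDeriv (I a) h ⟨1, hU⟩ : ℝ) : ℂ)) (f := f) (by
      intro a b
      rw [← evalAt_apply, hf]
      split_ifs <;> simp)]
  refine forall_congr' fun h => ?_
  rw [hT, physProj_fn, flow_algebraMap, zero_add]
  refine Eq.congr (Finset.sum_congr rfl fun x _ => ?_) rfl
  rw [hCfn, Polynomial.map_C, act_C, ← Polynomial.C_mul, Polynomial.coeff_C_zero, Algebra.smul_def]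
  exact congrArg (· * _) (physProj_fn hU K _)

theorem flow_eq_of_multiplier (hU : (1 : G) ∈ U) {K : ι → A} {C : ι → GaugedAlg A E U ι}
    {T : GaugedAlg A E U ι → A} {H : P.Fun} {n : ι → A}
    (hT : ∀ O, T O = P.flow H (physProj hU P K O) +
      ∑ x, (act P.D ((Pt.br (C x) O).map
        (physProj hU P K : GaugedAlg A E U ι →ₐ[ℂ] A).toRingHom)
      (Polynomial.C (∑ y, ((kinv I x y : ℝ) : ℂ) • n y))).coeff 0)
    (hn : ∀ b, n b = 0) (O : GaugedAlg A E U ι) : T O = P.flow H (physProj hU P K O) := by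
  rw [hT]
  simp only [hn, smul_zero, Finset.sum_const_zero, map_zero, act_zero_right, Polynomial.coeff_zero,
    add_zero]

end GaugedFlow

section FlowDerivation

variable {V : Type u} [CommRing V] [Algebra ℂ V]

/-- The Hamiltonian flow of a local functional as a derivation. -/
def PVA.flowDer (P : PVA V) (H : P.Fun) : Derivation ℂ V V :=
  Derivation.mk' (P.flow H) fun x y => P.flow_mul H x y

theorem PVA.flowDer_apply (P : PVA V) (H : P.Fun) (x : V) : P.flowDer H x = P.flow H x := rfl

variable {𝔤 : Type v} [LieRing 𝔤] [LieAlgebra ℝ 𝔤] {ι : Type w} [Fintype ι] [DecidableEq ι]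
  {I : Module.Basis ι ℝ 𝔤}

theorem derivation_pairing_eq_zero (δ : Derivation ℂ V V) {F F₂ : ι → V} (hF : ∀ e, δ (F e) = 0)
    (hF₂ : ∀ e, δ (F₂ e) = 0) : δ (pairing I F F₂) = 0 := by
  simp only [pairing, map_sum, Derivation.map_smul, Derivation.leibniz, hF, hF₂, smul_zero,
    add_zero, Finset.sum_const_zero]

theorem derivation_chargeDensity_eq_zero (δ : Derivation ℂ V V) {F L C : ι → V}
    (hF : ∀ e, δ (F e) = 0) (hL : ∀ e, δ (L e) = 0) (hC : ∀ e, δ (C e) = 0) (y r : ℂ) :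
    δ (chargeDensity I y F L C r) = 0 := by
  rw [chargeDensity, map_add, map_add, Derivation.map_smul, Derivation.map_smul,
    derivation_pairing_eq_zero δ hF hF, derivation_pairing_eq_zero δ hL hC,
    derivation_pairing_eq_zero δ hC hC, smul_zero, smul_zero, add_zero, add_zero]

theorem PVA.br_neg_sum_mul (P : PVA V) (x : V) (F F₂ : ι → V) :
    P.br x (-∑ b, F b * F₂ b) = -∑ b, (Polynomial.C (F b) * P.br x (F₂ b)
      + Polynomial.C (F₂ b) * P.br x (F b)) := by
  simp only [map_neg, map_sum, P.br_mul]

theorem PVA.flow_neg_sum_mul (P : PVA V) {x : V} {F Z u : ι → V} {k : ι → ℂ}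
    (hF : ∀ b, P.br x (F b) = 0)
    (hZ : ∀ b, P.br x (Z b) =
      Polynomial.C (u b) + Polynomial.C (algebraMap ℂ V (k b)) * Polynomial.X) :
    P.flow (P.int (-∑ b, F b * Z b)) x = ∑ b, F b * u b - ∑ b, k b • P.D (F b) := by
  have h : P.br x (-∑ b, F b * Z b) = -(Polynomial.C (∑ b, F b * u b)
      + Polynomial.C (∑ b, k b • F b) * Polynomial.X) := by
    rw [P.br_neg_sum_mul, map_sum, map_sum, Finset.sum_mul, ← Finset.sum_add_distrib]
    refine congrArg Neg.neg (Finset.sum_congr rfl fun b _ => ?_)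
    rw [hF, hZ, mul_zero, add_zero, mul_add, ← mul_assoc, ← Polynomial.C_mul, ← Polynomial.C_mul,
      Algebra.smul_def, mul_comm (algebraMap ℂ _ _)]
  rw [PVA.flow_int, P.br_skew x, h, adj_neg, neg_neg, adj_add, adj_C, adj_mul_X, adj_C,
    Polynomial.coeff_add, Polynomial.coeff_neg, shift_coeff_zero, Polynomial.coeff_C_zero,
    Polynomial.coeff_C_zero, ← sub_eq_add_neg, map_sum]
  simp only [Derivation.map_smul]

end FlowDerivation

section LeftSymmetry

variable {A : Type*} [CommRing A] [Algebra ℂ A]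
  {E : Type u} [NormedAddCommGroup E] [NormedSpace ℝ E] [FiniteDimensional ℝ E]
  {G : Type v} [TopologicalSpace G] [T2Space G] [ChartedSpace E G] [Group G]
  [LieGroup 𝓘(ℝ, E) ∞ G]
  [LieAlgebra.IsSemisimple ℝ (GroupLieAlgebra 𝓘(ℝ, E) G)]
  {U : TopologicalSpace.Opens G} {ι : Type w} [Fintype ι] [DecidableEq ι]
  {I : Module.Basis ι ℝ (GroupLieAlgebra 𝓘(ℝ, E) G)} {P : PVA A}
  {Pt : PVA (GaugedAlg A E U ι)} {B : ι → ι → SmoothFun E U} {l : ℂ}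

theorem leftMoment_eq (e : ι) : (leftMoment I B l e : GaugedAlg A E U ι) =
    -∑ b, fn (adInv I b (I e)) * (wzCurrent I B l - l • fieldj I : ι → GaugedAlg A E U ι) b := by
  rw [leftMoment]
  refine congrArg Neg.neg (Finset.sum_congr rfl fun b _ => congrArg (_ * ·) ?_)
  rw [Pi.sub_apply, Pi.smul_apply, wzCurrent_apply, fieldX]
  module

theorem fn_leftDeriv_adInv (e c b : ι) :
    (fn (leftDeriv (I c) (adInv I b (I e))) : GaugedAlg A E U ι) =
      ∑ a, ((I.repr ⁅I a, I c⁆ b : ℝ) : ℂ) • fn (adInv I a (I e)) := by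
  rw [leftDeriv_adInv, fn_sum]
  exact Finset.sum_congr rfl fun a _ => fn_smul _ _

namespace IsTensorBracket

theorem br_wzCurrent_leftMoment (ht : IsTensorBracket I P Pt) (hB : l ≠ 0 → IsWZPotential I B)
    (c e : ι) : Pt.br (wzCurrent I B l c) (leftMoment I B l e) = 0 := by
  set Z : ι → GaugedAlg A E U ι := wzCurrent I B l - l • fieldj I with hZ
  have h1 : ∀ b, Pt.br (wzCurrent I B l c) (Z b) = Polynomial.C (comp I Z ⁅I c, I b⁆) := by
    intro b
    rw [hZ, Pi.sub_apply, Pi.smul_apply, map_sub, map_smul, ht.br_wzCurrent_wzCurrent hB,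
      ht.br_wzCurrent_fieldj, sub_eq_add_neg (wzCurrent I B l), ← neg_smul, comp_add_left,
      comp_smul_left, neg_smul, ← sub_eq_add_neg, map_sub, smul_add, Polynomial.smul_C,
      ← smul_mul_assoc, Polynomial.smul_C, map_mul, ← Algebra.smul_def]
    abel
  rw [leftMoment_eq, Pt.br_neg_sum_mul, ← hZ]
  simp only [h1, ht.br_wzCurrent_fn, fn_leftDeriv_adInv, ← Polynomial.C_mul, ← Polynomial.C_add]
  rw [← map_sum, ← Polynomial.C_neg, ← Polynomial.C_0]
  refine congrArg Polynomial.C ?_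
  rw [Finset.sum_add_distrib, neg_eq_zero]
  have h2 : ∑ b, Z b * ∑ a, ((I.repr ⁅I a, I c⁆ b : ℝ) : ℂ) •
      (fn (adInv I a (I e)) : GaugedAlg A E U ι) =
      ∑ a, fn (adInv I a (I e)) * comp I Z ⁅I a, I c⁆ := by
    simp only [comp, Finset.mul_sum, mul_smul_comm]
    rw [Finset.sum_comm]
    simp only [mul_comm]
  rw [h2, ← Finset.sum_add_distrib]
  refine Finset.sum_eq_zero fun b _ => ?_
  rw [← mul_add, ← comp_add, ← lie_skew (I b) (I c), add_neg_cancel, comp_zero, mul_zero]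

theorem flow_leftMoment_wzCurrent (ht : IsTensorBracket I P Pt)
    (hB : l ≠ 0 → IsWZPotential I B) (c e : ι) :
    Pt.flow (Pt.int (leftMoment I B l e)) (wzCurrent I B l c) = 0 := by
  rw [PVA.flow_int, ht.swap_zero (ht.br_wzCurrent_leftMoment hB c e), Polynomial.coeff_zero]

theorem flow_leftMoment_fieldj (ht : IsTensorBracket I P Pt) (c e : ι) :
    Pt.flow (Pt.int (leftMoment I B l e)) (fieldj I c) = 0 := by
  have h1 : ∀ b, Pt.br (fieldj I c) ((wzCurrent I B l - l • fieldj I : ι → GaugedAlg A E U ι) b) =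
      Polynomial.C (comp I (fieldj I) ⁅I c, I b⁆)
        + Polynomial.C (algebraMap ℂ _ ((kap I c b : ℝ) : ℂ)) * Polynomial.X := by
    intro b
    rw [Pi.sub_apply, Pi.smul_apply, map_sub, map_smul, ht.br_fieldj_fieldj, smul_zero, sub_zero,
      ht.br_fieldj_wzCurrent]
  rw [leftMoment_eq, Pt.flow_neg_sum_mul (fun b => ht.br_fieldj_fn _ c) h1, sub_eq_zero]
  simp only [ht.D_fn, fn_leftDeriv_adInv, comp_fieldj]
  simp only [Finset.smul_sum, Finset.sum_mul, Finset.mul_sum, smul_mul_assoc, mul_smul_comm,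
    smul_smul]
  symm
  calc _ = ∑ x, ∑ d, ∑ b, ((kap I c b : ℂ) * (I.repr ⁅I d, I x⁆ b : ℝ)) •
        (fn (adInv I d (I e)) * jv x 0 : GaugedAlg A E U ι) := by
        rw [Finset.sum_comm]
        exact Finset.sum_congr rfl fun x _ => Finset.sum_comm
    _ = ∑ d, ∑ x, ∑ b, ((kap I c b : ℂ) * (I.repr ⁅I d, I x⁆ b : ℝ)) •
        (fn (adInv I d (I e)) * jv x 0 : GaugedAlg A E U ι) := Finset.sum_comm
    _ = _ := by
        refine Finset.sum_congr rfl fun d _ => Finset.sum_congr rfl fun x _ => ?_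
        rw [← Finset.sum_smul]
        congr 1
        rw [kform_lie, kform_symm, kform_eq_sum I, Complex.ofReal_sum]
        refine Finset.sum_congr rfl fun b _ => ?_
        rw [Complex.ofReal_mul, mul_comm, kap_symm]

theorem flow_leftMoment_inA (ht : IsTensorBracket I P Pt) (f : A) (e : ι) :
    Pt.flow (Pt.int (leftMoment I B l e)) (inA f) = 0 := by
  have h1 : Pt.br (inA f) (leftMoment I B l e) = 0 := by
    rw [leftMoment_eq, Pt.br_neg_sum_mul]
    simp only [ht.br_inA_fn, Pi.sub_apply, Pi.smul_apply, map_sub, map_smul, ht.br_inA_fieldj,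
      ht.br_inA_wzCurrent, smul_zero, sub_zero, mul_zero, add_zero, Finset.sum_const_zero, neg_zero]
  rw [PVA.flow_int, ht.swap_zero h1, Polynomial.coeff_zero]

theorem flow_leftMoment_fn (ht : IsTensorBracket I P Pt) (h : SmoothFun E U) (e : ι) :
    Pt.flow (Pt.int (leftMoment I B l e)) (fn h) =
      -∑ b, fn (adInv I b (I e) * leftDeriv (I b) h) := by
  have h2 : ∀ b, Pt.br (fn h) (wzCurrent I B l b) = -Polynomial.C (fn (leftDeriv (I b) h)) := by
    intro b
    rw [Pt.br_skew, ht.br_wzCurrent_fn, adj_C]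
  have h1 : Pt.br (fn h) (leftMoment I B l e) =
      Polynomial.C (∑ b, fn (adInv I b (I e) * leftDeriv (I b) h)) := by
    rw [leftMoment_eq, Pt.br_neg_sum_mul]
    simp only [ht.br_fn_fn, Pi.sub_apply, Pi.smul_apply, map_sub, map_smul, ht.br_fn_fieldj,
      h2, smul_zero, sub_zero, mul_zero, add_zero, mul_neg, ← Polynomial.C_mul, fn_mul]
    rw [sum_neg_poly, neg_neg, map_sum]
  rw [PVA.flow_int, Pt.br_skew, h1, adj_C, Polynomial.coeff_neg, Polynomial.coeff_C_zero]

end IsTensorBracket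

theorem physProj_leftMoment (hU : (1 : G) ∈ U) (K : ι → A) (e : ι) :
    physProj hU P K (leftMoment I B l e) = K e := by
  rw [leftMoment_eq, map_neg, map_sum, Finset.sum_eq_single e]
  · rw [map_mul, Pi.sub_apply, Pi.smul_apply, map_sub, map_smul, physProj_wzCurrent,
      physProj_fieldj, physProj_fn, adInv_one, Module.Basis.repr_self, Finsupp.single_eq_same,
      Complex.ofReal_one, map_one, one_mul, smul_zero, sub_zero, neg_neg]
  · intro b _ hb
    rw [map_mul, physProj_fn, adInv_one, Module.Basis.repr_self, Finsupp.single_eq_of_ne hb,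
      Complex.ofReal_zero, map_zero, zero_mul]
  · simp

end LeftSymmetry

section TransportFlow

variable {V : Type u} [CommRing V] [Algebra ℂ V] {V' : Type v} [CommRing V'] [Algebra ℂ V']
  (P : PVA V) (Φ : V ≃ₐ[ℂ] V')

theorem transportPVA_D (x : V) : (transportPVA P Φ).D (Φ x) = Φ (P.D x) := transportD_apply P.D Φ x

theorem transportPVA_br (x y : V) :
    (transportPVA P Φ).br (Φ x) (Φ y) = (P.br x y).map Φ.toAlgHom.toRingHom :=
  transportPre_br P Φ x y

theorem transportPVA_flow (x y : V) :
    (transportPVA P Φ).flow ((transportPVA P Φ).int (Φ x)) (Φ y) = Φ (P.flow (P.int x) y) := by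
  rw [PVA.flow_int, transportPVA_br, Polynomial.coeff_map]
  rfl

variable {P Φ} in
/-- Weakly equal densities have weakly equal integrals. -/
theorem transportPVA_int_eq {W : Type*} [CommRing W] [Algebra ℂ W] {Pt : PVA W} {σ : W →ₗ[ℂ] V'}
    (hσ : ∀ F, σ (Pt.D F) = (transportPVA P Φ).D (σ F)) {x qt : W} {y q : V} (hxy : σ x = Φ y)
    (hq : P.int q = P.int y) (hqt : Pt.int qt = Pt.int x) :
    (transportPVA P Φ).int (σ qt) = (transportPVA P Φ).int (Φ q) := by
  rw [PVA.int_map_congr (P' := transportPVA P Φ) σ hσ hqt, hxy]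
  exact PVA.int_map_congr (P' := transportPVA P Φ) Φ.toLinearMap
    (fun z => (transportPVA_D P Φ z).symm) hq.symm

/-- The local Poisson algebra of a quotient isomorphic to a local Poisson algebra. -/
theorem exists_quotient_pva {A : Type*} [CommRing A] [Algebra ℂ A] {W : Type*} [CommRing W]
    [Algebra ℂ W] (Pt : PVA W) {J : Ideal W} (P : PVA A) (Φ : A ≃ₐ[ℂ] W ⧸ J) (ρ : W →ₐ[ℂ] A)
    (hmk : ∀ F, Ideal.Quotient.mk J F = Φ (ρ F)) (hρD : ∀ F, ρ (Pt.D F) = P.D (ρ F))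
    {dir : W → W → W[X]} (hdir : ∀ F F₂, (dir F F₂).map ρ.toRingHom = P.br (ρ F) (ρ F₂)) :
    ∃ Pphys : PVA (W ⧸ J),
      (∀ F, Pphys.D (Ideal.Quotient.mk J F) = Ideal.Quotient.mk J (Pt.D F)) ∧
      (∀ F F₂, Pphys.br (Ideal.Quotient.mk J F) (Ideal.Quotient.mk J F₂) =
        (dir F F₂).map (Ideal.Quotient.mk J)) ∧
      (∀ x, Pphys.D (Φ x) = Φ (P.D x)) ∧
      (∀ x y, Pphys.br (Φ x) (Φ y) = (P.br x y).map Φ.toAlgHom.toRingHom) ∧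
      (∀ x y F, ρ x = y → Pphys.flow (Pphys.int (Ideal.Quotient.mk J x)) (Φ F) =
        Φ (P.flow (P.int y) F)) ∧
      (∀ x qt y q, ρ x = y → P.int q = P.int y → Pt.int qt = Pt.int x →
        Pphys.int (Ideal.Quotient.mk J qt) = Pphys.int (Φ q)) := by
  have h1 : Ideal.Quotient.mk J = Φ.toAlgHom.toRingHom.comp ρ.toRingHom := RingHom.ext hmk
  refine ⟨transportPVA P Φ, fun F => ?_, fun F F₂ => ?_, transportPVA_D P Φ, transportPVA_br P Φ,
    fun x y F h => ?_, fun x qt y q hxy hq hqt => ?_⟩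
  · rw [hmk, hmk, transportPVA_D, hρD]
  · rw [hmk, hmk, transportPVA_br, ← hdir, Polynomial.map_map, h1]
  · rw [hmk, h, transportPVA_flow]
  · rw [hmk]
    exact transportPVA_int_eq (σ := (Φ.toAlgHom.comp ρ).toLinearMap)
      (fun F => (congrArg Φ (hρD F)).trans (transportPVA_D P Φ _).symm) (congrArg Φ hxy) hq hqt

end TransportFlow

section DiagonalSymmetry

variable {𝔤 : Type*} [LieRing 𝔤] [LieAlgebra ℝ 𝔤] {ι : Type w} [Fintype ι] [DecidableEq ι]
  {I : Module.Basis ι ℝ 𝔤} {V : Type u} [CommRing V] [Algebra ℂ V] {P : PVA V} {cj : V →+* V}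
  {S : Type*} [Fintype S] [DecidableEq S] {𝒢 : GaudinData S ι V}

theorem IsRealisation.conj_sumZeroModes (h𝒢 : IsRealisation I P cj 𝒢) (e : ι) :
    cj (sumZeroModes 𝒢 e) = sumZeroModes 𝒢 e := by
  rw [sumZeroModes, map_sum]
  refine (Finset.sum_congr rfl fun α _ => (h𝒢.J_bar α 0 (h𝒢.m_pos α) e).symm).trans ?_
  exact Equiv.sum_comp (Function.Involutive.toPerm 𝒢.bar h𝒢.bar_bar) fun α => 𝒢.J α 0 e

theorem IsRealisation.flow_sumZeroModes_J (h𝒢 : IsRealisation I P cj 𝒢) (e : ι) (α : S) {p : ℕ}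
    (hp : p < 𝒢.m α) (e₂ : ι) :
    P.flow (P.int (sumZeroModes 𝒢 e)) (𝒢.J α p e₂) = comp I (𝒢.J α p) ⁅I e, I e₂⁆ := by
  rw [PVA.flow_int, h𝒢.br_sumZeroModes_J α hp, Polynomial.coeff_add, Polynomial.coeff_C_zero,
    Polynomial.mul_coeff_zero, Polynomial.coeff_X_zero, mul_zero, add_zero]

/-- The diagonal symmetry conserves the quadratic charges. -/
theorem IsRealisation.flow_sumZeroModes_charges [LieAlgebra.IsSemisimple ℝ 𝔤]
    (h𝒢 : IsRealisation I P cj 𝒢) (e : ι) {κ : Type*} (t : Finset κ) (r s : κ → ℂ) (z : κ → ℂ) :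
    P.flow (P.int (sumZeroModes 𝒢 e)) (∑ k ∈ t, r k • (s k •
      pairing I (gaudinLax 𝒢 (z k)) (gaudinLax 𝒢 (z k)))) = 0 := by
  rw [map_sum]
  refine Finset.sum_eq_zero fun k _ => ?_
  have h := h𝒢.isEquivariant_gaudinLax (z k)
  rw [map_smul, map_smul, PVA.flow_int, h.br_pairing h, Polynomial.mul_coeff_zero,
    Polynomial.coeff_X_zero, mul_zero, smul_zero, smul_zero]

end DiagonalSymmetry

section GaugedModel

variable {A : Type*} [CommRing A] [Algebra ℂ A]
  {E : Type u} [NormedAddCommGroup E] [NormedSpace ℝ E] [FiniteDimensional ℝ E]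
  {G : Type v} [TopologicalSpace G] [T2Space G] [ChartedSpace E G] [Group G]
  [LieGroup 𝓘(ℝ, E) ∞ G]
  [LieAlgebra.IsSemisimple ℝ (GroupLieAlgebra 𝓘(ℝ, E) G)]
  {U : TopologicalSpace.Opens G} {ι : Type w} [Fintype ι] [DecidableEq ι]
  {I : Module.Basis ι ℝ (GroupLieAlgebra 𝓘(ℝ, E) G)} {P : PVA A}
  {Pt : PVA (GaugedAlg A E U ι)} {B : ι → ι → SmoothFun E U} {cj : A →+* A}
  {S : Type*} [Fintype S] [DecidableEq S] {𝒢 : GaudinData S ι A} {linf a b c d : ℝ}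

theorem br_constraint_fn (ht : IsTensorBracket I P Pt) {l : ℂ} {K : ι → A}
    {C : ι → GaugedAlg A E U ι} (hC : ∀ e, C e = wzCurrent I B l e + inA (K e)) (e : ι)
    (h : SmoothFun E U) : Pt.br (C e) (fn h) = Polynomial.C (fn (leftDeriv (I e) h)) := by
  rw [hC, map_add, LinearMap.add_apply, ht.br_wzCurrent_fn, ht.br_inA_fn, add_zero]

theorem exists_mobiusSphere_eq (hdet : a * d - b * c ≠ 0) (hc : c ≠ 0) {M : ℕ} {ζ : Fin M → ℂ}
    (h : IsZeroSet ζ 𝒢 linf) (hlinf : linf ≠ 0) {w : ℂ}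
    (hw : ∀ α, w ≠ (gaugedData I B a b c d linf 𝒢 : GaudinData _ _ (GaugedAlg A E U ι)).z α)
    (h0 : mobTwist a b c d (twist linf 𝒢) w = 0) :
    ∃ i, mobiusSphere a b c d (ζ i) = (w : OnePoint ℂ) := by
  have hdet' := ofReal_det_ne_zero hdet
  obtain ⟨h1, h2, h3⟩ := mobius_inv (b := b) (d := d) hdet hc (hw none)
  set z := -((d : ℂ) * w - b) / (c * w - a) with hz
  have h4 : (c : ℂ) * z + d ≠ 0 := by rw [h2]; exact div_ne_zero (neg_ne_zero.2 hdet') h3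
  have h5 : ∀ α, z ≠ 𝒢.z α := fun α h' => hw (some α) (by rw [← h1, h']; rfl)
  rw [← h1, mobTwist_mobius hdet _ h4, mul_eq_zero] at h0
  obtain ⟨i, hi⟩ := (h.eq_zero_iff hlinf h5).1
    (h0.resolve_left (div_ne_zero (pow_ne_zero 2 h4) hdet'))
  exact ⟨i, by rw [← hi]; exact coe_ne_mobiusSphere.2 ⟨h4, h1⟩⟩

theorem exists_tendsto_mobTwist_infty (hdet : a * d - b * c ≠ 0) (hc : c ≠ 0)
    (hsites : ∀ α, (c : ℂ) * 𝒢.z α + d ≠ 0) {M : ℕ} {ζ : Fin M → ℂ}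
    (h : IsZeroSet ζ 𝒢 linf) (hlinf : linf ≠ 0)
    (hi : ∀ i, mobiusSphere a b c d (ζ i) ≠ OnePoint.infty) :
    ∃ r : ℂ, r ≠ 0 ∧ Filter.Tendsto
      (fun u : ℂ => -(u ^ 2)⁻¹ * mobTwist a b c d (twist linf 𝒢) u⁻¹) (𝓝[≠] 0) (𝓝 r) := by
  have hdet' := ofReal_det_ne_zero hdet
  have hc' : (c : ℂ) ≠ 0 := Complex.ofReal_ne_zero.2 hc
  have h0 : (c : ℂ) * (-(d : ℂ) / c) + d = 0 := by field_simp; ring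
  have hs : ∀ α, -(d : ℂ) / c ≠ 𝒢.z α := fun α h' => hsites α (by rw [← h', h0])
  refine ⟨_, mul_ne_zero (div_ne_zero (neg_ne_zero.2 hdet') (pow_ne_zero 2 hc')) fun h1 => ?_,
    tendsto_mobTwist_infty hdet hc (analyticAt_twist hs).continuousAt⟩
  obtain ⟨i, h2⟩ := (h.eq_zero_iff hlinf hs).1 h1
  exact hi i (by rw [mobiusSphere, ← h2, if_pos h0])

/-- The left symmetry leaves the Takiff currents of the gauged model invariant. -/
theorem flow_leftMoment_newJ (ht : IsTensorBracket I P Pt)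
    (hB : (∑ α, 𝒢.lev α 0) ≠ 0 → IsWZPotential I B) (e : ι) (α : Option S) (p : ℕ) (e₂ : ι) :
    Pt.flow (Pt.int (leftMoment I B (-∑ α, 𝒢.lev α 0) e)) (newJ I B a b c d linf 𝒢 α p e₂) = 0 := by
  have hl : -∑ α, 𝒢.lev α 0 ≠ 0 → IsWZPotential I B := fun h => hB fun h' => h (by rw [h', neg_zero])
  rcases α with _ | α
  · rcases p with _ | p
    · rw [newJ_none_zero]
      exact ht.flow_leftMoment_wzCurrent hl e₂ e
    · rw [newJ_none_succ, Pi.smul_apply, map_smul, ht.flow_leftMoment_fieldj, smul_zero]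
  · exact ht.flow_leftMoment_inA _ e

/-- The left symmetry conserves the quadratic charges of the gauged model. -/
theorem flow_leftMoment_charges (ht : IsTensorBracket I P Pt) {l : ℂ}
    (hB : l ≠ 0 → IsWZPotential I B) {K : ι → A} {C : ι → GaugedAlg A E U ι}
    (hC : ∀ e, C e = wzCurrent I B l e + inA (K e)) (e : ι) {M : ℕ} (φ : ℂ → ℂ) (ζ : Fin M → ℂ)
    (eps R : Fin M → ℂ) :
    Pt.flow (Pt.int (leftMoment I B l e)) (∑ i, eps i •
      chargeDensity I (deriv φ (ζ i)) (laxOne U I 𝒢 linf (ζ i))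
        (gaugeVec c d φ ζ (laxOne U I 𝒢 linf) (fieldj I) i) C (R i)) = 0 := by
  have hF : ∀ z e₂, Pt.flowDer (Pt.int (leftMoment I B l e)) (laxOne U I 𝒢 linf z e₂) = 0 := by
    intro z e₂
    rw [PVA.flowDer_apply, laxOne, map_sub, map_smul, ht.flow_leftMoment_inA,
      ht.flow_leftMoment_fieldj, smul_zero, sub_zero]
  rw [← PVA.flowDer_apply, map_sum]
  refine Finset.sum_eq_zero fun i _ => ?_
  rw [Derivation.map_smul, derivation_chargeDensity_eq_zero _ (fun e₂ => hF _ e₂)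
    (derivation_gaugeVec _ hF (fun e₂ => ht.flow_leftMoment_fieldj e₂ e) i) fun e₂ => ?_, smul_zero]
  rw [PVA.flowDer_apply, hC, map_add, ht.flow_leftMoment_wzCurrent hB, ht.flow_leftMoment_inA,
    add_zero]

theorem physProj_gaudinLax (hU : (1 : G) ∈ U) (hdet : a * d - b * c ≠ 0) (hc : c ≠ 0)
    (hsites : ∀ α, (c : ℂ) * 𝒢.z α + d ≠ 0) (hm : ∀ α, 0 < 𝒢.m α) {z : ℂ}
    (hz : ∀ α, z ≠ 𝒢.z α) (h : (c : ℂ) * z + d ≠ 0) (e : ι) :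
    physProj hU P (sumZeroModes 𝒢)
      (gaudinLax (gaugedData I B a b c d linf 𝒢 : GaudinData _ _ (GaugedAlg A E U ι))
        (mobius a b c d z) e) =
      (((c : ℂ) * z + d) ^ 2 / ((a : ℂ) * d - b * c)) • gaudinLax 𝒢 z e := by
  have hC := physProj_C hU (P := P) (B := B) (fun e => sumZeroModes_gaugedData (A := A) (U := U)
    (I := I) (B := B) (a := a) (b := b) (c := c) (d := d) (linf := linf) (𝒢 := 𝒢) e)
  rw [gaudinLax_gaugedData_eq hdet hc hsites hm hz h, Pi.smul_apply, Pi.sub_apply, Pi.smul_apply,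
    map_smul, map_sub, map_smul, hC, smul_zero, sub_zero, physProj_laxOne]

end GaugedModel

end AGM

end

set_option maxHeartbeats 1000000 in
theorem mainTheorem1
    -- the real semi-simple Lie group, with a basis of its Lie algebra
    {E : Type*} [NormedAddCommGroup E] [NormedSpace ℝ E] [FiniteDimensional ℝ E]
    {G : Type*} [TopologicalSpace G] [T2Space G] [ChartedSpace E G] [Group G]
    [LieGroup 𝓘(ℝ, E) ∞ G] [LieAlgebra.IsSemisimple ℝ (GroupLieAlgebra 𝓘(ℝ, E) G)]
    {ι : Type*} [Fintype ι] [DecidableEq ι]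
    (I : Module.Basis ι ℝ (GroupLieAlgebra 𝓘(ℝ, E) G))
    -- the domain of the field `g` and the two-form defining the Wess-Zumino field `W`
    (U : TopologicalSpace.Opens G) (hU : (1 : G) ∈ U) (B : ι → ι → SmoothFun E U)
    -- the non-constrained model
    {A : Type*} [CommRing A] [Algebra ℂ A] (P : PVA A) (cj : A →+* A)
    (hcj : P.IsConjugation cj)
    {S : Type*} [Fintype S] [DecidableEq S] (𝒢 : GaudinData S ι A)
    (h𝒢 : IsRealisation I P cj 𝒢) (linf : ℝ) (hlinf : linf ≠ 0)
    (hB : (∑ α, 𝒢.lev α 0) ≠ 0 → IsWZPotential I B)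
    (ζ : Fin (∑ α, 𝒢.m α) → ℂ) (hζ_inj : Function.Injective ζ)
    (hζ : ∀ z : ℂ, (∀ α, z ≠ 𝒢.z α) →
      twist linf 𝒢 z = -(linf : ℂ) * (∏ i, (z - ζ i)) / ∏ α, (z - 𝒢.z α) ^ 𝒢.m α)
    (eps : Fin (∑ α, 𝒢.m α) → ℂ)
    -- the Möbius transformation
    (a b c d : ℝ) (hdet : a * d - b * c ≠ 0) (hc : c ≠ 0)
    (hsites : ∀ α, (c : ℂ) * 𝒢.z α + d ≠ 0) :
    -- the canonical Poisson structure on `𝒜 ⊗ 𝒜_{G₀}` is well defined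
    (∃! Pt : PVA (GaugedAlg A E U ι), IsTensorBracket I P Pt) ∧
    ∀ Pt : PVA (GaugedAlg A E U ι), IsTensorBracket I P Pt →
      let φ : ℂ → ℂ := twist linf 𝒢
      let φt : ℂ → ℂ := mobTwist a b c d φ
      let f : ℂ → ℂ := mobius a b c d
      let ζs : Fin (∑ α, 𝒢.m α) → OnePoint ℂ := fun i => (ζ i : OnePoint ℂ)
      let ζt : Fin (∑ α, 𝒢.m α) → OnePoint ℂ := fun i => mobiusSphere a b c d (ζ i)
      let 𝒢t : GaudinData (Option S) ι (GaugedAlg A E U ι) := gaugedData I B a b c d linf 𝒢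
      let conj := gaugedConj (E := E) (U := U) (ι := ι) cj hcj.smul
      let C : ι → GaugedAlg A E U ι := sumZeroModes 𝒢t
      let mk := Ideal.Quotient.mk (weakIdeal hU Pt C)
      -- the gauged model is a realisation with twist function `φt`, whose levels satisfy the
      -- first-class condition
      (Pt.IsConjugation conj ∧ IsRealisation I Pt conj 𝒢t ∧
        (∀ w, (∀ α, w ≠ 𝒢t.z α) → φt w = twist₀ 𝒢t w) ∧ (∑ α, 𝒢t.lev α 0) = 0) ∧
      -- the constraint is first-class and generates the right multiplications of `g`
      ((∀ e e₂, Pt.br (C e) (C e₂) = Polynomial.C (comp I C ⁅I e, I e₂⁆)) ∧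
        (∀ e h, Pt.br (C e) (fn h) = Polynomial.C (fn (leftDeriv (I e) h))) ∧
        (∀ h F, Pt.br (fn h) F =
          ∑ e, act Pt.D (gBracket e F) (Polynomial.C (fn (leftDeriv (I e) h))))) ∧
      -- the zeroes of `φt(w) dw` are simple and are the images of the zeroes of `φ(z) dz`
      ((∀ i, IsSimpleFormZero φt (ζt i)) ∧
        (∀ w : ℂ, (∀ α, w ≠ 𝒢t.z α) → φt w = 0 → ∃ i, ζt i = (w : OnePoint ℂ)) ∧
        ((∀ i, ζt i ≠ OnePoint.infty) → ∃ r : ℂ, r ≠ 0 ∧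
          Filter.Tendsto (fun u : ℂ => -(u ^ 2)⁻¹ * φt u⁻¹) (𝓝[≠] 0) (𝓝 r))) ∧
      -- the Dirac bracket induces a Poisson structure on the physical observables, which is
      -- isomorphic to `𝒜`
      ∃ (Pphys : PVA (GaugedAlg A E U ι ⧸ weakIdeal hU Pt C))
        (Φ : A ≃ₐ[ℂ] (GaugedAlg A E U ι ⧸ weakIdeal hU Pt C)),
        ((∀ F, Φ F = mk (inA F)) ∧
          (∀ F, Pphys.D (mk F) = mk (Pt.D F)) ∧
          (∀ F F₂, Pphys.br (mk F) (mk F₂) = (dirac Pt C F F₂).map mk) ∧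
          (∀ F, Pphys.D (Φ F) = Φ (P.D F)) ∧
          (∀ F F₂, Pphys.br (Φ F) (Φ F₂) = (P.br F F₂).map Φ.toAlgHom.toRingHom) ∧
          (∀ F F₂, mk F = Φ F₂ → mk (conj F) = Φ (cj F₂))) ∧
        -- the Gaudin Lax matrix transforms as a one-form and the Lax matrix as a function
        ((∀ z : ℂ, (∀ α, z ≠ 𝒢.z α) → (c : ℂ) * z + d ≠ 0 → ∀ e,
            Φ (gaudinLax 𝒢 z e) =
              (((a : ℂ) * d - b * c) / ((c : ℂ) * z + d) ^ 2) • mk (gaudinLax 𝒢t (f z) e)) ∧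
          (∀ z : ℂ, (∀ α, z ≠ 𝒢.z α) → (∀ i, z ≠ ζ i) → (c : ℂ) * z + d ≠ 0 → ∀ e,
            mk (laxL φt 𝒢t (f z) e) = Φ (laxL φ 𝒢 z e))) ∧
        -- the quadratic charges and the Hamiltonians
        (∃ (Q : Fin (∑ α, 𝒢.m α) → P.Fun) (Qt : Fin (∑ α, 𝒢.m α) → Pt.Fun),
          (∀ i, HasResidue (quadQ I P φ 𝒢) (ζ i) (Q i)) ∧
          (∀ i, HasSphereResidue (quadQ I Pt φt 𝒢t) (ζt i) (Qt i)) ∧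
          (∀ i q qt, P.int q = Q i → Pt.int qt = Qt i →
            Pphys.int (mk qt) = Pphys.int (Φ q)) ∧
          (∀ q qt, P.int q = ∑ i, eps i • Q i → Pt.int qt = ∑ i, eps i • Qt i →
            Pphys.int (mk qt) = Pphys.int (Φ q)) ∧
          -- there is a Lagrange multiplier, unique up to weak equality, for which the total
          -- Hamiltonian preserves the gauge fixing
          (∃ μ : ι → GaugedAlg A E U ι,
            ∀ h, totalFlow I Pt C (∑ i, eps i • Qt i) μ (fn h) ∈ weakIdeal hU Pt C) ∧
          (∀ μ μ₂ : ι → GaugedAlg A E U ι,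
            (∀ h, totalFlow I Pt C (∑ i, eps i • Qt i) μ (fn h) ∈ weakIdeal hU Pt C) →
            (∀ h, totalFlow I Pt C (∑ i, eps i • Qt i) μ₂ (fn h) ∈ weakIdeal hU Pt C) →
            ∀ e, mk (μ e) = mk (μ₂ e)) ∧
          -- with this multiplier, the dynamics and the Lax pairs of the two models coincide
          (∀ μ : ι → GaugedAlg A E U ι,
            (∀ h, totalFlow I Pt C (∑ i, eps i • Qt i) μ (fn h) ∈ weakIdeal hU Pt C) →
            (∀ F F₂, mk F = Φ F₂ →
              mk (totalFlow I Pt C (∑ i, eps i • Qt i) μ F)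
                = Φ (P.flow (∑ i, eps i • Q i) F₂)) ∧
            (∀ z : ℂ, (∀ α, z ≠ 𝒢.z α) → (∀ i, z ≠ ζ i) → (c : ℂ) * z + d ≠ 0 → ∀ e,
              mk (laxM φt 𝒢t ζt eps μ (f z) e) = Φ (laxM φ 𝒢 ζs eps 0 z e))) ∧
          -- the moment maps of the diagonal and of the left symmetry are conserved
          (∀ e q, P.int q = ∑ i, eps i • Q i →
            P.int (P.flow (P.int (sumZeroModes 𝒢 e)) q) = 0) ∧
          (∀ e q, Pt.int q = ∑ i, eps i • Qt i →
            Pt.int (Pt.flow (Pt.int (leftMoment I B (𝒢t.lev none 0) e)) q) = 0)) ∧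
        -- the diagonal symmetry of the non-constrained model is the left symmetry of the
        -- PCM+WZ realisation
        ((∀ e α, ∀ p < 𝒢.m α, ∀ e₂, P.flow (P.int (sumZeroModes 𝒢 e)) (𝒢.J α p e₂) =
            comp I (𝒢.J α p) ⁅I e, I e₂⁆) ∧
          (∀ e h, Pt.flow (Pt.int (leftMoment I B (𝒢t.lev none 0) e)) (fn h) =
            -∑ e₂, fn (adInv I e₂ (I e) * leftDeriv (I e₂) h)) ∧
          (∀ e α, ∀ p < 𝒢t.m α, ∀ e₂,
            Pt.flow (Pt.int (leftMoment I B (𝒢t.lev none 0) e)) (𝒢t.J α p e₂) = 0) ∧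
          (∀ e, mk (leftMoment I B (𝒢t.lev none 0) e) = Φ (sumZeroModes 𝒢 e)) ∧
          (∀ e F, Pphys.flow (Pphys.int (mk (leftMoment I B (𝒢t.lev none 0) e))) (Φ F) =
            Φ (P.flow (P.int (sumZeroModes 𝒢 e)) F))) := by
  have hζ' : IsZeroSet ζ 𝒢 linf := hζ
  have hne : ∀ i α, ζ i ≠ 𝒢.z α := hζ'.ne_site h𝒢.z_inj h𝒢.m_pos h𝒢.lev_top
  have hφ : ∀ i, AnalyticAt ℂ (twist linf 𝒢) (ζ i) := fun i => analyticAt_twist (hne i)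
  have h0 : ∀ i, twist linf 𝒢 (ζ i) = 0 := fun i => (hζ'.eq_zero_iff hlinf (hne i)).2 ⟨i, rfl⟩
  have h1 : ∀ i, deriv (twist linf 𝒢) (ζ i) ≠ 0 :=
    fun i => hζ'.deriv_ne_zero hlinf hζ_inj (hne i)
  have hdet' := ofReal_det_ne_zero hdet
  refine ⟨existsUnique_isTensorBracket I P, fun Pt ht => ?_⟩
  intro φ φt f ζs ζt 𝒢t conj C mk
  have hreal : IsRealisation I Pt conj 𝒢t := ht.isRealisation hcj h𝒢 hlinf hB hdet hc hsites
  have hlev : ∑ α, 𝒢t.lev α 0 = 0 := sum_newLev_zero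
  have hC : ∀ e, C e = wzCurrent I B (-∑ α, 𝒢.lev α 0) e + inA (sumZeroModes 𝒢 e) :=
    fun e => sumZeroModes_gaugedData e
  have hfc : ∀ e e₂, Pt.br (C e) (C e₂) = Polynomial.C (comp I C ⁅I e, I e₂⁆) := by
    intro e e₂
    refine (hreal.br_sumZeroModes e e₂).trans ?_
    rw [hlev, zero_mul, map_zero, Polynomial.C_0, zero_mul, add_zero]
  have hCfn : ∀ e h, Pt.br (C e) (fn h) = Polynomial.C (fn (leftDeriv (I e) h)) :=
    fun e h => br_constraint_fn ht hC e h
  refine ⟨⟨ht.isConjugation hcj, hreal,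
      fun w hw => mobTwist_eq_twist₀ hdet hc hsites h𝒢.m_pos hw, hlev⟩,
    ⟨hfc, hCfn, fun h F => ht.br_fn h F⟩,
    ⟨fun i => isSimpleFormZero_mobiusSphere hdet hc (hφ i) (h0 i) (h1 i),
      fun w hw hw0 => exists_mobiusSphere_eq hdet hc hζ' hlinf hw hw0,
      fun hi => exists_tendsto_mobTwist_infty hdet hc hsites hζ' hlinf hi⟩, ?_⟩
  obtain ⟨ρ, hρ⟩ : ∃ ρ : GaugedAlg A E U ι →ₐ[ℂ] A, ρ = physProj hU P (sumZeroModes 𝒢) := ⟨_, rfl⟩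
  obtain ⟨Φ, hΦ, hmk⟩ : ∃ Φ : A ≃ₐ[ℂ] (GaugedAlg A E U ι ⧸ weakIdeal hU Pt C),
      (∀ F, Φ F = mk (inA F)) ∧ ∀ F, mk F = Φ (ρ F) :=
    ⟨physEquiv hU ht hC, fun F => rfl, fun F => by rw [hρ]; exact mk_eq_physEquiv hU hC ht F⟩
  have hmem : ∀ F, F ∈ weakIdeal hU Pt C ↔ ρ F = 0 := fun F => by
    rw [hρ]; exact mem_weakIdeal_iff hU hC ht F
  have hρF : ∀ F F₂, mk F = Φ F₂ → ρ F = F₂ := fun F F₂ h => by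
    rw [hmk] at h; exact Φ.injective h
  have hρD : ∀ F, ρ (Pt.D F) = P.D (ρ F) := fun F => by rw [hρ]; exact physProj_D hU _ ht F
  obtain ⟨Pphys, hPmk, hPdir, hPD, hPbr, hPflow, hPint⟩ := exists_quotient_pva Pt P Φ ρ hmk hρD
    (dir := dirac Pt C) (fun F F₂ => by rw [hρ]; exact map_dirac_physProj hU ht hC hfc hCfn F F₂)
  have hlax : ∀ z, (∀ α, z ≠ 𝒢.z α) → (c : ℂ) * z + d ≠ 0 → ∀ e, ρ (gaudinLax 𝒢t (f z) e) =
      (((c : ℂ) * z + d) ^ 2 / ((a : ℂ) * d - b * c)) • gaudinLax 𝒢 z e := fun z hz h e => by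
    rw [hρ]; exact physProj_gaudinLax hU hdet hc hsites h𝒢.m_pos hz h e
  have hhlax : ∀ z, (∀ α, z ≠ 𝒢.z α) → (c : ℂ) * z + d ≠ 0 → gaudinLax 𝒢t (f z) =
      (((c : ℂ) * z + d) ^ 2 / ((a : ℂ) * d - b * c)) •
        (laxOne U I 𝒢 linf z - ((c : ℂ) / (c * z + d)) • C) :=
    fun z hz h => gaudinLax_gaugedData_eq hdet hc hsites h𝒢.m_pos hz h
  have hR : ∀ i, ∃ R : ℂ, HasSphereResidue (quadQ I Pt φt 𝒢t) (ζt i)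
      (Pt.int (chargeDensity I (deriv φ (ζ i)) (laxOne U I 𝒢 linf (ζ i))
        (gaugeVec c d φ ζ (laxOne U I 𝒢 linf) (fieldj I) i) C R)) := by
    intro i
    obtain ⟨t, r, w, hr, hF⟩ := exists_laxOne_expansion (U := U) (I := I) (linf := linf) (hne i)
    exact exists_hasSphereResidue hdet hc hζ' hlinf hζ_inj hne hhlax
      (fun z hz hz' => laxOne_div hζ' hlinf hζ_inj hne rfl hz hz') i t hr hF
      (fun h α => mobius_ne_site hdet hc hsites (hne i) h α)
  choose R hR using hR
  obtain ⟨q₀, hq₀⟩ : ∃ q₀ : Fin (∑ α, 𝒢.m α) → A, ∀ i, q₀ i =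
    (-(2 * deriv φ (ζ i))⁻¹) • pairing I (gaudinLax 𝒢 (ζ i)) (gaudinLax 𝒢 (ζ i)) := ⟨_, fun _ => rfl⟩
  obtain ⟨h₀, hh₀⟩ : ∃ h₀ : Fin (∑ α, 𝒢.m α) → GaugedAlg A E U ι, ∀ i, h₀ i =
    chargeDensity I (deriv φ (ζ i)) (laxOne U I 𝒢 linf (ζ i))
        (gaugeVec c d φ ζ (laxOne U I 𝒢 linf) (fieldj I) i) C (R i) := ⟨_, fun _ => rfl⟩
  have hρC : ∀ e, ρ (C e) = 0 := fun e => by rw [hρ]; exact physProj_C hU hC e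
  have hρh : ∀ i, ρ (h₀ i) = q₀ i := by
    intro i
    rw [hh₀, hq₀, map_chargeDensity hρC]
    have : (fun e => ρ (laxOne U I 𝒢 linf (ζ i) e)) = gaudinLax 𝒢 (ζ i) :=
      funext fun e => by rw [hρ]; exact physProj_laxOne hU _ _ e
    rw [this]
  have hQ : ∑ i, eps i • P.int (q₀ i) = P.int (∑ i, eps i • q₀ i) := by
    rw [map_sum]; exact Finset.sum_congr rfl fun i _ => (map_smul _ _ _).symm
  have hQt : ∑ i, eps i • Pt.int (h₀ i) = Pt.int (∑ i, eps i • h₀ i) := by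
    rw [map_sum]; exact Finset.sum_congr rfl fun i _ => (map_smul _ _ _).symm
  have hflow : ∀ μ O, ρ (totalFlow I Pt C (∑ i, eps i • Pt.int (h₀ i)) μ O) =
      P.flow (P.int (∑ i, eps i • q₀ i)) (ρ O) +
      ∑ x, (act P.D ((Pt.br (C x) O).map ρ.toRingHom)
        (Polynomial.C (∑ y, ((kinv I x y : ℝ) : ℂ) • (ρ (μ y)
          + ∑ i, eps i • gaugeVec c d φ ζ (gaudinLax 𝒢) 0 i y)))).coeff 0 := by
    intro μ O
    rw [hQt, hρ]
    simp only [hh₀, hq₀]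
    exact physProj_totalFlow hU ht h𝒢 hC hfc hCfn h0 eps R μ O
  have hval : ∀ μ : ι → GaugedAlg A E U ι,
      (∀ h, totalFlow I Pt C (∑ i, eps i • Pt.int (h₀ i)) μ (fn h) ∈ weakIdeal hU Pt C) ↔
      ∀ y, ρ (μ y) + ∑ i, eps i • gaugeVec c d φ ζ (gaudinLax 𝒢) 0 i y = 0 := by
    intro μ
    have h2 := hflow μ
    rw [hρ] at h2
    simp only [hmem, hρ]
    exact forall_flow_fn_eq_zero_iff hU hCfn h2
  refine ⟨Pphys, Φ, ⟨hΦ, hPmk, hPdir, hPD, hPbr, ?_⟩, ⟨?_, ?_⟩,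
    ⟨fun i => P.int (q₀ i), fun i => Pt.int (h₀ i), ?_, ?_, ?_, ?_, ?_, ?_, ?_, ?_, ?_⟩,
    h𝒢.flow_sumZeroModes_J, ?_, ?_, ?_, ?_⟩
  · intro F F₂ h
    rw [hmk, ← hρF F F₂ h]
    refine congrArg Φ ?_
    rw [hρ]
    exact physProj_conj hU hcj h𝒢.conj_sumZeroModes F
  · intro z hz h e
    rw [hmk, hlax z hz h e, map_smul, smul_smul, div_mul_div_comm, mul_comm,
      div_self (mul_ne_zero (pow_ne_zero 2 h) hdet'), one_smul]
  · intro z hz hz' h e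
    rw [hmk]
    exact congrArg Φ (map_laxL (ρ := ρ.toLinearMap) hdet h (hlax z hz h e))
  · intro i
    beta_reduce
    rw [hq₀]
    exact hasResidue_quadQ (hne i) (hφ i) (h0 i) (h1 i)
  · intro i
    beta_reduce
    rw [hh₀]
    exact hR i
  · exact fun i q qt hq hqt => hPint _ _ _ _ (hρh i) hq hqt
  · intro q qt hq hqt
    refine hPint _ _ _ _ ?_ (hq.trans hQ) (hqt.trans hQt)
    rw [map_sum]
    exact Finset.sum_congr rfl fun i _ => by rw [map_smul, hρh]
  · refine ⟨fun y => inA (-∑ i, eps i • gaugeVec c d φ ζ (gaudinLax 𝒢) 0 i y), ?_⟩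
    rw [hval]
    intro y
    rw [hρ, physProj_inA, neg_add_cancel]
  · intro μ μ₂ hμ hμ₂ e
    rw [hmk, hmk]
    exact congrArg Φ (add_right_cancel (((hval μ).1 hμ e).trans ((hval μ₂).1 hμ₂ e).symm))
  · intro μ hμ
    have hμ' := (hval μ).1 hμ
    refine ⟨fun F F₂ h => ?_, fun z hz hz' h e => ?_⟩
    · rw [hmk, ← hρF F F₂ h, hQ]
      have h2 := hflow μ
      rw [hρ] at h2
      refine congrArg Φ ?_
      rw [hρ]
      exact flow_eq_of_multiplier hU h2 (fun y => by rw [← hρ]; exact hμ' y) F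
    · rw [hmk]
      exact congrArg Φ (map_laxM (ρ := ρ.toLinearMap) hdet hc hζ' hlinf hζ_inj hne rfl hlax hμ' hz
        hz' h e)
  · intro e q hq
    refine PVA.int_flow_eq_zero (hq.trans hQ) ?_
    simp only [hq₀]
    exact h𝒢.flow_sumZeroModes_charges e _ _ _ _
  · intro e q hq
    refine PVA.int_flow_eq_zero (hq.trans hQt) ?_
    simp only [hh₀]
    exact flow_leftMoment_charges ht (fun h => hB fun h' => h (by rw [h', neg_zero])) hC e φ ζ eps R
  · exact fun e h => ht.flow_leftMoment_fn h e
  · exact fun e α p _ e₂ => flow_leftMoment_newJ ht hB e α p e₂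
  · intro e
    rw [hmk, hρ]
    exact congrArg Φ (physProj_leftMoment hU _ e)
  · intro e F
    refine hPflow _ _ F ?_
    rw [hρ]
    exact physProj_leftMoment hU _ e
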